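/- **Conventions.** All categories are small (with respect to an arbitrary fixed universe). 2-functors are understood up to coherent isomorphism (pseudofunctors), transformations are pseudonatural. A *quasi 2-adjunction* $L\dashv R$ between 2-functors $L:\mathcal A\to\mathcal B$, $R:\mathcal B\to\mathcal A$ is a transformation $\eta:1\Rightarrow RL$ such that for all $a,b$ the functor $R(-)\circ\eta_a:\mathcal B(La,b)\to\mathcal A(a,Rb)$ is an equivalence of categories. **Doctrines.** A doctrine is a functor $P:\mathcal C^{op}\to\mathbf{PreOrd}$. A morphism $P\to Q$ of doctrines ($Q:\mathcal D^{op}\to\mathbf{PreOrd}$) is a pair $(F,a)$ of a functor $F:\mathcal C\to\mathcal D$ and a natural transformation $a:P\to Q\circ F^{op}$; a 2-cell $(F,a)\to(G,b)$ is a natural transformation $\alpha:F\to G$ with $a_c(x)\le Q(\alpha_c)(b_c(x))$. $\mathcal C\rtimes P$ is the category of pairs $(c,x)$, $x\in P(c)$, an arrow $(c,x)\to(d,y)$ being an $f:c\to d$ with $x\le P(f)(y)$; $(F,a)$ induces a functor $F\rtimes a:\mathcal C\rtimes P\to\mathcal D\rtimes Q$. A doctrinal site is a doctrine with a Grothendieck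 topology $J$ on $\mathcal C\rtimes P$; a morphism of doctrinal sites is an $(F,a)$ with $F$ flat and $F\rtimes a$ a morphism of sites. $\exists_f$ denotes the left adjoint of $P(f)$. *Existential doctrines* are doctrines $P$ for which $\mathcal C$ has finite limits, the $P(c)$ are meet-semilattices with top, the $P(f)$ preserve finite meets and have left adjoints $\exists_f$ that satisfy the Frobenius and Beck–Chevalley conditions; morphisms of existential doctrines are the $(F,a)$ such that $F$ preserves finite limits and $a$ preserves finite meets and the $\exists_f$. $\mathbf{ExDocSites}$: objects are the pairs $(P,J_\rtimes)$ where $P$ is an existential doctrine with Grothendieck topologies $J_c$ on the preorders $P(c)$ such that * if $T$ is a $J_c$-cover of $x$, then $\{\exists_f z\le\exists_f x\mid z\in T\}$ is a $J_d$-cover, for $f:c\to d$; * if $S$ is a sieve on $(d,y)$ in $\mathcal C\rtimes P$ for which the inequalities $\exists_f z\le y$, with $f:(c,z)\to(d,y)$ in $S$, form a $J_d$-cover (call such an $S$ covering), then the pullbacks of $S$ along the arrows $(d,x)\to(d,y)$, $x\le y$, over $1_d$ and along the arrows $h:(e,P(h)y)\to(d,y)$ are covering again; and $J_\rtimes$ is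 the topology of these covering sieves. 1-cells are the morphisms of doctrinal sites that are morphisms of existential doctrines; 2-cells are all those between the morphisms of doctrines. $\mathbf{GeomDoc}_{cart}$: objects are the geometric doctrines $\mathbb L$ over a category with finite limits, i.e. the $\mathbb L(c)$ are frames, the $\mathbb L(f)$ are frame homomorphisms with left adjoints $\exists_f$ that satisfy Frobenius, and the covering sieves of $K_{\mathbb L}$ are stable under pullback along the arrows $h:(e,\mathbb L(h)V)\to(d,V)$, where a sieve $S$ on $(d,V)$ is $K_{\mathbb L}$-covering if $V=\bigvee\{\exists_f U\mid f:(c,U)\to(d,V)\text{ in }S\}$. 1-cells are the morphisms of doctrinal sites for the topologies $K_{\mathbb L}$; 2-cells as before. **Categories.** $\mathbf{RegSites}$: objects are the regular categories $\mathcal C$ with a Grothendieck topology $K$ for which every regular epimorphism generates a covering sieve; 1-cells are the regular functors that preserve covers; 2-cells are natural transformations. $\mathbf{GeomCat}$: geometric categories (regular categories whose posets of subobjects have all joins, and these are stable under pullback), regular functors that preserve joins of subobjects, natural transformations. The geometric topology $J_{\mathrm{Geom}}$ on a geometric category $\mathcal G$ consists of the sieves on $X$ that are jointly extremally epimorphic,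 i.e. such that $X$ is the only subobject of $X$ through which all the arrows of the sieve factor. **Constructions.** * $\mathrm{Sub}$ takes $(\mathcal C,K)\in\mathbf{RegSites}$ to the doctrine $\mathrm{Sub}_{\mathcal C}$ of subobjects, with the topology on $\mathcal C\rtimes\mathrm{Sub}_{\mathcal C}$ whose covering sieves on $(d,V)$ are the $S$ for which the sieve of inclusions $W\hookrightarrow V$, for $W\le\exists_fU$ with $f:(c,U)\to(d,V)$ in $S$, generates a $K$-cover of the object $V$. It takes $\mathcal G\in\mathbf{GeomCat}$ to $(\mathrm{Sub}_{\mathcal G},K_{\mathrm{Sub}_{\mathcal G}})$. It takes $F$ to $(F,a^F)$ with $a^F(U)=F(U)$. * $\mathrm{Syn}(P)$, for an existential doctrine $P$, has as objects the pairs $(c,U)$, $U\in P(c)$; an arrow $(c,U)\to(d,V)$ is a $W\in P(c\times d)$ with $W\le P(pr_1)U\wedge P(pr_2)V$, $P(pr_{1,2})W\wedge P(pr_{1,3})W\le P(pr_{2,3})(\exists_{\Delta_d}\top)$ in $P(c\times d\times d)$, and $U\le\exists_{pr_1}W$; the composite of $W$ and $W'$ is $\exists_{pr_{1,3}}(P(pr_{1,2})W\wedge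 P(pr_{2,3})W')$, and the identity of $(c,U)$ is $\exists_{\Delta_c}U$. For $(P,J_\rtimes)\in\mathbf{ExDocSites}$ it has the topology $J_{\mathrm{Syn}}$ in which $S$ covers $(d,V)$ if and only if the inequalities $\exists_{pr_2}W\le V$, $W\in S$, form a $J_d$-cover. A morphism $(F,a)$ acts by $(c,U)\mapsto(F(c),a_c(U))$, $W\mapsto a_{c\times d}(W)$ (modulo $F(c\times d)\cong F(c)\times F(d)$), and a 2-cell $\alpha$ by the graphs $\exists_{(1,\alpha_c)}a_c(U)$. * The geometric completion $\mathfrak Z$ takes $(P,J)\in\mathbf{ExDocSites}$ to the doctrine $\mathfrak Z P:\mathcal C^{op}\to\mathbf{PreOrd}$ whose elements at $c$ are the sets $S$ of pairs $(f,x)$, $f:d\to c$, $x\in P(d)$, ordered by inclusion, such that $(f,x)\in S$ and $y\le P(g)x$ imply $(fg,y)\in S$, and such that $(f,x)\in S$ whenever $f:d\to c$ and there is a $J$-covering sieve $T$ on $(d,x)$ with $(fg,y)\in S$ for all $g:(e,y)\to(d,x)$ in $T$; $\mathfrak ZP(f)(S)=\{(g,y)\mid(fg,y)\in S\}$; and $\mathfrak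 ZP$ has the topology $K_{\mathfrak ZP}$. It takes $(F,a)$ to $(F,\mathfrak a)$, where $\mathfrak a_c(S)$ is the smallest element of the completion at $F(c)$ that contains all $(F(g),a(x))$, $(g,x)\in S$. **Theorem.** These constructions are well defined: $J_{\mathrm{Geom}}$, $J_{\mathrm{Syn}}$ and the topologies above are Grothendieck topologies, and there are 2-functors $$\mathrm{Sub}:\mathbf{RegSites}\to\mathbf{ExDocSites},\quad \mathrm{Sub}:\mathbf{GeomCat}\to\mathbf{GeomDoc}_{cart},\quad \mathrm{Syn}:\mathbf{ExDocSites}\to\mathbf{RegSites},\quad \mathrm{Syn}:\mathbf{GeomDoc}_{cart}\to\mathbf{GeomCat},$$ $$\mathfrak Z:\mathbf{ExDocSites}\to\mathbf{GeomDoc}_{cart},\quad \iota:\mathbf{GeomDoc}_{cart}\to\mathbf{ExDocSites},\ \mathbb L\mapsto(\mathbb L,K_{\mathbb L}),\quad \iota:\mathbf{GeomCat}\to\mathbf{RegSites},\ \mathcal G\mapsto(\mathcal G,J_{\mathrm{Geom}}).$$ Put $\mathfrak Z^{\mathrm{Cat}}:=\mathrm{Syn}\circ\mathfrak Z\circ\mathrm{Sub}:\mathbf{RegSites}\to\mathbf{GeomCat}$.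 Then: 1. $\mathfrak Z^{\mathrm{Cat}}\dashv\iota$ is a quasi 2-adjunction between $\mathbf{RegSites}$ and $\mathbf{GeomCat}$; 2. $\mathfrak Z\dashv\iota$ is a quasi 2-adjunction between $\mathbf{ExDocSites}$ and $\mathbf{GeomDoc}_{cart}$; 3. $\mathrm{Syn}\dashv\mathrm{Sub}$ is a quasi 2-adjunction both between $\mathbf{ExDocSites}$ and $\mathbf{RegSites}$ and between $\mathbf{GeomDoc}_{cart}$ and $\mathbf{GeomCat}$; 4. the squares commute: $\mathfrak Z^{\mathrm{Cat}}\circ\mathrm{Syn}\simeq\mathrm{Syn}\circ\mathfrak Z$ (pseudonatural equivalence), $\mathrm{Sub}\circ\iota=\iota\circ\mathrm{Sub}$ and $\mathrm{Syn}\circ\iota=\iota\circ\mathrm{Syn}$. -/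

import Mathlib

open CategoryTheory CategoryTheory.Limits Opposite
open scoped Bicategory

universe u v w v' u'

namespace GeomCompl

/-! ## Structured objects: locally full sub-2-categories -/

/-- Structure on the objects of a bicategory: `Str` is the data, `Ok` the axioms on the data,
and `IsHom` singles out the 1-cells that are compatible with it. -/
structure Structured (B : Type u) [Bicategory.{w, v} B] where
  Str : B → Type u'
  Ok : ∀ {b : B}, Str b → Prop
  IsHom : ∀ {a b : B}, Str a → Str b → (a ⟶ b) → Prop
  id_isHom : ∀ {a : B} (s : Str a), Ok s → IsHom s s (𝟙 a)
  comp_isHom : ∀ {a b c : B} (s : Str a) (t : Str b) (r : Str c) (f : a ⟶ b) (g : b ⟶ c),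
    Ok s → Ok t → Ok r → IsHom s t f → IsHom t r g → IsHom s r (f ≫ g)

namespace Structured

variable {B : Type u} [Bicategory.{w, v} B]

/-- An object of `B` together with a structure satisfying the axioms. -/
structure Obj (S : Structured.{u, v, w, u'} B) where
  base : B
  str : S.Str base
  ok : S.Ok str

variable {S : Structured.{u, v, w, u'} B}

/-- A structure preserving 1-cell. -/
@[ext]
structure Mor (X Y : S.Obj) where
  hom : X.base ⟶ Y.base
  isHom : S.IsHom X.str Y.str hom

/-- All the 2-cells of `B` between structure preserving 1-cells. -/
@[ext]
structure Cell {X Y : S.Obj} (F G : Mor X Y) where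
  cell : F.hom ⟶ G.hom

instance {X Y : S.Obj} : Category (Mor X Y) where
  Hom F G := Cell F G
  id F := ⟨𝟙 F.hom⟩
  comp a b := ⟨a.cell ≫ b.cell⟩
  id_comp _ := Cell.ext (Category.id_comp _)
  comp_id _ := Cell.ext (Category.comp_id _)
  assoc _ _ _ := Cell.ext (Category.assoc _ _ _)

@[ext]
theorem hom_ext {X Y : S.Obj} {F G : Mor X Y} {a b : F ⟶ G} (h : a.cell = b.cell) : a = b :=
  Cell.ext h

@[simp] theorem id_cell {X Y : S.Obj} (F : Mor X Y) : Cell.cell (𝟙 F) = 𝟙 F.hom := rfl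
@[simp] theorem comp_cell {X Y : S.Obj} {F G H : Mor X Y} (a : F ⟶ G) (b : G ⟶ H) :
    Cell.cell (a ≫ b) = a.cell ≫ b.cell := rfl

/-- Invertible 2-cells are those of `B`. -/
@[simps]
def isoMk {X Y : S.Obj} {F G : Mor X Y} (e : F.hom ≅ G.hom) : F ≅ G where
  hom := ⟨e.hom⟩
  inv := ⟨e.inv⟩
  hom_inv_id := hom_ext e.hom_inv_id
  inv_hom_id := hom_ext e.inv_hom_id

instance : Bicategory S.Obj where
  Hom X Y := Mor X Y
  id X := ⟨𝟙 X.base, S.id_isHom X.str X.ok⟩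
  comp {X Y Z} F G := ⟨F.hom ≫ G.hom,
    S.comp_isHom X.str Y.str Z.str _ _ X.ok Y.ok Z.ok F.isHom G.isHom⟩
  homCategory X Y := inferInstanceAs (Category (Mor X Y))
  whiskerLeft F _ _ a := ⟨F.hom ◁ a.cell⟩
  whiskerRight a G := ⟨a.cell ▷ G.hom⟩
  associator F G H := isoMk (α_ F.hom G.hom H.hom)
  leftUnitor F := isoMk (λ_ F.hom)
  rightUnitor F := isoMk (ρ_ F.hom)
  whiskerLeft_id _ _ := hom_ext (by simp)
  whiskerLeft_comp _ _ _ _ _ _ := hom_ext (by simp)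
  id_whiskerLeft _ := hom_ext (by simp)
  comp_whiskerLeft _ _ _ _ _ := hom_ext (by simp)
  id_whiskerRight _ _ := hom_ext (by simp)
  comp_whiskerRight _ _ _ := hom_ext (by simp)
  whiskerRight_id _ := hom_ext (by simp)
  whiskerRight_comp _ _ _ := hom_ext (by simp)
  whisker_assoc _ _ _ _ _ := hom_ext (by simp)
  whisker_exchange _ _ := hom_ext (Bicategory.whisker_exchange _ _)
  pentagon _ _ _ _ := hom_ext (Bicategory.pentagon _ _ _ _)
  triangle _ _ := hom_ext (Bicategory.triangle _ _)

@[simp] theorem id_hom (X : S.Obj) : Mor.hom (𝟙 X) = 𝟙 X.base := rfl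
@[simp] theorem comp_hom {X Y Z : S.Obj} (F : X ⟶ Y) (G : Y ⟶ Z) :
    Mor.hom (F ≫ G) = F.hom ≫ G.hom := rfl

/-- The forgetful 2-functor. -/
@[simps]
def forget (S : Structured.{u, v, w, u'} B) : S.Obj ⥤ᵖ B where
  obj X := X.base
  map F := F.hom
  map₂ a := a.cell
  map₂_id _ := rfl
  map₂_comp _ _ := rfl
  mapId X := Iso.refl _
  mapComp F G := Iso.refl _
  map₂_whisker_left f _ _ η := by
    change f.hom ◁ η.cell = 𝟙 _ ≫ _ ≫ 𝟙 _; simp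
  map₂_whisker_right η h := by
    change η.cell ▷ h.hom = 𝟙 _ ≫ _ ≫ 𝟙 _; simp
  map₂_associator f g h := by
    change (α_ f.hom g.hom h.hom).hom = 𝟙 _ ≫ 𝟙 _ ▷ _ ≫ _ ≫ _ ◁ 𝟙 _ ≫ 𝟙 _; simp
  map₂_left_unitor f := by
    change (λ_ f.hom).hom = 𝟙 _ ≫ 𝟙 _ ▷ _ ≫ _; simp
  map₂_right_unitor f := by
    change (ρ_ f.hom).hom = 𝟙 _ ≫ _ ◁ 𝟙 _ ≫ _; simp

section Lift

variable {A : Type*} [Bicategory A]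

/-- A pseudofunctor `F` to `B`, with a choice `s` of structure on each of its values, takes values
in structured objects and structure preserving 1-cells. -/
structure LiftsTo (S : Structured.{u, v, w, u'} B) (F : A ⥤ᵖ B) (s : ∀ a, S.Str (F.obj a)) :
    Prop where
  ok : ∀ a, S.Ok (s a)
  isHom : ∀ {a b : A} (f : a ⟶ b), S.IsHom (s a) (s b) (F.map f)

/-- The resulting pseudofunctor to the bicategory of structured objects. -/
@[simps]
def lift {F : A ⥤ᵖ B} {s : ∀ a, S.Str (F.obj a)} (h : S.LiftsTo F s) : A ⥤ᵖ S.Obj where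
  obj a := ⟨F.obj a, s a, h.ok a⟩
  map f := ⟨F.map f, h.isHom f⟩
  map₂ a := ⟨F.map₂ a⟩
  map₂_id _ := hom_ext (F.map₂_id _)
  map₂_comp _ _ := hom_ext (F.map₂_comp _ _)
  mapId a := isoMk (F.mapId a)
  mapComp f g := isoMk (F.mapComp f g)
  map₂_whisker_left _ _ _ _ := hom_ext (F.map₂_whisker_left _ _)
  map₂_whisker_right _ _ := hom_ext (F.map₂_whisker_right _ _)
  map₂_associator _ _ _ := hom_ext (F.map₂_associator _ _ _)
  map₂_left_unitor _ := hom_ext (F.map₂_left_unitor _)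
  map₂_right_unitor _ := hom_ext (F.map₂_right_unitor _)

end Lift

end Structured

/-- A quasi 2-adjunction `L ⊣ R`: a transformation `1 ⟶ R L` such that, for all `a` and `b`, the
induced functor `B(L a, b) ⟶ A(a, R b)` (apply `R`, then precompose with the unit) is an
equivalence of categories. -/
structure QuasiAdjunction {A : Type*} [Bicategory A] {B : Type*} [Bicategory B]
    (L : A ⥤ᵖ B) (R : B ⥤ᵖ A) where
  unit : Pseudofunctor.StrongTrans (Pseudofunctor.id A) (L.comp R)
  isEquivalence : ∀ (a : A) (b : B),
    (R.toPrelaxFunctor.mapFunctor (L.obj a) b ⋙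
      Bicategory.precomp (R.obj b) (unit.app a)).IsEquivalence

/-! ## Doctrines -/

/-- A doctrine `P : Cᵒᵖ ⥤ PreOrd` on a small category `C`: `El c` is `P c`, and `re f` is `P f`. -/
structure Doctrine where
  base : Type u
  [cat : SmallCategory base]
  El : base → Type u
  [pre : ∀ c, Preorder (El c)]
  re : ∀ {c d : base}, (c ⟶ d) → El d → El c
  re_mono : ∀ {c d : base} (f : c ⟶ d) {x y : El d}, x ≤ y → re f x ≤ re f y
  re_id : ∀ {c : base} (x : El c), re (𝟙 c) x = x
  re_comp : ∀ {c d e : base} (f : c ⟶ d) (g : d ⟶ e) (x : El e), re (f ≫ g) x = re f (re g x)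

attribute [instance] Doctrine.cat Doctrine.pre
attribute [simp] Doctrine.re_id Doctrine.re_comp

namespace Doctrine

/-- A morphism of doctrines: a functor `F` with a natural transformation `a : P ⟶ Q ∘ Fᵒᵖ`. -/
structure Mor (P Q : Doctrine.{u}) where
  F : P.base ⥤ Q.base
  a : ∀ {c : P.base}, P.El c → Q.El (F.obj c)
  mono : ∀ {c : P.base} {x y : P.El c}, x ≤ y → a x ≤ a y
  nat : ∀ {c d : P.base} (f : c ⟶ d) (x : P.El d), a (P.re f x) = Q.re (F.map f) (a x)

/-- A 2-cell `(F, a) ⟶ (G, b)`: a natural transformation `α : F ⟶ G` with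
`a_c x ≤ Q(α_c) (b_c x)`. -/
@[ext]
structure Cell {P Q : Doctrine.{u}} (F G : Mor P Q) where
  α : F.F ⟶ G.F
  cond : ∀ {c : P.base} (x : P.El c), F.a x ≤ Q.re (α.app c) (G.a x)

instance {P Q : Doctrine.{u}} : Category (Mor P Q) where
  Hom F G := Cell F G
  id F := ⟨𝟙 F.F, fun x => by simp⟩
  comp s t := ⟨s.α ≫ t.α, fun x => by
    simpa using (s.cond x).trans (Q.re_mono _ (t.cond x))⟩
  id_comp _ := Cell.ext (Category.id_comp _)
  comp_id _ := Cell.ext (Category.comp_id _)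
  assoc _ _ _ := Cell.ext (Category.assoc _ _ _)

@[ext]
theorem cell_ext {P Q : Doctrine.{u}} {F G : Mor P Q} {s t : F ⟶ G} (h : s.α = t.α) : s = t :=
  Cell.ext h

theorem ext_app {P Q : Doctrine.{u}} {F G : Mor P Q} {s t : F ⟶ G}
    (h : ∀ c, s.α.app c = t.α.app c) : s = t :=
  cell_ext (NatTrans.ext (funext h))

@[simp] theorem id_α {P Q : Doctrine.{u}} (F : Mor P Q) : Cell.α (𝟙 F) = 𝟙 F.F := rfl
@[simp] theorem comp_α {P Q : Doctrine.{u}} {F G H : Mor P Q} (a : F ⟶ G) (b : G ⟶ H) :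
    Cell.α (a ≫ b) = a.α ≫ b.α := rfl

/-- Two morphisms with the same functor and the same action on fibres, up to order equivalence,
are isomorphic. -/
@[simps]
def isoOfLe {P Q : Doctrine.{u}} {F G : Mor P Q} (e : F.F ≅ G.F)
    (h : ∀ {c : P.base} (x : P.El c), F.a x ≤ Q.re (e.hom.app c) (G.a x))
    (h' : ∀ {c : P.base} (x : P.El c), G.a x ≤ Q.re (e.inv.app c) (F.a x)) : F ≅ G where
  hom := ⟨e.hom, h⟩
  inv := ⟨e.inv, h'⟩
  hom_inv_id := cell_ext e.hom_inv_id
  inv_hom_id := cell_ext e.inv_hom_id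

/-- The identity morphism. -/
@[simps]
def Mor.idMor (P : Doctrine.{u}) : Mor P P where
  F := 𝟭 _
  a x := x
  mono h := h
  nat _ _ := rfl

/-- The composite `(G, b) ∘ (F, a) = (G F, b_F ∘ a)`. -/
@[simps]
def Mor.compMor {P Q R : Doctrine.{u}} (F : Mor P Q) (G : Mor Q R) : Mor P R where
  F := F.F ⋙ G.F
  a x := G.a (F.a x)
  mono h := G.mono (F.mono h)
  nat f x := by rw [F.nat, G.nat]; rfl

instance : Bicategory Doctrine.{u} where
  Hom P Q := Mor P Q
  id P := Mor.idMor P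
  comp F G := F.compMor G
  homCategory P Q := inferInstanceAs (Category (Mor P Q))
  whiskerLeft F _ _ s := ⟨Functor.whiskerLeft F.F s.α, fun x => s.cond (F.a x)⟩
  whiskerRight {_ _ R F G} s H := ⟨Functor.whiskerRight s.α H.F, fun x =>
    (H.mono (s.cond x)).trans_eq (H.nat _ _)⟩
  associator {_ _ _ S} F G H := isoOfLe (Functor.associator F.F G.F H.F)
    (fun _ => (S.re_id _).ge) (fun _ => (S.re_id _).ge)
  leftUnitor {_ Q} F := isoOfLe F.F.leftUnitor (fun _ => (Q.re_id _).ge) (fun _ => (Q.re_id _).ge)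
  rightUnitor {_ Q} F := isoOfLe F.F.rightUnitor (fun _ => (Q.re_id _).ge) (fun _ => (Q.re_id _).ge)
  whiskerLeft_id _ _ := rfl
  whiskerLeft_comp _ _ _ _ _ _ := rfl
  id_whiskerLeft s := ext_app fun c => by change s.α.app c = 𝟙 _ ≫ s.α.app c ≫ 𝟙 _; simp
  comp_whiskerLeft F G _ _ s := ext_app fun c => by
    change s.α.app (G.F.obj (F.F.obj c)) = 𝟙 _ ≫ s.α.app (G.F.obj (F.F.obj c)) ≫ 𝟙 _; simp
  id_whiskerRight _ H := ext_app fun _ => H.F.map_id _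
  comp_whiskerRight _ _ H := ext_app fun _ => H.F.map_comp _ _
  whiskerRight_id s := ext_app fun c => by change s.α.app c = 𝟙 _ ≫ s.α.app c ≫ 𝟙 _; simp
  whiskerRight_comp s G H := ext_app fun c => by
    change H.F.map (G.F.map (s.α.app c)) = 𝟙 _ ≫ H.F.map (G.F.map (s.α.app c)) ≫ 𝟙 _; simp
  whisker_assoc F _ _ s H := ext_app fun c => by
    change H.F.map (s.α.app (F.F.obj c)) = 𝟙 _ ≫ H.F.map (s.α.app (F.F.obj c)) ≫ 𝟙 _; simp
  whisker_exchange s t := ext_app fun c => (t.α.naturality (s.α.app c)).symm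
  pentagon F G H I := ext_app fun c => by
    change I.F.map (𝟙 _) ≫ 𝟙 _ ≫ 𝟙 _ = 𝟙 _ ≫ 𝟙 _; simp
  triangle F G := ext_app fun c => by
    change 𝟙 _ ≫ 𝟙 _ = G.F.map (𝟙 _); simp

/-- The category `C ⋊ P`: objects are pairs `(c, x)` with `x ∈ P c`. -/
structure Total (P : Doctrine.{u}) where
  pt : P.base
  el : P.El pt

/-- An arrow `(c, x) ⟶ (d, y)` of `C ⋊ P`: an arrow `f : c ⟶ d` with `x ≤ P(f) y`. -/
@[ext]
structure TotalHom {P : Doctrine.{u}} (X Y : P.Total) where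
  f : X.pt ⟶ Y.pt
  cond : X.el ≤ P.re f Y.el

variable {P Q : Doctrine.{u}}

instance : SmallCategory P.Total where
  Hom X Y := TotalHom X Y
  id X := ⟨𝟙 _, by simp⟩
  comp s t := ⟨s.f ≫ t.f, by simpa using s.cond.trans (P.re_mono _ t.cond)⟩
  id_comp _ := TotalHom.ext (Category.id_comp _)
  comp_id _ := TotalHom.ext (Category.comp_id _)
  assoc _ _ _ := TotalHom.ext (Category.assoc _ _ _)

@[ext]
theorem total_ext {X Y : P.Total} {s t : X ⟶ Y} (h : s.f = t.f) : s = t := TotalHom.ext h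

@[simp] theorem total_id (X : P.Total) : TotalHom.f (𝟙 X) = 𝟙 X.pt := rfl
@[simp] theorem total_comp {X Y Z : P.Total} (s : X ⟶ Y) (t : Y ⟶ Z) :
    TotalHom.f (s ≫ t) = s.f ≫ t.f := rfl

/-- The functor `F ⋊ a`. -/
@[simps]
def Mor.total (F : Mor P Q) : P.Total ⥤ Q.Total where
  obj X := ⟨F.F.obj X.pt, F.a X.el⟩
  map s := ⟨F.F.map s.f, by simpa [F.nat] using F.mono s.cond⟩
  map_id _ := total_ext (by simp)
  map_comp _ _ := total_ext (by simp)

end Doctrine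

/-! ## Sites -/

/-- A collection of covering sieves, not subject to any axiom. -/
abbrev Cov (C : Type u) [Category.{v} C] := ∀ X : C, Set (Sieve X)

/-- The axioms of a Grothendieck topology. -/
def IsTopology {C : Type u} [Category.{v} C] (K : Cov C) : Prop :=
  ∃ J : GrothendieckTopology C, ∀ (X : C) (S : Sieve X), S ∈ K X ↔ S ∈ J X

namespace IsTopology

variable {C : Type u} [Category.{v} C] {K : Cov C}

theorem top_mem (h : IsTopology K) (X : C) : ⊤ ∈ K X := by
  obtain ⟨J, hJ⟩ := h
  rw [hJ]; exact J.top_mem X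

theorem pullback_mem (h : IsTopology K) {X Y : C} {S : Sieve X} (hS : S ∈ K X) (f : Y ⟶ X) :
    S.pullback f ∈ K Y := by
  obtain ⟨J, hJ⟩ := h
  rw [hJ] at hS ⊢; exact J.pullback_stable f hS

theorem trans (h : IsTopology K) {X : C} {S : Sieve X} (hS : S ∈ K X) (R : Sieve X)
    (H : ∀ ⦃Y : C⦄ ⦃f : Y ⟶ X⦄, S f → R.pullback f ∈ K Y) : R ∈ K X := by
  obtain ⟨J, hJ⟩ := h
  simp only [hJ] at hS H ⊢; exact J.transitive hS R fun _ _ hf => H hf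

theorem superset (h : IsTopology K) {X : C} {S R : Sieve X} (hS : S ∈ K X) (hR : S ≤ R) :
    R ∈ K X := by
  obtain ⟨J, hJ⟩ := h
  rw [hJ] at hS ⊢; exact J.superset_covering hR hS

end IsTopology

section MorphismOfSites

variable {C : Type u} [Category.{v} C] {D : Type u'} [Category.{v'} D]

/-- Arrows into `d` whose source maps to the image of `F`. -/
def inhSieve (F : C ⥤ D) (d : D) : Sieve d where
  arrows e _ := ∃ c : C, Nonempty (e ⟶ F.obj c)
  downward_closed := by
    rintro e e' h ⟨c, ⟨k⟩⟩ g
    exact ⟨c, ⟨g ≫ k⟩⟩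

/-- Arrows `h` into `d` such that `(h ≫ g₁, h ≫ g₂)` factors through the image under `F` of a
span `c₁ ← c → c₂`. -/
def spanSieve (F : C ⥤ D) {d : D} {c₁ c₂ : C} (g₁ : d ⟶ F.obj c₁) (g₂ : d ⟶ F.obj c₂) :
    Sieve d where
  arrows e h := ∃ (c : C) (f₁ : c ⟶ c₁) (f₂ : c ⟶ c₂) (k : e ⟶ F.obj c),
    h ≫ g₁ = k ≫ F.map f₁ ∧ h ≫ g₂ = k ≫ F.map f₂
  downward_closed := by
    rintro e e' h ⟨c, f₁, f₂, k, h₁, h₂⟩ g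
    exact ⟨c, f₁, f₂, g ≫ k, by simp [h₁], by simp [h₂]⟩

/-- Arrows `h` into `d` such that `h ≫ g` factors through the image under `F` of an arrow
equalizing `f₁` and `f₂`. -/
def equSieve (F : C ⥤ D) {d : D} {c₁ c₂ : C} (f₁ f₂ : c₁ ⟶ c₂) (g : d ⟶ F.obj c₁) :
    Sieve d where
  arrows e h := ∃ (c : C) (p : c ⟶ c₁) (k : e ⟶ F.obj c), p ≫ f₁ = p ≫ f₂ ∧ h ≫ g = k ≫ F.map p
  downward_closed := by
    rintro e e' h ⟨c, p, k, h₁, h₂⟩ g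
    exact ⟨c, p, g ≫ k, h₁, by simp [h₂]⟩

/-- Morphisms of sites. -/
structure IsMorphismOfSites (F : C ⥤ D) (J : Cov C) (K : Cov D) : Prop where
  cover : ∀ {c : C} {S : Sieve c}, S ∈ J c → S.functorPushforward F ∈ K (F.obj c)
  inh : ∀ d : D, inhSieve F d ∈ K d
  span : ∀ {d : D} {c₁ c₂ : C} (g₁ : d ⟶ F.obj c₁) (g₂ : d ⟶ F.obj c₂), spanSieve F g₁ g₂ ∈ K d
  equ : ∀ {d : D} {c₁ c₂ : C} (f₁ f₂ : c₁ ⟶ c₂) (g : d ⟶ F.obj c₁),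
    g ≫ F.map f₁ = g ≫ F.map f₂ → equSieve F f₁ f₂ g ∈ K d

theorem IsMorphismOfSites.id {K : Cov C} (h : IsTopology K) :
    IsMorphismOfSites (𝟭 C) K K where
  cover hS := by simpa [Sieve.functorPushforward_id] using hS
  inh d := h.superset (h.top_mem d) fun e _ _ => ⟨e, ⟨𝟙 e⟩⟩
  span {d _ _} g₁ g₂ := h.superset (h.top_mem d) fun e f _ =>
    ⟨d, g₁, g₂, f, rfl, rfl⟩
  equ {d _ _} f₁ f₂ g hg := h.superset (h.top_mem d) fun e f _ =>
    ⟨d, g, f, hg, rfl⟩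

theorem IsMorphismOfSites.comp {E : Type w} [Category.{w} E] {F : C ⥤ D} {G : D ⥤ E}
    {J : Cov C} {K : Cov D} {M : Cov E} (hM : IsTopology M)
    (hF : IsMorphismOfSites F J K) (hG : IsMorphismOfSites G K M) :
    IsMorphismOfSites (F ⋙ G) J M where
  cover hS := by
    rw [Sieve.functorPushforward_comp]
    exact hG.cover (hF.cover hS)
  inh e := by
    refine hM.trans (hG.inh e) _ ?_
    rintro e' f ⟨d, ⟨k⟩⟩
    refine hM.superset (hM.pullback_mem (hG.cover (hF.inh d)) k) ?_
    rintro e'' g ⟨d', p, q, ⟨c, ⟨m⟩⟩, hq⟩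
    exact ⟨c, ⟨q ≫ G.map m⟩⟩
  span {e c₁ c₂} g₁ g₂ := by
    refine hM.trans (hG.span g₁ g₂) _ ?_
    rintro e' f ⟨d, f₁, f₂, k, h₁, h₂⟩
    refine hM.superset (hM.pullback_mem (hG.cover (hF.span f₁ f₂)) k) ?_
    rintro e'' g ⟨d', p, q, ⟨c, m₁, m₂, l, hm₁, hm₂⟩, hq⟩
    refine ⟨c, m₁, m₂, q ≫ G.map l, ?_, ?_⟩
    · simp only [Category.assoc, h₁, reassoc_of% hq, ← G.map_comp, hm₁, Functor.comp_map]
    · simp only [Category.assoc, h₂, reassoc_of% hq, ← G.map_comp, hm₂, Functor.comp_map]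
  equ {e c₁ c₂} f₁ f₂ g hg := by
    refine hM.trans (hG.equ (F.map f₁) (F.map f₂) g hg) _ ?_
    rintro e' f ⟨d, p, k, hp, hk⟩
    refine hM.superset (hM.pullback_mem (hG.cover (hF.equ f₁ f₂ p hp)) k) ?_
    rintro e'' h ⟨d', r, q, ⟨c, m, l, hm, hl⟩, hq⟩
    refine ⟨c, m, q ≫ G.map l, hm, ?_⟩
    simp only [Category.assoc, hk, reassoc_of% hq, ← G.map_comp, hl, Functor.comp_map]

end MorphismOfSites

/-- The 2-category of doctrinal sites: doctrines `P : Cᵒᵖ ⥤ PreOrd` with a Grothendieck topology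
on `C ⋊ P`; 1-cells are morphisms `(F, a)` of doctrines such that `F` is flat and `F ⋊ a` is a
morphism of sites. -/
def docSites : Structured Doctrine.{u} where
  Str P := Cov P.Total
  Ok K := IsTopology K
  IsHom {P Q} J K (F : Doctrine.Mor P Q) := RepresentablyFlat F.F ∧ IsMorphismOfSites F.total J K
  id_isHom _ hK := ⟨RepresentablyFlat.id, .id hK⟩
  comp_isHom {_ _ _} _ _ _ (F : Doctrine.Mor _ _) (G : Doctrine.Mor _ _) _ _ hR hF hG :=
    ⟨have := hF.1; have := hG.1; RepresentablyFlat.comp F.F G.F, hF.2.comp hR hG.2⟩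

/-! ## Existential and geometric doctrines -/

namespace Doctrine

variable {P Q R : Doctrine.{u}}

/-- `e` is the value `∃_f x` of a left adjoint of `P(f)`. -/
def IsEx {c d : P.base} (f : c ⟶ d) (x : P.El c) (e : P.El d) : Prop :=
  ∀ y, e ≤ y ↔ x ≤ P.re f y

/-- Existential doctrines: the base has finite limits, the fibres are meet-semilattices
(with top) and the maps `P(f)` meet-semilattice homomorphisms, with left adjoints `∃_f` that
satisfy the Frobenius and Beck-Chevalley conditions. -/
class IsExistential (P : Doctrine.{u}) : Prop where
  hasFiniteLimits : HasFiniteLimits P.base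
  antisymm : ∀ {c : P.base} {x y : P.El c}, x ≤ y → y ≤ x → x = y
  exists_top : ∀ c : P.base, ∃ t : P.El c, IsTop t
  exists_inf : ∀ {c : P.base} (x y : P.El c), ∃ z, IsGLB {x, y} z
  re_top : ∀ {c d : P.base} (f : c ⟶ d) {t : P.El d}, IsTop t → IsTop (P.re f t)
  re_inf : ∀ {c d : P.base} (f : c ⟶ d) {x y z : P.El d},
    IsGLB {x, y} z → IsGLB {P.re f x, P.re f y} (P.re f z)
  exists_ex : ∀ {c d : P.base} (f : c ⟶ d) (x : P.El c), ∃ e, IsEx f x e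
  frobenius : ∀ {c d : P.base} (f : c ⟶ d) {x : P.El c} {y : P.El d} {e w : P.El d} {z : P.El c},
    IsEx f x e → IsGLB {x, P.re f y} z → IsGLB {e, y} w → IsEx f z w
  beckChevalley : ∀ {b c d e : P.base} {g : b ⟶ d} {k : b ⟶ c} {h : d ⟶ e} {f : c ⟶ e},
    IsPullback g k h f → ∀ {x : P.El c} {w : P.El e}, IsEx f x w → IsEx g (P.re k x) (P.re h w)

/-- Morphisms of existential doctrines: `F` preserves finite limits and `a` preserves finite meets
and the left adjoints. -/
structure IsExMor (F : Mor P Q) : Prop where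
  preservesFiniteLimits : PreservesFiniteLimits F.F
  top : ∀ {c : P.base} {t : P.El c}, IsTop t → IsTop (F.a t)
  inf : ∀ {c : P.base} {x y z : P.El c}, IsGLB {x, y} z → IsGLB {F.a x, F.a y} (F.a z)
  ex : ∀ {c d : P.base} (f : c ⟶ d) {x : P.El c} {e : P.El d},
    IsEx f x e → IsEx (F.F.map f) (F.a x) (F.a e)

theorem IsExMor.id : IsExMor (Mor.idMor P) :=
  ⟨inferInstanceAs (PreservesFiniteLimits (𝟭 _)), fun h => h, fun h => h, fun _ _ _ h => h⟩

theorem IsExMor.comp {F : Mor P Q} {G : Mor Q R} (hF : IsExMor F) (hG : IsExMor G) :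
    IsExMor (F.compMor G) :=
  ⟨have := hF.1; have := hG.1; comp_preservesFiniteLimits F.F G.F,
    fun h => hG.top (hF.top h), fun h => hG.inf (hF.inf h), fun _ _ _ h => hG.ex _ (hF.ex _ h)⟩

/-- The 2-category of existential doctrines. -/
def _root_.GeomCompl.exDoc : Structured Doctrine.{u} where
  Str _ := PUnit.{u + 1}
  Ok {P} _ := P.IsExistential
  IsHom {P Q} _ _ (F : Mor P Q) := IsExMor F
  id_isHom _ _ := .id
  comp_isHom {_ _ _} _ _ _ (_ : Mor _ _) (_ : Mor _ _) _ _ _ hF hG := hF.comp hG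

/-- For a sieve `S` on `(d, y)` in `C ⋊ P`, the sieve on `y` in the preorder `P d` generated by the
inequalities `∃_f z ≤ y`, for `f : (c, z) ⟶ (d, y)` in `S`. -/
def exSieve {X : P.Total} (S : Sieve X) : Sieve X.el where
  arrows w _ := ∃ (Z : P.Total) (f : Z ⟶ X), S f ∧ ∃ e, IsEx f.f Z.el e ∧ w ≤ e
  downward_closed := by
    rintro w w' _ ⟨Z, f, hf, e, he, hw⟩ g
    exact ⟨Z, f, hf, e, he, (leOfHom g).trans hw⟩

/-- For a sieve `T` on `x` in `P c`, the sieve on `e = ∃_f x` generated by the inequalities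
`∃_f z ≤ ∃_f x`, for `z ≤ x` in `T`. -/
def exImage {c d : P.base} (f : c ⟶ d) {x : P.El c} (T : Sieve x) (e : P.El d) : Sieve e where
  arrows w _ := ∃ (z : P.El c) (i : z ⟶ x), T i ∧ ∃ e', IsEx f z e' ∧ w ≤ e'
  downward_closed := by
    rintro w w' _ ⟨z, i, hi, e', he, hw⟩ g
    exact ⟨z, i, hi, e', he, (leOfHom g).trans hw⟩

/-- The arrow `(d, x) ⟶ (d, y)` over the identity given by `x ≤ y`. -/
def vertical {d : P.base} {x y : P.El d} (h : x ≤ y) :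
    (⟨d, x⟩ : P.Total) ⟶ (⟨d, y⟩ : P.Total) :=
  ⟨𝟙 d, by simpa using h⟩

/-- The arrow `(e, P(h) y) ⟶ (d, y)` over `h`. -/
def cartesian {e d : P.base} (h : e ⟶ d) (y : P.El d) :
    (⟨e, P.re h y⟩ : P.Total) ⟶ (⟨d, y⟩ : P.Total) :=
  ⟨h, le_rfl⟩

/-- Existential doctrinal sites. -/
structure IsExistentialSite (P : Doctrine.{u}) (J : ∀ c : P.base, GrothendieckTopology (P.El c)) :
    Prop where
  exists_ex : ∀ {c d : P.base} (f : c ⟶ d) (x : P.El c), ∃ e, IsEx f x e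
  ex_cover : ∀ {c d : P.base} (f : c ⟶ d) {x : P.El c} {e : P.El d} {T : Sieve x},
    IsEx f x e → T ∈ J c x → exImage f T e ∈ J d e
  frobenius : ∀ {d : P.base} {x y : P.El d} (h : x ≤ y) {S : Sieve (⟨d, y⟩ : P.Total)},
    exSieve S ∈ J d y → exSieve (S.pullback (vertical h)) ∈ J d x
  beckChevalley : ∀ {e d : P.base} (h : e ⟶ d) {y : P.El d} {S : Sieve (⟨d, y⟩ : P.Total)},
    exSieve S ∈ J d y → exSieve (S.pullback (cartesian h y)) ∈ J e (P.re h y)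

/-- The existential topology on `C ⋊ P`: a sieve on `(d, y)` covers when the inequalities
`∃_f z ≤ y`, for `f : (c, z) ⟶ (d, y)` in it, are a `J_d`-cover. -/
def exCov (P : Doctrine.{u}) (J : ∀ c : P.base, Cov (P.El c)) : Cov P.Total :=
  fun X => {S | exSieve S ∈ J X.pt X.el}

/-- The sieves on `(d, V)` such that `V` is the join of the `∃_f U`, for `f : (c, U) ⟶ (d, V)` in
the sieve. -/
def geomCov (P : Doctrine.{u}) : Cov P.Total :=
  fun X => {S | IsLUB {e | ∃ (Z : P.Total) (f : Z ⟶ X), S f ∧ IsEx f.f Z.el e} X.el}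

/-- Geometric doctrines: functors from `Cᵒᵖ` to frames and open frame homomorphisms that satisfy
the relative Beck-Chevalley condition. -/
structure IsGeometric (P : Doctrine.{u}) : Prop where
  antisymm : ∀ {c : P.base} {x y : P.El c}, x ≤ y → y ≤ x → x = y
  exists_sup : ∀ {c : P.base} (A : Set (P.El c)), ∃ s, IsLUB A s
  inf_sup : ∀ {c : P.base} {A : Set (P.El c)} {x s m : P.El c}, IsLUB A s → IsGLB {x, s} m →
    IsLUB {w | ∃ y ∈ A, IsGLB {x, y} w} m
  re_top : ∀ {c d : P.base} (f : c ⟶ d) {t : P.El d}, IsTop t → IsTop (P.re f t)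
  re_inf : ∀ {c d : P.base} (f : c ⟶ d) {x y z : P.El d},
    IsGLB {x, y} z → IsGLB {P.re f x, P.re f y} (P.re f z)
  re_sup : ∀ {c d : P.base} (f : c ⟶ d) {A : Set (P.El d)} {s : P.El d},
    IsLUB A s → IsLUB (P.re f '' A) (P.re f s)
  exists_ex : ∀ {c d : P.base} (f : c ⟶ d) (x : P.El c), ∃ e, IsEx f x e
  frobenius : ∀ {c d : P.base} (f : c ⟶ d) {x : P.El c} {y : P.El d} {e w : P.El d} {z : P.El c},
    IsEx f x e → IsGLB {x, P.re f y} z → IsGLB {e, y} w → IsEx f z w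
  beckChevalley : ∀ {e d : P.base} (h : e ⟶ d) {y : P.El d} {S : Sieve (⟨d, y⟩ : P.Total)},
    S ∈ P.geomCov ⟨d, y⟩ → S.pullback (cartesian h y) ∈ P.geomCov ⟨e, P.re h y⟩

end Doctrine

/-- The 2-category `ExDocSites`: objects are the existential doctrinal sites with an existential
underlying doctrine, equipped with the existential topology; 1-cells are the morphisms of
doctrinal sites that are morphisms of existential doctrines. -/
def exDocSites : Structured Doctrine.{u} where
  Str P := Cov P.Total
  Ok {P} K := IsTopology K ∧ P.IsExistential ∧
    ∃ J : ∀ c : P.base, GrothendieckTopology (P.El c),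
      P.IsExistentialSite J ∧ K = P.exCov fun c x => J c x
  IsHom {P Q} J K (F : Doctrine.Mor P Q) := docSites.IsHom J K F ∧ Doctrine.IsExMor F
  id_isHom K h := ⟨docSites.id_isHom K h.1, .id⟩
  comp_isHom J K L F G hJ hK hL hF hG :=
    ⟨docSites.comp_isHom J K L F G hJ.1 hK.1 hL.1 hF.1 hG.1, hF.2.comp hG.2⟩

/-- The 2-category `GeomDoc_cart`: the full sub-2-category of doctrinal sites on the geometric
doctrines `L` over a base with finite limits, equipped with the topology `K_L`. -/
def geomDocCart : Structured Doctrine.{u} where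
  Str P := Cov P.Total
  Ok {P} K := docSites.Ok K ∧ HasFiniteLimits P.base ∧ P.IsGeometric ∧ K = P.geomCov
  IsHom J K F := docSites.IsHom J K F
  id_isHom K h := docSites.id_isHom K h.1
  comp_isHom J K L F G hJ hK hL hF hG := docSites.comp_isHom J K L F G hJ.1 hK.1 hL.1 hF hG

/-! ## Regular and geometric categories -/

/-- The 2-category of (small) regular categories, regular functors and natural transformations. -/
def reg : Structured Cat.{u, u} where
  Str _ := PUnit.{u + 1}
  Ok {C} _ := Regular C
  IsHom {C _} _ _ F := PreservesFiniteLimits F.toFunctor ∧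
    ∀ {X Y : C} (f : X ⟶ Y), IsRegularEpi f → IsRegularEpi (F.toFunctor.map f)
  id_isHom {C} _ _ := ⟨inferInstanceAs (PreservesFiniteLimits (𝟭 C)), fun _ h => h⟩
  comp_isHom _ _ _ F G _ _ _ hF hG :=
    ⟨have := hF.1; have := hG.1; comp_preservesFiniteLimits F.toFunctor G.toFunctor,
      fun f h => hG.2 _ (hF.2 f h)⟩

/-- The 2-category of regular sites: regular categories with a Grothendieck topology for which
regular epimorphisms generate covering sieves, and cover preserving regular functors. -/
def regSites : Structured Cat.{u, u} where
  Str C := Cov C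
  Ok {C} K := IsTopology K ∧ Regular C ∧
    ∀ {X Y : C} (f : X ⟶ Y), IsRegularEpi f → Sieve.generateSingleton f ∈ K Y
  IsHom {C _} J K F := reg.IsHom ⟨⟩ ⟨⟩ F ∧
    ∀ {X : C} {S : Sieve X}, S ∈ J X → S.functorPushforward F.toFunctor ∈ K _
  id_isHom {C} K h := ⟨reg.id_isHom _ h.2.1, fun {X S} hS => by
    change S.functorPushforward (𝟭 C) ∈ K X
    rwa [Sieve.functorPushforward_id]⟩
  comp_isHom {C D E} J K L F G hJ hK hL hF hG :=
    ⟨reg.comp_isHom _ _ _ F G hJ.2.1 hK.2.1 hL.2.1 hF.1 hG.1, fun {X S} hS => by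
      change S.functorPushforward (F.toFunctor ⋙ G.toFunctor) ∈ L _
      rw [Sieve.functorPushforward_comp]
      exact hG.2 (hF.2 hS)⟩

section Subobjects

variable {C D E : Type u} [SmallCategory C] [SmallCategory D] [SmallCategory E]

/-- The action of a finite limit preserving functor on subobjects. -/
noncomputable def subMap (F : C ⥤ D) [PreservesFiniteLimits F] {c : C} (S : Subobject c) :
    Subobject (F.obj c) :=
  Subobject.mk (F.map S.arrow)

theorem subMap_mk (F : C ⥤ D) [PreservesFiniteLimits F] {c s : C} (i : s ⟶ c) [Mono i] :
    subMap F (Subobject.mk i) = Subobject.mk (F.map i) :=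
  Subobject.mk_eq_mk_of_comm _ _ (F.mapIso (Subobject.underlyingIso i))
    (by
      rw [Functor.mapIso_hom, ← F.map_comp]
      congr 1
      exact ((Iso.inv_comp_eq _).1 (Subobject.underlyingIso_arrow i)).symm)

theorem subMap_id {c : C} (S : Subobject c) : subMap (𝟭 C) S = S :=
  Subobject.mk_arrow S

theorem subMap_comp (F : C ⥤ D) (G : D ⥤ E) [PreservesFiniteLimits F] [PreservesFiniteLimits G]
    [PreservesFiniteLimits (F ⋙ G)] {c : C} (S : Subobject c) :
    subMap (F ⋙ G) S = subMap G (subMap F S) :=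
  (subMap_mk G (F.map S.arrow)).symm

theorem subMap_mono (F : C ⥤ D) [PreservesFiniteLimits F] {c : C} {S T : Subobject c}
    (h : S ≤ T) : subMap F S ≤ subMap F T :=
  Subobject.mk_le_mk_of_comm (F.map (Subobject.ofLE S T h))
    (by rw [← F.map_comp, Subobject.ofLE_arrow])

/-- The doctrine of subobjects of a category with finite limits. -/
noncomputable def subDoctrine (C : Type u) [SmallCategory C] [HasFiniteLimits C] :
    Doctrine.{u} where
  base := C
  El c := Subobject c
  re f := (Subobject.pullback f).obj
  re_mono f _ _ h := (Subobject.pullback f).monotone h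
  re_id x := Subobject.pullback_id x
  re_comp f g x := Subobject.pullback_comp f g x

theorem subMap_pullback [HasFiniteLimits C] [HasFiniteLimits D] (F : C ⥤ D)
    [PreservesFiniteLimits F] {c d : C} (f : c ⟶ d) (S : Subobject d) :
    (Subobject.pullback (F.map f)).obj (subMap F S) =
      subMap F ((Subobject.pullback f).obj S) :=
  Subobject.pullback_obj_mk ((Subobject.isPullback f S).map F)

/-- The morphism `(F, a^F)` of subobject doctrines. -/
noncomputable def subDoctrineMap [HasFiniteLimits C] [HasFiniteLimits D] (F : C ⥤ D)
    [PreservesFiniteLimits F] : Doctrine.Mor (subDoctrine C) (subDoctrine D) where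
  F := F
  a S := subMap F S
  mono h := subMap_mono F h
  nat f S := (subMap_pullback F f S).symm

theorem subMap_le [HasFiniteLimits C] [HasFiniteLimits D] {F G : C ⥤ D}
    [PreservesFiniteLimits F] [PreservesFiniteLimits G] (α : F ⟶ G) {c : C} (S : Subobject c) :
    subMap F S ≤ (Subobject.pullback (α.app c)).obj (subMap G S) := by
  have h := Subobject.isPullback (α.app c) (subMap G S)
  refine Subobject.mk_le_of_comm (h.lift
    (α.app _ ≫ (Subobject.underlyingIso (G.map S.arrow)).inv) (F.map S.arrow) ?_) (h.lift_snd _ _ _)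
  simp [subMap]

end Subobjects

instance (C : reg.{u}.Obj) : Regular C.base := C.ok

instance {C D : reg.{u}.Obj} (F : C ⟶ D) : PreservesFiniteLimits F.hom.toFunctor := F.isHom.1

/-- The 2-functor taking a regular category to its doctrine of subobjects. -/
noncomputable def subDoc : reg.{u}.Obj ⥤ᵖ Doctrine.{u} where
  obj C := subDoctrine C.base
  map F := subDoctrineMap F.hom.toFunctor
  map₂ {_ _ _ _} α := ⟨α.cell.toNatTrans, fun S => subMap_le α.cell.toNatTrans S⟩
  map₂_id _ := rfl
  map₂_comp _ _ := rfl
  mapId C := Doctrine.isoOfLe (Iso.refl (𝟭 C.base))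
    (fun S => (subMap_id S).le.trans (Subobject.pullback_id _).ge)
    (fun S => (subMap_id S).ge.trans (Subobject.pullback_id _).ge)
  mapComp F G := Doctrine.isoOfLe (Iso.refl (F.hom.toFunctor ⋙ G.hom.toFunctor))
    (fun S => (subMap_comp F.hom.toFunctor G.hom.toFunctor S).le.trans (Subobject.pullback_id _).ge)
    (fun S => (subMap_comp F.hom.toFunctor G.hom.toFunctor S).ge.trans (Subobject.pullback_id _).ge)
  map₂_whisker_left F G H α := Doctrine.ext_app fun c => by
    change α.cell.toNatTrans.app _ = 𝟙 _ ≫ α.cell.toNatTrans.app _ ≫ 𝟙 _; simp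
  map₂_whisker_right α H := Doctrine.ext_app fun c => by
    change H.hom.toFunctor.map (α.cell.toNatTrans.app c) =
      𝟙 _ ≫ H.hom.toFunctor.map (α.cell.toNatTrans.app c) ≫ 𝟙 _; simp
  map₂_associator F G H := Doctrine.ext_app fun c => by
    change 𝟙 _ = 𝟙 _ ≫ H.hom.toFunctor.map (𝟙 _) ≫ 𝟙 _ ≫ 𝟙 _ ≫ 𝟙 _; simp
  map₂_left_unitor F := Doctrine.ext_app fun c => by
    change 𝟙 _ = 𝟙 _ ≫ F.hom.toFunctor.map (𝟙 _) ≫ 𝟙 _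
    rw [Category.id_comp, Category.comp_id]; exact (F.hom.toFunctor.map_id c).symm
  map₂_right_unitor F := Doctrine.ext_app fun c => by
    change 𝟙 _ = 𝟙 _ ≫ 𝟙 _ ≫ 𝟙 _; simp

/-- Geometric categories: regular categories whose subobject lattices have arbitrary joins, that
are preserved by pullback. -/
class IsGeometricCat (C : Type u) [SmallCategory C] : Prop extends Regular C where
  exists_sup : ∀ {X : C} (A : Set (Subobject X)), ∃ s, IsLUB A s
  pullback_sup : ∀ {X Y : C} (f : X ⟶ Y) {A : Set (Subobject Y)} {s : Subobject Y},
    IsLUB A s → IsLUB ((Subobject.pullback f).obj '' A) ((Subobject.pullback f).obj s)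

/-- The 2-category of geometric categories, geometric functors (regular functors that preserve
joins of subobjects) and natural transformations. -/
def geomCat : Structured Cat.{u, u} where
  Str _ := PUnit.{u + 1}
  Ok {C} _ := IsGeometricCat C
  IsHom {C _} _ _ F := reg.IsHom ⟨⟩ ⟨⟩ F ∧
    ∀ [PreservesFiniteLimits F.toFunctor] {X : C} {A : Set (Subobject X)} {s : Subobject X},
      IsLUB A s → IsLUB (subMap F.toFunctor '' A) (subMap F.toFunctor s)
  id_isHom {C} _ h := ⟨reg.id_isHom (a := C) ⟨⟩ h.toRegular, fun {_ X A s} hs => by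
    have : (subMap (𝟭 C) : Subobject X → _) '' A = A := by
      rw [show (subMap (𝟭 C) : Subobject X → _) = id from funext subMap_id, Set.image_id]
    change IsLUB ((subMap (𝟭 C) : Subobject X → _) '' A) (subMap (𝟭 C) s)
    rwa [this, subMap_id]⟩
  comp_isHom {C D E} _ _ _ F G hC hD hE hF hG := by
    refine ⟨reg.comp_isHom ⟨⟩ ⟨⟩ ⟨⟩ F G hC.toRegular hD.toRegular hE.toRegular hF.1 hG.1,
      fun {h X A s} hs => ?_⟩
    have hF1 := hF.1.1
    have hG1 := hG.1.1
    have h' : PreservesFiniteLimits (F.toFunctor ⋙ G.toFunctor) := h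
    change IsLUB ((subMap (F.toFunctor ⋙ G.toFunctor) : Subobject X → _) '' A)
      (subMap (F.toFunctor ⋙ G.toFunctor) s)
    rw [show (subMap (F.toFunctor ⋙ G.toFunctor) : Subobject X → _) =
      (subMap G.toFunctor) ∘ (subMap F.toFunctor) from
      funext (subMap_comp F.toFunctor G.toFunctor), Set.image_comp, Function.comp]
    exact hG.2 (hF.2 hs)

/-- The geometric topology: a sieve on `X` covers when it is jointly (extremally) epimorphic, that
is, when the only subobject of `X` through which all its arrows factor is `X` itself. -/
def jointlyEpiCov (C : Type u) [SmallCategory C] : Cov C :=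
  fun X => {S | ∀ A : Subobject X, (∀ {Y : C} (f : Y ⟶ X), S f → A.Factors f) → A = ⊤}

/-- The restriction of `K` to the preorders of subobjects. -/
def subCov {C : Type u} [SmallCategory C] (K : Cov C) (c : C) : Cov (Subobject c) :=
  fun b => {T | T.functorPushforward Subobject.underlying ∈ K (b : C)}

/-- Forgetting the topology of a regular site. -/
def regSitesToReg : regSites.{u}.Obj ⥤ᵖ reg.{u}.Obj :=
  reg.lift (F := regSites.forget) (s := fun _ => ⟨⟩) ⟨fun a => a.ok.2.1, fun f => f.isHom.1⟩

/-- Forgetting that a geometric category is geometric. -/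
def geomCatToReg : geomCat.{u}.Obj ⥤ᵖ reg.{u}.Obj :=
  reg.lift (F := geomCat.forget) (s := fun _ => ⟨⟩) ⟨fun a => a.ok.toRegular, fun f => f.isHom.1⟩

/-- The topology `K_Sub` on `C ⋊ Sub_C` of a regular site `(C, K)`. -/
noncomputable def kSub (C : regSites.{u}.Obj) :
    Cov ((regSitesToReg.comp subDoc).obj C).Total :=
  (subDoctrine (regSitesToReg.obj C).base).exCov fun c => subCov C.str c

/-- The topology `K_{Sub_G}` on `G ⋊ Sub_G` of a geometric category `G`. -/
noncomputable def kSubGeom (G : geomCat.{u}.Obj) :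
    Cov ((geomCatToReg.comp subDoc).obj G).Total :=
  (subDoctrine (geomCatToReg.obj G).base).geomCov

/-! ## Syntactic categories -/

namespace Doctrine

noncomputable section

variable {P Q R : Doctrine.{u}}

section Ops

variable [hP : P.IsExistential]

instance : HasFiniteLimits P.base := hP.hasFiniteLimits

/-- The top element of a fibre. -/
def top (c : P.base) : P.El c := (hP.exists_top c).choose

/-- Binary meets in the fibres. -/
def inf {c : P.base} (x y : P.El c) : P.El c := (hP.exists_inf x y).choose

/-- The left adjoint of `P(f)`. -/
def ex {c d : P.base} (f : c ⟶ d) (x : P.El c) : P.El d := (hP.exists_ex f x).choose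

theorem isTop_top (c : P.base) : IsTop (top c) := (hP.exists_top c).choose_spec

theorem isGLB_inf {c : P.base} (x y : P.El c) : IsGLB {x, y} (inf x y) :=
  (hP.exists_inf x y).choose_spec

theorem isEx_ex {c d : P.base} (f : c ⟶ d) (x : P.El c) : IsEx f x (ex f x) :=
  (hP.exists_ex f x).choose_spec

theorem le_inf {c : P.base} {x y z : P.El c} (h : z ≤ x) (h' : z ≤ y) : z ≤ inf x y :=
  (isGLB_inf x y).2 (by simp [lowerBounds, h, h'])

theorem inf_le_left {c : P.base} (x y : P.El c) : inf x y ≤ x := (isGLB_inf x y).1 (by simp)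

theorem inf_le_right {c : P.base} (x y : P.El c) : inf x y ≤ y := (isGLB_inf x y).1 (by simp)

theorem isGLB_eq {c : P.base} {x y z : P.El c} (h : IsGLB {x, y} z) : z = inf x y :=
  hP.antisymm ((isGLB_inf x y).2 h.1) (h.2 (isGLB_inf x y).1)

theorem isEx_eq {c d : P.base} {f : c ⟶ d} {x : P.El c} {e : P.El d} (h : IsEx f x e) :
    e = ex f x :=
  hP.antisymm ((h _).2 ((isEx_ex f x _).1 le_rfl)) ((isEx_ex f x _).2 ((h _).1 le_rfl))

theorem re_inf {c d : P.base} (f : c ⟶ d) (x y : P.El d) :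
    P.re f (inf x y) = inf (P.re f x) (P.re f y) :=
  isGLB_eq (hP.re_inf f (isGLB_inf x y))

theorem le_re_top {c d : P.base} (f : c ⟶ d) (x : P.El c) : x ≤ P.re f (top d) :=
  hP.re_top f (isTop_top d) x

/-- Introduction rule for `∃_f`. -/
theorem ex_intro {X c d : P.base} {f : c ⟶ d} {M : P.El c} {A : P.El X} (s : X ⟶ c)
    (h : A ≤ P.re s M) : A ≤ P.re (s ≫ f) (ex f M) := by
  rw [P.re_comp]
  exact h.trans (P.re_mono _ ((isEx_ex f M _).1 le_rfl))

/-- Elimination rule for `∃_f`. -/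
theorem ex_elim {X c d : P.base} {t : X ⟶ d} {f : c ⟶ d} {M : P.El c} {A B : P.El X}
    (h : A ≤ P.re t (ex f M))
    (H : ∀ {X' : P.base} (p : X' ⟶ X) (s : X' ⟶ c), p ≫ t = s ≫ f →
      ∀ A' : P.El X', A' ≤ P.re p A → A' ≤ P.re s M → A' ≤ P.re p B) : A ≤ B := by
  have h1 := hP.beckChevalley (IsPullback.of_hasPullback t f) (isEx_ex f M)
  have h2 := hP.frobenius _ h1 (isGLB_inf _ (P.re (pullback.fst t f) A)) (isGLB_inf _ A)
  refine (le_inf h le_rfl).trans ((h2 B).2 ?_)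
  exact H _ _ pullback.condition _ (inf_le_right _ _) (inf_le_left _ _)

/-- The value of a binary predicate `W` on a pair of generalized elements. -/
def at₂ {X c d : P.base} (W : P.El (c ⨯ d)) (x : X ⟶ c) (y : X ⟶ d) : P.El X :=
  P.re (prod.lift x y) W

theorem re_at₂ {Y X c d : P.base} (p : Y ⟶ X) (W : P.El (c ⨯ d)) (x : X ⟶ c) (y : X ⟶ d) :
    P.re p (at₂ W x y) = at₂ W (p ≫ x) (p ≫ y) := by
  rw [at₂, at₂, ← P.re_comp, prod.comp_lift]

theorem re_eq_at₂ {X c d : P.base} (t : X ⟶ c ⨯ d) (W : P.El (c ⨯ d)) :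
    P.re t W = at₂ W (t ≫ prod.fst) (t ≫ prod.snd) := by
  rw [at₂, ← prod.comp_lift, prod.lift_fst_snd, Category.comp_id]

theorem at₂_fst_snd {c d : P.base} (W : P.El (c ⨯ d)) : at₂ W prod.fst prod.snd = W := by
  rw [at₂, prod.lift_fst_snd, P.re_id]

theorem ext₂ {c d : P.base} {W W' : P.El (c ⨯ d)}
    (h : ∀ {X : P.base} (x : X ⟶ c) (y : X ⟶ d) (A : P.El X), A ≤ at₂ W x y ↔ A ≤ at₂ W' x y) :
    W = W' := by
  rw [← at₂_fst_snd W, ← at₂_fst_snd W']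
  exact hP.antisymm ((h _ _ _).1 le_rfl) ((h _ _ _).2 le_rfl)

/-- The internal equality predicate. -/
def eqPred (d : P.base) : P.El (d ⨯ d) := ex (diag d) (top d)

/-- The relational composite
`∃_{pr_{1,3}} (P(pr_{1,2}) W ∧ P(pr_{2,3}) W')` of `W ∈ P (c × d)` and `W' ∈ P (d × e)`. -/
def relComp {c d e : P.base} (W : P.El (c ⨯ d)) (W' : P.El (d ⨯ e)) : P.El (c ⨯ e) :=
  ex (prod.lift prod.fst (prod.snd ≫ prod.snd) : c ⨯ (d ⨯ e) ⟶ c ⨯ e)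
    (inf (P.re (prod.lift prod.fst (prod.snd ≫ prod.fst)) W) (P.re prod.snd W'))

/-- Provably functional relations `(c, U) ⟶ (d, V)`. -/
structure IsFunctional {c d : P.base} (U : P.El c) (V : P.El d) (W : P.El (c ⨯ d)) : Prop where
  le : W ≤ inf (P.re prod.fst U) (P.re prod.snd V)
  unique : inf
      (P.re (prod.lift prod.fst (prod.snd ≫ prod.fst) : c ⨯ (d ⨯ d) ⟶ c ⨯ d) W)
      (P.re (prod.lift prod.fst (prod.snd ≫ prod.snd) : c ⨯ (d ⨯ d) ⟶ c ⨯ d) W) ≤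
    P.re (prod.snd : c ⨯ (d ⨯ d) ⟶ d ⨯ d) (eqPred d)
  total : U ≤ ex prod.fst W

theorem eq_elim {X d : P.base} {x y : X ⟶ d} {A B : P.El X} (h : A ≤ at₂ (eqPred d) x y)
    (H : ∀ {X' : P.base} (p : X' ⟶ X), p ≫ x = p ≫ y → ∀ A' : P.El X', A' ≤ P.re p A →
      A' ≤ P.re p B) : A ≤ B := by
  refine ex_elim h fun p s hs A' hA _ => H p ?_ A' hA
  have h1 := congrArg (· ≫ prod.fst) hs
  have h2 := congrArg (· ≫ prod.snd) hs
  simp only [Category.comp_id, diag, prod.comp_lift, prod.lift_fst, prod.lift_snd] at h1 h2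
  rw [h1, h2]

theorem eq_intro {X d : P.base} (x : X ⟶ d) (A : P.El X) : A ≤ at₂ (eqPred d) x x := by
  have := ex_intro (f := diag d) x (le_re_top x A)
  simpa [at₂, eqPred, prod.comp_lift, prod.lift_fst_assoc, prod.lift_snd_assoc, prod.lift_fst, prod.lift_snd] using this

theorem relComp_intro {X c d e : P.base} {W : P.El (c ⨯ d)} {W' : P.El (d ⨯ e)} {x : X ⟶ c}
    (y : X ⟶ d) {z : X ⟶ e} {A : P.El X} (h : A ≤ at₂ W x y) (h' : A ≤ at₂ W' y z) :
    A ≤ at₂ (relComp W W') x z := by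
  have := ex_intro (f := (prod.lift prod.fst (prod.snd ≫ prod.snd) : c ⨯ (d ⨯ e) ⟶ c ⨯ e))
    (M := inf (P.re (prod.lift prod.fst (prod.snd ≫ prod.fst)) W) (P.re prod.snd W'))
    (A := A) (prod.lift x (prod.lift y z)) (by
      rw [re_inf, ← P.re_comp, ← P.re_comp]
      exact le_inf (by rwa [prod.comp_lift, prod.lift_fst, prod.lift_snd_assoc, prod.lift_fst])
        (by rw [prod.lift_snd]; exact h'))
  simpa [at₂, relComp, prod.comp_lift, prod.lift_fst_assoc, prod.lift_snd_assoc, prod.lift_fst, prod.lift_snd] using this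

theorem relComp_elim {X c d e : P.base} {W : P.El (c ⨯ d)} {W' : P.El (d ⨯ e)} {x : X ⟶ c}
    {z : X ⟶ e} {A B : P.El X} (h : A ≤ at₂ (relComp W W') x z)
    (H : ∀ {X' : P.base} (p : X' ⟶ X) (y : X' ⟶ d) (A' : P.El X'), A' ≤ P.re p A →
      A' ≤ at₂ W (p ≫ x) y → A' ≤ at₂ W' y (p ≫ z) → A' ≤ P.re p B) : A ≤ B := by
  refine ex_elim h fun p s hs A' hA hM => H p (s ≫ prod.snd ≫ prod.fst) A' hA ?_ ?_
  · have h1 := congrArg (· ≫ prod.fst) hs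
    simp only [prod.comp_lift, prod.lift_fst] at h1
    have := hM.trans (P.re_mono s (inf_le_left _ _))
    rw [← P.re_comp, prod.comp_lift] at this
    rwa [h1]
  · have h2 := congrArg (· ≫ prod.snd) hs
    simp only [prod.comp_lift, prod.lift_snd] at h2
    have := hM.trans (P.re_mono s (inf_le_right _ _))
    rw [← P.re_comp, re_eq_at₂] at this
    rw [h2]; simpa using this

namespace IsFunctional

variable {c d : P.base} {U : P.El c} {V : P.El d} {W : P.El (c ⨯ d)}

theorem dom (h : IsFunctional U V W) {X : P.base} {x : X ⟶ c} {y : X ⟶ d} {A : P.El X}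
    (hA : A ≤ at₂ W x y) : A ≤ P.re x U := by
  have := hA.trans (P.re_mono _ (h.le.trans (inf_le_left _ _)))
  rwa [← P.re_comp, prod.lift_fst] at this

theorem cod (h : IsFunctional U V W) {X : P.base} {x : X ⟶ c} {y : X ⟶ d} {A : P.El X}
    (hA : A ≤ at₂ W x y) : A ≤ P.re y V := by
  have := hA.trans (P.re_mono _ (h.le.trans (inf_le_right _ _)))
  rwa [← P.re_comp, prod.lift_snd] at this

theorem unique_elim (h : IsFunctional U V W) {X : P.base} {x : X ⟶ c} {y y' : X ⟶ d}
    {A B : P.El X} (hA : A ≤ at₂ W x y) (hA' : A ≤ at₂ W x y')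
    (H : ∀ {X' : P.base} (p : X' ⟶ X), p ≫ y = p ≫ y' → ∀ A' : P.El X', A' ≤ P.re p A →
      A' ≤ P.re p B) : A ≤ B := by
  refine eq_elim (x := y) (y := y') ?_ H
  have := P.re_mono (prod.lift x (prod.lift y y')) h.unique
  rw [re_inf, ← P.re_comp, ← P.re_comp, ← P.re_comp, prod.lift_snd] at this
  refine (le_inf ?_ ?_).trans this
  · rwa [prod.comp_lift, prod.lift_fst, prod.lift_snd_assoc, prod.lift_fst]
  · rwa [prod.comp_lift, prod.lift_fst, prod.lift_snd_assoc, prod.lift_snd]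

theorem total_elim (h : IsFunctional U V W) {X : P.base} {x : X ⟶ c} {A B : P.El X}
    (hA : A ≤ P.re x U)
    (H : ∀ {X' : P.base} (p : X' ⟶ X) (y : X' ⟶ d) (A' : P.El X'), A' ≤ P.re p A →
      A' ≤ at₂ W (p ≫ x) y → A' ≤ P.re p B) : A ≤ B := by
  refine ex_elim (hA.trans (P.re_mono x h.total)) fun p s hs A' hA hM =>
    H p (s ≫ prod.snd) A' hA ?_
  rwa [hs, ← re_eq_at₂]

/-- Functionality in terms of generalized elements. -/
theorem of_elements
    (le : ∀ {X : P.base} {x : X ⟶ c} {y : X ⟶ d} {A : P.El X}, A ≤ at₂ W x y →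
      A ≤ P.re x U ∧ A ≤ P.re y V)
    (unique : ∀ {X : P.base} {x : X ⟶ c} {y y' : X ⟶ d} {A : P.El X}, A ≤ at₂ W x y →
      A ≤ at₂ W x y' → A ≤ at₂ (eqPred d) y y')
    (total : U ≤ ex prod.fst W) : IsFunctional U V W where
  le := le_inf (le (at₂_fst_snd W).ge).1 (le (at₂_fst_snd W).ge).2
  unique := (unique (x := prod.fst) (y := prod.snd ≫ prod.fst) (y' := prod.snd ≫ prod.snd)
      (inf_le_left _ _) (inf_le_right _ _)).trans_eq (re_eq_at₂ _ _).symm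
  total := total

end IsFunctional

/-- The graph `∃_{(1, f)} U` of `f`, restricted to `U`. -/
def graph {c d : P.base} (f : c ⟶ d) (U : P.El c) : P.El (c ⨯ d) := ex (prod.lift (𝟙 c) f) U

theorem graph_intro {X c d : P.base} {f : c ⟶ d} {U : P.El c} (x : X ⟶ c) {A : P.El X}
    (h : A ≤ P.re x U) : A ≤ at₂ (graph f U) x (x ≫ f) := by
  have := ex_intro (f := prod.lift (𝟙 c) f) x h
  simpa [at₂, graph, prod.comp_lift, prod.lift_fst_assoc, prod.lift_snd_assoc, prod.lift_fst, prod.lift_snd] using this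

theorem graph_elim {X c d : P.base} {f : c ⟶ d} {U : P.El c} {x : X ⟶ c} {y : X ⟶ d}
    {A B : P.El X} (h : A ≤ at₂ (graph f U) x y)
    (H : ∀ {X' : P.base} (p : X' ⟶ X) (A' : P.El X'), A' ≤ P.re p A → p ≫ y = p ≫ x ≫ f →
      A' ≤ P.re (p ≫ x) U → A' ≤ P.re p B) : A ≤ B := by
  refine ex_elim h fun p s hs A' hA hM => ?_
  have h1 := congrArg (· ≫ prod.fst) hs
  have h2 := congrArg (· ≫ prod.snd) hs
  simp only [Category.comp_id, prod.comp_lift, prod.lift_fst, prod.lift_snd] at h1 h2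
  refine H p A' hA ?_ (by rwa [h1])
  rw [h2, ← Category.assoc, h1]

theorem isFunctional_graph {c d : P.base} {f : c ⟶ d} {U : P.El c} {V : P.El d}
    (h : U ≤ P.re f V) : IsFunctional U V (graph f U) :=
  .of_elements
    (fun {X x y A} hA => by
      constructor <;> refine graph_elim hA fun p A' hA' e hU => ?_
      · rwa [← P.re_comp]
      · rw [← P.re_comp, e, ← Category.assoc, P.re_comp]
        exact hU.trans (P.re_mono _ h))
    (fun {X x y y' A} hA hA' => by
      refine graph_elim hA fun p A' h1 e _ => ?_
      refine graph_elim (h1.trans ((P.re_mono p hA').trans_eq (re_at₂ _ _ _ _)))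
        fun q A'' h2 e' _ => ?_
      have e2 : q ≫ p ≫ y = q ≫ p ≫ y' := by rw [e, e', Category.assoc]
      rw [re_at₂, re_at₂, e2]
      exact eq_intro _ _)
    (by
      have := ex_intro (f := (prod.fst : c ⨯ d ⟶ c)) _
        (graph_intro (f := f) (U := U) (𝟙 c) (A := U) (by simp))
      rwa [prod.lift_fst, P.re_id] at this)

theorem isFunctional_relComp {c d e : P.base} {U : P.El c} {V : P.El d} {V' : P.El e}
    {W : P.El (c ⨯ d)} {W' : P.El (d ⨯ e)} (h : IsFunctional U V W) (h' : IsFunctional V V' W') :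
    IsFunctional U V' (relComp W W') :=
  .of_elements
    (fun {X x y A} hA => by
      constructor <;> refine relComp_elim hA fun p y' A' hA' h1 h2 => ?_
      · rw [← P.re_comp]; exact h.dom h1
      · rw [← P.re_comp]; exact h'.cod h2)
    (fun {X x z z' A} hA hA' => by
      refine relComp_elim hA fun p y A' h1 h2 h3 => ?_
      refine relComp_elim (h1.trans ((P.re_mono p hA').trans_eq (re_at₂ _ _ _ _)))
        fun q y' A'' h4 h5 h6 => ?_
      have h2' := h4.trans ((P.re_mono q h2).trans_eq (re_at₂ _ _ _ _))
      have h3' := h4.trans ((P.re_mono q h3).trans_eq (re_at₂ _ _ _ _))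
      refine h.unique_elim h2' h5 fun r e A3 h7 => ?_
      have h3'' := h7.trans ((P.re_mono r h3').trans_eq (re_at₂ _ _ _ _))
      have h6' := h7.trans ((P.re_mono r h6).trans_eq (re_at₂ _ _ _ _))
      rw [e] at h3''
      refine h'.unique_elim h3'' h6' fun t e' A4 h8 => ?_
      simp only [re_at₂]
      rw [e']
      exact eq_intro _ _)
    (by
      have hU : U ≤ P.re (𝟙 c) U := by simp
      refine h.total_elim hU fun p y A' h1 h2 => ?_
      refine h'.total_elim (h.cod h2) fun q z A'' h3 h4 => ?_
      have h2' := h3.trans ((P.re_mono q h2).trans_eq (re_at₂ _ _ _ _))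
      have := ex_intro (f := (prod.fst : c ⨯ e ⟶ c)) _ (relComp_intro _ h2' h4)
      rw [← P.re_comp]
      rwa [prod.lift_fst, Category.comp_id] at this)

end Ops

/-- Objects of the syntactic category: pairs `(c, U)` with `U ∈ P c`. -/
structure Syn (P : Doctrine.{u}) where
  pt : P.base
  el : P.El pt

/-- Arrows of the syntactic category: provably functional relations. -/
@[ext]
structure SynHom [P.IsExistential] (X Y : P.Syn) where
  rel : P.El (X.pt ⨯ Y.pt)
  isFunctional : IsFunctional X.el Y.el rel

section

variable [hP : P.IsExistential]

/-- The provably functional relation `(c, U) ⟶ (d, V)` given by an arrow `f` with `U ≤ P(f) V`. -/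
def synGraph {X Y : P.Syn} (f : X.pt ⟶ Y.pt) (h : X.el ≤ P.re f Y.el) : SynHom X Y :=
  ⟨graph f X.el, isFunctional_graph h⟩

theorem relComp_graph {c d e : P.base} (f : c ⟶ d) {U : P.El c} {V : P.El d} {V' : P.El e}
    (hf : U ≤ P.re f V) {W : P.El (d ⨯ e)} (hW : IsFunctional V V' W) {X : P.base} (x : X ⟶ c)
    (z : X ⟶ e) (A : P.El X) :
    A ≤ at₂ (relComp (graph f U) W) x z ↔ A ≤ P.re x U ∧ A ≤ at₂ W (x ≫ f) z := by
  constructor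
  · intro h
    refine ⟨(isFunctional_relComp (isFunctional_graph hf) hW).dom h, ?_⟩
    refine relComp_elim h fun p y A' h1 h2 h3 => ?_
    refine graph_elim h2 fun q A'' h4 e1 h5 => ?_
    have := h4.trans ((P.re_mono q h3).trans_eq (re_at₂ _ _ _ _))
    rw [re_at₂, re_at₂]
    rw [e1] at this
    simpa using this
  · rintro ⟨h, h'⟩
    exact relComp_intro (x ≫ f) (graph_intro x h) h'

theorem relComp_graph_right {c d e : P.base} {U : P.El c} {V : P.El d} (f : d ⟶ e) {W : P.El (c ⨯ d)} (hW : IsFunctional U V W) {X : P.base} (x : X ⟶ c)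
    (y : X ⟶ d) {A : P.El X} (h : A ≤ at₂ W x y) :
    A ≤ at₂ (relComp W (graph f V)) x (y ≫ f) :=
  relComp_intro y h (graph_intro y (hW.cod h))

instance : SmallCategory P.Syn where
  Hom X Y := SynHom X Y
  id X := ⟨ex (diag X.pt) X.el, isFunctional_graph (by simp)⟩
  comp F G := ⟨relComp F.rel G.rel, isFunctional_relComp F.isFunctional G.isFunctional⟩
  id_comp {X Y} F := SynHom.ext <| ext₂ fun x y A => by
    refine (relComp_graph (𝟙 X.pt) (by simp) F.isFunctional x y A).trans ?_
    rw [Category.comp_id]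
    exact and_iff_right_of_imp fun h => F.isFunctional.dom h
  comp_id {X Y} F := SynHom.ext <| ext₂ fun x y A => by
    constructor
    · intro h
      refine relComp_elim h fun p z A' h1 h2 h3 => ?_
      refine graph_elim h3 fun q A'' h4 e1 h5 => ?_
      have := h4.trans ((P.re_mono q h2).trans_eq (re_at₂ _ _ _ _))
      rw [re_at₂, re_at₂, e1, Category.comp_id]
      exact this
    · intro h
      have := relComp_graph_right (𝟙 Y.pt) F.isFunctional x y h
      rwa [Category.comp_id] at this
  assoc F G H := SynHom.ext <| ext₂ fun x y A => by
    constructor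
    · intro h
      refine relComp_elim h fun p z A' h1 h2 h3 => ?_
      refine relComp_elim h2 fun q w A'' h4 h5 h6 => ?_
      have := h4.trans ((P.re_mono q h3).trans_eq (re_at₂ _ _ _ _))
      rw [re_at₂, re_at₂]
      exact relComp_intro w h5 (relComp_intro _ h6 this)
    · intro h
      refine relComp_elim h fun p z A' h1 h2 h3 => ?_
      refine relComp_elim h3 fun q w A'' h4 h5 h6 => ?_
      have := h4.trans ((P.re_mono q h2).trans_eq (re_at₂ _ _ _ _))
      rw [re_at₂, re_at₂]
      exact relComp_intro w (relComp_intro _ this h5) h6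

@[ext]
theorem syn_ext {X Y : P.Syn} {F G : X ⟶ Y} (h : F.rel = G.rel) : F = G := SynHom.ext h

theorem syn_id (X : P.Syn) : 𝟙 X = synGraph (𝟙 X.pt) (by simp) := rfl

theorem syn_comp_rel {X Y Z : P.Syn} (F : X ⟶ Y) (G : Y ⟶ Z) :
    (F ≫ G).rel = relComp F.rel G.rel := rfl

end

end

end Doctrine
namespace Doctrine

noncomputable section

section SynMap

set_option linter.unusedSectionVars false

variable {P Q R : Doctrine.{u}} [hP : P.IsExistential] [hQ : Q.IsExistential]
  [hR : R.IsExistential]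

theorem map_inf {F : Mor P Q} (hF : IsExMor F) {c : P.base} (x y : P.El c) :
    F.a (inf x y) = inf (F.a x) (F.a y) :=
  isGLB_eq (hF.inf (isGLB_inf x y))

theorem map_ex {F : Mor P Q} (hF : IsExMor F) {c d : P.base} (f : c ⟶ d) (x : P.El c) :
    F.a (ex f x) = ex (F.F.map f) (F.a x) :=
  isEx_eq (hF.ex f (isEx_ex f x))

/-- The action of a morphism `(F, a)` of existential doctrines on relations: `a(W)`, transported
along `F (c × d) ≅ F c × F d`. -/
def synRel (F : Mor P Q) [PreservesFiniteLimits F.F] {c d : P.base} (W : P.El (c ⨯ d)) :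
    Q.El (F.F.obj c ⨯ F.F.obj d) :=
  Q.re (inv (prodComparison F.F c d)) (F.a W)

variable (F : Mor P Q) [PreservesFiniteLimits F.F]

theorem at₂_synRel {X : Q.base} {T c d : P.base} (t : X ⟶ F.F.obj T) (x : T ⟶ c) (y : T ⟶ d)
    (W : P.El (c ⨯ d)) :
    at₂ (synRel F W) (t ≫ F.F.map x) (t ≫ F.F.map y) = Q.re t (F.a (at₂ W x y)) := by
  have : prod.lift (t ≫ F.F.map x) (t ≫ F.F.map y) ≫ inv (prodComparison F.F c d) =
      t ≫ F.F.map (prod.lift x y) := by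
    rw [IsIso.comp_inv_eq]
    ext
    · rw [prod.lift_fst, Category.assoc, Category.assoc, prodComparison_fst, ← F.F.map_comp,
        prod.lift_fst]
    · rw [prod.lift_snd, Category.assoc, Category.assoc, prodComparison_snd, ← F.F.map_comp,
        prod.lift_snd]
  rw [at₂, synRel, ← Q.re_comp, this, Q.re_comp, at₂, F.nat]

theorem at₂_synRel' {X : Q.base} {c d : P.base} (t : X ⟶ F.F.obj (c ⨯ d)) (W : P.El (c ⨯ d)) :
    at₂ (synRel F W) (t ≫ F.F.map prod.fst) (t ≫ F.F.map prod.snd) = Q.re t (F.a W) := by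
  rw [at₂_synRel, at₂_fst_snd]

theorem exists_pair {X : Q.base} {c d : P.base} (x : X ⟶ F.F.obj c) (y : X ⟶ F.F.obj d) :
    ∃ t : X ⟶ F.F.obj (c ⨯ d), t ≫ F.F.map prod.fst = x ∧ t ≫ F.F.map prod.snd = y :=
  ⟨prod.lift x y ≫ inv (prodComparison F.F c d),
    by rw [Category.assoc, inv_prodComparison_map_fst, prod.lift_fst],
    by rw [Category.assoc, inv_prodComparison_map_snd, prod.lift_snd]⟩

theorem exists_triple {X : Q.base} {c d e : P.base} (x : X ⟶ F.F.obj c) (y : X ⟶ F.F.obj d)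
    (z : X ⟶ F.F.obj e) :
    ∃ t : X ⟶ F.F.obj (c ⨯ (d ⨯ e)), t ≫ F.F.map prod.fst = x ∧
      t ≫ F.F.map (prod.snd ≫ prod.fst) = y ∧ t ≫ F.F.map (prod.snd ≫ prod.snd) = z := by
  obtain ⟨s, rfl, rfl⟩ := exists_pair F y z
  obtain ⟨t, rfl, rfl⟩ := exists_pair F x s
  exact ⟨t, rfl, by simp, by simp⟩

variable {F}

theorem at₂_synRel_graph (hF : IsExMor F) {c d : P.base} (f : c ⟶ d) (U : P.El c) :
    synRel F (graph f U) = graph (F.F.map f) (F.a U) := by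
  refine ext₂ fun {X} x y A => ⟨fun h => ?_, fun h => ?_⟩
  · obtain ⟨t, rfl, rfl⟩ := exists_pair F x y
    rw [at₂_synRel', graph, map_ex hF] at h
    refine ex_elim h fun p s hs A' h1 h2 => ?_
    have e1 : p ≫ t ≫ F.F.map prod.fst = s := by
      rw [← Category.assoc, hs, Category.assoc, ← F.F.map_comp, prod.lift_fst, F.F.map_id,
        Category.comp_id]
    have e2 : p ≫ t ≫ F.F.map prod.snd = s ≫ F.F.map f := by
      rw [← Category.assoc, hs, Category.assoc, ← F.F.map_comp, prod.lift_snd]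
    rw [re_at₂, e1, e2]
    exact graph_intro s h2
  · refine graph_elim h fun p A' h1 e h2 => ?_
    have e' : p ≫ x = (p ≫ x) ≫ F.F.map (𝟙 c) := by simp
    rw [re_at₂, e, ← Category.assoc p x, e', Category.assoc (p ≫ x), ← F.F.map_comp,
      at₂_synRel]
    refine h2.trans (Q.re_mono _ (F.mono ?_))
    have := graph_intro (f := f) (U := U) (𝟙 c) (A := U) (by simp)
    simpa using this

theorem at₂_synRel_eqPred (hF : IsExMor F) {X : Q.base} {d : P.base} (t : X ⟶ F.F.obj (d ⨯ d))
    {A : Q.El X} (h : A ≤ Q.re t (F.a (eqPred d))) :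
    A ≤ at₂ (eqPred _) (t ≫ F.F.map prod.fst) (t ≫ F.F.map prod.snd) := by
  rw [eqPred, map_ex hF] at h
  refine ex_elim h fun p s hs A' _ _ => ?_
  have e1 : p ≫ t ≫ F.F.map prod.fst = s := by
    rw [← Category.assoc, hs, Category.assoc, ← F.F.map_comp, prod.lift_fst, F.F.map_id,
      Category.comp_id]
  have e2 : p ≫ t ≫ F.F.map prod.snd = s := by
    rw [← Category.assoc, hs, Category.assoc, ← F.F.map_comp, prod.lift_snd, F.F.map_id,
      Category.comp_id]
  rw [re_at₂, e1, e2]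
  exact eq_intro _ _

theorem isFunctional_synRel (hF : IsExMor F) {c d : P.base} {U : P.El c} {V : P.El d}
    {W : P.El (c ⨯ d)} (h : IsFunctional U V W) :
    IsFunctional (F.a U) (F.a V) (synRel F W) :=
  .of_elements
    (fun {X x y A} hA => by
      obtain ⟨t, rfl, rfl⟩ := exists_pair F x y
      rw [at₂_synRel'] at hA
      constructor
      · rw [Q.re_comp, ← F.nat]
        exact hA.trans (Q.re_mono _ (F.mono (h.le.trans (inf_le_left _ _))))
      · rw [Q.re_comp, ← F.nat]
        exact hA.trans (Q.re_mono _ (F.mono (h.le.trans (inf_le_right _ _)))))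
    (fun {X x y y' A} hA hA' => by
      obtain ⟨t, rfl, rfl, rfl⟩ := exists_triple F x y y'
      rw [at₂_synRel] at hA hA'
      have := (le_inf hA hA').trans_eq (re_inf _ _ _).symm
      rw [← map_inf hF] at this
      have := this.trans (Q.re_mono _ (F.mono h.unique))
      rw [F.nat, ← Q.re_comp] at this
      have := at₂_synRel_eqPred hF _ this
      simpa using this)
    (by
      have := F.mono h.total
      rw [map_ex hF, ← Q.re_id (ex (F.F.map prod.fst) (F.a W))] at this
      refine ex_elim this fun p s hs A' h1 h2 => ?_
      rw [← at₂_synRel'] at h2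
      have := ex_intro (f := (prod.fst : F.F.obj c ⨯ F.F.obj d ⟶ _)) _ h2
      rwa [prod.lift_fst, ← hs, Category.comp_id] at this)

theorem synRel_relComp (hF : IsExMor F) {c d e : P.base} (W : P.El (c ⨯ d))
    (W' : P.El (d ⨯ e)) :
    synRel F (relComp W W') = relComp (synRel F W) (synRel F W') := by
  refine ext₂ fun {X} x z A => ⟨fun h => ?_, fun h => ?_⟩
  · obtain ⟨t, rfl, rfl⟩ := exists_pair F x z
    rw [at₂_synRel', relComp, map_ex hF] at h
    refine ex_elim h fun p s hs A' h1 h2 => ?_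
    have e1 : p ≫ t ≫ F.F.map prod.fst = s ≫ F.F.map prod.fst := by
      rw [← Category.assoc, hs, Category.assoc, ← F.F.map_comp, prod.lift_fst]
    have e2 : p ≫ t ≫ F.F.map prod.snd = s ≫ F.F.map (prod.snd ≫ prod.snd) := by
      rw [← Category.assoc, hs, Category.assoc, ← F.F.map_comp, prod.lift_snd]
    rw [re_at₂, e1, e2]
    refine relComp_intro (s ≫ F.F.map (prod.snd ≫ prod.fst)) ?_ ?_
    · rw [at₂_synRel]
      exact h2.trans (Q.re_mono _ (F.mono (inf_le_left _ _)))
    · rw [at₂_synRel, ← re_eq_at₂]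
      exact h2.trans (Q.re_mono _ (F.mono (inf_le_right _ _)))
  · refine relComp_elim h fun p y A' h1 h2 h3 => ?_
    obtain ⟨t, e1, rfl, e3⟩ := exists_triple F (p ≫ x) y (p ≫ z)
    rw [re_at₂]
    rw [← e1] at h2 ⊢
    rw [← e3] at h3 ⊢
    rw [at₂_synRel] at h2 h3 ⊢
    have := (le_inf h2 h3).trans_eq (re_inf _ _ _).symm
    rw [← map_inf hF] at this
    exact this.trans (Q.re_mono _ (F.mono
      (relComp_intro (prod.snd ≫ prod.fst) (inf_le_left _ _) (inf_le_right _ _))))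

/-- The regular functor `Syn(F, a)`. -/
def synMap (hF : IsExMor F) : P.Syn ⥤ Q.Syn where
  obj X := ⟨F.F.obj X.pt, F.a X.el⟩
  map W := ⟨synRel F W.rel, isFunctional_synRel hF W.isFunctional⟩
  map_id X := syn_ext (by
    refine (at₂_synRel_graph hF (𝟙 X.pt) X.el).trans ?_
    rw [F.F.map_id]; rfl)
  map_comp W W' := syn_ext (synRel_relComp hF W.rel W'.rel)

variable {G : Mor P Q} [PreservesFiniteLimits G.F]

theorem synRel_cell (α : F ⟶ G) {X : Q.base} {c d : P.base} {x : X ⟶ F.F.obj c}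
    {y : X ⟶ F.F.obj d} {W : P.El (c ⨯ d)} {A : Q.El X} (h : A ≤ at₂ (synRel F W) x y) :
    A ≤ at₂ (synRel G W) (x ≫ α.α.app c) (y ≫ α.α.app d) := by
  obtain ⟨t, rfl, rfl⟩ := exists_pair F x y
  rw [at₂_synRel'] at h
  have := h.trans (Q.re_mono _ (α.cond W))
  rw [← Q.re_comp, ← at₂_synRel'] at this
  simpa using this

theorem synRel_nat (hF : IsExMor F) (hG : IsExMor G) (α : F ⟶ G) {c d : P.base} {U : P.El c}
    {V : P.El d} {W : P.El (c ⨯ d)} (hW : IsFunctional U V W) :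
    relComp (synRel F W) (graph (α.α.app d) (F.a V)) =
      relComp (graph (α.α.app c) (F.a U)) (synRel G W) := by
  have hFW := isFunctional_synRel hF hW
  have hGW := isFunctional_synRel hG hW
  refine ext₂ fun {T} x z A => ?_
  rw [relComp_graph (α.α.app c) (α.cond U) hGW]
  constructor
  · intro h
    constructor
    · refine relComp_elim h fun p y A' h1 h2 h3 => ?_
      rw [← Q.re_comp]
      exact hFW.dom h2
    · refine relComp_elim h fun p y A' h1 h2 h3 => ?_
      refine graph_elim h3 fun q A'' h4 e h5 => ?_
      have := synRel_cell α (h4.trans ((Q.re_mono q h2).trans_eq (re_at₂ _ _ _ _)))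
      rw [re_at₂, re_at₂, e]
      simpa using this
  · rintro ⟨h, h'⟩
    refine hFW.total_elim h fun p y A' h1 h2 => ?_
    have h3 := synRel_cell α h2
    have h4 := h1.trans ((Q.re_mono p h').trans_eq (re_at₂ _ _ _ _))
    rw [← Category.assoc] at h4
    refine hGW.unique_elim h3 h4 fun q e A'' h5 => ?_
    have h6 := h5.trans ((Q.re_mono q h2).trans_eq (re_at₂ _ _ _ _))
    rw [re_at₂, re_at₂, ← e, ← Category.assoc q y]
    exact relComp_graph_right _ hFW _ _ h6

/-- The natural transformation `Syn(α)`. -/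
def synCell (hF : IsExMor F) (hG : IsExMor G) (α : F ⟶ G) : synMap hF ⟶ synMap hG where
  app X := synGraph (X := (synMap hF).obj X) (Y := (synMap hG).obj X) (α.α.app X.pt) (α.cond X.el)
  naturality _ _ W := syn_ext (synRel_nat hF hG α W.isFunctional)

instance : PreservesFiniteLimits (Mor.idMor P).F := inferInstanceAs (PreservesFiniteLimits (𝟭 _))

instance {H : Mor Q R} [PreservesFiniteLimits H.F] : PreservesFiniteLimits (F.compMor H).F :=
  comp_preservesFiniteLimits F.F H.F

theorem synRel_id {c d : P.base} (W : P.El (c ⨯ d)) :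
    synRel (Mor.idMor P) W = W := by
  refine ext₂ fun {X} x y A => ?_
  obtain ⟨t, rfl, rfl⟩ := exists_pair (Mor.idMor P) x y
  rw [at₂_synRel']
  exact iff_of_eq (congrArg (A ≤ ·) (re_eq_at₂ (P := P) t W))

theorem synRel_comp {H : Mor Q R} [PreservesFiniteLimits H.F] {c d : P.base} (W : P.El (c ⨯ d)) :
    synRel (F.compMor H) W = synRel H (synRel F W) := by
  refine ext₂ fun {X} x y A => ?_
  obtain ⟨t, rfl, rfl⟩ := exists_pair (F.compMor H) x y
  have e : F.a W = at₂ (synRel F W) (F.F.map prod.fst) (F.F.map prod.snd) := by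
    have := at₂_synRel' F (𝟙 _) W
    rw [Category.id_comp, Category.id_comp, Q.re_id] at this
    exact this.symm
  have e' := at₂_synRel H t (F.F.map prod.fst) (F.F.map prod.snd) (synRel F W)
  rw [← e] at e'
  rw [at₂_synRel']
  exact iff_of_eq (congrArg (A ≤ ·) e'.symm)

end SynMap

end

end Doctrine

theorem Doctrine.graph_comp {P : Doctrine.{u}} [P.IsExistential] {c d e : P.base} {U : P.El c}
    {V : P.El d} {V' : P.El e} (f : c ⟶ d) (g : d ⟶ e) (hf : U ≤ P.re f V) (hg : V ≤ P.re g V') :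
    Doctrine.graph (f ≫ g) U = Doctrine.relComp (Doctrine.graph f U) (Doctrine.graph g V) := by
  have h : U ≤ P.re (f ≫ g) V' := by
    rw [P.re_comp]; exact hf.trans (P.re_mono _ hg)
  refine Doctrine.ext₂ (P := P) fun {X} x z A => ?_
  refine Iff.trans ?_ (Doctrine.relComp_graph f hf (Doctrine.isFunctional_graph hg) x z A).symm
  constructor
  · intro hA
    refine ⟨(Doctrine.isFunctional_graph h).dom hA, ?_⟩
    refine Doctrine.graph_elim hA fun p A' h1 e h2 => ?_
    rw [Doctrine.re_at₂, e, ← Category.assoc x, ← Category.assoc p (x ≫ f)]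
    refine Doctrine.graph_intro (P := P) _ ?_
    rw [← Category.assoc, P.re_comp]
    exact h2.trans (P.re_mono _ hf)
  · rintro ⟨hA, hA'⟩
    refine Doctrine.graph_elim hA' fun p A' h1 e h2 => ?_
    have e' : p ≫ z = (p ≫ x) ≫ f ≫ g := by rw [e]; simp
    rw [Doctrine.re_at₂, e']
    exact Doctrine.graph_intro (P := P) _
      ((h1.trans (P.re_mono p hA)).trans_eq (P.re_comp _ _ _).symm)

instance (P : exDoc.{u}.Obj) : P.base.IsExistential := P.ok

instance {P Q : exDoc.{u}.Obj} (F : P ⟶ Q) :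
    PreservesFiniteLimits (Doctrine.Mor.F F.hom) := F.isHom.1

theorem cat_ext {C D : Cat.{u, u}} {F G : C ⟶ D} {s t : F ⟶ G}
    (h : ∀ X, s.toNatTrans.app X = t.toNatTrans.app X) : s = t :=
  Cat.Hom₂.ext (NatTrans.ext (funext h))

/-- The 2-functor `Syn` on existential doctrines. -/
noncomputable def synCat : exDoc.{u}.Obj ⥤ᵖ Cat.{u, u} where
  obj P := Cat.of P.base.Syn
  map F := (Doctrine.synMap F.isHom).toCatHom
  map₂ {_ _ F G} α := NatTrans.toCatHom₂ (Doctrine.synCell F.isHom G.isHom α.cell)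
  map₂_id {P Q} F := cat_ext fun X => rfl
  map₂_comp {P Q F G H} α β := cat_ext fun X =>
    Doctrine.syn_ext (Doctrine.graph_comp _ _ (α.cell.cond X.el) (β.cell.cond X.el))
  mapId P := Cat.Hom.isoMk (NatIso.ofComponents (fun X => Iso.refl X)
    fun W => (Category.comp_id _).trans ((Doctrine.syn_ext (Doctrine.synRel_id W.rel)).trans
      (Category.id_comp W).symm))
  mapComp F G := Cat.Hom.isoMk (NatIso.ofComponents
    (fun X => Iso.refl ((Doctrine.synMap G.isHom).obj ((Doctrine.synMap F.isHom).obj X)))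
    fun W => (Category.comp_id _).trans ((Doctrine.syn_ext (Doctrine.synRel_comp W.rel)).trans
      (Category.id_comp _).symm))
  map₂_whisker_left F G H α := cat_ext fun X => by
    have key : ∀ Y, (Doctrine.synCell G.isHom H.isHom α.cell).app Y =
      𝟙 _ ≫ (Doctrine.synCell G.isHom H.isHom α.cell).app Y ≫ 𝟙 _ := fun Y => by simp
    exact key ((Doctrine.synMap F.isHom).obj X)
  map₂_whisker_right {_ _ _ F G} α H := cat_ext fun X => by
    change _ = 𝟙 _ ≫ (Doctrine.synMap H.isHom).map
      ((Doctrine.synCell F.isHom G.isHom α.cell).app X) ≫ 𝟙 _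
    simp only [Category.comp_id, Category.id_comp]
    exact Doctrine.syn_ext (Doctrine.at₂_synRel_graph H.isHom _ _).symm
  map₂_associator F G H := cat_ext fun X => by
    have key : ∀ Y, 𝟙 ((Doctrine.synMap H.isHom).obj Y) =
      𝟙 _ ≫ (Doctrine.synMap H.isHom).map (𝟙 Y) ≫ 𝟙 _ ≫ 𝟙 _ ≫ 𝟙 _ := fun Y => by simp
    exact key ((Doctrine.synMap G.isHom).obj ((Doctrine.synMap F.isHom).obj X))
  map₂_left_unitor F := cat_ext fun X => by
    change 𝟙 _ = 𝟙 _ ≫ (Doctrine.synMap F.isHom).map (𝟙 _) ≫ 𝟙 _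
    simp only [Category.comp_id, Category.id_comp]
    exact ((Doctrine.synMap F.isHom).map_id _).symm
  map₂_right_unitor {_ Q} F := cat_ext fun X => by
    have key : ∀ Y : Q.base.Syn, 𝟙 Y = 𝟙 Y ≫ 𝟙 Y ≫ 𝟙 Y := fun Y => by simp
    exact key ((Doctrine.synMap F.isHom).obj X)

/-- For a sieve `S` on `(d, V)` in `Syn P`, the sieve on `(d, V)` in `C ⋊ P` generated by the
arrows `(d, ∃_{pr₂} W) ⟶ (d, V)` over the identity, for `W` in `S`. -/
def Doctrine.synSieve {P : Doctrine.{u}} [P.IsExistential] {Y : P.Syn} (S : Sieve Y) :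
    Sieve (⟨Y.pt, Y.el⟩ : P.Total) where
  arrows Z g := ∃ (X : P.Syn) (W : X ⟶ Y), S W ∧
    Z.el ≤ P.re g.f (Doctrine.ex (prod.snd : X.pt ⨯ Y.pt ⟶ Y.pt) W.rel)
  downward_closed := by
    rintro Z Z' g ⟨X, W, hW, h⟩ g'
    exact ⟨X, W, hW, (g'.cond.trans (P.re_mono _ h)).trans_eq (P.re_comp _ _ _).symm⟩

/-- The topology `J_Syn`: a sieve `S` on `(d, V)` covers when the family of the inequalities
`∃_{pr₂} W ≤ V`, for `W` in `S`, is covering. (If `K` is the existential topology defined by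
topologies `J_c` on the fibres, a family of inequalities `z ≤ V` in `P d` is `J_d`-covering if and
only if the sieve generated by the arrows `(d, z) ⟶ (d, V)` over the identity is `K`-covering.) -/
def Doctrine.synCov {P : Doctrine.{u}} [P.IsExistential] (K : Cov P.Total) : Cov P.Syn :=
  fun Y => {S | Doctrine.synSieve S ∈ K ⟨Y.pt, Y.el⟩}

/-- Forgetting the topology of an existential doctrinal site. -/
def exDocSitesToExDoc : exDocSites.{u}.Obj ⥤ᵖ exDoc.{u}.Obj :=
  exDoc.lift (F := exDocSites.forget) (s := fun _ => ⟨⟩) ⟨fun a => a.ok.2.1, fun f => f.isHom.2⟩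

/-- The topology `J_Syn` on the syntactic category of an existential doctrinal site. -/
def jSyn (P : exDocSites.{u}.Obj) : Cov ((exDocSitesToExDoc.comp synCat).obj P) :=
  Doctrine.synCov (P := (exDocSitesToExDoc.obj P).base) P.str

/-! ## The geometric completion -/

/-- The elements of the geometric completion of `(P, K)` at `c`: sets of pairs `(f, x)` with
`f : d ⟶ c` and `x ∈ P d`, closed under precomposition and under `K`. -/
@[ext]
structure ZEl {P : Doctrine.{u}} (K : Cov P.Total) (c : P.base) where
  mem : ∀ {d : P.base}, (d ⟶ c) → P.El d → Prop
  down : ∀ {d e : P.base} {f : d ⟶ c} {x : P.El d} {y : P.El e} (g : e ⟶ d),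
    y ≤ P.re g x → mem f x → mem (g ≫ f) y
  closed : ∀ {X : P.Total} {f : X.pt ⟶ c} {T : Sieve X}, T ∈ K X →
    (∀ {Y : P.Total} (g : Y ⟶ X), T g → mem (g.f ≫ f) Y.el) → mem f X.el

namespace ZEl

variable {P Q R : Doctrine.{u}} {J : Cov P.Total} {K : Cov Q.Total} {L : Cov R.Total}

/-- Inclusion. -/
instance {c : P.base} : PartialOrder (ZEl J c) where
  le S T := ∀ (d : P.base) (f : d ⟶ c) (x : P.El d), S.mem f x → T.mem f x
  le_refl _ _ _ _ h := h
  le_trans _ _ _ h h' d f x hx := h' d f x (h d f x hx)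
  le_antisymm S T h h' := ZEl.ext (by
    funext d f x; exact propext ⟨h d f x, h' d f x⟩)

theorem le_iff {c : P.base} {S T : ZEl J c} :
    S ≤ T ↔ ∀ {d : P.base} (f : d ⟶ c) (x : P.El d), S.mem f x → T.mem f x :=
  ⟨fun h d f x => h d f x, fun h _ f x => h f x⟩

/-- `Z(f) S = {(g, y) | (f ∘ g, y) ∈ S}`. -/
@[simps]
def re {c d : P.base} (f : c ⟶ d) (S : ZEl J d) : ZEl J c where
  mem g x := S.mem (g ≫ f) x
  down g hy h := by
    rw [Category.assoc]; exact S.down g hy h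
  closed hT h := S.closed hT fun g hg => by
    rw [← Category.assoc]; exact h g hg

/-- The doctrine underlying the geometric completion. -/
def doctrine (J : Cov P.Total) : Doctrine.{u} where
  base := P.base
  El c := ZEl J c
  re f S := re f S
  re_mono f _ _ h := le_iff.2 fun g x hx => le_iff.1 h (g ≫ f) x hx
  re_id S := ZEl.ext (by funext d f x; simp)
  re_comp f g S := ZEl.ext (by funext d h x; simp)

/-- The image of `S` under a morphism of sites `(F, a)`: the closure of the set of all the pairs
`(F g, a x)` with `(g, x) ∈ S`. -/
def map (F : Doctrine.Mor P Q) (K : Cov Q.Total) {c : P.base} (S : ZEl J c) :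
    ZEl K (F.F.obj c) where
  mem h y := ∀ T : ZEl K (F.F.obj c),
    (∀ {d : P.base} (g : d ⟶ c) (x : P.El d), S.mem g x → T.mem (F.F.map g) (F.a x)) → T.mem h y
  down g hy h T hT := T.down g hy (h T hT)
  closed hU h T hT := T.closed hU fun g hg => h g hg T hT

variable {F : Doctrine.Mor P Q} {G : Doctrine.Mor Q R}

theorem mem_map {c d : P.base} {S : ZEl J c} {g : d ⟶ c} {x : P.El d} (h : S.mem g x) :
    (map F K S).mem (F.F.map g) (F.a x) := fun _ hT => hT g x h

theorem map_le {c : P.base} {S : ZEl J c} {T : ZEl K (F.F.obj c)}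
    (h : ∀ {d : P.base} (g : d ⟶ c) (x : P.El d), S.mem g x → T.mem (F.F.map g) (F.a x)) :
    map F K S ≤ T := le_iff.2 fun _ _ hx => hx T h

theorem map_mono {c : P.base} {S T : ZEl J c} (h : S ≤ T) : map F K S ≤ map F K T :=
  map_le fun g x hx => mem_map (le_iff.1 h g x hx)

theorem map_id {c : P.base} (S : ZEl J c) : map (Doctrine.Mor.idMor P) J S = S :=
  le_antisymm (map_le (F := Doctrine.Mor.idMor P) fun _ _ hx => hx)
    (le_iff.2 fun _ _ hx => mem_map (F := Doctrine.Mor.idMor P) hx)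

theorem map_comp (hG : IsMorphismOfSites G.total K L) {c : P.base}
    (S : ZEl J c) : map (F.compMor G) L S = map G L (map F K S) := by
  refine le_antisymm (map_le (F := F.compMor G) fun g x hx =>
    mem_map (F := G) (mem_map (F := F) hx)) ?_
  let T : ZEl K (F.F.obj c) :=
    { mem := fun h y => (map (F.compMor G) L S).mem (G.F.map h) (G.a y)
      down := fun g hy h => by
        rw [G.F.map_comp]
        exact ZEl.down _ _ ((G.mono hy).trans_eq (G.nat _ _)) h
      closed := fun {X f U} hU h => by
        refine ZEl.closed (X := G.total.obj X) (map (F.compMor G) L S) (hG.cover hU) ?_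
        rintro Y g ⟨Z, g', k, hg', rfl⟩
        have h1 := h g' hg'
        rw [G.F.map_comp] at h1
        have h2 := ZEl.down _ k.f k.cond h1
        have e : k.f ≫ (G.F.map g'.f ≫ G.F.map f) = (k ≫ G.total.map g').f ≫ G.F.map f :=
          (Category.assoc _ _ _).symm
        exact Eq.mp (congrArg (fun q => ZEl.mem _ q Y.el) e) h2 }
  have hT : map F K S ≤ T := map_le fun g x hx => mem_map (F := F.compMor G) hx
  exact map_le (F := G) fun g x hx => le_iff.1 hT g x hx

theorem map_re [HasPullbacks P.base] [PreservesFiniteLimits F.F] (hK : IsTopology K)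
    {c d : P.base} (f : c ⟶ d) (S : ZEl J d) :
    map F K (re f S) = re (F.F.map f) (map F K S) := by
  refine le_antisymm (map_le fun g x hx => ?_) ?_
  · have := mem_map (F := F) (K := K) (S := S) (g := g ≫ f) hx
    rw [F.F.map_comp] at this
    exact this
  let T : ZEl K (F.F.obj d) :=
    { mem := fun {e} k y => ∀ {e' : Q.base} (r : e' ⟶ e) (y' : Q.El e') (n : e' ⟶ F.F.obj c),
        y' ≤ Q.re r y → n ≫ F.F.map f = r ≫ k → (map F K (re f S)).mem n y'
      down := fun {e e₁ k y y₁} g hy h e' r y' n hy' hn =>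
        h (r ≫ g) y' n (by rw [Q.re_comp]; exact hy'.trans (Q.re_mono _ hy)) (by simpa using hn)
      closed := fun {X k U} hU h e' r y' n hy' hn => by
        let ρ : (⟨e', y'⟩ : Q.Total) ⟶ X := ⟨r, hy'⟩
        refine ZEl.closed (X := ⟨e', y'⟩) _ (hK.pullback_mem hU ρ) ?_
        intro Y g hg
        refine h (g ≫ ρ) hg (𝟙 _) Y.el (g.f ≫ n) (by simp) ?_
        rw [Category.assoc, hn]
        simp [ρ] }
  have hT : map F K S ≤ T := map_le fun {b} g x hx e' r y' n hy' hn => by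
    have pb := (IsPullback.of_hasPullback f g).map F.F
    have h1 : (re f S).mem (pullback.fst f g) (P.re (pullback.snd f g) x) := by
      change S.mem _ _
      rw [pullback.condition]
      exact S.down _ le_rfl hx
    have h2 := ZEl.down _ (pb.lift n r hn) (y := y') (by
      rw [F.nat, ← Q.re_comp, pb.lift_snd]; exact hy') (mem_map (F := F) (K := K) h1)
    rwa [pb.lift_fst] at h2
  refine le_iff.2 fun k y hy => ?_
  exact le_iff.1 hT _ _ hy (𝟙 _) y k (by simp) (by simp)

theorem map_cell {F' : Doctrine.Mor P Q} (α : F ⟶ F') {c : P.base} (S : ZEl J c) :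
    map F K S ≤ re (α.α.app c) (map F' K S) :=
  map_le fun g x hx => by
    change (map F' K S).mem _ _
    rw [α.α.naturality]
    exact ZEl.down _ _ (α.cond x) (mem_map hx)

/-- The morphism `(F, 𝔞)` between the geometric completions. -/
def mor [HasPullbacks P.base] (F : Doctrine.Mor P Q) [PreservesFiniteLimits F.F]
    (hK : IsTopology K) : Doctrine.Mor (doctrine J) (doctrine K) where
  F := F.F
  a S := map F K S
  mono h := map_mono h
  nat {_ _} f S := map_re (P := P) hK f S

end ZEl

instance (P : exDocSites.{u}.Obj) : HasFiniteLimits P.base.base :=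
  P.ok.2.1.hasFiniteLimits

instance {P Q : exDocSites.{u}.Obj} (F : P ⟶ Q) :
    PreservesFiniteLimits (Doctrine.Mor.F F.hom) := F.isHom.2.1

/-- The geometric completion, as a 2-functor to doctrines. -/
def zDoc : exDocSites.{u}.Obj ⥤ᵖ Doctrine.{u} where
  obj P := ZEl.doctrine P.str
  map {_ Q} F := ZEl.mor F.hom Q.ok.1
  map₂ {_ _ _ _} α := ⟨α.cell.α, fun S => ZEl.map_cell α.cell S⟩
  map₂_id _ := rfl
  map₂_comp _ _ := rfl
  mapId P := Doctrine.isoOfLe (Iso.refl (𝟭 P.base.base))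
    (fun S => le_of_eq ((ZEl.map_id S).trans (Doctrine.re_id (ZEl.doctrine P.str) _).symm))
    (fun S => le_of_eq ((ZEl.map_id S).symm.trans (Doctrine.re_id (ZEl.doctrine P.str) _).symm))
  mapComp {_ _ R} F G := Doctrine.isoOfLe (Iso.refl (Doctrine.Mor.F F.hom ⋙ Doctrine.Mor.F G.hom))
    (fun S => le_of_eq ((ZEl.map_comp G.isHom.1.2 S).trans
      (Doctrine.re_id (ZEl.doctrine R.str) _).symm))
    (fun S => le_of_eq ((ZEl.map_comp G.isHom.1.2 S).symm.trans
      (Doctrine.re_id (ZEl.doctrine R.str) _).symm))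
  map₂_whisker_left F G H α := Doctrine.ext_app fun c => by
    change α.cell.α.app _ = 𝟙 _ ≫ α.cell.α.app _ ≫ 𝟙 _; simp
  map₂_whisker_right α H := Doctrine.ext_app fun c => by
    change (Doctrine.Mor.F H.hom).map (α.cell.α.app c) =
      𝟙 _ ≫ (Doctrine.Mor.F H.hom).map (α.cell.α.app c) ≫ 𝟙 _; simp
  map₂_associator F G H := Doctrine.ext_app fun c => by
    have key : ∀ Y, 𝟙 ((Doctrine.Mor.F H.hom).obj Y) =
      𝟙 _ ≫ (Doctrine.Mor.F H.hom).map (𝟙 Y) ≫ 𝟙 _ ≫ 𝟙 _ ≫ 𝟙 _ := fun Y => by simp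
    exact key _
  map₂_left_unitor F := Doctrine.ext_app fun c => by
    have key : ∀ Y, 𝟙 ((Doctrine.Mor.F F.hom).obj Y) =
      𝟙 _ ≫ (Doctrine.Mor.F F.hom).map (𝟙 Y) ≫ 𝟙 _ := fun Y => by simp
    exact key c
  map₂_right_unitor {_ Q} F := Doctrine.ext_app fun c => by
    have key : ∀ Y : Q.base.base, 𝟙 Y = 𝟙 Y ≫ 𝟙 Y ≫ 𝟙 Y := fun Y => by simp
    exact key _

/-- The topology `K_Z` on the geometric completion. -/
def kZ (P : exDocSites.{u}.Obj) : Cov (zDoc.obj P).Total := (ZEl.doctrine P.str).geomCov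

/-! ## The 2-functors between the four 2-categories -/

/-- The assertion that all the constructions are well defined 2-functors between the four
2-categories: the topologies that were specified above are topologies, the objects satisfy the
axioms of the target, and the 1-cells have the required preservation properties. -/
structure WellDefined : Prop where
  /-- `(C, K) ↦ (Sub_C, K_Sub)`, from regular sites to existential doctrinal sites. -/
  sub : exDocSites.{u}.LiftsTo (regSitesToReg.comp subDoc) kSub
  /-- `G ↦ (Sub_G, K_{Sub_G})`, from geometric categories to geometric doctrines. -/
  subGeom : geomDocCart.{u}.LiftsTo (geomCatToReg.comp subDoc) kSubGeom
  /-- The geometric completion of existential doctrinal sites. -/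
  z : geomDocCart.{u}.LiftsTo zDoc kZ
  /-- Geometric doctrines over a base with finite limits are existential doctrinal sites. -/
  inclDoc : exDocSites.{u}.LiftsTo geomDocCart.forget fun L => L.str
  /-- Geometric categories, with the geometric topology, are regular sites. -/
  inclCat : regSites.{u}.LiftsTo geomCat.forget fun G => jointlyEpiCov G.base
  /-- `(P, J) ↦ (Syn P, J_Syn)`, from existential doctrinal sites to regular sites. -/
  syn : regSites.{u}.LiftsTo (exDocSitesToExDoc.comp synCat) jSyn
  /-- `L ↦ Syn L`, from geometric doctrines to geometric categories. -/
  synGeom : geomCat.{u}.LiftsTo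
    ((exDocSites.lift inclDoc).comp (exDocSitesToExDoc.comp synCat)) fun _ => ⟨⟩

namespace WellDefined

variable (h : WellDefined.{u})

/-- `Sub : RegSites ⟶ ExDocSites`. -/
noncomputable def Sub : regSites.{u}.Obj ⥤ᵖ exDocSites.{u}.Obj := exDocSites.lift h.sub

/-- `Sub : GeomCat ⟶ GeomDoc_cart`. -/
noncomputable def SubGeom : geomCat.{u}.Obj ⥤ᵖ geomDocCart.{u}.Obj := geomDocCart.lift h.subGeom

/-- The geometric completion `Z : ExDocSites ⟶ GeomDoc_cart`. -/
def Z : exDocSites.{u}.Obj ⥤ᵖ geomDocCart.{u}.Obj := geomDocCart.lift h.z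

/-- The inclusion `GeomDoc_cart ⟶ ExDocSites`. -/
def InclDoc : geomDocCart.{u}.Obj ⥤ᵖ exDocSites.{u}.Obj := exDocSites.lift h.inclDoc

/-- The inclusion `GeomCat ⟶ RegSites`. -/
def InclCat : geomCat.{u}.Obj ⥤ᵖ regSites.{u}.Obj := regSites.lift h.inclCat

/-- `Syn : ExDocSites ⟶ RegSites`. -/
noncomputable def Syn : exDocSites.{u}.Obj ⥤ᵖ regSites.{u}.Obj := regSites.lift h.syn

/-- `Syn : GeomDoc_cart ⟶ GeomCat`. -/
noncomputable def SynGeom : geomDocCart.{u}.Obj ⥤ᵖ geomCat.{u}.Obj := geomCat.lift h.synGeom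

/-- The geometric completion of regular sites, `Syn ∘ Z ∘ Sub : RegSites ⟶ GeomCat`. -/
noncomputable def ZCat : regSites.{u}.Obj ⥤ᵖ geomCat.{u}.Obj := (h.Sub.comp h.Z).comp h.SynGeom

end WellDefined

end GeomCompl

/-! The theorem combines three universal constructions, each understood by describing its elements
concretely.

Existential and geometric doctrines. In a geometric doctrine the sup-topologies on the fibres form
an existential site, and the induced topology on `C ⋊ P` is `K_L` (`IsGeometric.geomCov_eq`).
Conversely, a morphism of sites between geometric doctrines over finitely complete bases
automatically preserves tops, meets and `∃_f`, because each of these can be tested on a cover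
(`isExMor_of_isMorphismOfSites`). Hence the inclusion `ι` is well defined and loses nothing on
1-cells.

Geometric completion. The closed sets of pairs form a geometric doctrine (`ZEl.isGeometric`). The
unit sends `x` to the closed set `principal x` generated by `(1, x)`, and a Yoneda-type rule holds:
`principal x` lies in `T` exactly when `(1, x)` does. Every closed set `S` is the join of the `∃_g
(principal x)` with `(g, x)` in `S`, so 2-cells out of the completion are controlled by principal
elements (`ZEl.le_re_of_principal`). For a geometric doctrine every closed set is principal, and
`ev` is inverse to `principal`; a morphism `F` into a geometric doctrine is therefore extended by
`ev ∘ Z(F)`. This gives `Z ⊣ ι`.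

Syntactic categories. Arrows of `Syn P` are manipulated through generalized elements, that is, in
the internal regular logic of `P`. Regular epimorphisms are the surjective relations, subobjects of
`(c, U)` are the elements of `P c` below `U`, and `Syn P` is regular, respectively geometric when
`P` is. The unit `P ⟶ Sub (Syn P)` sends `c` to `(c, ⊤)`. Each object `(c, U)` embeds in `(c, ⊤)`,
and each arrow `W` is tabulated by the graphs of two projections, the first of which is a regular
epimorphism; hence a transformation is determined by, and extends from, its components at the
objects `(c, ⊤)` (`synNatTrans_ext`, `exists_synNatTrans`). For a regular category `D` the functor
`D ⥤ Syn (Sub D)` is an equivalence, since predicates are comprehended by monomorphisms, so a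
morphism `P ⟶ Sub D` extends as `Syn P ⥤ Syn (Sub D) ≃ D` (`exists_synExt_cover`). This gives both
adjunctions `Syn ⊣ Sub`.

The composite. For a regular site `C` and a geometric category `D`, a 1-cell `C ⟶ ι D` is
transported by `Sub`, extended along `Z ⊣ ι` and then along `Syn ⊣ Sub`; faithfulness and fullness
come from the two extension principles for transformations.

The squares. The squares involving `ι` commute strictly, because the two topologies that occur
coincide (`exCov_subCov_jointlyEpiCov`, `synCov_geomCov`). For the square of left adjoints, `Syn ∘
Z` is applied to the unit `P ⟶ Sub (Syn P)`. Precomposition with this unit is an equivalence on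
1-cells into doctrines of subobjects, since `Sub` is an equivalence on hom-categories; by the two
adjunctions, precomposition with the resulting 1-cell of geometric categories is an equivalence too,
so a bicategorical Yoneda argument makes it invertible up to isomorphism. A pseudonatural
transformation with such components has a pseudonatural inverse, constructed by mates. -/

namespace GeomCompl

/-! ### Geometric doctrines as existential doctrinal sites. -/

namespace Doctrine

variable {P Q : Doctrine.{u}}

theorem IsEx.id {c : P.base} (x : P.El c) : IsEx (𝟙 c) x x := fun y => by rw [P.re_id]

theorem IsEx.comp {c d e : P.base} {f : c ⟶ d} {g : d ⟶ e} {x : P.El c} {y : P.El d} {z : P.El e}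
    (h : IsEx f x y) (h' : IsEx g y z) : IsEx (f ≫ g) x z := fun w => by
  rw [P.re_comp, h' w, h]

theorem IsEx.le {c d : P.base} {f : c ⟶ d} {x : P.El c} {e : P.El d} (h : IsEx f x e) :
    x ≤ P.re f e := (h e).1 le_rfl

theorem IsEx.mono {c d : P.base} {f : c ⟶ d} {x x' : P.El c} {e e' : P.El d} (h : IsEx f x e)
    (h' : IsEx f x' e') (hx : x ≤ x') : e ≤ e' := (h e').2 (hx.trans h'.le)

/-- Reduces pullback stability along an arbitrary arrow to the vertical and the cartesian case,
which are the two conditions imposed on an existential site. -/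
theorem vertical_comp_cartesian {X Y : P.Total} (s : X ⟶ Y) :
    (vertical s.cond : X ⟶ (⟨X.pt, P.re s.f Y.el⟩ : P.Total)) ≫ cartesian s.f Y.el = s :=
  total_ext (Category.id_comp _)

/-- The existential topology of an existential site is a Grothendieck topology. -/
theorem IsExistentialSite.isTopology {J : ∀ c : P.base, GrothendieckTopology (P.El c)}
    (h : P.IsExistentialSite J) : IsTopology (P.exCov fun c x => J c x) := by
  refine ⟨⟨fun X => {S | exSieve S ∈ J X.pt X.el}, fun X => ?_, fun X Y S f hS => ?_,
    fun X S hS R hR => ?_⟩, fun X S => Iff.rfl⟩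
  · refine (J X.pt).superset_covering ?_ ((J X.pt).top_mem X.el)
    intro w i _
    exact ⟨X, 𝟙 X, trivial, X.el, .id _, leOfHom i⟩
  · have h1 := h.beckChevalley f.f (y := X.el) (S := S) hS
    have h2 := h.frobenius f.cond h1
    rw [← Sieve.pullback_comp] at h2
    have e : (vertical f.cond : Y ⟶ (⟨Y.pt, P.re f.f X.el⟩ : P.Total)) ≫ cartesian f.f X.el = f :=
      vertical_comp_cartesian f
    rw [← e]
    exact h2
  · refine (J X.pt).transitive hS _ ?_
    rintro w i ⟨Z, f, hf, e, he, hw⟩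
    -- The pullback of `R` along `f` covers the source of `f`; `ex_cover` transports this to `e =
    -- ∃_f Z.el`, and stability in the fibre restricts it to `w ≤ e`. Functoriality of `∃` then
    -- identifies the members as images along composites in `R`.
    have h1 := h.ex_cover f.f he (hR hf)
    have hey : e ≤ X.el := (he _).2 f.cond
    have h2 := (J X.pt).pullback_stable (homOfLE hw) h1
    refine (J X.pt).superset_covering ?_ h2
    rintro v j ⟨u, k, ⟨Z', g, hg, e₁, he₁, hu⟩, e₂, he₂, hv⟩
    obtain ⟨e₃, he₃⟩ := h.exists_ex f.f e₁
    exact ⟨Z', g ≫ f, hg, e₃, he₁.comp he₃, hv.trans (he₂.mono he₃ hu)⟩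

namespace IsGeometric

variable (hP : P.IsGeometric)
include hP

theorem exists_inf {c : P.base} (x y : P.El c) : ∃ z, IsGLB {x, y} z := by
  obtain ⟨s, hs⟩ := hP.exists_sup (lowerBounds {x, y})
  exact ⟨s, isLUB_lowerBounds.1 hs⟩

theorem exists_top (c : P.base) : ∃ t : P.El c, IsTop t := by
  obtain ⟨s, hs⟩ := hP.exists_sup (Set.univ : Set (P.El c))
  exact ⟨s, fun x => hs.1 trivial⟩

/-- The canonical topology of the fibres of a geometric doctrine. -/
def supTopology (c : P.base) : GrothendieckTopology (P.El c) where
  sieves x := {T | IsLUB {z | ∃ i : z ⟶ x, T i} x}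
  top_mem' x := ⟨fun z ⟨i, _⟩ => leOfHom i, fun b hb => hb ⟨𝟙 x, trivial⟩⟩
  pullback_stable' := by
    intro x y T f hT
    refine ⟨fun z ⟨i, _⟩ => leOfHom i, fun b hb => ?_⟩
    -- Since `y ≤ x`, stability is frame distributivity for `y = y ∧ x`.
    have hm : IsGLB {y, x} y := ⟨by simp [lowerBounds, leOfHom f], fun z hz => hz (by simp)⟩
    refine (hP.inf_sup hT hm).2 ?_
    rintro w ⟨z, ⟨i, hi⟩, hw⟩
    have hwy : w ≤ y := hw.1 (by simp)
    have hwz : w ≤ z := hw.1 (by simp)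
    exact hb ⟨homOfLE hwy, T.downward_closed hi (homOfLE hwz)⟩
  transitive' := by
    intro x S hS R hR
    refine ⟨fun z ⟨i, _⟩ => leOfHom i, fun b hb => hS.2 ?_⟩
    rintro z ⟨i, hi⟩
    refine (hR hi).2 ?_
    rintro w ⟨j, hj⟩
    exact hb ⟨_, hj⟩

/-- A family and the down-set that it generates have the same upper bounds, and being a least upper
bound depends on nothing else. -/
theorem mem_geomCov_iff {X : P.Total} {S : Sieve X} :
    S ∈ P.geomCov X ↔ exSieve S ∈ hP.supTopology X.pt X.el := by
  have e : upperBounds {e | ∃ (Z : P.Total) (f : Z ⟶ X), S f ∧ IsEx f.f Z.el e} =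
      upperBounds {z | ∃ i : z ⟶ X.el, exSieve S i} := by
    ext b
    constructor
    · rintro h w ⟨i, Z, f, hf, e, he, hw⟩
      exact hw.trans (h ⟨Z, f, hf, he⟩)
    · rintro h e ⟨Z, f, hf, he⟩
      exact h ⟨homOfLE ((he _).2 f.cond), Z, f, hf, e, he, le_rfl⟩
  change IsLeast _ _ ↔ IsLeast _ _
  rw [e]

theorem geomCov_eq : P.geomCov = P.exCov fun c x => hP.supTopology c x := by
  funext X
  exact Set.ext fun S => hP.mem_geomCov_iff

theorem isExistentialSite : P.IsExistentialSite hP.supTopology where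
  exists_ex := hP.exists_ex
  ex_cover := by
    intro c d f x e T he hT
    refine ⟨fun z ⟨i, _⟩ => leOfHom i, fun b hb => (he b).2 (hT.2 ?_)⟩
    rintro z ⟨i, hi⟩
    obtain ⟨e', he'⟩ := hP.exists_ex f z
    exact (he' b).1 (hb ⟨homOfLE (he'.mono he (leOfHom i)), z, i, hi, e', he', le_rfl⟩)
  frobenius := by
    intro d x y h S hS
    rw [← hP.mem_geomCov_iff (X := ⟨d, y⟩)] at hS
    rw [← hP.mem_geomCov_iff (X := ⟨d, x⟩)]
    refine ⟨?_, fun b hb => ?_⟩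
    · rintro e ⟨Z, f, hf, he⟩
      exact (he _).2 f.cond
    have hm : IsGLB {x, y} x := ⟨by simp [lowerBounds, h], fun z hz => hz (by simp)⟩
    refine (hP.inf_sup hS hm).2 ?_
    rintro w ⟨e, ⟨Z, f, hf, he⟩, hw⟩
    obtain ⟨z, hz⟩ := hP.exists_inf Z.el (P.re f.f x)
    -- By Frobenius, `∃_f Z.el ∧ x` is `∃_f (Z.el ∧ P(f) x)`, and `f` restricted to `Z.el ∧ P(f) x`
    -- belongs to the pulled back sieve.
    have hw' := hP.frobenius f.f he hz (Set.pair_comm x e ▸ hw)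
    let g : (⟨Z.pt, z⟩ : P.Total) ⟶ ⟨d, x⟩ := ⟨f.f, hz.1 (by simp)⟩
    refine hb ⟨⟨Z.pt, z⟩, g, ?_, hw'⟩
    let v : (⟨Z.pt, z⟩ : P.Total) ⟶ Z := vertical (hz.1 (by simp))
    have e : g ≫ vertical h = v ≫ f := total_ext (by
      change f.f ≫ 𝟙 _ = 𝟙 _ ≫ f.f; simp)
    change S (g ≫ vertical h)
    rw [e]
    exact S.downward_closed hf v
  beckChevalley := by
    intro e d h y S hS
    rw [← hP.mem_geomCov_iff (X := ⟨d, y⟩)] at hS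
    rw [← hP.mem_geomCov_iff (X := ⟨e, P.re h y⟩)]
    exact hP.beckChevalley h hS

theorem isTopology : IsTopology P.geomCov := by
  rw [hP.geomCov_eq]; exact hP.isExistentialSite.isTopology

end IsGeometric

/-- The sieve generated by an arrow `f : (c, x) ⟶ (d, ∃_f x)` is covering. -/
theorem generateSingleton_mem_geomCov {X Y : P.Total} (f : X ⟶ Y) (h : IsEx f.f X.el Y.el) :
    Sieve.generateSingleton f ∈ P.geomCov Y := by
  refine ⟨?_, fun b hb => hb ⟨X, f, ⟨𝟙 X, by simp⟩, h⟩⟩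
  rintro e ⟨Z, g, _, he⟩
  exact (he _).2 g.cond

/-- Only Beck–Chevalley needs an argument. The arrow `(c, x) ⟶ (e, ∃_f x)` generates a cover; an
arrow in its pullback along `h` amounts to a commutative square over `f` and `h`, which factors
through the given pullback square. The relative condition says that these arrows still cover. -/
theorem IsGeometric.isExistential [HasFiniteLimits P.base] (hP : P.IsGeometric) :
    P.IsExistential where
  hasFiniteLimits := inferInstance
  antisymm := hP.antisymm
  exists_top := hP.exists_top
  exists_inf := hP.exists_inf
  re_top := hP.re_top
  re_inf := hP.re_inf
  exists_ex := hP.exists_ex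
  frobenius := hP.frobenius
  beckChevalley := by
    intro b c d e g k h f hsq x w hw y
    have hxw : x ≤ P.re f w := hw.le
    constructor
    · intro hy
      refine le_trans ?_ (P.re_mono g hy)
      rw [← P.re_comp, hsq.w, P.re_comp]
      exact P.re_mono k hxw
    · intro hy
      let F : (⟨c, x⟩ : P.Total) ⟶ ⟨e, w⟩ := ⟨f, hxw⟩
      refine (hP.beckChevalley h (y := w) (generateSingleton_mem_geomCov F hw)).2 ?_
      rintro v ⟨Z, m, ⟨l, hl⟩, hv⟩
      refine (hv y).2 ?_
      have hl' : l.f ≫ f = m.f ≫ h := congrArg TotalHom.f hl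
      have h1 : Z.el ≤ P.re (hsq.lift m.f l.f hl'.symm) (P.re k x) := by
        rw [← P.re_comp, hsq.lift_snd]; exact l.cond
      refine (h1.trans (P.re_mono _ hy)).trans_eq ?_
      rw [← P.re_comp, hsq.lift_fst]

/-- Morphisms of doctrines over categories with finite limits that preserve finite limits, finite
meets and covers are morphisms of sites. -/
theorem isMorphismOfSites_total [HasFiniteLimits P.base] (F : Mor P Q)
    [PreservesFiniteLimits F.F] {J : Cov P.Total} {K : Cov Q.Total} (hK : IsTopology K)
    (exists_top : ∀ c : P.base, ∃ t : P.El c, IsTop t)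
    (exists_inf : ∀ {c : P.base} (x y : P.El c), ∃ z, IsGLB {x, y} z)
    (re_top : ∀ {c d : Q.base} (f : c ⟶ d) {t : Q.El d}, IsTop t → IsTop (Q.re f t))
    (re_inf : ∀ {c d : Q.base} (f : c ⟶ d) {x y z : Q.El d},
      IsGLB {x, y} z → IsGLB {Q.re f x, Q.re f y} (Q.re f z))
    (top : ∀ {c : P.base} {t : P.El c}, IsTop t → IsTop (F.a t))
    (inf : ∀ {c : P.base} {x y z : P.El c}, IsGLB {x, y} z → IsGLB {F.a x, F.a y} (F.a z))
    (cover : ∀ {X : P.Total} {S : Sieve X}, S ∈ J X →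
      S.functorPushforward F.total ∈ K (F.total.obj X)) : IsMorphismOfSites F.total J K where
  cover := cover
  -- The remaining three sieves are all maximal: `C ⋊ P` has a terminal object, products and
  -- equalizers computed from those of `C` with tops, meets and reindexing in the fibres, and `F ⋊
  -- a` preserves them.
  inh X := hK.superset (hK.top_mem X) fun Y _ _ => by
    obtain ⟨t, ht⟩ := exists_top (⊤_ P.base)
    have hT : IsTerminal (F.F.obj (⊤_ P.base)) := terminalIsTerminal.isTerminalObj F.F _
    exact ⟨⟨⊤_ P.base, t⟩, ⟨⟨hT.from _, re_top _ (top ht) _⟩⟩⟩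
  span := by
    intro X X₁ X₂ g₁ g₂
    refine hK.superset (hK.top_mem X) fun Y s _ => ?_
    obtain ⟨m, hm⟩ := exists_inf (P.re (prod.fst : X₁.pt ⨯ X₂.pt ⟶ _) X₁.el)
      (P.re (prod.snd : X₁.pt ⨯ X₂.pt ⟶ _) X₂.el)
    let hl := isLimitOfHasBinaryProductOfPreservesLimit F.F X₁.pt X₂.pt
    obtain ⟨k, hk₁, hk₂⟩ := BinaryFan.IsLimit.lift' hl (s ≫ g₁).f (s ≫ g₂).f
    change k ≫ F.F.map prod.fst = _ at hk₁
    change k ≫ F.F.map prod.snd = _ at hk₂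
    refine ⟨⟨X₁.pt ⨯ X₂.pt, m⟩, ⟨prod.fst, hm.1 (by simp)⟩, ⟨prod.snd, hm.1 (by simp)⟩,
      ⟨k, (re_inf k (inf hm)).2 ?_⟩, total_ext hk₁.symm, total_ext hk₂.symm⟩
    rintro _ (rfl | rfl)
    · rw [F.nat, ← Q.re_comp, hk₁]; exact (s ≫ g₁).cond
    · rw [F.nat, ← Q.re_comp, hk₂]; exact (s ≫ g₂).cond
  equ := by
    intro X X₁ X₂ f₁ f₂ g hg
    refine hK.superset (hK.top_mem X) fun Y s _ => ?_
    let hl := isLimitForkMapOfIsLimit F.F (equalizer.condition f₁.f f₂.f)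
      (equalizerIsEqualizer f₁.f f₂.f)
    obtain ⟨k, hk⟩ := Fork.IsLimit.lift' hl (s ≫ g).f
      (by
        have h₁ : (s ≫ g).f ≫ F.F.map f₁.f = (s ≫ g).f ≫ F.F.map f₂.f := by
          have : (s ≫ g) ≫ F.total.map f₁ = (s ≫ g) ≫ F.total.map f₂ := by
            rw [Category.assoc, Category.assoc, hg]
          exact congrArg TotalHom.f this
        exact h₁)
    change k ≫ F.F.map (equalizer.ι f₁.f f₂.f) = _ at hk
    refine ⟨⟨equalizer f₁.f f₂.f, P.re (equalizer.ι f₁.f f₂.f) X₁.el⟩,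
      ⟨equalizer.ι f₁.f f₂.f, le_rfl⟩, ⟨k, ?_⟩, total_ext (equalizer.condition _ _),
      total_ext hk.symm⟩
    change _ ≤ Q.re k (F.a (P.re _ _))
    rw [F.nat, ← Q.re_comp, hk]
    exact (s ≫ g).cond

/-- By adjointness, upper bounds of the `∃_f U` can be tested without computing any `∃_f`. This and
its converse below are the working form of `K_L`-covers. -/
theorem le_of_mem_geomCov {X : P.Total} {S : Sieve X} (hS : S ∈ P.geomCov X) {b : P.El X.pt}
    (h : ∀ {Z : P.Total} (f : Z ⟶ X), S f → Z.el ≤ P.re f.f b) : X.el ≤ b := by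
  refine hS.2 ?_
  rintro e ⟨Z, f, hf, he⟩
  exact (he b).2 (h f hf)

theorem mem_geomCov_of_forall (hP : ∀ {c d : P.base} (f : c ⟶ d) (x : P.El c), ∃ e, IsEx f x e)
    {X : P.Total} {S : Sieve X} (h : ∀ b : P.El X.pt,
      (∀ {Z : P.Total} (f : Z ⟶ X), S f → Z.el ≤ P.re f.f b) → X.el ≤ b) : S ∈ P.geomCov X := by
  refine ⟨?_, fun b hb => h b fun {Z} f hf => ?_⟩
  · rintro e ⟨Z, g, _, he⟩
    exact (he _).2 g.cond
  · obtain ⟨e, he⟩ := hP f.f Z.el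
    exact (he b).1 (hb ⟨Z, f, hf, he⟩)

/-- Morphisms of sites between geometric doctrines over categories with finite limits are
morphisms of existential doctrines. -/
theorem isExMor_of_isMorphismOfSites [HasFiniteLimits P.base] (hP : P.IsGeometric)
    (F : Mor P Q) [PreservesFiniteLimits F.F]
    (hF : IsMorphismOfSites F.total P.geomCov Q.geomCov) : IsExMor F where
  preservesFiniteLimits := inferInstance
  top := by
    intro c t ht y
    refine le_of_mem_geomCov (X := ⟨F.F.obj c, y⟩) (hF.inh ⟨F.F.obj c, y⟩) ?_
    rintro Z h ⟨X', ⟨⟨k, hk⟩⟩⟩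
    change Z.pt ⟶ F.F.obj X'.pt at k
    change Z.el ≤ Q.re k (F.a X'.el) at hk
    obtain ⟨s, hs⟩ := hP.exists_top (⊤_ P.base)
    -- The tops at `c` and at `X'.pt` are compared over the terminal object, of whose top both are
    -- restrictions.
    have hT : IsTerminal (F.F.obj (⊤_ P.base)) := terminalIsTerminal.isTerminalObj F.F _
    have h1 : X'.el ≤ P.re (terminal.from _) s := hP.re_top _ hs _
    have h2 := hk.trans (Q.re_mono _ (F.mono h1))
    have h3 : P.re (terminal.from c) s ≤ t := ht _
    refine le_trans ?_ (Q.re_mono h.f (F.mono h3))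
    rw [F.nat, ← Q.re_comp] at h2 ⊢
    rwa [hT.hom_ext (h.f ≫ F.F.map (terminal.from c)) (k ≫ F.F.map (terminal.from _))]
  inf := by
    intro c x y z hz
    refine ⟨?_, fun w hw => ?_⟩
    · rintro _ (rfl | rfl)
      · exact F.mono (hz.1 (by simp))
      · exact F.mono (hz.1 (by simp))
    let g₁ : (⟨F.F.obj c, w⟩ : Q.Total) ⟶ F.total.obj ⟨c, x⟩ := vertical (hw (by simp))
    let g₂ : (⟨F.F.obj c, w⟩ : Q.Total) ⟶ F.total.obj ⟨c, y⟩ := vertical (hw (by simp))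
    refine le_of_mem_geomCov (X := ⟨F.F.obj c, w⟩) (hF.span g₁ g₂) ?_
    rintro Z h ⟨X', f₁, f₂, ⟨k, hk⟩, h₁, h₂⟩
    change Z.pt ⟶ F.F.obj X'.pt at k
    change Z.el ≤ Q.re k (F.a X'.el) at hk
    have h₁' : h.f = k ≫ F.F.map f₁.f := (Category.comp_id _).symm.trans (congrArg TotalHom.f h₁)
    have h₂' : h.f = k ≫ F.F.map f₂.f := (Category.comp_id _).symm.trans (congrArg TotalHom.f h₂)
    -- Both `k ≫ F f₁` and `k ≫ F f₂` equal `h`, so `k` factors through `F` of the equalizer of `f₁`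
    -- and `f₂`. There `X'.el` lies below the restrictions of `x` and `y` along one and the same
    -- arrow, hence below that of their meet.
    let hl := isLimitForkMapOfIsLimit F.F (equalizer.condition f₁.f f₂.f)
      (equalizerIsEqualizer f₁.f f₂.f)
    obtain ⟨l, hl⟩ := Fork.IsLimit.lift' hl k (h₁'.symm.trans h₂')
    change Z.pt ⟶ F.F.obj (equalizer f₁.f f₂.f) at l
    change l ≫ F.F.map (equalizer.ι f₁.f f₂.f) = _ at hl
    have hu : P.re (equalizer.ι f₁.f f₂.f) X'.el ≤ P.re (equalizer.ι f₁.f f₂.f ≫ f₁.f) z := by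
      refine (hP.re_inf _ hz).2 ?_
      rintro _ (rfl | rfl)
      · rw [P.re_comp]; exact P.re_mono _ f₁.cond
      · rw [equalizer.condition, P.re_comp]; exact P.re_mono _ f₂.cond
    have h3 := Q.re_mono l (F.mono hu)
    rw [F.nat, F.nat, ← Q.re_comp, ← Q.re_comp, hl, F.F.map_comp, ← Category.assoc, hl,
      ← h₁'] at h3
    exact le_trans hk h3
  ex := by
    intro c d f x e he w
    let f' : (⟨c, x⟩ : P.Total) ⟶ ⟨d, e⟩ := ⟨f, he.le⟩
    constructor
    · intro h
      have := F.mono he.le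
      rw [F.nat] at this
      exact this.trans (Q.re_mono _ h)
    · intro h
      -- The arrow `(c, x) ⟶ (d, ∃_f x)` generates a cover, and its image is again a cover; bounds
      -- of `F.a e` can therefore be checked on `F.a x`.
      refine le_of_mem_geomCov (X := ⟨F.F.obj d, F.a e⟩)
        (hF.cover (generateSingleton_mem_geomCov f' he)) ?_
      rintro Z g ⟨X', m, k, ⟨l, rfl⟩, rfl⟩
      have h1 := (k ≫ F.total.map l).cond.trans (Q.re_mono _ h)
      refine h1.trans_eq ((Q.re_comp _ _ _).symm.trans ?_)
      have : (k ≫ F.total.map l) ≫ F.total.map f' = k ≫ F.total.map (l ≫ f') := by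
        rw [F.total.map_comp, Category.assoc]
      exact congrArg (fun i => Q.re (TotalHom.f i) w) this

/-- A morphism of doctrines whose components preserve joins and left adjoints preserves the
covers of geometric doctrines. -/
theorem functorPushforward_mem_geomCov
    (hQ : ∀ {c d : Q.base} (f : c ⟶ d) (x : Q.El c), ∃ e, IsEx f x e) (F : Mor P Q)
    (sup : ∀ {c : P.base} {A : Set (P.El c)} {s : P.El c}, IsLUB A s → IsLUB (F.a '' A) (F.a s))
    (ex : ∀ {c d : P.base} (f : c ⟶ d) {x : P.El c} {e : P.El d},
      IsEx f x e → IsEx (F.F.map f) (F.a x) (F.a e))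
    {X : P.Total} {S : Sieve X} (hS : S ∈ P.geomCov X) :
    S.functorPushforward F.total ∈ Q.geomCov (F.total.obj X) := by
  refine mem_geomCov_of_forall hQ fun b hb => (sup hS).2 ?_
  rintro _ ⟨e, ⟨Z, f, hf, he⟩, rfl⟩
  refine (ex f.f he b).2 (hb (F.total.map f) ⟨Z, f, 𝟙 _, hf, (Category.id_comp _).symm⟩)

end Doctrine

theorem liftsTo_inclDoc : exDocSites.{u}.LiftsTo geomDocCart.forget fun L => L.str where
  ok L := by
    obtain ⟨hK, hfl, hL, e⟩ := L.ok
    exact ⟨hK, hL.isExistential, hL.supTopology, hL.isExistentialSite, e.trans hL.geomCov_eq⟩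
  isHom {L M} F := by
    obtain ⟨_, hfl, hL, e⟩ := L.ok
    obtain ⟨_, _, hM, e'⟩ := M.ok
    have hF := F.isHom
    refine ⟨hF, ?_⟩
    have : RepresentablyFlat (Doctrine.Mor.F F.hom) := hF.1
    have : PreservesFiniteLimits (Doctrine.Mor.F F.hom) := preservesFiniteLimits_of_flat _
    have h2 : IsMorphismOfSites (Doctrine.Mor.total F.hom) L.str M.str := hF.2
    rw [e, e'] at h2
    exact Doctrine.isExMor_of_isMorphismOfSites hL F.hom h2

end GeomCompl

/-! ### The geometric completion is a geometric doctrine, functorially. -/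

namespace GeomCompl

open Doctrine

/-- In an existential doctrinal site, an arrow `(c, x) ⟶ (d, ∃_f x)` generates a cover. -/
theorem generateSingleton_mem_exCov {P : Doctrine.{u}}
    {J : ∀ c : P.base, GrothendieckTopology (P.El c)}
    {X Y : P.Total} (f : X ⟶ Y) (h : IsEx f.f X.el Y.el) :
    Sieve.generateSingleton f ∈ P.exCov (fun c x => J c x) Y := by
  refine (J Y.pt).superset_covering ?_ ((J Y.pt).top_mem Y.el)
  intro w i _
  exact ⟨X, f, ⟨𝟙 X, by simp⟩, Y.el, h, leOfHom i⟩

namespace ZEl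

variable {P Q : Doctrine.{u}} {J : Cov P.Total} {K : Cov Q.Total}

/-- The arrows `g` into `X` such that `(g ≫ f, _)` lies below an element of `M`. -/
def genSieve {c : P.base} (M : ∀ {d : P.base}, (d ⟶ c) → P.El d → Prop) {X : P.Total}
    (f : X.pt ⟶ c) : Sieve X where
  arrows Y g := ∃ (Z : P.Total) (h : Z.pt ⟶ c), M h Z.el ∧ ∃ k : Y ⟶ Z, g.f ≫ f = k.f ≫ h
  downward_closed := by
    rintro Y Y' g ⟨Z, h, hM, k, hk⟩ l
    exact ⟨Z, h, hM, l ≫ k, by simp [hk]⟩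

/-- The element of the completion generated by a set of pairs. -/
def cl (hJ : IsTopology J) {c : P.base} (M : ∀ {d : P.base}, (d ⟶ c) → P.El d → Prop) :
    ZEl J c where
  -- One closure step suffices: by transitivity of `J`, the pairs that are locally below members of
  -- `M` already form a closed set.
  mem {d} f x := genSieve M (X := ⟨d, x⟩) f ∈ J ⟨d, x⟩
  down {d e f x y} g hy h := by
    let k : (⟨e, y⟩ : P.Total) ⟶ ⟨d, x⟩ := ⟨g, hy⟩
    refine hJ.superset (hJ.pullback_mem h k) ?_
    rintro Y l ⟨Z, h, hM, m, hm⟩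
    exact ⟨Z, h, hM, m, by rw [← hm]; exact (Category.assoc _ _ _).symm⟩
  closed {X f T} hT h := by
    refine hJ.trans hT _ fun Y g hg => hJ.superset (h g hg) ?_
    rintro Z l ⟨W, k, hM, m, hm⟩
    exact ⟨W, k, hM, m, by rw [← hm]; exact Category.assoc _ _ _⟩

section

variable {hJ : IsTopology J} {c : P.base} {M : ∀ {d : P.base}, (d ⟶ c) → P.El d → Prop}

theorem mem_cl {d : P.base} {f : d ⟶ c} {x : P.El d} (h : M f x) : (cl hJ M).mem f x :=
  hJ.superset (hJ.top_mem _) fun Y g _ => ⟨⟨d, x⟩, f, h, g, rfl⟩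

/-- The elimination rule for generated closed sets. The target `b` may live over another object `e`,
reached by `p`; this makes it possible to nest eliminations and to use the rule for reindexed sets.
-/
theorem cl_mem_elim {d : P.base} {f : d ⟶ c} {x : P.El d} (h : (cl hJ M).mem f x) {e : P.base}
    (p : d ⟶ e) (b : ZEl J e)
    (H : ∀ {Y : P.Total} (g : Y ⟶ (⟨d, x⟩ : P.Total)) {Z : P.Total} (h : Z.pt ⟶ c) (k : Y ⟶ Z),
      M h Z.el → g.f ≫ f = k.f ≫ h → b.mem (g.f ≫ p) Y.el) : b.mem p x :=
  b.closed (X := ⟨d, x⟩) h fun g ⟨_, h, hM, k, hk⟩ => H g h k hM hk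

theorem cl_le {b : ZEl J c} :
    cl hJ M ≤ b ↔ ∀ (d : P.base) (f : d ⟶ c) (x : P.El d), M f x → b.mem f x := by
  refine ⟨fun h _ f x hx => le_iff.1 h f x (mem_cl hx), fun h => le_iff.2 fun f x hx => ?_⟩
  refine cl_mem_elim hx f b fun {Y} g {Z} l k hM e => ?_
  rw [e]
  exact b.down k.f k.cond (h _ _ _ hM)

end

/-- Replaces the impredicative definition of `map` by a local one, so that `cl_mem_elim` applies to
its members. -/
theorem map_eq_cl {F : Doctrine.Mor P Q} (hK : IsTopology K) {c : P.base} (S : ZEl J c) :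
    map F K S = cl hK (fun {e} h y => ∃ (d : P.base) (g : d ⟶ c) (x : P.El d), S.mem g x ∧
      ∃ k : e ⟶ F.F.obj d, y ≤ Q.re k (F.a x) ∧ h = k ≫ F.F.map g) := by
  refine le_antisymm (map_le fun g x hx => mem_cl ⟨_, g, x, hx, 𝟙 _, by simp, by simp⟩)
    (cl_le.2 ?_)
  rintro e h y ⟨d, g, x, hx, k, hy, rfl⟩
  exact ZEl.down _ k hy (mem_map hx)

/-- Intersection. -/
def infEl {c : P.base} (S T : ZEl J c) : ZEl J c where
  mem f x := S.mem f x ∧ T.mem f x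
  down g hy h := ⟨S.down g hy h.1, T.down g hy h.2⟩
  closed hT h := ⟨S.closed hT fun g hg => (h g hg).1, T.closed hT fun g hg => (h g hg).2⟩

theorem isGLB_infEl {c : P.base} (S T : ZEl J c) : IsGLB {S, T} (infEl S T) := by
  refine ⟨?_, fun U hU => le_iff.2 fun f x hx => ⟨?_, ?_⟩⟩
  · rintro _ (rfl | rfl)
    · exact le_iff.2 fun f x hx => hx.1
    · exact le_iff.2 fun f x hx => hx.2
  · exact le_iff.1 (hU (by simp)) f x hx
  · exact le_iff.1 (hU (by simp)) f x hx

theorem mem_isGLB {c : P.base} {S T U : ZEl J c} (h : IsGLB {S, T} U) {d : P.base} {f : d ⟶ c}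
    {x : P.El d} : U.mem f x ↔ S.mem f x ∧ T.mem f x := by
  rw [h.unique (isGLB_infEl S T)]; rfl

/-- The set of all pairs. -/
def topEl (c : P.base) : ZEl J c where
  mem _ _ := True
  down _ _ _ := trivial
  closed _ _ := trivial

theorem mem_isTop {c : P.base} {S : ZEl J c} (h : IsTop S) {d : P.base} (f : d ⟶ c)
    (x : P.El d) : S.mem f x := le_iff.1 (h (topEl c)) f x trivial

theorem isTop_of_mem {c : P.base} {S : ZEl J c} (h : ∀ {d : P.base} (f : d ⟶ c)
    (x : P.El d), S.mem f x) : IsTop S := fun _ => le_iff.2 fun f x _ => h f x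

theorem isLUB_cl (hJ : IsTopology J) {c : P.base} (A : Set (ZEl J c)) :
    IsLUB A (cl hJ fun f x => ∃ S ∈ A, S.mem f x) :=
  ⟨fun S hS => le_iff.2 fun f x hx => mem_cl ⟨S, hS, hx⟩, fun _ hb => cl_le.2 fun _ _ _ ⟨_, hS, hx⟩ =>
    le_iff.1 (hb hS) _ _ hx⟩

/-- Joins are closures of unions, so a member of a join belongs locally to one of the sets. With
`mem_isEx_elim`, the analogue for closures of images, this reduces the frame axioms to pointwise
statements. -/
theorem mem_isLUB_elim (hJ : IsTopology J) {c d e : P.base} {A : Set (ZEl J c)} {s : ZEl J c}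
    (hs : IsLUB A s) {f : d ⟶ c} {x : P.El d} (h : s.mem f x) (p : d ⟶ e) (b : ZEl J e)
    (H : ∀ {Y : P.Total} (g : Y ⟶ (⟨d, x⟩ : P.Total)) (S : ZEl J c), S ∈ A →
      S.mem (g.f ≫ f) Y.el → b.mem (g.f ≫ p) Y.el) : b.mem p x := by
  rw [hs.unique (isLUB_cl hJ A)] at h
  refine cl_mem_elim h p b fun {Y} g {Z} l k ⟨S, hS, hM⟩ e => H g S hS ?_
  rw [e]
  exact S.down k.f k.cond hM

theorem isEx_cl (hJ : IsTopology J) {c d : P.base} (f : c ⟶ d) (S : ZEl J c) :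
    IsEx (P := doctrine J) f S (cl hJ fun {e} (h : e ⟶ d) x => ∃ g : e ⟶ c, h = g ≫ f ∧
      S.mem g x) := by
  intro b
  refine cl_le.trans ⟨fun h => le_iff.2 fun g x hx => h _ _ x ⟨g, rfl, hx⟩, ?_⟩
  rintro h _ _ x ⟨g, rfl, hx⟩
  exact le_iff.1 h g x hx

theorem mem_isEx_elim (hJ : IsTopology J) {c d c' e : P.base} {f : c ⟶ d} {S : ZEl J c}
    {T : ZEl J d} (hT : IsEx (P := doctrine J) f S T) {h : c' ⟶ d} {x : P.El c'}
    (hx : T.mem h x) (p : c' ⟶ e) (b : ZEl J e)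
    (H : ∀ {Y : P.Total} (g : Y ⟶ (⟨c', x⟩ : P.Total)) (k : Y.pt ⟶ c), S.mem k Y.el →
      g.f ≫ h = k ≫ f → b.mem (g.f ≫ p) Y.el) : b.mem p x := by
  have e₁ : T = _ := le_antisymm ((hT _).2 (isEx_cl hJ f S).le) ((isEx_cl hJ f S _).2 hT.le)
  rw [e₁] at hx
  refine cl_mem_elim hx p b ?_
  rintro Y g Z _ k ⟨m, rfl, hm⟩ e
  exact H g (k.f ≫ m) (S.down _ k.cond hm) (by rw [e, Category.assoc])

theorem isEx_mem {c d c' : P.base} {f : c ⟶ d} {S : ZEl J c} {T : ZEl J d}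
    (hT : IsEx (P := doctrine J) f S T) {g : c' ⟶ c} {x : P.El c'} (h : S.mem g x) :
    T.mem (g ≫ f) x :=
  le_iff.1 hT.le g x h

/-- The geometric completion is a geometric doctrine. -/
theorem isGeometric (hJ : IsTopology J) : (doctrine J).IsGeometric where
  antisymm {c} := by
    change P.base at c
    intro (x : ZEl J c) (y : ZEl J c) (h : x ≤ y) (h' : y ≤ x)
    exact @le_antisymm (ZEl J c) _ x y h h'
  exists_sup A := ⟨_, isLUB_cl hJ A⟩
  inf_sup := by
    intro (c : P.base) (A : Set (ZEl J c)) (x : ZEl J c) (s : ZEl J c) (m : ZEl J c)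
      (hs : @IsLUB (ZEl J c) _ A s) (hm : @IsGLB (ZEl J c) _ {x, s} m)
    refine ⟨?_, fun b hb => le_iff.2 fun f y hy => ?_⟩
    · rintro w ⟨y, hy, (hw : @IsGLB (ZEl J c) _ {x, y} w)⟩
      refine hm.2 ?_
      rintro _ (rfl | rfl)
      · exact hw.1 (.inl rfl)
      · exact le_trans (α := ZEl J c) (hw.1 (.inr rfl)) (hs.1 hy)
    · obtain ⟨h₁, h₂⟩ := (mem_isGLB hm).1 hy
      refine mem_isLUB_elim hJ hs h₂ f b fun g S hS hg => ?_
      exact le_iff.1 (hb ⟨S, hS, isGLB_infEl x S⟩) _ _ ⟨x.down _ g.cond h₁, hg⟩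
  re_top f t ht := isTop_of_mem fun g x => mem_isTop ht _ x
  re_inf := by
    intro (c : P.base) (d : P.base) (f : c ⟶ d) (x : ZEl J d) (y : ZEl J d) (z : ZEl J d) h
    have : (re f z : ZEl J c) = infEl (re f x) (re f y) := ZEl.ext (by
      funext d g w
      exact propext (mem_isGLB h))
    change IsGLB {(re f x : ZEl J c), re f y} (re f z)
    rw [this]
    exact isGLB_infEl _ _
  re_sup := by
    intro (c : P.base) (d : P.base) (f : c ⟶ d) (A : Set (ZEl J d)) (s : ZEl J d) hs
    refine ⟨?_, fun (b : ZEl J c) hb => le_iff.2 fun g x hx => ?_⟩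
    · rintro _ ⟨S, hS, rfl⟩
      exact (doctrine J).re_mono f (hs.1 hS)
    · refine mem_isLUB_elim hJ hs (f := g ≫ f) hx g b fun k S hS hk => ?_
      refine le_iff.1 (hb ⟨S, hS, rfl⟩) (k.f ≫ g) _ ?_
      change S.mem ((k.f ≫ g) ≫ f) _
      rwa [Category.assoc]
  exists_ex f S := ⟨_, isEx_cl hJ f S⟩
  frobenius := by
    intro (c : P.base) (d : P.base) (f : c ⟶ d) (x : ZEl J c) (y : ZEl J d) (e : ZEl J d) (w : ZEl J d)
      (z : ZEl J c) he hz hw (b : ZEl J d)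
    constructor
    · intro h
      refine le_iff.2 fun g u hu => ?_
      obtain ⟨h₁, h₂⟩ := (mem_isGLB hz).1 hu
      exact le_iff.1 h _ _ ((mem_isGLB hw).2 ⟨isEx_mem he h₁, h₂⟩)
    · intro h
      refine le_iff.2 fun g u hu => ?_
      obtain ⟨h₁, h₂⟩ := (mem_isGLB hw).1 hu
      refine mem_isEx_elim hJ he h₁ g b fun {Y} l k hk e' => ?_
      rw [e']
      refine le_iff.1 h _ _ ((mem_isGLB hz).2 ⟨hk, ?_⟩)
      change y.mem (k ≫ f) _
      rw [← e']
      exact y.down _ l.cond h₂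
  beckChevalley := by
    intro (e : P.base) (d : P.base) (h : e ⟶ d) (y : ZEl J d) S hS
    refine mem_geomCov_of_forall (P := doctrine J)
      (fun {c d} f S => ⟨_, isEx_cl (c := c) (d := d) hJ f S⟩) fun (b : ZEl J e) hb => ?_
    refine le_iff.2 fun k x hx => ?_
    refine mem_isLUB_elim hJ hS (f := k ≫ h) hx k b fun {Y} g T hT hg => ?_
    obtain ⟨⟨c, V⟩, ⟨f, hfy⟩, hf, he⟩ := hT
    change P.base at c
    change ZEl J c at V
    change c ⟶ d at f
    refine mem_isEx_elim hJ he hg (g.f ≫ k) b fun {Y'} l m hm e' => ?_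
    -- Locally the given pair comes from `V` through `m`. The object `Z'` contains the pair `(1,
    -- Y'.el)` and maps by `r` to `(e, Z(h) y)`; followed by `h`, the arrow `r` becomes `m` followed
    -- by `f`, so it lies in the pulled back sieve.
    let Z' : (doctrine J).Total := ⟨Y'.pt, re m V⟩
    let r : Z' ⟶ (⟨e, re h y⟩ : (doctrine J).Total) := ⟨l.f ≫ g.f ≫ k, by
      change re m V ≤ re (l.f ≫ g.f ≫ k) (re h y)
      refine le_iff.2 fun q v hv => ?_
      change y.mem ((q ≫ l.f ≫ g.f ≫ k) ≫ h) v
      have h₂ := le_iff.1 hfy _ _ hv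
      change y.mem ((q ≫ m) ≫ f) v at h₂
      rw [Category.assoc, ← e'] at h₂
      simpa using h₂⟩
    have hr : S (r ≫ cartesian (P := doctrine J) h y) := by
      let m' : Z' ⟶ ⟨c, V⟩ := ⟨m, le_rfl⟩
      have e₂ : r ≫ cartesian (P := doctrine J) h y = m' ≫ ⟨f, hfy⟩ := total_ext (by
        change (l.f ≫ g.f ≫ k) ≫ h = m ≫ f
        rw [← e']; simp)
      rw [e₂]
      exact S.downward_closed hf _
    have h₃ := le_iff.1 (hb r hr) (𝟙 _) Y'.el (by
      change V.mem (𝟙 _ ≫ m) _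
      rwa [Category.id_comp])
    change b.mem (𝟙 _ ≫ l.f ≫ g.f ≫ k) _ at h₃
    rwa [Category.id_comp] at h₃

/-- The preimage of `T` under a morphism of sites. -/
def comap (F : Doctrine.Mor P Q)
    (hF : ∀ {X : P.Total} {S : Sieve X}, S ∈ J X → S.functorPushforward F.total ∈ K (F.total.obj X))
    {c : P.base} (T : ZEl K (F.F.obj c)) : ZEl J c where
  mem g x := T.mem (F.F.map g) (F.a x)
  down g hy h := by
    rw [F.F.map_comp]
    exact T.down _ ((F.mono hy).trans_eq (F.nat _ _)) h
  closed {X f U} hU h := by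
    refine T.closed (X := F.total.obj X) (hF hU) ?_
    rintro Y _ ⟨Z, g, k, hg, rfl⟩
    have h₁ := h g hg
    rw [F.F.map_comp] at h₁
    have h₂ := T.down k.f k.cond h₁
    have e : k.f ≫ (F.F.map g.f ≫ F.F.map f) = (k ≫ F.total.map g).f ≫ F.F.map f :=
      (Category.assoc _ _ _).symm
    exact Eq.mp (congrArg (fun q => T.mem q Y.el) e) h₂

/-- The direct image is left adjoint to the preimage `comap`, and preimages commute with reindexing.
Preservation of joins and of `∃_f` follows formally. -/
theorem map_le_iff {F : Doctrine.Mor P Q}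
    (hF : ∀ {X : P.Total} {S : Sieve X}, S ∈ J X → S.functorPushforward F.total ∈ K (F.total.obj X))
    {c : P.base} {S : ZEl J c} {T : ZEl K (F.F.obj c)} : map F K S ≤ T ↔ S ≤ comap F hF T :=
  ⟨fun h => le_iff.2 fun _ _ hx => le_iff.1 h _ _ (mem_map hx),
    fun h => map_le fun g x hx => le_iff.1 h g x hx⟩

/-- Joins and left adjoints are handled by the adjunction with `comap`; the content is in the meets.
A pair in both images comes locally from generators `(p, x)` of `S` and `(p', x')` of `T`; they are
brought together over the pullback of `p` and `p'`, which `F` preserves, where the meet of the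
restrictions of `x` and `x'` belongs to `S` and to `T`. -/
theorem isMorphismOfSites_mor [HasFiniteLimits P.base] (F : Doctrine.Mor P Q)
    [PreservesFiniteLimits F.F] (hJ : IsTopology J) (hK : IsTopology K)
    (hF : ∀ {X : P.Total} {S : Sieve X}, S ∈ J X → S.functorPushforward F.total ∈ K (F.total.obj X))
    (top : ∀ c : P.base, ∃ t : P.El c, IsTop (F.a t))
    (inf : ∀ {c : P.base} (x y : P.El c), ∃ z, z ≤ x ∧ z ≤ y ∧ IsGLB {F.a x, F.a y} (F.a z))
    (re_top : ∀ {c d : Q.base} (f : c ⟶ d) {t : Q.El d}, IsTop t → IsTop (Q.re f t))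
    (re_inf : ∀ {c d : Q.base} (f : c ⟶ d) {x y z : Q.El d},
      IsGLB {x, y} z → IsGLB {Q.re f x, Q.re f y} (Q.re f z)) :
    IsMorphismOfSites (mor (J := J) F hK).total (doctrine J).geomCov (doctrine K).geomCov := by
  have : HasFiniteLimits (doctrine J).base := inferInstanceAs (HasFiniteLimits P.base)
  have : PreservesFiniteLimits (mor (J := J) F hK).F :=
    inferInstanceAs (PreservesFiniteLimits F.F)
  refine isMorphismOfSites_total _ (isGeometric hK).isTopology (isGeometric hJ).exists_top
    (isGeometric hJ).exists_inf (isGeometric hK).re_top (isGeometric hK).re_inf ?_ ?_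
    (functorPushforward_mem_geomCov (isGeometric hK).exists_ex _ ?_ ?_)
  · intro (c : P.base) (t : ZEl J c) ht
    obtain ⟨s, hs⟩ := top c
    refine isTop_of_mem (S := map F K t) fun {d} f x => ?_
    have h₁ := mem_map (F := F) (K := K) (mem_isTop ht (𝟙 c) s)
    rw [F.F.map_id] at h₁
    have h₂ := ZEl.down _ f (re_top f hs x) h₁
    rwa [Category.comp_id] at h₂
  · intro (c : P.base) (S : ZEl J c) (T : ZEl J c) (U : ZEl J c)
      (hU : @IsGLB (ZEl J c) _ {S, T} U)
    rw [hU.unique (isGLB_infEl S T)]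
    refine ⟨?_, fun (b : ZEl K (F.F.obj c)) hb => le_iff.2 fun f w hw => ?_⟩
    · rintro _ (rfl | rfl)
      · exact map_mono ((isGLB_infEl S T).1 (.inl rfl))
      · exact map_mono ((isGLB_infEl S T).1 (.inr rfl))
    have h₁ : (map F K S).mem f w := le_iff.1 (hb (.inl rfl)) f w hw
    have h₂ : (map F K T).mem f w := le_iff.1 (hb (.inr rfl)) f w hw
    change (map F K (infEl S T)).mem f w
    rw [map_eq_cl hK] at h₁ h₂
    refine cl_mem_elim h₁ f _ ?_
    rintro Y g Z _ k ⟨d, p, x, hx, l, hl, rfl⟩ e₁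
    have h₃ := ZEl.down _ g.f g.cond h₂
    refine cl_mem_elim h₃ (g.f ≫ f) _ ?_
    rintro Y' g' Z' _ k' ⟨d', p', x', hx', l', hl', rfl⟩ e₂
    have pb := (IsPullback.of_hasPullback p p').map F.F
    let r := pb.lift (g'.f ≫ k.f ≫ l) (k'.f ≫ l') (by
      rw [Category.assoc, Category.assoc, ← e₁, Category.assoc, ← e₂])
    have hr₁ : r ≫ F.F.map (pullback.fst p p') = g'.f ≫ k.f ≫ l := pb.lift_fst _ _ _
    have hr₂ : r ≫ F.F.map (pullback.snd p p') = k'.f ≫ l' := pb.lift_snd _ _ _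
    obtain ⟨z, hz₁, hz₂, hz⟩ := inf (P.re (pullback.fst p p') x) (P.re (pullback.snd p p') x')
    have hm : (infEl S T).mem (pullback.fst p p' ≫ p) z :=
      ⟨S.down _ hz₁ hx, by rw [pullback.condition]; exact T.down _ hz₂ hx'⟩
    have hy : Y'.el ≤ Q.re r (F.a z) := by
      refine (re_inf r hz).2 ?_
      rintro _ (rfl | rfl)
      · rw [F.nat, ← Q.re_comp, hr₁, Q.re_comp, Q.re_comp]
        exact g'.cond.trans (Q.re_mono _ (k.cond.trans (Q.re_mono _ hl)))
      · rw [F.nat, ← Q.re_comp, hr₂, Q.re_comp]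
        exact k'.cond.trans (Q.re_mono _ hl')
    have h₄ := ZEl.down _ r hy (mem_map (F := F) (K := K) hm)
    rw [F.F.map_comp, ← Category.assoc, hr₁, Category.assoc, Category.assoc, ← e₁] at h₄
    exact h₄
  · intro (c : P.base) (A : Set (ZEl J c)) (s : ZEl J c) hs
    refine ⟨?_, fun b hb => (map_le_iff hF).2 (hs.2 fun S hS => (map_le_iff hF).1 (hb ⟨S, hS, rfl⟩))⟩
    rintro _ ⟨S, hS, rfl⟩
    exact map_mono (hs.1 hS)
  · intro (c : P.base) (d : P.base) (f : c ⟶ d) (x : ZEl J c) (e : ZEl J d) he (b : ZEl K (F.F.obj d))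
    refine (map_le_iff hF).trans ((he _).trans (Iff.trans ?_ (map_le_iff hF).symm))
    refine iff_of_eq (congrArg (x ≤ ·) (ZEl.ext ?_))
    funext e' g y
    exact congrArg (fun q => b.mem q (F.a y)) (F.F.map_comp g f)

end ZEl

theorem liftsTo_zDoc : geomDocCart.{u}.LiftsTo zDoc kZ where
  ok P := ⟨(ZEl.isGeometric P.ok.1).isTopology, inferInstanceAs (HasFiniteLimits P.base.base),
    ZEl.isGeometric P.ok.1, rfl⟩
  isHom {P Q} F := by
    have hP := P.ok.2.1
    have hQ := Q.ok.2.1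
    have hF := F.isHom.2
    refine ⟨flat_of_preservesFiniteLimits (Doctrine.Mor.F F.hom), ?_⟩
    refine ZEl.isMorphismOfSites_mor F.hom P.ok.1 Q.ok.1 F.isHom.1.2.cover (fun c => ?_) ?_
      hQ.re_top hQ.re_inf
    · obtain ⟨t, ht⟩ := hP.exists_top c
      exact ⟨t, hF.top ht⟩
    · intro c x y
      obtain ⟨z, hz⟩ := hP.exists_inf x y
      exact ⟨z, hz.1 (by simp), hz.1 (by simp), hF.inf hz⟩

end GeomCompl

/-! ### Doctrines of subobjects of regular categories. -/

namespace GeomCompl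

open Doctrine

section Regular

variable {C D : Type u} [SmallCategory C] [SmallCategory D]

/-- Order relations between subobjects are translated into factorizations of arrows throughout,
because these compose and descend along regular epimorphisms. -/
theorem le_pullback_iff [HasPullbacks C] {c d : C} {f : c ⟶ d} {x : Subobject c}
    {y : Subobject d} : x ≤ (Subobject.pullback f).obj y ↔ y.Factors (x.arrow ≫ f) := by
  have h := Subobject.isPullback f y
  constructor
  · intro hx
    refine (Subobject.factors_iff _ _).2 ⟨Subobject.ofLE _ _ hx ≫ Subobject.pullbackπ f y, ?_⟩
    refine (Category.assoc _ _ _).trans ((congrArg (_ ≫ ·) h.w).trans ?_)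
    exact Subobject.ofLE_arrow_assoc _ _
  · intro hx
    refine Subobject.le_of_comm (h.lift (y.factorThru _ hx) x.arrow (by simp)) (h.lift_snd _ _ _)

theorem mk_le_iff_factors {c b : C} {i : b ⟶ c} [Mono i] {x : Subobject c} :
    Subobject.mk i ≤ x ↔ x.Factors i := by
  constructor
  · intro h
    exact Subobject.factors_of_le i h (Subobject.mk_factors_self i)
  · intro h
    exact Subobject.mk_le_of_comm (x.factorThru i h) (by simp)

theorem le_iff_factors {c : C} {x y : Subobject c} : x ≤ y ↔ y.Factors x.arrow :=
  ⟨fun h => Subobject.factors_of_le _ h x.factors_self, Subobject.le_of_factors⟩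

/-- A regular epimorphism lifts against the monomorphism `x.arrow`. -/
theorem factors_of_isRegularEpi {a b c : C} {q : a ⟶ b} (hq : IsRegularEpi q) {m : b ⟶ c}
    {x : Subobject c} (h : x.Factors (q ≫ m)) : x.Factors m := by
  have sq : CommSq (x.factorThru _ h) q x.arrow m := ⟨by simp⟩
  exact (Subobject.factors_iff _ _).2 ⟨sq.lift, sq.fac_right⟩

theorem exists_iso_subMap (F : C ⥤ D) [PreservesFiniteLimits F] {c : C} (x : Subobject c) :
    ∃ u : (subMap F x : D) ≅ F.obj (x : C), u.hom ≫ F.map x.arrow = (subMap F x).arrow :=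
  ⟨Subobject.underlyingIso (F.map x.arrow), Subobject.underlyingIso_hom_comp_eq_mk _⟩

theorem functorPushforward_underlying {c : C} {b : Subobject c} {T : Sieve b} {e : C}
    {k : e ⟶ (b : C)} : T.functorPushforward Subobject.underlying k ↔
      ∃ (z : Subobject c) (i : z ⟶ b), T i ∧ z.Factors (k ≫ b.arrow) := by
  constructor
  · rintro ⟨z, i, h, hi, rfl⟩
    refine ⟨z, i, hi, ?_⟩
    rw [Category.assoc, Subobject.underlying_arrow]
    exact Subobject.factors_comp_arrow h
  · rintro ⟨z, i, hi, h⟩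
    refine ⟨z, i, z.factorThru _ h, hi, ?_⟩
    rw [← cancel_mono b.arrow, Category.assoc, Subobject.underlying_arrow,
      Subobject.factorThru_arrow]

variable [Regular C] [Regular D]

theorem isRegularEpi_comp {a b c : C} {f : a ⟶ b} {g : b ⟶ c} (hf : IsRegularEpi f)
    (hg : IsRegularEpi g) : IsRegularEpi (f ≫ g) :=
  have : StrongEpi (f ≫ g) := strongEpi_comp f g
  inferInstance

/-- A factorization through `y` precomposed with the regular epimorphism `q` descends, so the image
of `i ≫ f` satisfies the adjunction for `∃_f`. With uniqueness of adjoints, `isEx_sub_iff`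
recognizes `∃_f x` by a regular epimorphism from `x`. -/
theorem isEx_mk {c d a b : C} {f : c ⟶ d} {i : a ⟶ c} [Mono i] {j : b ⟶ d} [Mono j] {q : a ⟶ b}
    (hq : IsRegularEpi q) (h : q ≫ j = i ≫ f) :
    IsEx (P := subDoctrine C) f (Subobject.mk i) (Subobject.mk j) := by
  intro (y : Subobject d)
  refine (mk_le_iff_factors (x := y)).trans (Iff.trans ?_
    (mk_le_iff_factors (x := (Subobject.pullback f).obj y)).symm)
  have e : ((Subobject.pullback f).obj y).Factors i ↔ y.Factors (i ≫ f) := by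
    rw [← mk_le_iff_factors, le_pullback_iff]
    constructor
    · intro h
      have := Subobject.factors_of_factors_right (Subobject.underlyingIso i).inv h
      simpa using this
    · intro h
      have := Subobject.factors_of_factors_right (Subobject.underlyingIso i).hom h
      simpa using this
  rw [e, ← h]
  exact ⟨fun h => Subobject.factors_of_factors_right q h, factors_of_isRegularEpi hq⟩

theorem exists_isEx_sub {c d : C} (f : c ⟶ d) (x : Subobject c) :
    ∃ (e : Subobject d) (q : (x : C) ⟶ (e : C)), IsRegularEpi q ∧ q ≫ e.arrow = x.arrow ≫ f ∧
      IsEx (P := subDoctrine C) f x e := by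
  let F := Regular.strongEpiMonoFactorisation (x.arrow ≫ f)
  refine ⟨Subobject.mk F.m, F.e ≫ (Subobject.underlyingIso F.m).inv,
    isRegularEpi_comp (inferInstanceAs (IsRegularEpi F.e)) inferInstance,
    by simp [F], ?_⟩
  have := isEx_mk (f := f) (i := x.arrow) (j := F.m) (q := F.e)
    (inferInstanceAs (IsRegularEpi F.e)) (by simp [F])
  rwa [Subobject.mk_arrow] at this

theorem isEx_sub_iff {c d : C} {f : c ⟶ d} {x : Subobject c} {e : Subobject d} :
    IsEx (P := subDoctrine C) f x e ↔
      ∃ q : (x : C) ⟶ (e : C), IsRegularEpi q ∧ q ≫ e.arrow = x.arrow ≫ f := by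
  constructor
  · intro h
    obtain ⟨e', q, hq, hqe, h'⟩ := exists_isEx_sub f x
    have : e = e' := le_antisymm ((h _).2 h'.le) ((h' _).2 h.le)
    subst this
    exact ⟨q, hq, hqe⟩
  · rintro ⟨q, hq, h⟩
    have := isEx_mk (f := f) (i := x.arrow) (j := e.arrow) hq h
    rwa [Subobject.mk_arrow, Subobject.mk_arrow] at this

theorem isEx_exists {c d : C} (f : c ⟶ d) (x : Subobject c) :
    IsEx (P := subDoctrine C) f x ((Subobject.exists f).obj x) := fun y =>
  ((Subobject.existsPullbackAdj f).gc x y)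

/-- Subobjects of a regular category form an existential doctrine. -/
theorem isExistential_subDoctrine : (subDoctrine C).IsExistential where
  hasFiniteLimits := inferInstanceAs (HasFiniteLimits C)
  antisymm := by
    intro (c : C) (x : Subobject c) (y : Subobject c) (h : x ≤ y) (h' : y ≤ x)
    exact @le_antisymm (Subobject c) _ x y h h'
  exists_top := by
    intro (c : C)
    exact ⟨(⊤ : Subobject c), fun (x : Subobject c) => le_top (a := x)⟩
  exists_inf := by
    intro (c : C) (x : Subobject c) (y : Subobject c)
    have : ∃ z : Subobject c, IsGLB {x, y} z := ⟨x ⊓ y, isGLB_pair⟩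
    exact this
  re_top := by
    intro (c : C) (d : C) (f : c ⟶ d) (t : Subobject d) (ht : IsTop t) (x : Subobject c)
    have e : t = (⊤ : Subobject d) := top_unique (α := Subobject d) (ht (⊤ : Subobject d))
    change x ≤ (Subobject.pullback f).obj t
    rw [e, Subobject.pullback_top]
    exact le_top (α := Subobject c)
  re_inf := by
    intro (c : C) (d : C) (f : c ⟶ d) (x : Subobject d) (y : Subobject d) (z : Subobject d)
      (h : @IsGLB (Subobject d) _ {x, y} z)
    change @IsGLB (Subobject c) _ {(Subobject.pullback f).obj x, (Subobject.pullback f).obj y}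
      ((Subobject.pullback f).obj z)
    rw [h.unique isGLB_pair, Subobject.inf_pullback]
    exact isGLB_pair
  exists_ex := by
    intro (c : C) (d : C) (f : c ⟶ d) (x : Subobject c)
    exact ⟨_, isEx_exists f x⟩
  frobenius := by
    intro (c : C) (d : C) (f : c ⟶ d) (x : Subobject c) (y : Subobject d) (e : Subobject d)
      (w : Subobject d) (z : Subobject c) he
      (hz : @IsGLB (Subobject c) _ {x, (Subobject.pullback f).obj y} z)
      (hw : @IsGLB (Subobject d) _ {e, y} w)
    have h₁ : e = (Subobject.exists f).obj x :=
      le_antisymm ((he _).2 (isEx_exists f x).le) ((isEx_exists f x _).2 he.le)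
    rw [hz.unique isGLB_pair, hw.unique isGLB_pair, h₁,
      ← Regular.exists_inf_pullback_eq_exists_inf]
    exact isEx_exists f _
  beckChevalley := by
    intro (b : C) (c : C) (d : C) (e : C) (g : b ⟶ d) (k : b ⟶ c) (h : d ⟶ e) (f : c ⟶ e) sq
      (x : Subobject c) (w : Subobject e) hw
    obtain ⟨q, hq, hqw⟩ := isEx_sub_iff.1 hw
    have s₁ := (Subobject.isPullback k x).paste_vert sq.flip
    have s₂ := Subobject.isPullback h w
    let q' := s₂.lift (Subobject.pullbackπ k x ≫ q) (((Subobject.pullback k).obj x).arrow ≫ g) (by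
      rw [Category.assoc, hqw]; exact s₁.w)
    have h₁ : q' ≫ Subobject.pullbackπ h w = Subobject.pullbackπ k x ≫ q := s₂.lift_fst _ _ _
    have h₂ : q' ≫ ((Subobject.pullback h).obj w).arrow =
      ((Subobject.pullback k).obj x).arrow ≫ g := s₂.lift_snd _ _ _
    rw [← hqw, ← h₂] at s₁
    -- Cancelling squares presents `q'` as a base change of `q`; Beck–Chevalley is the stability of
    -- regular epimorphisms.
    have s₃ := IsPullback.of_bot s₁ h₁.symm s₂
    exact isEx_sub_iff.2 ⟨q', Regular.regularEpiIsStableUnderBaseChange.of_isPullback s₃ hq, h₂⟩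

instance : (subDoctrine C).IsExistential := isExistential_subDoctrine

/-- Pairs of an object and a subobject, as objects of `C ⋊ Sub_C`. -/
def subObj (c : C) (z : Subobject c) : (subDoctrine C).Total := ⟨c, z⟩

/-- The arrow of `C ⋊ Sub_C` given by an arrow that restricts to subobjects. -/
def subHom {c d : C} {z : Subobject c} {V : Subobject d} (f : c ⟶ d)
    (h : V.Factors (z.arrow ≫ f)) : subObj c z ⟶ subObj d V :=
  ⟨f, le_pullback_iff.2 h⟩

theorem exists_eq_subHom {c d : C} {z : Subobject c} {V : Subobject d}
    (s : subObj c z ⟶ subObj d V) : ∃ (f : c ⟶ d) (h : V.Factors (z.arrow ≫ f)), s = subHom f h :=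
  ⟨s.f, le_pullback_iff.1 s.cond, rfl⟩

/-- The sieve on the object `V` generated by the restrictions to `U` of the arrows
`f : (c, U) ⟶ (d, V)` of `S`. -/
def subSieve {d : C} {V : Subobject d} (S : Sieve (subObj d V)) : Sieve (V : C) where
  arrows e k := ∃ (c : C) (z : Subobject c) (f : c ⟶ d) (hf : V.Factors (z.arrow ≫ f))
    (s : e ⟶ (z : C)), S (subHom f hf) ∧ k ≫ V.arrow = s ≫ z.arrow ≫ f
  downward_closed := by
    rintro e e' k ⟨c, z, f, hf, s, hS, h⟩ g
    exact ⟨c, z, f, hf, g ≫ s, hS, by rw [Category.assoc, Category.assoc, h]⟩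

theorem exSieve_sub_iff {d : C} {V : Subobject d} {S : Sieve (subObj d V)} {w : Subobject d}
    {i : w ⟶ V} : exSieve S (Y := w) i ↔
      ∃ (c : C) (z : Subobject c) (f : c ⟶ d) (hf : V.Factors (z.arrow ≫ f)),
        S (subHom f hf) ∧ ∃ (e : Subobject d) (q : (z : C) ⟶ (e : C)), IsRegularEpi q ∧
          q ≫ e.arrow = z.arrow ≫ f ∧ w ≤ e := by
  constructor
  · rintro ⟨⟨c, z⟩, s, hs, e, he, hw⟩
    change C at c
    change Subobject c at z
    change Subobject d at e
    change w ≤ e at hw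
    obtain ⟨f, hf, rfl⟩ := exists_eq_subHom (z := z) (V := V) s
    obtain ⟨q, hq, h⟩ := (isEx_sub_iff (C := C) (f := f) (x := z) (e := e)).1 he
    exact ⟨c, z, f, hf, hs, e, q, hq, h, hw⟩
  · rintro ⟨c, z, f, hf, hs, e, q, hq, h, hw⟩
    exact ⟨subObj c z, subHom f hf, hs, e,
      (isEx_sub_iff (C := C) (f := f) (x := z) (e := e)).2 ⟨q, hq, h⟩, hw⟩

/-- The restriction of a topology to subobjects is a topology. -/
def subTopology {K : Cov C} (hK : IsTopology K) (c : C) : GrothendieckTopology (Subobject c) where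
  sieves b := subCov K c b
  top_mem' b := hK.superset (hK.top_mem _) fun e k _ =>
    functorPushforward_underlying.2 ⟨b, 𝟙 b, trivial, Subobject.factors_comp_arrow k⟩
  pullback_stable' := by
    intro b b' T i hT
    refine hK.superset (hK.pullback_mem hT (Subobject.underlying.map i)) fun e k hk => ?_
    obtain ⟨z, j, hj, h⟩ := functorPushforward_underlying.1 hk
    rw [Category.assoc, Subobject.underlying_arrow] at h
    refine functorPushforward_underlying.2 ⟨z ⊓ b', homOfLE inf_le_right, ?_,
      (Subobject.inf_factors _).2 ⟨h, Subobject.factors_comp_arrow k⟩⟩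
    exact T.downward_closed (f := j) hj (homOfLE inf_le_left)
  transitive' := by
    intro b S hS R hR
    refine hK.trans hS _ ?_
    rintro _ _ ⟨z, i, h, hi, rfl⟩
    refine hK.superset (hK.pullback_mem (hR hi) h) fun a l hl => ?_
    obtain ⟨w, j, hj, hw⟩ := functorPushforward_underlying.1 hl
    refine functorPushforward_underlying.2 ⟨w, j ≫ i, hj, ?_⟩
    rw [Category.assoc, Category.assoc, Subobject.underlying_arrow, ← Category.assoc]
    exact hw

/-- Because regular epimorphisms generate covers, it makes no difference whether `V` is covered by
the images of the `z` or by the `z` themselves. The second description is the one that is stable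
under pullback. -/
theorem mem_exCov_sub_iff {K : Cov C} (hK : IsTopology K)
    (hreg : ∀ {X Y : C} (f : X ⟶ Y), IsRegularEpi f → Sieve.generateSingleton f ∈ K Y)
    {d : C} {V : Subobject d} {S : Sieve (subObj d V)} :
    S ∈ (subDoctrine C).exCov (fun c => subCov K c) (subObj d V) ↔ subSieve S ∈ K _ := by
  change Sieve.functorPushforward (X := V) Subobject.underlying (exSieve S) ∈ K (V : C) ↔ _
  constructor
  · intro h
    refine hK.trans h _ fun e k hk => ?_
    obtain ⟨w, i, hw, hk⟩ := functorPushforward_underlying.1 hk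
    obtain ⟨c, z, f, hf, hS, e₀, q, hq, hqe, hw⟩ := exSieve_sub_iff.1 hw
    have he : e₀.Factors (k ≫ V.arrow) := Subobject.factors_of_le _ hw hk
    let m := e₀.factorThru _ he
    have : IsRegularEpi (pullback.snd q m) :=
      Regular.regularEpiIsStableUnderBaseChange.of_isPullback (IsPullback.of_hasPullback q m) hq
    refine hK.superset (hreg (pullback.snd q m) this) ?_
    rintro a _ ⟨l, rfl⟩
    refine ⟨c, z, f, hf, l ≫ pullback.fst q m, hS, ?_⟩
    have e₁ : k ≫ V.arrow = m ≫ e₀.arrow := (Subobject.factorThru_arrow _ _ _).symm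
    rw [Category.assoc, Category.assoc, e₁, ← pullback.condition_assoc, hqe, Category.assoc]
  · intro h
    refine hK.superset h ?_
    rintro e k ⟨c, z, f, hf, s, hS, hk⟩
    obtain ⟨e₀, q, hq, hqe, he₀⟩ := exists_isEx_sub f z
    refine functorPushforward_underlying.2 ⟨e₀, homOfLE ((he₀ V).2 (le_pullback_iff.2 hf)),
      exSieve_sub_iff.2 ⟨c, z, f, hf, hS, e₀, q, hq, hqe, le_rfl⟩, ?_⟩
    rw [hk, ← hqe, ← Category.assoc]
    exact Subobject.factors_comp_arrow _

/-- Pullback of covers along an arbitrary arrow of `C ⋊ Sub_C`. -/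
theorem subSieve_pullback_mem {K : Cov C} (hK : IsTopology K) {d d' : C} {V : Subobject d}
    {V' : Subobject d'} (s : subObj d' V' ⟶ subObj d V)
    {S : Sieve (subObj d V)} (hS : subSieve S ∈ K _) :
    subSieve (S.pullback s) ∈ K _ := by
  obtain ⟨h, hs, rfl⟩ := exists_eq_subHom s
  refine hK.superset (hK.pullback_mem hS (Subobject.factorThru _ _ hs)) ?_
  rintro e k ⟨c, z, f, hf, m, hS, hk⟩
  rw [Category.assoc, Subobject.factorThru_arrow] at hk
  have h₁ : V'.Factors ((⊤ : Subobject e).arrow ≫ k ≫ V'.arrow) := by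
    rw [← Category.assoc]
    exact Subobject.factors_comp_arrow _
  have h₂ : z.Factors ((⊤ : Subobject e).arrow ≫ m ≫ z.arrow) := by
    rw [← Category.assoc]
    exact Subobject.factors_comp_arrow _
  have h₃ : V.Factors ((⊤ : Subobject e).arrow ≫ (k ≫ V'.arrow) ≫ h) := by
    rw [Category.assoc, hk, ← Category.assoc]
    exact Subobject.factors_of_factors_right _ hf
  -- An arrow `k` into the object `V'` is regarded as an arrow of `C ⋊ Sub_C` out of its own source
  -- with the largest subobject.
  refine ⟨e, ⊤, k ≫ V'.arrow, h₁, inv (⊤ : Subobject e).arrow, ?_, by simp⟩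
  change S (subHom (k ≫ V'.arrow) h₁ ≫ subHom h hs)
  have : subHom (k ≫ V'.arrow) h₁ ≫ subHom h hs = subHom (m ≫ z.arrow) h₂ ≫ subHom f hf :=
    total_ext (P := subDoctrine C) (by
      change (k ≫ V'.arrow) ≫ h = (m ≫ z.arrow) ≫ f
      rw [Category.assoc, Category.assoc, hk])
  rw [this]
  exact S.downward_closed hS _

/-- Both stability conditions are instances of `subSieve_pullback_mem`. For `ex_cover`, the regular
epimorphism `x ⟶ ∃_f x` generates a cover, and after pulling back along it the image sieve contains
the given cover of `x`. -/
theorem isExistentialSite_sub {K : Cov C} (hK : IsTopology K)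
    (hreg : ∀ {X Y : C} (f : X ⟶ Y), IsRegularEpi f → Sieve.generateSingleton f ∈ K Y) :
    (subDoctrine C).IsExistentialSite (subTopology (C := C) hK) where
  exists_ex := (isExistential_subDoctrine (C := C)).exists_ex
  ex_cover := by
    intro (c : C) (d : C) (f : c ⟶ d) (x : Subobject c) (e : Subobject d) T he hT
    obtain ⟨q, hq, hqe⟩ :=
      (isEx_sub_iff (C := C) (c := c) (d := d) (f := f) (x := x) (e := e)).1 he
    refine hK.trans (hreg q hq) _ ?_
    rintro a _ ⟨l, rfl⟩
    rw [Sieve.pullback_comp]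
    refine hK.pullback_mem (hK.superset hT fun b k hk => ?_) l
    obtain ⟨z, i, hi, h⟩ := (functorPushforward_underlying (C := C) (b := x)).1 hk
    obtain ⟨e', q', _, hqe', he'⟩ := exists_isEx_sub (C := C) f z
    have hzx : z ≤ x := leOfHom i
    have he'e : e' ≤ e := he'.mono he hzx
    refine (functorPushforward_underlying (C := C) (b := e)).2 ⟨e', homOfLE he'e,
      ⟨z, i, hi, e', he', le_refl (α := Subobject d) e'⟩, ?_⟩
    rw [Category.assoc, hqe, ← Category.assoc, ← Subobject.factorThru_arrow _ _ h, Category.assoc,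
      ← hqe', ← Category.assoc]
    exact Subobject.factors_comp_arrow _
  frobenius := by
    intro (d : C) (x : Subobject d) (y : Subobject d) h S hS
    exact (mem_exCov_sub_iff hK hreg).2 (subSieve_pullback_mem hK _
      ((mem_exCov_sub_iff hK hreg).1 hS))
  beckChevalley := by
    intro (e : C) (d : C) (h : e ⟶ d) (y : Subobject d) S hS
    exact (mem_exCov_sub_iff (V := (Subobject.pullback h).obj y) hK hreg).2
      (subSieve_pullback_mem hK _ ((mem_exCov_sub_iff hK hreg).1 hS))

theorem isExMor_subDoctrineMap (F : C ⥤ D) [PreservesFiniteLimits F]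
    (hF : ∀ {X Y : C} (f : X ⟶ Y), IsRegularEpi f → IsRegularEpi (F.map f)) :
    IsExMor (subDoctrineMap F) where
  preservesFiniteLimits := inferInstanceAs (PreservesFiniteLimits F)
  top := by
    intro (c : C) (t : Subobject c) (ht : IsTop t) (x : Subobject (F.obj c))
    have e : t = (⊤ : Subobject c) := top_unique (α := Subobject c) (ht (⊤ : Subobject c))
    have e' : subMap F t = ⊤ := by
      rw [e]; exact Subobject.mk_eq_top_of_isIso _
    exact (le_top (α := Subobject (F.obj c))).trans_eq e'.symm
  inf := by
    intro (c : C) (x : Subobject c) (y : Subobject c) (z : Subobject c)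
      (h : @IsGLB (Subobject c) _ {x, y} z)
    rw [h.unique isGLB_pair]
    change @IsGLB (Subobject (F.obj c)) _ {subMap F x, subMap F y} (subMap F (x ⊓ y))
    refine ⟨?_, fun w hw => ?_⟩
    · rintro _ (rfl | rfl)
      · exact subMap_mono F inf_le_left
      · exact subMap_mono F inf_le_right
    · have h₁ := le_iff_factors.1 (hw (.inl rfl))
      have h₂ := le_iff_factors.1 (hw (.inr rfl))
      obtain ⟨a, ha⟩ := (Subobject.mk_factors_iff _ _).1 h₁
      obtain ⟨b, hb⟩ := (Subobject.mk_factors_iff _ _).1 h₂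
      change (w : D) ⟶ F.obj (x : C) at a
      change (w : D) ⟶ F.obj (y : C) at b
      change a ≫ F.map x.arrow = _ at ha
      change b ≫ F.map y.arrow = _ at hb
      have pb := (Subobject.inf_isPullback x y).map F
      refine le_iff_factors.2 ((Subobject.mk_factors_iff _ _).2
        ⟨pb.lift a b (ha.trans hb.symm), ?_⟩)
      change _ ≫ F.map _ = _
      rw [← Subobject.inf_comp_left, F.map_comp, pb.lift_fst_assoc, ha]
  ex := by
    intro (c : C) (d : C) (f : c ⟶ d) (x : Subobject c) (e : Subobject d) he
    obtain ⟨q, hq, hqe⟩ := isEx_sub_iff.1 he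
    exact isEx_mk (C := D) (f := F.map f) (hF q hq) (by rw [← F.map_comp, ← F.map_comp, hqe])

theorem functorPushforward_mem_kSub (F : C ⥤ D) [PreservesFiniteLimits F] {J : Cov C} {K : Cov D}
    (hJ : IsTopology J) (hK : IsTopology K)
    (hregJ : ∀ {X Y : C} (f : X ⟶ Y), IsRegularEpi f → Sieve.generateSingleton f ∈ J Y)
    (hregK : ∀ {X Y : D} (f : X ⟶ Y), IsRegularEpi f → Sieve.generateSingleton f ∈ K Y)
    (hF : ∀ {X : C} {S : Sieve X}, S ∈ J X → S.functorPushforward F ∈ K _)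
    {d : C} {x : Subobject d} {S : Sieve (subObj d x)}
    (hS : S ∈ (subDoctrine C).exCov (fun c => subCov J c) (subObj d x)) :
    S.functorPushforward (subDoctrineMap F).total ∈
      (subDoctrine D).exCov (fun c => subCov K c) ((subDoctrineMap F).total.obj (subObj d x)) := by
  rw [mem_exCov_sub_iff hJ hregJ] at hS
  refine (mem_exCov_sub_iff (V := subMap F x) hK hregK).2 ?_
  obtain ⟨u, hu⟩ := exists_iso_subMap F x
  refine hK.superset (hK.pullback_mem (hF hS) u.hom) ?_
  rintro e k ⟨a, m, l, ⟨c, z, f, hf, s, hS, hm⟩, hk⟩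
  change e ⟶ (subMap F x : D) at k
  change a ⟶ (x : C) at m
  change m ≫ x.arrow = s ≫ z.arrow ≫ f at hm
  change e ⟶ F.obj a at l
  change k ≫ u.hom = l ≫ F.map m at hk
  have hf' : (subMap F x).Factors ((subMap F z).arrow ≫ F.map f) :=
    le_pullback_iff.1 (((subDoctrineMap F).total.map (subHom f hf)).cond)
  obtain ⟨v, hv⟩ := exists_iso_subMap F z
  refine ⟨F.obj c, subMap F z, F.map f, hf', l ≫ F.map s ≫ v.inv,
    Sieve.image_mem_functorPushforward _ _ hS, ?_⟩
  rw [← hu, ← Category.assoc, hk, Category.assoc, ← F.map_comp, hm, F.map_comp, F.map_comp, ← hv]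
  simp

end Regular

theorem liftsTo_sub : exDocSites.{u}.LiftsTo (regSitesToReg.comp subDoc) kSub where
  ok C := by
    obtain ⟨hK, hC, hreg⟩ := C.ok
    have h := isExistentialSite_sub hK hreg
    exact ⟨h.isTopology, isExistential_subDoctrine, _, h, rfl⟩
  isHom {C D} F := by
    obtain ⟨hJ, hC, hreg⟩ := C.ok
    obtain ⟨hK, hD, hreg'⟩ := D.ok
    obtain ⟨⟨hF, hFreg⟩, hFcov⟩ := F.isHom
    have h := isExMor_subDoctrineMap F.hom.toFunctor hFreg
    have hC' := isExistential_subDoctrine (C := C.base)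
    have hD' := isExistential_subDoctrine (C := D.base)
    refine ⟨⟨flat_of_preservesFiniteLimits F.hom.toFunctor, ?_⟩, h⟩
    have : PreservesFiniteLimits (subDoctrineMap F.hom.toFunctor).F := hF
    have : HasFiniteLimits (subDoctrine C.base).base := inferInstanceAs (HasFiniteLimits C.base)
    exact isMorphismOfSites_total (subDoctrineMap F.hom.toFunctor)
      (isExistentialSite_sub hK hreg').isTopology hC'.exists_top hC'.exists_inf hD'.re_top
      hD'.re_inf h.top h.inf
      (functorPushforward_mem_kSub F.hom.toFunctor hJ hK hreg hreg' hFcov)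

end GeomCompl

/-! ### Geometric categories and the topology of jointly extremally epimorphic sieves. -/

namespace GeomCompl

open Doctrine

section Geometric

variable {C D : Type u} [SmallCategory C] [SmallCategory D]

theorem mk_factors_iff_exists {X Y Z : C} {i : X ⟶ Y} [Mono i] {g : Z ⟶ Y} :
    (Subobject.mk i).Factors g ↔ ∃ k : Z ⟶ X, k ≫ i = g :=
  (Subobject.mk_factors_iff _ _).trans Iff.rfl

theorem factors_iff_exists {Y Z : C} {A : Subobject Y} {g : Z ⟶ Y} :
    A.Factors g ↔ ∃ k : Z ⟶ (A : C), k ≫ A.arrow = g :=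
  ⟨fun h => ⟨A.factorThru g h, A.factorThru_arrow g h⟩, by
    rintro ⟨k, rfl⟩; exact Subobject.factors_comp_arrow k⟩

theorem subMap_factors_iff (F : C ⥤ D) [PreservesFiniteLimits F] {X : C} {A : Subobject X} {Z : D}
    {g : Z ⟶ F.obj X} : (subMap F A).Factors g ↔ ∃ k : Z ⟶ F.obj (A : C), k ≫ F.map A.arrow = g :=
  mk_factors_iff_exists

theorem exists_image [Regular C] {X Y : C} (f : X ⟶ Y) :
    ∃ (A : Subobject Y) (q : X ⟶ (A : C)), IsRegularEpi q ∧ q ≫ A.arrow = f := by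
  let F := Regular.strongEpiMonoFactorisation f
  refine ⟨Subobject.mk F.m, F.e ≫ (Subobject.underlyingIso F.m).inv,
    isRegularEpi_comp (inferInstanceAs (IsRegularEpi F.e)) inferInstance, by simp [F]⟩

theorem eq_top_iff_factors_id {X : C} {A : Subobject X} : A = ⊤ ↔ A.Factors (𝟙 X) := by
  rw [eq_top_iff, Subobject.top_eq_id, mk_le_iff_factors]

/-- The subobjects of `X` that are images of arrows in `S`. -/
def images {X : C} (S : Sieve X) : Set (Subobject X) :=
  {A | ∃ (Y : C) (f : Y ⟶ X), S f ∧ ∃ q : Y ⟶ (A : C), IsRegularEpi q ∧ q ≫ A.arrow = f}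

theorem isLUB_images [IsGeometricCat C] {X : C} {S : Sieve X} (hS : S ∈ jointlyEpiCov C X) :
    IsLUB (images S) ⊤ := by
  obtain ⟨s, hs⟩ := IsGeometricCat.exists_sup (images S)
  have : s = ⊤ := hS s fun {Y} f hf => by
    obtain ⟨A, q, hq, h⟩ := exists_image f
    rw [← h]
    exact Subobject.factors_of_factors_right q (le_iff_factors.1 (hs.1 ⟨Y, f, hf, q, hq, h⟩))
  rwa [← this]

/-- The images of the arrows of `S` have join `⊤`, which pullback along `g` preserves. Each pulled
back image receives a regular epimorphism, a base change of the one from the source of the arrow,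
and its composite into `Y` belongs to `S.pullback g`. -/
theorem pullback_mem_jointlyEpiCov [IsGeometricCat C] {X Y : C} {S : Sieve X}
    (hS : S ∈ jointlyEpiCov C X) (g : Y ⟶ X) : S.pullback g ∈ jointlyEpiCov C Y := by
  intro A hA
  have h := IsGeometricCat.pullback_sup g (isLUB_images hS)
  rw [Subobject.pullback_top] at h
  refine top_unique (h.2 ?_)
  rintro _ ⟨B, ⟨Z, f, hf, q, hq, rfl⟩, rfl⟩
  have sq := Subobject.isPullback g B
  have hq' := Regular.regularEpiIsStableUnderBaseChange.of_isPullback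
    (IsPullback.of_hasPullback q (Subobject.pullbackπ g B)) hq
  refine le_iff_factors.2 (factors_of_isRegularEpi hq' (hA _ ?_))
  change S _
  rw [Category.assoc, ← sq.w, ← pullback.condition_assoc]
  exact S.downward_closed hf _

theorem isTopology_jointlyEpiCov [IsGeometricCat C] : IsTopology (jointlyEpiCov C) := by
  refine ⟨⟨fun X => jointlyEpiCov C X, fun X A hA => ?_, fun X Y S f hS =>
    pullback_mem_jointlyEpiCov hS f, fun X S hS R hR A hA => ?_⟩, fun X S => Iff.rfl⟩
  · exact eq_top_iff_factors_id.2 (hA (𝟙 X) trivial)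
  · refine hS A fun {Y} f hf => ?_
    have := hR hf ((Subobject.pullback f).obj A) fun {Z} g hg =>
      (Limits.pullback_factors_iff _ _ _).2 (hA _ hg)
    have := (Limits.pullback_factors_iff _ _ _).1 (eq_top_iff_factors_id.1 this)
    rwa [Category.id_comp] at this

theorem generateSingleton_mem_jointlyEpiCov [Regular C] {X Y : C} (f : X ⟶ Y)
    (hf : IsRegularEpi f) : Sieve.generateSingleton f ∈ jointlyEpiCov C Y := fun A hA =>
  eq_top_iff_factors_id.2 (factors_of_isRegularEpi hf
    (by rw [Category.comp_id]; exact hA f ⟨𝟙 X, Category.id_comp _⟩))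

theorem functorPushforward_mem_jointlyEpiCov [IsGeometricCat C] [Regular D] (F : C ⥤ D)
    [PreservesFiniteLimits F]
    (hreg : ∀ {X Y : C} (f : X ⟶ Y), IsRegularEpi f → IsRegularEpi (F.map f))
    (hF : ∀ {X : C} {A : Set (Subobject X)} {s : Subobject X},
      IsLUB A s → IsLUB (subMap F '' A) (subMap F s))
    {X : C} {S : Sieve X} (hS : S ∈ jointlyEpiCov C X) :
    S.functorPushforward F ∈ jointlyEpiCov D (F.obj X) := by
  intro B hB
  have h := hF (isLUB_images hS)
  have e : subMap F (⊤ : Subobject X) = ⊤ := Subobject.mk_eq_top_of_isIso _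
  rw [e] at h
  refine top_unique (h.2 ?_)
  rintro _ ⟨A, ⟨Z, f, hf, q, hq, rfl⟩, rfl⟩
  refine mk_le_iff_factors.2 (factors_of_isRegularEpi (hreg q hq) ?_)
  rw [← F.map_comp]
  exact hB _ (Sieve.image_mem_functorPushforward F S hf)

/-- A regular functor that preserves jointly extremally epimorphic sieves preserves joins of
subobjects. -/
theorem isLUB_subMap [IsGeometricCat C] [Regular D] (F : C ⥤ D) [PreservesFiniteLimits F]
    (hF : ∀ {X : C} {S : Sieve X}, S ∈ jointlyEpiCov C X →
      S.functorPushforward F ∈ jointlyEpiCov D (F.obj X))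
    {X : C} {A : Set (Subobject X)} {s : Subobject X} (hs : IsLUB A s) :
    IsLUB (subMap F '' A) (subMap F s) := by
  refine ⟨?_, fun y hy => ?_⟩
  · rintro _ ⟨a, ha, rfl⟩
    exact subMap_mono F (hs.1 ha)
  -- The members of `A` generate a jointly epimorphic sieve on the object `s`, and the image of this
  -- sieve under `F` detects upper bounds of `subMap F '' A`.
  let T : Sieve (s : C) :=
    { arrows := fun _ k => ∃ a ∈ A, a.Factors (k ≫ s.arrow)
      downward_closed := by
        rintro _ _ k ⟨a, ha, h⟩ g
        exact ⟨a, ha, by rw [Category.assoc]; exact Subobject.factors_of_factors_right g h⟩ }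
  have hT : T ∈ jointlyEpiCov C (s : C) := by
    intro B hB
    have h : s ≤ Subobject.mk (B.arrow ≫ s.arrow) := hs.2 fun a ha => by
      have has := hs.1 ha
      have := hB (Subobject.ofLE a s has) ⟨a, ha, by simp [a.factors_self]⟩
      exact le_iff_factors.2 (mk_factors_iff_exists.2 ⟨B.factorThru _ this, by
        rw [Subobject.factorThru_arrow_assoc, Subobject.ofLE_arrow]⟩)
    obtain ⟨k, hk⟩ := mk_factors_iff_exists.1 (le_iff_factors.1 h)
    refine eq_top_iff_factors_id.2 (factors_iff_exists.2 ⟨k, ?_⟩)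
    rw [← cancel_mono s.arrow, Category.assoc, hk, Category.id_comp]
  have h := hF hT ((Subobject.pullback (F.map s.arrow)).obj y) fun {Y} f hf => by
    obtain ⟨Z, m, l, ⟨a, ha, hm⟩, rfl⟩ := hf
    refine (Limits.pullback_factors_iff _ _ _).2 ?_
    obtain ⟨k, hk⟩ := factors_iff_exists.1 hm
    rw [Category.assoc, ← F.map_comp, ← hk, F.map_comp, ← Category.assoc]
    exact Subobject.factors_of_le _ (hy ⟨a, ha, rfl⟩) ((subMap_factors_iff F).2 ⟨_, rfl⟩)
  have := (Limits.pullback_factors_iff _ _ _).1 (eq_top_iff_factors_id.1 h)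
  rw [Category.id_comp] at this
  exact mk_le_iff_factors.2 this

/-- Covers of `C ⋊ Sub_C` in terms of subobjects through which the arrows of a sieve factor. -/
theorem mem_geomCov_sub_iff [Regular C] {d : C} {V : Subobject d} {S : Sieve (subObj d V)} :
    S ∈ (subDoctrine C).geomCov (subObj d V) ↔ ∀ W : Subobject d,
      (∀ {c : C} (z : Subobject c) (f : c ⟶ d) (hf : V.Factors (z.arrow ≫ f)),
        S (subHom f hf) → W.Factors (z.arrow ≫ f)) → V ≤ W := by
  constructor
  · intro h W hW
    refine le_of_mem_geomCov (P := subDoctrine C) (X := subObj d V) h (b := W) ?_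
    rintro ⟨c, z⟩ s hs
    change C at c
    change Subobject c at z
    obtain ⟨f, hf, rfl⟩ := exists_eq_subHom (z := z) (V := V) s
    exact le_pullback_iff.2 (hW z f hf hs)
  · intro h
    refine mem_geomCov_of_forall (P := subDoctrine C)
      (isExistential_subDoctrine (C := C)).exists_ex (X := subObj d V) fun (W : Subobject d) hW => ?_
    exact h W fun z f hf hs => le_pullback_iff.1 (hW (Z := subObj _ z) (subHom f hf) hs)

/-- For a geometric category, the existential topology of the geometric topology is the topology of
the geometric doctrine of subobjects. -/
theorem exCov_subCov_jointlyEpiCov [IsGeometricCat C] :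
    (subDoctrine C).exCov (fun c => subCov (jointlyEpiCov C) c) = (subDoctrine C).geomCov := by
  funext X
  obtain ⟨d, V⟩ := X
  change C at d
  change Subobject d at V
  ext (S : Sieve (subObj d V))
  refine (mem_exCov_sub_iff isTopology_jointlyEpiCov generateSingleton_mem_jointlyEpiCov).trans
    (Iff.trans ?_ mem_geomCov_sub_iff.symm)
  constructor
  · intro h W hW
    have := h ((Subobject.pullback V.arrow).obj W) (by
      rintro Y f ⟨c, z, g, hg, s, hs, hf⟩
      refine (Limits.pullback_factors_iff _ _ _).2 ?_
      rw [hf]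
      exact Subobject.factors_of_factors_right s (hW z g hg hs))
    have := (Limits.pullback_factors_iff _ _ _).1 (eq_top_iff_factors_id.1 this)
    rw [Category.id_comp] at this
    exact le_iff_factors.2 this
  · intro h A hA
    have := h (Subobject.mk (A.arrow ≫ V.arrow)) fun z f hf hs => by
      obtain ⟨k, hk⟩ := factors_iff_exists.1 hf
      obtain ⟨l, rfl⟩ := factors_iff_exists.1 (hA k ⟨_, z, f, hf, 𝟙 _, hs, by rw [hk]; simp⟩)
      exact mk_factors_iff_exists.2 ⟨l, by rw [← hk, Category.assoc]⟩
    obtain ⟨k, hk⟩ := mk_factors_iff_exists.1 (le_iff_factors.1 this)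
    refine eq_top_iff_factors_id.2 (factors_iff_exists.2 ⟨k, ?_⟩)
    rw [← cancel_mono V.arrow, Category.assoc, hk, Category.id_comp]

/-- Meeting with `x` is pullback along `x.arrow` followed by composition with it, so distributivity
is stability of joins. The relative Beck–Chevalley condition is pullback stability of the
existential topology induced by `jointlyEpiCov`, which coincides with `geomCov`. -/
theorem isGeometric_subDoctrine [IsGeometricCat C] : (subDoctrine C).IsGeometric where
  antisymm := (isExistential_subDoctrine (C := C)).antisymm
  exists_sup := by
    intro (c : C) (A : Set (Subobject c))
    exact IsGeometricCat.exists_sup A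
  inf_sup := by
    intro (c : C) (A : Set (Subobject c)) (x : Subobject c) (s : Subobject c) (m : Subobject c)
      (hs : @IsLUB (Subobject c) _ A s) (hm : @IsGLB (Subobject c) _ {x, s} m)
    obtain rfl : m = x ⊓ s := hm.unique isGLB_pair
    change @IsLUB (Subobject c) _ {w | ∃ y ∈ A, @IsGLB (Subobject c) _ {x, y} w} (x ⊓ s)
    refine ⟨?_, fun t ht => ?_⟩
    · rintro w ⟨y, hy, hw⟩
      rw [hw.unique isGLB_pair]
      exact inf_le_inf_left x (hs.1 hy)
    · have h : (Subobject.pullback x.arrow).obj s ≤ (Subobject.pullback x.arrow).obj t := by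
        refine (IsGeometricCat.pullback_sup x.arrow hs).2 ?_
        rintro _ ⟨y, hy, rfl⟩
        refine le_pullback_iff.2 (Subobject.factors_of_le _ (ht ⟨y, hy, isGLB_pair⟩) ?_)
        exact (Subobject.inf_factors _).2
          ⟨Subobject.factors_comp_arrow _, le_pullback_iff.1 le_rfl⟩
      have h₁ : ((Subobject.pullback x.arrow).obj s).Factors ((x ⊓ s).ofLE x inf_le_left) :=
        (Limits.pullback_factors_iff _ _ _).2 (by
          rw [Subobject.ofLE_arrow]; exact Subobject.inf_arrow_factors_right x s)
      have h₂ := (Limits.pullback_factors_iff _ _ _).1 (Subobject.factors_of_le _ h h₁)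
      rw [Subobject.ofLE_arrow] at h₂
      exact le_iff_factors.2 h₂
  re_top := (isExistential_subDoctrine (C := C)).re_top
  re_inf := (isExistential_subDoctrine (C := C)).re_inf
  re_sup := by
    intro (c : C) (d : C) (f : c ⟶ d) (A : Set (Subobject d)) (s : Subobject d) hs
    exact IsGeometricCat.pullback_sup f hs
  exists_ex := (isExistential_subDoctrine (C := C)).exists_ex
  frobenius := (isExistential_subDoctrine (C := C)).frobenius
  beckChevalley := by
    have h : IsTopology (subDoctrine C).geomCov := by
      rw [← exCov_subCov_jointlyEpiCov]
      exact (isExistentialSite_sub isTopology_jointlyEpiCov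
        generateSingleton_mem_jointlyEpiCov).isTopology
    intro e d f y S hS
    exact h.pullback_mem hS _

end Geometric

theorem liftsTo_inclCat :
    regSites.{u}.LiftsTo geomCat.forget fun G => jointlyEpiCov G.base where
  ok G := by
    have : IsGeometricCat G.base := G.ok
    exact ⟨isTopology_jointlyEpiCov (C := G.base), inferInstanceAs (Regular G.base),
      generateSingleton_mem_jointlyEpiCov (C := G.base)⟩
  isHom {G H} F := by
    have : IsGeometricCat G.base := G.ok
    have : IsGeometricCat H.base := H.ok
    have := F.isHom.1.1
    exact ⟨F.isHom.1, functorPushforward_mem_jointlyEpiCov F.hom.toFunctor F.isHom.1.2 F.isHom.2⟩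

theorem kSub_lift_inclCat (G : geomCat.{u}.Obj) :
    kSub ((regSites.lift liftsTo_inclCat).obj G) = kSubGeom G := by
  have : IsGeometricCat G.base := G.ok
  exact exCov_subCov_jointlyEpiCov (C := G.base)

theorem liftsTo_subGeom : geomDocCart.{u}.LiftsTo (geomCatToReg.comp subDoc) kSubGeom where
  ok G := by
    have : IsGeometricCat G.base := G.ok
    have h := isGeometric_subDoctrine (C := G.base)
    exact ⟨h.isTopology, inferInstanceAs (HasFiniteLimits G.base), h, rfl⟩
  isHom {G H} F := by
    -- The underlying regular sites give the same topologies on the two total categories, so the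
    -- claim for regular sites transfers.
    have := (liftsTo_sub.isHom ((regSites.lift liftsTo_inclCat).map F)).1
    rwa [kSub_lift_inclCat, kSub_lift_inclCat] at this

end GeomCompl

/-! ### Internal logic of an existential doctrine, and pullbacks of functional relations. -/

namespace GeomCompl

namespace Doctrine

variable {P Q : Doctrine.{u}} [hP : P.IsExistential] [hQ : Q.IsExistential]

section Elements

/-- In this section `A ≤ at₂ W x y` is read as the judgement "in context `A`, the relation `W` holds
of `x` and `y`". The restriction lemmas `re_res` and `at₂_res` change the context, and the others
are the rules for equality, converse and image. -/
theorem re_res {Y X c : P.base} {p : Y ⟶ X} {x : X ⟶ c} {U : P.El c} {A : P.El X} {B : P.El Y}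
    (h : A ≤ P.re x U) (hB : B ≤ P.re p A) : B ≤ P.re (p ≫ x) U := by
  rw [P.re_comp]; exact hB.trans (P.re_mono p h)

theorem at₂_res {Y X c d : P.base} {p : Y ⟶ X} {W : P.El (c ⨯ d)} {x : X ⟶ c} {y : X ⟶ d}
    {A : P.El X} {B : P.El Y} (h : A ≤ at₂ W x y) (hB : B ≤ P.re p A) :
    B ≤ at₂ W (p ≫ x) (p ≫ y) := by
  rw [← re_at₂]; exact hB.trans (P.re_mono p h)

theorem at₂_mono {X c d : P.base} {W W' : P.El (c ⨯ d)} (h : W ≤ W') (x : X ⟶ c) (y : X ⟶ d) :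
    at₂ W x y ≤ at₂ W' x y := P.re_mono _ h

theorem le_of_at₂ {c d : P.base} {W W' : P.El (c ⨯ d)}
    (h : ∀ {X : P.base} (x : X ⟶ c) (y : X ⟶ d) (A : P.El X), A ≤ at₂ W x y → A ≤ at₂ W' x y) :
    W ≤ W' := by
  rw [← at₂_fst_snd W, ← at₂_fst_snd W']; exact h _ _ _ le_rfl

theorem at₂_inf {X c d : P.base} (W W' : P.El (c ⨯ d)) (x : X ⟶ c) (y : X ⟶ d) :
    at₂ (inf W W') x y = inf (at₂ W x y) (at₂ W' x y) := re_inf _ _ _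

theorem le_at₂_inf {X c d : P.base} {W W' : P.El (c ⨯ d)} {x : X ⟶ c} {y : X ⟶ d} {A : P.El X} :
    A ≤ at₂ (inf W W') x y ↔ A ≤ at₂ W x y ∧ A ≤ at₂ W' x y := by
  rw [at₂_inf]
  exact ⟨fun h => ⟨h.trans (inf_le_left _ _), h.trans (inf_le_right _ _)⟩,
    fun h => le_inf h.1 h.2⟩

theorem eq_subst_left {X c d : P.base} {x x' : X ⟶ c} {y : X ⟶ d} {W : P.El (c ⨯ d)}
    {A : P.El X} (h : A ≤ at₂ (eqPred c) x x') (hW : A ≤ at₂ W x y) : A ≤ at₂ W x' y := by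
  refine eq_elim h fun p e A' hA => ?_
  rw [re_at₂, ← e]; exact at₂_res hW hA

theorem eq_subst_right {X c d : P.base} {x : X ⟶ c} {y y' : X ⟶ d} {W : P.El (c ⨯ d)}
    {A : P.El X} (h : A ≤ at₂ (eqPred d) y y') (hW : A ≤ at₂ W x y) : A ≤ at₂ W x y' := by
  refine eq_elim h fun p e A' hA => ?_
  rw [re_at₂, ← e]; exact at₂_res hW hA

theorem eq_symm {X c : P.base} {x x' : X ⟶ c} {A : P.El X} (h : A ≤ at₂ (eqPred c) x x') :
    A ≤ at₂ (eqPred c) x' x :=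
  eq_subst_left h (eq_intro x A)

theorem eq_prod {X c d : P.base} {t t' : X ⟶ c ⨯ d} {A : P.El X}
    (h : A ≤ at₂ (eqPred c) (t ≫ prod.fst) (t' ≫ prod.fst))
    (h' : A ≤ at₂ (eqPred d) (t ≫ prod.snd) (t' ≫ prod.snd)) : A ≤ at₂ (eqPred _) t t' := by
  refine eq_elim h fun p e A' hA => ?_
  refine eq_elim (at₂_res h' hA) fun q e' A'' hA' => ?_
  have : q ≫ p ≫ t = q ≫ p ≫ t' := by
    ext
    · simpa using congrArg (q ≫ ·) e
    · simpa using e'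
  rw [re_at₂, re_at₂, this]
  exact eq_intro _ _

theorem IsFunctional.unique_eq {c d : P.base} {U : P.El c} {V : P.El d} {W : P.El (c ⨯ d)}
    (h : IsFunctional U V W) {X : P.base} {x : X ⟶ c} {y y' : X ⟶ d} {A : P.El X}
    (hA : A ≤ at₂ W x y) (hA' : A ≤ at₂ W x y') : A ≤ at₂ (eqPred d) y y' :=
  h.unique_elim hA hA' fun p e A' _ => by rw [re_at₂, e]; exact eq_intro _ _

/-- The converse relation. -/
noncomputable def conv {c d : P.base} (W : P.El (c ⨯ d)) : P.El (d ⨯ c) :=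
  P.re (prod.lift prod.snd prod.fst) W

@[simp]
theorem at₂_conv {X c d : P.base} (W : P.El (c ⨯ d)) (x : X ⟶ c) (y : X ⟶ d) :
    at₂ (conv W) y x = at₂ W x y := by
  rw [at₂, conv, ← P.re_comp, prod.comp_lift, prod.lift_snd, prod.lift_fst, at₂]

/-- The image of a relation. -/
noncomputable def im {c d : P.base} (W : P.El (c ⨯ d)) : P.El d := ex prod.snd W

theorem im_intro {X c d : P.base} {W : P.El (c ⨯ d)} {y : X ⟶ d} {A : P.El X} (x : X ⟶ c)
    (h : A ≤ at₂ W x y) : A ≤ P.re y (im W) := by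
  have := ex_intro (f := (prod.snd : c ⨯ d ⟶ d)) _ h
  rwa [prod.lift_snd] at this

theorem im_elim {X c d : P.base} {W : P.El (c ⨯ d)} {y : X ⟶ d} {A B : P.El X}
    (h : A ≤ P.re y (im W))
    (H : ∀ {X' : P.base} (p : X' ⟶ X) (x : X' ⟶ c) (A' : P.El X'), A' ≤ P.re p A →
      A' ≤ at₂ W x (p ≫ y) → A' ≤ P.re p B) : A ≤ B := by
  refine ex_elim h fun p s hs A' hA hM => H p (s ≫ prod.fst) A' hA ?_
  rwa [hs, ← re_eq_at₂]

theorem le_of_re {c : P.base} {U U' : P.El c}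
    (h : ∀ {X : P.base} (x : X ⟶ c) (A : P.El X), A ≤ P.re x U → A ≤ P.re x U') : U ≤ U' := by
  have := h (𝟙 c) U (P.re_id U).ge
  rwa [P.re_id] at this

theorem graph_eq {X c d : P.base} {f : c ⟶ d} {U : P.El c} {x : X ⟶ c} {y : X ⟶ d} {A : P.El X}
    (h : A ≤ at₂ (graph f U) x y) : A ≤ at₂ (eqPred d) (x ≫ f) y :=
  graph_elim h fun p A' _ e _ => by
    rw [re_at₂, e]; exact eq_intro _ _

theorem graph_dom {X c d : P.base} {f : c ⟶ d} {U : P.El c} {x : X ⟶ c} {y : X ⟶ d} {A : P.El X}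
    (h : A ≤ at₂ (graph f U) x y) : A ≤ P.re x U :=
  graph_elim h fun p A' _ _ h' => by rwa [← P.re_comp]

end Elements

section SynBasic

variable {X Y Z : P.Syn}

/-- If `G` relates `x` to `y`, then totality of `F` provides a `y'` related to `x` by `F`, hence by
`G`, and uniqueness for `G` gives `y' = y`. One inclusion therefore suffices to prove arrows equal.
-/
theorem syn_eq_of_le {F G : X ⟶ Y} (h : F.rel ≤ G.rel) : F = G := by
  refine syn_ext (hP.antisymm h (le_of_at₂ fun x y A hA => ?_))
  refine F.isFunctional.total_elim (G.isFunctional.dom hA) fun p y' A' h₁ h₂ => ?_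
  rw [re_at₂]
  exact eq_subst_right (G.isFunctional.unique_eq (h₂.trans (at₂_mono h _ _)) (at₂_res hA h₁)) h₂

theorem syn_eq_of_at₂ {F G : X ⟶ Y} (h : ∀ {T : P.base} (x : T ⟶ X.pt) (y : T ⟶ Y.pt) (A : P.El T),
    A ≤ at₂ F.rel x y → A ≤ at₂ G.rel x y) : F = G :=
  syn_eq_of_le (le_of_at₂ h)

/-- Surjectivity of a provably functional relation. -/
def IsSurj (F : X ⟶ Y) : Prop := Y.el ≤ im F.rel

theorem isSurj_comp {F : X ⟶ Y} {G : Y ⟶ Z} (hF : IsSurj F) (hG : IsSurj G) : IsSurj (F ≫ G) := by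
  refine le_of_re fun z A hz => ?_
  refine im_elim (hz.trans (P.re_mono _ hG)) fun p y A' h₁ h₂ => ?_
  refine im_elim ((G.isFunctional.dom h₂).trans (P.re_mono _ hF)) fun q x A'' h₃ h₄ => ?_
  rw [← P.re_comp, ← P.re_comp]
  refine im_intro x (relComp_intro _ h₄ ?_)
  have := at₂_res h₂ h₃
  rwa [← Category.assoc] at this

theorem isSurj_of_comp_eq_id {F : X ⟶ Y} {G : Y ⟶ X} (h : G ≫ F = 𝟙 Y) : IsSurj F := by
  refine le_of_re fun y A hy => ?_
  have : A ≤ at₂ (relComp G.rel F.rel) y y := by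
    change A ≤ at₂ (G ≫ F).rel y y
    rw [h]
    have := graph_intro (f := 𝟙 Y.pt) y hy
    rwa [Category.comp_id] at this
  refine relComp_elim this fun p x A' h₁ h₂ h₃ => ?_
  rw [← P.re_comp]
  exact im_intro x h₃

theorem isSurj_of_isIso (F : X ⟶ Y) [IsIso F] : IsSurj F :=
  isSurj_of_comp_eq_id (IsIso.inv_hom_id F)

/-- The inclusion `(c, U) ⟶ (c, V)` for `U ≤ V`. -/
noncomputable def synIncl {c : P.base} {U V : P.El c} (h : U ≤ V) : (⟨c, U⟩ : P.Syn) ⟶ ⟨c, V⟩ :=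
  synGraph (𝟙 c) (by simpa using h)

theorem le_synIncl {c : P.base} {U V : P.El c} (h : U ≤ V) {T : P.base} {x y : T ⟶ c} {A : P.El T} :
    A ≤ at₂ (synIncl h).rel x y ↔ A ≤ at₂ (eqPred c) x y ∧ A ≤ P.re x U := by
  constructor
  · intro hA
    have := graph_eq hA
    rw [Category.comp_id] at this
    exact ⟨this, graph_dom hA⟩
  · rintro ⟨e, hU⟩
    refine eq_subst_right e ?_
    have := graph_intro (f := 𝟙 c) x hU
    rwa [Category.comp_id] at this

instance {c : P.base} {U V : P.El c} (h : U ≤ V) : Mono (synIncl h) where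
  right_cancellation {Z} F G e := by
    refine syn_eq_of_at₂ fun x y A hA => ?_
    have h₁ : A ≤ at₂ (F ≫ synIncl h).rel x y :=
      relComp_intro y hA ((le_synIncl h).2 ⟨eq_intro _ _, F.isFunctional.cod hA⟩)
    rw [e] at h₁
    refine relComp_elim h₁ fun p z A' h₂ h₃ h₄ => ?_
    rw [re_at₂]
    exact eq_subst_right ((le_synIncl h).1 h₄).1 h₃

/-- The image factorization: corestriction. -/
noncomputable def synCorestr (F : X ⟶ Y) {V : P.El Y.pt} (h : im F.rel ≤ V) :
    X ⟶ (⟨Y.pt, V⟩ : P.Syn) :=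
  ⟨F.rel, .of_elements (fun hA => ⟨F.isFunctional.dom hA, (im_intro _ hA).trans (P.re_mono _ h)⟩)
    F.isFunctional.unique_eq F.isFunctional.total⟩

theorem im_le (F : X ⟶ Y) : im F.rel ≤ Y.el :=
  le_of_re fun y A h => im_elim h fun p x A' h₁ h₂ => by
    rw [← P.re_comp]; exact F.isFunctional.cod h₂

theorem synCorestr_comp_synIncl (F : X ⟶ Y) {V : P.El Y.pt} (h : im F.rel ≤ V) (h' : V ≤ Y.el) :
    synCorestr F h ≫ synIncl h' = F := by
  refine (syn_eq_of_at₂ (F := F) fun x y A hA => ?_).symm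
  exact relComp_intro y hA ((le_synIncl h').2 ⟨eq_intro _ _, (synCorestr F h).isFunctional.cod hA⟩)

theorem isSurj_synCorestr (F : X ⟶ Y) : IsSurj (synCorestr F le_rfl) := le_rfl (a := im F.rel)

end SynBasic

section Pullbacks

variable {W X Y Z : P.Syn}

/-- A commutative square of provably functional relations is a pullback when its legs are jointly
injective and jointly surjective. -/
theorem isPullback_syn {p : W ⟶ X} {q : W ⟶ Y} {F : X ⟶ Z} {G : Y ⟶ Z} (w : p ≫ F = q ≫ G)
    (inj : inf (relComp p.rel (conv p.rel)) (relComp q.rel (conv q.rel)) ≤ eqPred W.pt)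
    (surj : relComp F.rel (conv G.rel) ≤ relComp (conv p.rel) q.rel) : IsPullback p q F G := by
  have inj' : ∀ {T : P.base} {a b : T ⟶ W.pt} {x : T ⟶ X.pt} {y : T ⟶ Y.pt} {A : P.El T},
      A ≤ at₂ p.rel a x → A ≤ at₂ p.rel b x → A ≤ at₂ q.rel a y → A ≤ at₂ q.rel b y →
      A ≤ at₂ (eqPred W.pt) a b := fun {T a b x y A} h₁ h₂ h₃ h₄ =>
    (le_at₂_inf.2 ⟨relComp_intro x h₁ (by rwa [at₂_conv]),
      relComp_intro y h₃ (by rwa [at₂_conv])⟩).trans (at₂_mono inj _ _)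
  have lift : ∀ {T : P.Syn} (H : T ⟶ X) (K : T ⟶ Y), H ≫ F = K ≫ G →
      ∃ L : T ⟶ W, L ≫ p = H ∧ L ≫ q = K := by
    intro T H K e
    -- The lift relates `t` to the `a` with `p a = H t` and `q a = K t`.
    let R := inf (relComp H.rel (conv p.rel)) (relComp K.rel (conv q.rel))
    have hR : IsFunctional T.el W.el R := by
      refine .of_elements (fun {S t a A} hA => ?_) (fun {S t a b A} hA hB => ?_) ?_
      · obtain ⟨h₁, -⟩ := le_at₂_inf.1 hA
        constructor <;> refine relComp_elim h₁ fun r x A' _ h₂ h₃ => ?_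
        · rw [← P.re_comp]; exact H.isFunctional.dom h₂
        · rw [at₂_conv] at h₃
          rw [← P.re_comp]; exact p.isFunctional.dom h₃
      -- Single-valuedness: for two values `a`, `b` witnesses of all four composites are chosen.
      -- Uniqueness for `H` and `K` identifies them in pairs, and joint injectivity gives `a = b`.
      · obtain ⟨h₁, h₂⟩ := le_at₂_inf.1 hA
        obtain ⟨h₃, h₄⟩ := le_at₂_inf.1 hB
        refine relComp_elim h₁ fun r₁ x A₁ k₁ k₂ k₃ => ?_
        refine relComp_elim (at₂_res h₂ k₁) fun r₂ y A₂ l₁ l₂ l₃ => ?_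
        replace k₂ := at₂_res k₂ l₁
        replace k₃ := (at₂_conv p.rel _ _ ▸ at₂_res k₃ l₁ :)
        refine relComp_elim (at₂_res (at₂_res h₃ k₁) l₁) fun r₃ x' A₃ m₁ m₂ m₃ => ?_
        replace k₂ := at₂_res k₂ m₁
        replace k₃ := at₂_res k₃ m₁
        replace l₂ := at₂_res l₂ m₁
        replace l₃ := (at₂_conv q.rel _ _ ▸ at₂_res l₃ m₁ :)
        refine relComp_elim (at₂_res (at₂_res (at₂_res h₄ k₁) l₁) m₁) fun r₄ y' A₄ n₁ n₂ n₃ => ?_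
        replace k₂ := at₂_res k₂ n₁
        replace k₃ := at₂_res k₃ n₁
        replace l₂ := at₂_res l₂ n₁
        replace l₃ := at₂_res l₃ n₁
        replace m₂ := at₂_res m₂ n₁
        replace m₃ := (at₂_conv p.rel _ _ ▸ at₂_res m₃ n₁ :)
        rw [at₂_conv] at n₃
        have ex := H.isFunctional.unique_eq k₂ m₂
        have ey := K.isFunctional.unique_eq l₂ n₂
        simp only [re_at₂]
        exact inj' (eq_subst_right ex k₃) m₃ (eq_subst_right ey l₃) n₃
      -- Totality: take `x = H t` and `z = F x`. Commutativity of the outer square provides `y = K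
      -- t` with `G y = z`, and joint surjectivity provides `a` over `x` and `y`.
      · refine le_of_re fun t A ht => ?_
        refine H.isFunctional.total_elim ht fun r₁ x A₁ k₁ k₂ => ?_
        refine F.isFunctional.total_elim (H.isFunctional.cod k₂) fun r₂ z A₂ l₁ l₂ => ?_
        replace k₂ := at₂_res k₂ l₁
        have h : A₂ ≤ at₂ (H ≫ F).rel (r₂ ≫ r₁ ≫ t) z := relComp_intro _ k₂ l₂
        rw [e] at h
        refine relComp_elim h fun r₃ y A₃ m₁ m₂ m₃ => ?_
        have h' := (relComp_intro (W' := conv G.rel) (r₃ ≫ z) (at₂_res l₂ m₁)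
          (by rwa [at₂_conv])).trans (at₂_mono surj _ y)
        refine relComp_elim h' fun r₄ a A₄ n₁ n₂ n₃ => ?_
        rw [at₂_conv] at n₂
        have h₁ : A₄ ≤ at₂ R (r₄ ≫ r₃ ≫ r₂ ≫ r₁ ≫ t) a := by
          refine le_at₂_inf.2 ⟨relComp_intro _ ?_ (by rw [at₂_conv]; exact n₂),
            relComp_intro _ ?_ (by rw [at₂_conv]; exact n₃)⟩
          · exact at₂_res (at₂_res k₂ m₁) n₁
          · exact at₂_res m₂ n₁
        have := ex_intro (f := (prod.fst : T.pt ⨯ W.pt ⟶ _)) _ h₁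
        rw [prod.lift_fst] at this
        simpa only [P.re_comp] using this
    refine ⟨⟨R, hR⟩, syn_eq_of_at₂ fun t x A h => ?_, syn_eq_of_at₂ fun t y A h => ?_⟩
    · refine relComp_elim h fun r₁ a A₁ k₁ k₂ k₃ => ?_
      refine relComp_elim (le_at₂_inf.1 k₂).1 fun r₂ x' A₂ l₁ l₂ l₃ => ?_
      rw [at₂_conv] at l₃
      simp only [re_at₂]
      exact eq_subst_right (p.isFunctional.unique_eq l₃ (at₂_res k₃ l₁)) l₂
    · refine relComp_elim h fun r₁ a A₁ k₁ k₂ k₃ => ?_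
      refine relComp_elim (le_at₂_inf.1 k₂).2 fun r₂ x' A₂ l₁ l₂ l₃ => ?_
      rw [at₂_conv] at l₃
      simp only [re_at₂]
      exact eq_subst_right (q.isFunctional.unique_eq l₃ (at₂_res k₃ l₁)) l₂
  have uniq : ∀ {T : P.Syn} (L M : T ⟶ W), L ≫ p = M ≫ p → L ≫ q = M ≫ q → L = M := by
    intro T L M e e'
    refine syn_eq_of_at₂ fun t a A h => ?_
    refine p.isFunctional.total_elim (L.isFunctional.cod h) fun r₁ x A₁ k₁ k₂ => ?_
    refine q.isFunctional.total_elim (L.isFunctional.cod (at₂_res h k₁)) fun r₂ y A₂ l₁ l₂ => ?_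
    replace k₂ := at₂_res k₂ l₁
    have h₁ := at₂_res (at₂_res h k₁) l₁
    have h₂ : A₂ ≤ at₂ (L ≫ p).rel _ _ := relComp_intro _ h₁ k₂
    have h₃ : A₂ ≤ at₂ (L ≫ q).rel _ _ := relComp_intro _ h₁ l₂
    rw [e] at h₂
    rw [e'] at h₃
    refine relComp_elim h₂ fun r₃ b A₃ m₁ m₂ m₃ => ?_
    refine relComp_elim (at₂_res h₃ m₁) fun r₄ b' A₄ n₁ n₂ n₃ => ?_
    have h₄ := eq_subst_left (M.isFunctional.unique_eq n₂ (at₂_res m₂ n₁)) n₃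
    simp only [re_at₂]
    exact eq_subst_right (inj' (at₂_res m₃ n₁) (at₂_res (at₂_res k₂ m₁) n₁) h₄
      (at₂_res (at₂_res l₂ m₁) n₁)) (at₂_res m₂ n₁)
  refine ⟨⟨w⟩, ⟨PullbackCone.IsLimit.mk w (fun s => (lift s.fst s.snd s.condition).choose)
    (fun s => (lift s.fst s.snd s.condition).choose_spec.1)
    (fun s => (lift s.fst s.snd s.condition).choose_spec.2) fun s m h₁ h₂ => ?_⟩⟩
  refine uniq _ _ (h₁.trans (lift s.fst s.snd s.condition).choose_spec.1.symm)
    (h₂.trans (lift s.fst s.snd s.condition).choose_spec.2.symm)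

end Pullbacks

end Doctrine

end GeomCompl

/-! ### The syntactic category is regular. -/

namespace GeomCompl

namespace Doctrine

variable {P Q : Doctrine.{u}} [hP : P.IsExistential] [hQ : Q.IsExistential]

section FiniteLimits

variable {X Y Z : P.Syn}

theorem le_synGraph {f : X.pt ⟶ Y.pt} {h : X.el ≤ P.re f Y.el} {T : P.base} {x : T ⟶ X.pt}
    {y : T ⟶ Y.pt} {A : P.El T} :
    A ≤ at₂ (synGraph f h).rel x y ↔ A ≤ at₂ (eqPred Y.pt) (x ≫ f) y ∧ A ≤ P.re x X.el :=
  ⟨fun hA => ⟨graph_eq hA, graph_dom hA⟩, fun ⟨e, hU⟩ => eq_subst_right e (graph_intro x hU)⟩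

/-- An object `(c, ⊤)` over a terminal object is terminal. -/
theorem nonempty_isTerminal_syn (h : IsTerminal Y.pt) (hY : IsTop Y.el) :
    Nonempty (IsTerminal Y) := by
  refine ⟨IsTerminal.ofUniqueHom (fun X => synGraph (h.from _) ((hP.re_top _ hY) _)) fun X F => ?_⟩
  refine syn_eq_of_at₂ fun x y A hA => le_synGraph.2 ⟨?_, F.isFunctional.dom hA⟩
  rw [h.hom_ext (x ≫ h.from _) y]
  exact eq_intro _ _

/-- The pullback of two provably functional relations. -/
noncomputable abbrev synPb (F : X ⟶ Z) (G : Y ⟶ Z) : P.Syn :=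
  ⟨X.pt ⨯ Y.pt, relComp F.rel (conv G.rel)⟩

variable (F : X ⟶ Z) (G : Y ⟶ Z)

noncomputable def synPbFst : synPb F G ⟶ X :=
  synGraph (X := synPb F G) prod.fst (le_of_re fun t A hA => by
    refine relComp_elim ((re_eq_at₂ t _).symm ▸ hA :) fun p z A' h₁ h₂ h₃ => ?_
    rw [← P.re_comp, ← P.re_comp]
    simpa using F.isFunctional.dom h₂)

noncomputable def synPbSnd : synPb F G ⟶ Y :=
  synGraph (X := synPb F G) prod.snd (le_of_re fun t A hA => by
    refine relComp_elim ((re_eq_at₂ t _).symm ▸ hA :) fun p z A' h₁ h₂ h₃ => ?_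
    rw [at₂_conv] at h₃
    rw [← P.re_comp, ← P.re_comp]
    simpa using G.isFunctional.dom h₃)

variable {F G} in
theorem le_synPbFst {T : P.base} {t : T ⟶ X.pt ⨯ Y.pt} {x : T ⟶ X.pt} {A : P.El T} :
    A ≤ at₂ (synPbFst F G).rel t x ↔ A ≤ at₂ (eqPred X.pt) (t ≫ prod.fst) x ∧
      A ≤ at₂ (relComp F.rel (conv G.rel)) (t ≫ prod.fst) (t ≫ prod.snd) := by
  rw [← re_eq_at₂]; exact le_synGraph (X := synPb F G)

variable {F G} in
theorem le_synPbSnd {T : P.base} {t : T ⟶ X.pt ⨯ Y.pt} {y : T ⟶ Y.pt} {A : P.El T} :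
    A ≤ at₂ (synPbSnd F G).rel t y ↔ A ≤ at₂ (eqPred Y.pt) (t ≫ prod.snd) y ∧
      A ≤ at₂ (relComp F.rel (conv G.rel)) (t ≫ prod.fst) (t ≫ prod.snd) := by
  rw [← re_eq_at₂]; exact le_synGraph (X := synPb F G)

theorem synPb_condition : synPbFst F G ≫ F = synPbSnd F G ≫ G := by
  refine syn_eq_of_at₂ fun t z A hA => ?_
  refine relComp_elim hA fun p x A₁ h₁ h₂ h₃ => ?_
  obtain ⟨e, ht⟩ := le_synPbFst.1 h₂
  replace h₃ := eq_subst_left (eq_symm e) h₃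
  refine relComp_elim ht fun q z' A₂ k₁ k₂ k₃ => ?_
  rw [at₂_conv] at k₃
  simp only [re_at₂]
  refine relComp_intro _ (at₂_res (le_synPbSnd.2 ⟨eq_intro _ _, ht⟩) k₁)
    (eq_subst_right (F.isFunctional.unique_eq k₂ (at₂_res h₃ k₁)) k₃)

theorem synPb_inj : inf (relComp (synPbFst F G).rel (conv (synPbFst F G).rel))
    (relComp (synPbSnd F G).rel (conv (synPbSnd F G).rel)) ≤ eqPred (synPb F G).pt := by
  refine le_of_at₂ fun a b A hA => ?_
  obtain ⟨h₁, h₂⟩ := le_at₂_inf.1 hA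
  refine relComp_elim h₁ fun r x A₁ k₁ k₂ k₃ => ?_
  refine relComp_elim (at₂_res h₂ k₁) fun s y A₂ l₁ l₂ l₃ => ?_
  rw [at₂_conv] at k₃ l₃
  simp only [re_at₂]
  exact eq_prod
    (eq_subst_right (eq_symm (le_synPbFst.1 (at₂_res k₃ l₁)).1)
      (le_synPbFst.1 (at₂_res k₂ l₁)).1)
    (eq_subst_right (eq_symm (le_synPbSnd.1 l₃).1) (le_synPbSnd.1 l₂).1)

theorem synPb_surj : relComp F.rel (conv G.rel) ≤
    relComp (conv (synPbFst F G).rel) (synPbSnd F G).rel := by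
  refine le_of_at₂ fun x y A hA => ?_
  refine relComp_intro (prod.lift x y) ?_ (le_synPbSnd.2 ⟨?_, ?_⟩)
  · rw [at₂_conv]
    refine le_synPbFst.2 ⟨?_, ?_⟩
    · rw [prod.lift_fst]; exact eq_intro _ _
    · rwa [prod.lift_fst, prod.lift_snd]
  · rw [prod.lift_snd]; exact eq_intro _ _
  · rwa [prod.lift_fst, prod.lift_snd]

theorem isPullback_synPb : IsPullback (synPbFst F G) (synPbSnd F G) F G :=
  isPullback_syn (synPb_condition F G) (synPb_inj F G) (synPb_surj F G)

instance : HasFiniteLimits P.Syn := by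
  have : HasTerminal P.Syn :=
    (nonempty_isTerminal_syn (Y := (⟨⊤_ P.base, top _⟩ : P.Syn)) terminalIsTerminal
      (isTop_top _)).some.hasTerminal
  have : HasPullbacks P.Syn :=
    have : ∀ {X Y Z : P.Syn} {F : X ⟶ Z} {G : Y ⟶ Z}, HasLimit (cospan F G) :=
      fun {_ _ _ F G} => (isPullback_synPb F G).hasPullback
    hasPullbacks_of_hasLimit_cospan _
  exact hasFiniteLimits_of_hasTerminal_and_pullbacks

end FiniteLimits

section RegularEpi

variable {X Y Z : P.Syn}

theorem isSurj_synPbSnd {F : X ⟶ Z} (G : Y ⟶ Z) (hF : IsSurj F) : IsSurj (synPbSnd F G) := by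
  refine le_of_re fun y A hy => ?_
  refine G.isFunctional.total_elim hy fun p z A₁ h₁ h₂ => ?_
  refine im_elim ((G.isFunctional.cod h₂).trans (P.re_mono _ hF)) fun q x A₂ k₁ k₂ => ?_
  simp only [← P.re_comp]
  refine im_intro (prod.lift x (q ≫ p ≫ y)) (le_synPbSnd.2 ⟨?_, ?_⟩)
  · rw [prod.lift_snd]; exact eq_intro _ _
  · rw [prod.lift_fst, prod.lift_snd]
    exact relComp_intro _ k₂ (by rw [at₂_conv]; exact at₂_res h₂ k₁)

theorem isSurj_of_isPullback {W : P.Syn} {p : W ⟶ X} {q : W ⟶ Y} {F : X ⟶ Z} {G : Y ⟶ Z}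
    (h : IsPullback p q F G) (hF : IsSurj F) : IsSurj q := by
  rw [← h.isoIsPullback_hom_snd _ _ (isPullback_synPb F G)]
  exact isSurj_comp (isSurj_of_isIso _) (isSurj_synPbSnd G hF)

theorem epi_of_isSurj {F : X ⟶ Y} (hF : IsSurj F) : Epi F where
  left_cancellation {Z} G H e := by
    refine syn_eq_of_at₂ fun y z A hA => ?_
    refine im_elim ((G.isFunctional.dom hA).trans (P.re_mono _ hF)) fun p x A₁ h₁ h₂ => ?_
    have h : A₁ ≤ at₂ (F ≫ G).rel x _ := relComp_intro _ h₂ (at₂_res hA h₁)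
    rw [e] at h
    refine relComp_elim h fun q y' A₂ k₁ k₂ k₃ => ?_
    simp only [re_at₂]
    exact eq_subst_left (F.isFunctional.unique_eq k₂ (at₂_res h₂ k₁)) k₃

/-- Descent along a surjective provably functional relation. -/
theorem exists_desc {F : X ⟶ Y} (hF : IsSurj F) (G : X ⟶ Z)
    (h : synPbFst F F ≫ G = synPbSnd F F ≫ G) : ∃ H : Y ⟶ Z, F ≫ H = G := by
  -- The value of `G` depends only on the value of `F`: two elements with the same `F`-value form an
  -- element of the kernel pair, on which the two composites with `G` agree.
  have key : ∀ {T : P.base} {x x' : T ⟶ X.pt} {y : T ⟶ Y.pt} {z : T ⟶ Z.pt} {A : P.El T},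
      A ≤ at₂ F.rel x y → A ≤ at₂ F.rel x' y → A ≤ at₂ G.rel x z → A ≤ at₂ G.rel x' z := by
    intro T x x' y z A h₁ h₂ h₃
    have h₀ : A ≤ at₂ (relComp F.rel (conv F.rel)) (prod.lift x x' ≫ prod.fst)
        (prod.lift x x' ≫ prod.snd) := by
      rw [prod.lift_fst, prod.lift_snd]
      exact relComp_intro _ h₁ (by rw [at₂_conv]; exact h₂)
    have h₄ : A ≤ at₂ (synPbFst F F ≫ G).rel (prod.lift x x') z :=
      relComp_intro x (le_synPbFst.2 ⟨by rw [prod.lift_fst]; exact eq_intro _ _, h₀⟩) h₃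
    rw [h] at h₄
    refine relComp_elim h₄ fun p w A₁ k₁ k₂ k₃ => ?_
    have e := (le_synPbSnd.1 k₂).1
    rw [Category.assoc, prod.lift_snd] at e
    rw [re_at₂]
    exact eq_subst_left (eq_symm e) k₃
  -- The descended arrow is the converse of `F` followed by `G`; it is single-valued by `key` and
  -- total because `F` is surjective.
  have hR : IsFunctional Y.el Z.el (relComp (conv F.rel) G.rel) := by
    refine .of_elements (fun {T y z A} hA => ?_) (fun {T y z z' A} hA hB => ?_) ?_
    · constructor <;> refine relComp_elim hA fun p x A₁ h₁ h₂ h₃ => ?_ <;> rw [← P.re_comp]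
      · rw [at₂_conv] at h₂; exact F.isFunctional.cod h₂
      · exact G.isFunctional.cod h₃
    · refine relComp_elim hA fun p x A₁ h₁ h₂ h₃ => ?_
      refine relComp_elim (at₂_res hB h₁) fun q x' A₂ k₁ k₂ k₃ => ?_
      rw [at₂_conv] at h₂ k₂
      simp only [re_at₂]
      exact G.isFunctional.unique_eq (key (at₂_res h₂ k₁) k₂ (at₂_res h₃ k₁)) k₃
    · refine le_of_re fun y A hy => ?_
      refine im_elim (hy.trans (P.re_mono _ hF)) fun p x A₁ h₁ h₂ => ?_
      refine G.isFunctional.total_elim (F.isFunctional.dom h₂) fun q z A₂ k₁ k₂ => ?_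
      have h : A₂ ≤ at₂ (relComp (conv F.rel) G.rel) (q ≫ p ≫ y) z :=
        relComp_intro _ (by rw [at₂_conv]; exact at₂_res h₂ k₁) k₂
      have := ex_intro (f := (prod.fst : Y.pt ⨯ Z.pt ⟶ _)) _ h
      rw [prod.lift_fst] at this
      simpa only [P.re_comp] using this
  refine ⟨⟨_, hR⟩, syn_eq_of_at₂ fun x z A hA => ?_⟩
  refine relComp_elim hA fun p y A₁ h₁ h₂ h₃ => ?_
  refine relComp_elim h₃ fun q x' A₂ k₁ k₂ k₃ => ?_
  rw [at₂_conv] at k₂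
  simp only [re_at₂]
  exact key k₂ (at₂_res h₂ k₁) k₃

/-- `F` is the coequalizer of its explicit kernel pair, by `exists_desc`. -/
theorem isRegularEpi_of_isSurj {F : X ⟶ Y} (hF : IsSurj F) : IsRegularEpi F := by
  have := epi_of_isSurj hF
  refine ⟨⟨{ W := synPb F F, left := synPbFst F F, right := synPbSnd F F,
             w := synPb_condition F F, isColimit := ?_ }⟩⟩
  refine Cofork.IsColimit.mk _ (fun s => (exists_desc hF s.π s.condition).choose)
    (fun s => (exists_desc hF s.π s.condition).choose_spec) fun s m hm => ?_
  exact (cancel_epi F).1 (Eq.trans hm (exists_desc hF s.π s.condition).choose_spec.symm)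

theorem isSurj_synIncl {c : P.base} {U V : P.El c} (h : U ≤ V) (hs : IsSurj (synIncl h)) :
    V ≤ U := by
  refine le_of_re fun y A hy => ?_
  refine im_elim (hy.trans (P.re_mono y hs)) fun p x A' h₁ h₂ => ?_
  rw [← P.re_comp]
  obtain ⟨e, hx⟩ := (le_synIncl h).1 h₂
  refine eq_elim e fun q e' A'' h₃ => ?_
  rw [← P.re_comp, ← e']
  exact re_res hx h₃

/-- A strong epimorphism factors through the inclusion of its image, which is then a monomorphism
and a strong epimorphism, hence invertible; an isomorphism is surjective, so the image is
everything. -/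
theorem isSurj_of_strongEpi (F : X ⟶ Y) [StrongEpi F] : IsSurj F := by
  have e := synCorestr_comp_synIncl F le_rfl (im_le F)
  have : StrongEpi (synCorestr F le_rfl ≫ synIncl (im_le F)) := by rw [e]; infer_instance
  have := strongEpi_of_strongEpi (synCorestr F le_rfl) (synIncl (im_le F))
  have := isIso_of_mono_of_strongEpi (synIncl (im_le F))
  exact isSurj_synIncl _ (isSurj_of_isIso _)

theorem isRegularEpi_iff_isSurj {F : X ⟶ Y} : IsRegularEpi F ↔ IsSurj F :=
  ⟨fun _ => isSurj_of_strongEpi F, isRegularEpi_of_isSurj⟩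

/-- A kernel pair of `F` is also one of the corestriction of `F` to its image, which is a regular
epimorphism and so the coequalizer of its kernel pair. Stability reduces to that of surjections. -/
instance : Regular P.Syn where
  hasCoequalizer_of_isKernelPair {X Y Z F p q} h := by
    have e := synCorestr_comp_synIncl F le_rfl (im_le F)
    rw [← e] at h
    have := isRegularEpi_of_isSurj (isSurj_synCorestr F)
    exact ⟨⟨_, h.cancel_right_of_mono.toCoequalizer'⟩⟩
  regularEpiIsStableUnderBaseChange :=
    { of_isPullback := fun h hF =>
        isRegularEpi_of_isSurj (isSurj_of_isPullback h (isRegularEpi_iff_isSurj.1 hF)) }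

end RegularEpi

end Doctrine

end GeomCompl

/-! ### Functoriality of the syntactic category, and its topology. -/

namespace GeomCompl

namespace Doctrine

variable {P Q : Doctrine.{u}} [hP : P.IsExistential] [hQ : Q.IsExistential]

section SynMapRegular

variable {F : Mor P Q} [PreservesFiniteLimits F.F]

variable (F) in
theorem synRel_mono {c d : P.base} {W W' : P.El (c ⨯ d)} (h : W ≤ W') :
    synRel F W ≤ synRel F W' := Q.re_mono _ (F.mono h)

variable (F) in
theorem synRel_conv {c d : P.base} (W : P.El (c ⨯ d)) : synRel F (conv W) = conv (synRel F W) := by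
  refine ext₂ fun {T} x y A => ?_
  obtain ⟨t, rfl, rfl⟩ := exists_pair F y x
  rw [at₂_conv, at₂_synRel, at₂_synRel, at₂_conv]

theorem synRel_inf (hF : IsExMor F) {c d : P.base} (W W' : P.El (c ⨯ d)) :
    synRel F (inf W W') = inf (synRel F W) (synRel F W') := by
  rw [synRel, map_inf hF, re_inf]; rfl

theorem synRel_eqPred_le (hF : IsExMor F) (d : P.base) : synRel F (eqPred d) ≤ eqPred (F.F.obj d) := by
  refine le_of_at₂ fun {T} x y A hA => ?_
  obtain ⟨t, rfl, rfl⟩ := exists_pair F x y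
  rw [at₂_synRel'] at hA
  exact at₂_synRel_eqPred hF t hA

theorem map_im (hF : IsExMor F) {c d : P.base} (W : P.El (c ⨯ d)) : F.a (im W) = im (synRel F W) := by
  rw [im, map_ex hF]
  refine hQ.antisymm (le_of_re fun y A hA => ?_) (le_of_re fun y A hA => ?_)
  · refine ex_elim hA fun p s hs A' h₁ h₂ => ?_
    rw [← Q.re_comp, hs]
    exact im_intro (s ≫ F.F.map prod.fst) (by rwa [at₂_synRel'])
  · refine im_elim hA fun p x A' h₁ h₂ => ?_
    obtain ⟨t, rfl, e⟩ := exists_pair F x (p ≫ y)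
    rw [← e, at₂_synRel'] at h₂
    rw [← Q.re_comp, ← e]
    exact ex_intro t h₂

theorem isSurj_synMap (hF : IsExMor F) {X Y : P.Syn} {W : X ⟶ Y} (h : IsSurj W) : IsSurj ((synMap hF).map W) := by
  have := F.mono h
  rw [map_im hF] at this
  exact this

/-- The criterion `isPullback_syn` consists of inequalities built from composites, converses, meets
and equality of relations, all compatible with a morphism of existential doctrines in the direction
needed. The explicit pullbacks `synPb` are therefore preserved. -/
theorem isPullback_synMap (hF : IsExMor F) {W X Y Z : P.Syn} {p : W ⟶ X} {q : W ⟶ Y} {H : X ⟶ Z} {K : Y ⟶ Z}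
    (w : p ≫ H = q ≫ K)
    (inj : inf (relComp p.rel (conv p.rel)) (relComp q.rel (conv q.rel)) ≤ eqPred W.pt)
    (surj : relComp H.rel (conv K.rel) ≤ relComp (conv p.rel) q.rel) :
    IsPullback ((synMap hF).map p) ((synMap hF).map q) ((synMap hF).map H) ((synMap hF).map K) := by
  refine isPullback_syn (by rw [← Functor.map_comp, w, Functor.map_comp]) ?_ ?_
  · have := (synRel_mono F inj).trans (synRel_eqPred_le hF _)
    rwa [synRel_inf hF, synRel_relComp hF, synRel_relComp hF, synRel_conv, synRel_conv] at this
  · have := synRel_mono F surj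
    rwa [synRel_relComp hF, synRel_relComp hF, synRel_conv, synRel_conv] at this

theorem preservesFiniteLimits_synMap (hF : IsExMor F) : PreservesFiniteLimits (synMap hF) := by
  have h₁ : PreservesLimitsOfShape WalkingCospan (synMap hF) := by
    refine ⟨fun {K} => ?_⟩
    have := (isPullback_synPb (K.map WalkingCospan.Hom.inl)
      (K.map WalkingCospan.Hom.inr)).preservesLimit_cospan_iff (F := synMap hF)
    have := this.2 (isPullback_synMap hF (synPb_condition _ _) (synPb_inj _ _) (synPb_surj _ _))
    exact preservesLimit_of_iso_diagram _ (diagramIsoCospan K).symm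
  have h₂ : PreservesLimitsOfShape (Discrete.{0} PEmpty) (synMap hF) := by
    let T : P.Syn := ⟨⊤_ P.base, top _⟩
    have hT : IsTerminal T := (nonempty_isTerminal_syn (Y := T) terminalIsTerminal
      (isTop_top _)).some
    have hT' : IsTerminal ((synMap hF).obj T) := (nonempty_isTerminal_syn
      (Y := (synMap hF).obj T) (IsTerminal.isTerminalObj F.F _ terminalIsTerminal)
      (hF.top (isTop_top _))).some
    have := preservesTerminal_of_iso (synMap hF)
      ((synMap hF).mapIso (terminalIsTerminal.uniqueUpToIso hT) ≪≫
        hT'.uniqueUpToIso terminalIsTerminal)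
    exact preservesLimitsOfShape_pempty_of_preservesTerminal _
  exact preservesFiniteLimits_of_preservesTerminal_and_pullbacks _

end SynMapRegular

section SynTopology

variable {K : Cov P.Total} {L : Cov Q.Total}

/-- A relation `F` is replaced by its tabulation, the object `(c × d, F)` with its two projections.
The first projection generates a cover because `F` is total, so stability is checked there, where
the given cover can be pulled back along the second projection. For transitivity, the second
projection generates a cover of the image of `W`, and the cover of the domain is pulled back along
the first. -/
theorem isTopology_synCov (hK : IsTopology K)
    (hcov : ∀ {X Y : P.Total} (f : X ⟶ Y), IsEx f.f X.el Y.el → Sieve.generateSingleton f ∈ K Y) :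
    IsTopology (synCov K) := by
  refine ⟨⟨fun Y => synCov K Y, fun Y => ?_, fun Y Y' S F hS => ?_, fun Y S hS R hR => ?_⟩,
    fun X S => Iff.rfl⟩
  · refine hK.superset (hK.top_mem _) fun Z g _ => ⟨Y, 𝟙 Y, trivial, ?_⟩
    exact g.cond.trans (P.re_mono _ (isSurj_of_isIso (𝟙 Y)))
  · let T : P.Total := ⟨Y'.pt ⨯ Y.pt, F.rel⟩
    let s : T ⟶ ⟨Y'.pt, Y'.el⟩ := ⟨prod.fst, F.isFunctional.le.trans (inf_le_left _ _)⟩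
    let t : T ⟶ ⟨Y.pt, Y.el⟩ := ⟨prod.snd, F.isFunctional.le.trans (inf_le_right _ _)⟩
    have hs : IsEx s.f T.el Y'.el := by
      have := isEx_ex prod.fst F.rel
      rwa [hP.antisymm ((this _).2 s.cond) F.isFunctional.total] at this
    refine hK.trans (hcov s hs) _ ?_
    rintro Z _ ⟨g, rfl⟩
    rw [Sieve.pullback_comp]
    refine hK.pullback_mem (hK.superset (hK.pullback_mem hS t) ?_) g
    rintro Z g ⟨X, W, hW, h⟩
    refine ⟨synPb W F, synPbSnd W F, ?_, ?_⟩
    · change S _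
      rw [← synPb_condition]
      exact S.downward_closed hW _
    · have h₀ : Z.el ≤ at₂ F.rel (g.f ≫ prod.fst) (g.f ≫ prod.snd) := by
        rw [← re_eq_at₂]; exact g.cond
      refine im_elim h fun p x A h₁ h₂ => ?_
      rw [← P.re_comp]
      refine im_intro (prod.lift x (p ≫ g.f ≫ prod.fst)) (le_synPbSnd.2 ⟨?_, ?_⟩)
      · rw [prod.lift_snd]; exact eq_intro _ _
      · rw [prod.lift_fst, prod.lift_snd]
        exact relComp_intro _ h₂ (by rw [at₂_conv]; exact at₂_res h₀ h₁)
  · refine hK.trans hS _ ?_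
    rintro Z g ⟨X, W, hW, h⟩
    let I : P.Total := ⟨Y.pt, im W.rel⟩
    let i : I ⟶ ⟨Y.pt, Y.el⟩ := vertical (im_le W)
    let g' : Z ⟶ I := ⟨g.f, h⟩
    have e : g = g' ≫ i := total_ext (Category.comp_id _).symm
    rw [e, Sieve.pullback_comp]
    refine hK.pullback_mem ?_ _
    let T : P.Total := ⟨X.pt ⨯ Y.pt, W.rel⟩
    let s : T ⟶ I := ⟨prod.snd, (isEx_ex _ W.rel).le⟩
    let t : T ⟶ ⟨X.pt, X.el⟩ := ⟨prod.fst, W.isFunctional.le.trans (inf_le_left _ _)⟩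
    refine hK.trans (hcov s (isEx_ex _ _)) _ ?_
    rintro Z' _ ⟨k, rfl⟩
    rw [Sieve.pullback_comp]
    refine hK.pullback_mem (hK.superset (hK.pullback_mem (hR hW) t) ?_) k
    rintro Z'' l ⟨X', W', hW', h'⟩
    refine ⟨X', W' ≫ W, hW', ?_⟩
    have h₀ : Z''.el ≤ at₂ W.rel (l.f ≫ prod.fst) (l.f ≫ prod.snd) := by
      rw [← re_eq_at₂]; exact l.cond
    refine im_elim h' fun p x A h₁ h₂ => ?_
    have e : ((l ≫ s) ≫ i).f = l.f ≫ prod.snd := Category.comp_id _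
    rw [e, ← P.re_comp]
    exact im_intro x (relComp_intro _ h₂ (at₂_res h₀ h₁))

theorem generateSingleton_mem_synCov (hK : IsTopology K) {X Y : P.Syn} {F : X ⟶ Y}
    (hF : IsSurj F) : Sieve.generateSingleton F ∈ synCov K Y :=
  hK.superset (hK.top_mem _) fun _ g _ =>
    ⟨X, F, ⟨𝟙 X, Category.id_comp _⟩, g.cond.trans (P.re_mono _ hF)⟩

theorem functorPushforward_mem_synCov {F : Mor P Q} [PreservesFiniteLimits F.F] (hF : IsExMor F)
    (hL : IsTopology L) (hFc : ∀ {X : P.Total} {S : Sieve X}, S ∈ K X →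
      S.functorPushforward F.total ∈ L (F.total.obj X)) {Y : P.Syn} {S : Sieve Y}
    (hS : S ∈ synCov K Y) : S.functorPushforward (synMap hF) ∈ synCov L ((synMap hF).obj Y) := by
  refine hL.superset (hFc hS) ?_
  rintro Z _ ⟨T, g, k, ⟨X, W, hW, h⟩, rfl⟩
  refine ⟨_, (synMap hF).map W, Sieve.image_mem_functorPushforward _ _ hW, ?_⟩
  obtain ⟨k, hk⟩ := k
  change Z.pt ⟶ F.F.obj T.pt at k
  refine hk.trans ?_
  change Q.re k (F.a T.el) ≤ Q.re (k ≫ F.F.map g.f) (im (synRel F W.rel))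
  rw [Q.re_comp, ← map_im hF, ← F.nat]
  exact Q.re_mono _ (F.mono h)

end SynTopology

end Doctrine

theorem generateSingleton_mem_str (P : exDocSites.{u}.Obj) {X Y : P.base.Total} (f : X ⟶ Y)
    (h : Doctrine.IsEx f.f X.el Y.el) : Sieve.generateSingleton f ∈ P.str Y := by
  obtain ⟨_, hP, J, hJ, e⟩ := P.ok
  rw [e]
  exact generateSingleton_mem_exCov (J := J) f h

theorem liftsTo_syn : regSites.{u}.LiftsTo (exDocSitesToExDoc.comp synCat) jSyn where
  ok P := by
    have : P.base.IsExistential := P.ok.2.1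
    refine ⟨Doctrine.isTopology_synCov (P := P.base) P.ok.1 (generateSingleton_mem_str P),
      inferInstanceAs (Regular P.base.Syn), fun {X Y} f hf => ?_⟩
    exact Doctrine.generateSingleton_mem_synCov (P := P.base) P.ok.1
      (Doctrine.isRegularEpi_iff_isSurj.1 hf)
  isHom {P Q} F := by
    have hP : P.base.IsExistential := P.ok.2.1
    have hQ : Q.base.IsExistential := Q.ok.2.1
    have hF := F.isHom.2
    refine ⟨⟨Doctrine.preservesFiniteLimits_synMap hF, fun {X Y} f hf => ?_⟩, fun {X S} hS => ?_⟩
    · exact Doctrine.isRegularEpi_of_isSurj (Doctrine.isSurj_synMap hF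
        (Doctrine.isRegularEpi_iff_isSurj.1 hf))
    · exact Doctrine.functorPushforward_mem_synCov hF Q.ok.1 F.isHom.1.2.cover hS

end GeomCompl

/-! ### Subobjects in the syntactic category, and the geometric case. -/

namespace GeomCompl

namespace Doctrine

variable {P : Doctrine.{u}} [hP : P.IsExistential]

section SynSubobjects

variable {X Y : P.Syn}

theorem im_synIncl {c : P.base} {U V : P.El c} (h : U ≤ V) : im (synIncl h).rel = U := by
  refine hP.antisymm (im_le (X := ⟨c, U⟩) (Y := ⟨c, U⟩) (synIncl le_rfl)) ?_
  refine le_of_re fun x A hA => im_intro x ((le_synIncl h).2 ⟨eq_intro _ _, hA⟩)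

theorem im_comp_le (F : X ⟶ Y) {Z : P.Syn} (G : Y ⟶ Z) : im (F ≫ G).rel ≤ im G.rel :=
  le_of_re fun z A hA => im_elim hA fun p x A₁ h₁ h₂ => relComp_elim h₂ fun q y A₂ k₁ k₂ k₃ => by
    rw [← P.re_comp, ← P.re_comp]
    exact im_intro y (by rwa [Category.assoc] at *)

/-- The subobject of `(c, V)` given by `U ≤ V`. -/
noncomputable def synSub {U : P.El Y.pt} (h : U ≤ Y.el) : Subobject Y :=
  Subobject.mk (X := Y) (synIncl h)

theorem synSub_factors_iff {U : P.El Y.pt} (h : U ≤ Y.el) {F : X ⟶ Y} :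
    (synSub h).Factors F ↔ im F.rel ≤ U := by
  refine mk_factors_iff_exists.trans ⟨?_, fun hF => ⟨_, synCorestr_comp_synIncl F hF h⟩⟩
  rintro ⟨k, rfl⟩
  exact (im_comp_le k (synIncl h)).trans_eq (im_synIncl h)

/-- The element of the fibre corresponding to a subobject. -/
noncomputable def imSub (A : Subobject Y) : P.El Y.pt := im A.arrow.rel

theorem imSub_le (A : Subobject Y) : imSub A ≤ Y.el := im_le _

/-- The corestriction of the monomorphism `A.arrow` to its image is a regular epimorphism and a
monomorphism, hence an isomorphism over `Y`. -/
theorem synSub_imSub (A : Subobject Y) : synSub (imSub_le A) = A := by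
  have := isRegularEpi_of_isSurj (isSurj_synCorestr A.arrow)
  have e := synCorestr_comp_synIncl A.arrow le_rfl (im_le A.arrow)
  have : Mono (synCorestr A.arrow le_rfl ≫ synIncl (im_le A.arrow)) := by rw [e]; infer_instance
  have := mono_of_mono (synCorestr A.arrow le_rfl) (synIncl (im_le A.arrow))
  have := isIso_of_mono_of_strongEpi (synCorestr A.arrow le_rfl)
  exact ((Subobject.mk_eq_mk_of_comm A.arrow (synIncl (im_le A.arrow))
    (asIso (synCorestr A.arrow le_rfl)) e).symm).trans (Subobject.mk_arrow A)

theorem factors_iff_im_le {A : Subobject Y} {F : X ⟶ Y} : A.Factors F ↔ im F.rel ≤ imSub A := by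
  conv_lhs => rw [← synSub_imSub A]
  exact synSub_factors_iff _

theorem le_iff_imSub_le {A B : Subobject Y} : A ≤ B ↔ imSub A ≤ imSub B :=
  le_iff_factors.trans factors_iff_im_le

theorem synSub_le_iff {U : P.El Y.pt} (h : U ≤ Y.el) {A : Subobject Y} :
    synSub h ≤ A ↔ U ≤ imSub A := by
  rw [synSub, mk_le_iff_factors, factors_iff_im_le, im_synIncl]

/-- With `synSub_imSub` and `le_iff_imSub_le` this makes `imSub` an order isomorphism from the
subobjects of `(c, V)` to the elements of `P c` below `V`. -/
theorem imSub_synSub {U : P.El Y.pt} (h : U ≤ Y.el) : imSub (synSub h) = U :=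
  hP.antisymm ((synSub_factors_iff h).1 (synSub h).factors_self) ((synSub_le_iff h).1 le_rfl)

theorem eq_top_iff_le_imSub {A : Subobject Y} : A = ⊤ ↔ Y.el ≤ imSub A := by
  rw [eq_top_iff_factors_id, factors_iff_im_le]
  exact ⟨fun h => (isSurj_of_isIso (𝟙 Y)).trans h, (im_le (𝟙 Y)).trans⟩

/-- Logically, the pullback of `A` is the predicate `∃ y, F(x, y) ∧ A(y)`, and the quantifier is
removed by adjointness. What remains on the left is a meet with a reindexing of `imSub A`,
operations that preserve joins in a geometric doctrine. -/
theorem pullback_le_iff {F : X ⟶ Y} {A : Subobject Y} {B : Subobject X} :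
    (Subobject.pullback F).obj A ≤ B ↔
      inf F.rel (P.re prod.snd (imSub A)) ≤ P.re prod.fst (imSub B) := by
  constructor
  · intro h
    let U := ex (prod.fst : X.pt ⨯ Y.pt ⟶ _) (inf F.rel (P.re prod.snd (imSub A)))
    have hU : U ≤ X.el := (isEx_ex _ _ _).2
      ((inf_le_left _ _).trans (F.isFunctional.le.trans (inf_le_left _ _)))
    have : synSub hU ≤ (Subobject.pullback F).obj A := by
      rw [synSub, mk_le_iff_factors, pullback_factors_iff, factors_iff_im_le]
      refine le_of_re fun y T hT => ?_
      refine im_elim hT fun p x T₁ h₁ h₂ => ?_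
      refine relComp_elim h₂ fun q x' T₂ k₁ k₂ k₃ => ?_
      obtain ⟨e, hx⟩ := (le_synIncl hU).1 k₂
      refine ex_elim hx fun r s hs T₃ l₁ l₂ => ?_
      have m₁ : T₃ ≤ at₂ F.rel (s ≫ prod.fst) (s ≫ prod.snd) := by
        rw [← re_eq_at₂]; exact l₂.trans (P.re_mono _ (inf_le_left _ _))
      have m₂ : T₃ ≤ P.re (s ≫ prod.snd) (imSub A) := by
        rw [P.re_comp]; exact l₂.trans (P.re_mono _ (inf_le_right _ _))
      have m₃ := eq_subst_left (eq_symm (at₂_res e l₁)) (at₂_res k₃ l₁)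
      rw [hs] at m₃
      refine eq_elim (F.isFunctional.unique_eq m₁ m₃) fun t e' T₄ n₁ => ?_
      simp only [← P.re_comp] at e' ⊢
      rw [← e']
      exact re_res m₂ n₁
    exact (isEx_ex _ _ _).1 ((synSub_le_iff hU).1 (this.trans h))
  · intro h
    rw [le_iff_imSub_le]
    refine le_of_re fun x T hT => im_elim hT fun p t T₁ h₁ h₂ => ?_
    refine F.isFunctional.total_elim ((((Subobject.pullback F).obj A).arrow).isFunctional.cod h₂)
      fun q y T₂ k₁ k₂ => ?_
    have hA : im (((Subobject.pullback F).obj A).arrow ≫ F).rel ≤ imSub A :=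
      factors_iff_im_le.1 ((pullback_factors_iff _ _ _).1 (Subobject.factors_self _))
    have m : T₂ ≤ P.re (prod.lift (q ≫ p ≫ x) y) (P.re prod.fst (imSub B)) := by
      refine le_trans ?_ (P.re_mono _ h)
      rw [re_inf, ← P.re_comp _ _ (imSub A), prod.lift_snd]
      exact le_inf k₂ ((im_intro _ (relComp_intro _ (at₂_res h₂ k₁) k₂)).trans (P.re_mono _ hA))
    rw [← P.re_comp, prod.lift_fst] at m
    simpa only [P.re_comp] using m

theorem isLUB_imSub {A : Set (Subobject Y)} {s : Subobject Y} (h : IsLUB A s) :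
    IsLUB (imSub '' A) (imSub s) := by
  refine ⟨?_, fun b hb => ?_⟩
  · rintro _ ⟨a, ha, rfl⟩
    exact le_iff_imSub_le.1 (h.1 ha)
  · have : s ≤ synSub (inf_le_right b Y.el) := h.2 fun a ha => by
      rw [le_iff_imSub_le, imSub_synSub]
      exact le_inf (hb ⟨a, ha, rfl⟩) (imSub_le a)
    rw [le_iff_imSub_le, imSub_synSub] at this
    exact this.trans (inf_le_left _ _)

/-- The syntactic category of a geometric doctrine is geometric. -/
theorem isGeometricCat_syn (hG : P.IsGeometric) : IsGeometricCat P.Syn where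
  exists_sup {Y} A := by
    obtain ⟨s, hs⟩ := hG.exists_sup (imSub '' A)
    have hsY : s ≤ Y.el := hs.2 (by rintro _ ⟨a, _, rfl⟩; exact imSub_le a)
    refine ⟨synSub hsY, fun a ha => ?_, fun B hB => (synSub_le_iff hsY).2 (hs.2 ?_)⟩
    · rw [le_iff_imSub_le, imSub_synSub]; exact hs.1 ⟨a, ha, rfl⟩
    · rintro _ ⟨a, ha, rfl⟩
      exact le_iff_imSub_le.1 (hB ha)
  pullback_sup {X Y} F A s hs := by
    refine ⟨?_, fun B hB => pullback_le_iff.2 ?_⟩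
    · rintro _ ⟨a, ha, rfl⟩
      exact (Subobject.pullback F).monotone (hs.1 ha)
    · refine (hG.inf_sup (hG.re_sup prod.snd (isLUB_imSub hs)) (isGLB_inf F.rel _)).2 ?_
      rintro w ⟨_, ⟨_, ⟨a, ha, rfl⟩, rfl⟩, hw⟩
      rw [isGLB_eq hw]
      exact pullback_le_iff.1 (hB ⟨a, ha, rfl⟩)

/-- Under the correspondence between subobjects and predicates, both conditions say that a predicate
on `Y` containing the images of all arrows of the sieve contains `Y.el`. -/
theorem synCov_geomCov : synCov P.geomCov = jointlyEpiCov P.Syn := by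
  funext Y
  ext S
  constructor
  · intro h A hA
    rw [eq_top_iff_le_imSub]
    refine le_of_mem_geomCov (X := ⟨Y.pt, Y.el⟩) h ?_
    rintro Z f ⟨X, W, hW, h⟩
    exact h.trans (P.re_mono _ (factors_iff_im_le.1 (hA W hW)))
  · intro h
    refine mem_geomCov_of_forall (X := ⟨Y.pt, Y.el⟩) hP.exists_ex fun b hb => ?_
    have := h (synSub (inf_le_right b Y.el)) fun {X} W hW => by
      refine (synSub_factors_iff _).2 (le_inf ?_ (im_le W))
      have := hb (Z := ⟨Y.pt, im W.rel⟩) (vertical (im_le W)) ⟨X, W, hW, by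
        change im W.rel ≤ P.re (𝟙 _) (im W.rel)
        rw [P.re_id]⟩
      rwa [vertical, P.re_id] at this
    rw [eq_top_iff_le_imSub, imSub_synSub] at this
    exact this.trans (inf_le_left _ _)

end SynSubobjects

end Doctrine

theorem jSyn_lift_inclDoc (L : geomDocCart.{u}.Obj) :
    jSyn ((exDocSites.lift liftsTo_inclDoc).obj L) =
      jointlyEpiCov ((exDocSites.lift liftsTo_inclDoc).comp
        (exDocSitesToExDoc.comp synCat) |>.obj L) := by
  obtain ⟨_, hfl, hG, e⟩ := L.ok
  have := hG.isExistential
  change Doctrine.synCov (P := L.base) L.str = _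
  rw [e]
  exact Doctrine.synCov_geomCov (P := L.base)

theorem isGeometricCat_syn_obj (L : geomDocCart.{u}.Obj) :
    IsGeometricCat ((exDocSites.lift liftsTo_inclDoc).comp
        (exDocSitesToExDoc.comp synCat) |>.obj L) := by
  obtain ⟨_, hfl, hG, _⟩ := L.ok
  have := hG.isExistential
  exact Doctrine.isGeometricCat_syn (P := L.base) hG

theorem liftsTo_synGeom : geomCat.{u}.LiftsTo
    ((exDocSites.lift liftsTo_inclDoc).comp (exDocSitesToExDoc.comp synCat)) fun _ => ⟨⟩ where
  ok := isGeometricCat_syn_obj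
  isHom {L M} F := by
    have h := liftsTo_syn.isHom ((exDocSites.lift liftsTo_inclDoc).map F)
    have := isGeometricCat_syn_obj L
    have := isGeometricCat_syn_obj M
    refine ⟨h.1, fun {_ X A s} hs => isLUB_subMap _ (fun {X S} hS => ?_) hs⟩
    rw [← jSyn_lift_inclDoc] at hS
    have := h.2 hS
    rw [jSyn_lift_inclDoc] at this
    exact this

theorem wellDefined : WellDefined.{u} where
  sub := liftsTo_sub
  subGeom := liftsTo_subGeom
  z := liftsTo_zDoc
  inclDoc := liftsTo_inclDoc
  inclCat := liftsTo_inclCat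
  syn := liftsTo_syn
  synGeom := liftsTo_synGeom

end GeomCompl

/-! ### The unit from a doctrine to the subobjects of its syntactic category. -/

namespace GeomCompl

namespace Doctrine

variable {P Q : Doctrine.{u}} [hP : P.IsExistential] [hQ : Q.IsExistential]

section Base

/-- The graph of an arrow, as an arrow of the syntactic category. -/
noncomputable abbrev synOf {X Y : P.Syn} (f : X.pt ⟶ Y.pt) (h : X.el ≤ P.re f Y.el) : X ⟶ Y :=
  synGraph f h

theorem synOf_comp {X Y Z : P.Syn} {f : X.pt ⟶ Y.pt} {g : Y.pt ⟶ Z.pt}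
    (hf : X.el ≤ P.re f Y.el) (hg : Y.el ≤ P.re g Z.el) (h : X.el ≤ P.re (f ≫ g) Z.el) :
    synOf f hf ≫ synOf g hg = synOf (X := X) (Y := Z) (f ≫ g) h :=
  (syn_ext (graph_comp f g hf hg)).symm

theorem synOf_congr {X Y : P.Syn} {f g : X.pt ⟶ Y.pt} (e : f = g) (h : X.el ≤ P.re f Y.el)
    (h' : X.el ≤ P.re g Y.el) : synOf f h = synOf g h' := by
  subst e; rfl

theorem synMap_synGraph {F : Mor P Q} [PreservesFiniteLimits F.F] (hF : IsExMor F) {X Y : P.Syn}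
    {f : X.pt ⟶ Y.pt} (h : X.el ≤ P.re f Y.el)
    (h' : F.a X.el ≤ Q.re (F.F.map f) (F.a Y.el)) :
    (synMap hF).map (synGraph f h : X ⟶ Y) =
      (synGraph (F.F.map f) h' : (synMap hF).obj X ⟶ (synMap hF).obj Y) :=
  syn_ext (at₂_synRel_graph hF f X.el)

theorem synMap_synIncl {F : Mor P Q} [PreservesFiniteLimits F.F] (hF : IsExMor F) {c : P.base}
    {U V : P.El c} (h : U ≤ V) :
    (synMap hF).map (synIncl h) = synIncl (F.mono h) := by
  refine (synMap_synGraph hF _ (by simpa using F.mono h)).trans (syn_ext ?_)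
  exact congrArg (fun f => graph f (F.a U)) (F.F.map_id c)

variable (P) in
/-- The functor `c ↦ (c, ⊤)` to the syntactic category. -/
noncomputable abbrev synBase : P.base ⥤ P.Syn where
  obj c := ⟨c, top c⟩
  map {c d} f := synGraph (X := ⟨c, top c⟩) (Y := ⟨d, top d⟩) f (le_re_top f _)
  map_id _ := rfl
  map_comp _ _ := (synOf_comp (X := ⟨_, top _⟩) (Y := ⟨_, top _⟩) (Z := ⟨_, top _⟩)
    (le_re_top _ _) (le_re_top _ _) (le_re_top _ _)).symm

theorem le_synBase_map {c d : P.base} {f : c ⟶ d} {T : P.base} {x : T ⟶ c} {y : T ⟶ d}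
    {A : P.El T} : A ≤ at₂ ((synBase P).map f).rel x y ↔ A ≤ at₂ (eqPred d) (x ≫ f) y :=
  (le_synGraph (X := ⟨c, top c⟩) (Y := ⟨d, top d⟩) (h := le_re_top f _)).trans
    (and_iff_left (le_re_top x A))

/-- Pullbacks are recognized by `isPullback_syn`. The internal equalities that occur become
equalities of generalized elements after `eq_elim`, and then the universal property of the pullback
in the base applies. -/
instance : PreservesFiniteLimits (synBase P) := by
  have h₁ : PreservesLimitsOfShape WalkingCospan (synBase P) := by
    refine ⟨fun {K} => ?_⟩
    have h : ∀ {a b c : P.base} (f : a ⟶ c) (g : b ⟶ c),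
        PreservesLimit (cospan f g) (synBase P) := by
      intro a b c f g
      refine (IsPullback.of_hasPullback f g).preservesLimit_cospan_iff.2
        (isPullback_syn (by rw [← Functor.map_comp, pullback.condition, Functor.map_comp])
          (le_of_at₂ fun x y A hA => ?_) (le_of_at₂ fun x y A hA => ?_))
      · obtain ⟨h₁, h₂⟩ := le_at₂_inf.1 hA
        refine relComp_elim h₁ fun p z A₁ k₁ k₂ k₃ => ?_
        refine relComp_elim (at₂_res h₂ k₁) fun q w A₂ l₁ l₂ l₃ => ?_
        rw [at₂_conv] at k₃ l₃
        have e₁ := eq_subst_right (eq_symm (le_synBase_map.1 (at₂_res k₃ l₁)))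
          (le_synBase_map.1 (at₂_res k₂ l₁))
        have e₂ := eq_subst_right (eq_symm (le_synBase_map.1 l₃)) (le_synBase_map.1 l₂)
        refine eq_elim e₁ fun r e A₃ m₁ => eq_elim (at₂_res e₂ m₁) fun s e' A₄ m₂ => ?_
        have e'' : s ≫ r ≫ q ≫ p ≫ x = s ≫ r ≫ q ≫ p ≫ y :=
          pullback.hom_ext (by simpa only [Category.assoc] using congrArg (s ≫ ·) e)
            (by simpa only [Category.assoc] using e')
        simp only [re_at₂]
        rw [e'']
        exact eq_intro _ _
      · refine relComp_elim hA fun p z A₁ k₁ k₂ k₃ => ?_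
        rw [at₂_conv] at k₃
        have e := eq_subst_right (eq_symm (le_synBase_map.1 k₃)) (le_synBase_map.1 k₂)
        refine eq_elim e fun q e' A₂ l₁ => ?_
        simp only [re_at₂]
        refine relComp_intro (pullback.lift (q ≫ p ≫ x) (q ≫ p ≫ y) (by simpa only [Category.assoc] using e')) ?_ ?_
        · rw [at₂_conv]
          refine le_synBase_map.2 ?_
          rw [pullback.lift_fst]; exact eq_intro _ _
        · refine le_synBase_map.2 ?_
          rw [pullback.lift_snd]; exact eq_intro _ _
    have := h (K.map WalkingCospan.Hom.inl) (K.map WalkingCospan.Hom.inr)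
    exact preservesLimit_of_iso_diagram _ (diagramIsoCospan K).symm
  have h₂ : PreservesLimitsOfShape (Discrete.{0} PEmpty) (synBase P) := by
    have h : IsTerminal ((synBase P).obj (⊤_ P.base)) :=
      (nonempty_isTerminal_syn (Y := (synBase P).obj (⊤_ P.base)) terminalIsTerminal
        (isTop_top _)).some
    have := preservesTerminal_of_iso (synBase P) (h.uniqueUpToIso terminalIsTerminal)
    exact preservesLimitsOfShape_pempty_of_preservesTerminal _
  exact preservesFiniteLimits_of_preservesTerminal_and_pullbacks _

end Base

section Unit

/-- The subobject `(c, x) ↪ (c, ⊤)`. -/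
noncomputable def synSubTop {c : P.base} (x : P.El c) : Subobject ((synBase P).obj c) :=
  synSub (Y := (synBase P).obj c) (isTop_top c x)

theorem synSubTop_le_iff {c : P.base} {x : P.El c} {A : Subobject ((synBase P).obj c)} :
    synSubTop x ≤ A ↔ x ≤ imSub A := synSub_le_iff _

theorem imSub_synSubTop {c : P.base} (x : P.El c) : imSub (synSubTop x) = x := imSub_synSub _

theorem synSubTop_imSub {c : P.base} (A : Subobject ((synBase P).obj c)) :
    synSubTop (imSub A) = A := synSub_imSub A

theorem synSubTop_factors_iff {c : P.base} {x : P.El c} {X : P.Syn}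
    {F : X ⟶ (synBase P).obj c} : (synSubTop x).Factors F ↔ im F.rel ≤ x := synSub_factors_iff _

theorem synSubTop_mono {c : P.base} {x y : P.El c} (h : x ≤ y) : synSubTop x ≤ synSubTop y := by
  rwa [synSubTop_le_iff, imSub_synSubTop]

/-- The substitution rule: composition with the graph of `f` on one side is reindexing along `f` on
the other. It is what makes the unit natural in `pullback_synSubTop`. -/
theorem im_comp_synBase_le_iff {c d : P.base} {f : c ⟶ d} {x : P.El d} {X : P.Syn}
    {F : X ⟶ (synBase P).obj c} : im (F ≫ (synBase P).map f).rel ≤ x ↔ im F.rel ≤ P.re f x := by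
  constructor
  · refine fun h => le_of_re fun y A hA => im_elim hA fun p z A₁ h₁ h₂ => ?_
    have : A₁ ≤ at₂ (F ≫ (synBase P).map f).rel z ((p ≫ y) ≫ f) :=
      relComp_intro _ h₂ (le_synBase_map.2 (eq_intro _ _))
    rw [← P.re_comp, ← P.re_comp]
    exact (im_intro _ this).trans (P.re_mono _ h)
  · refine fun h => le_of_re fun y A hA => im_elim hA fun p z A₁ h₁ h₂ => ?_
    refine relComp_elim h₂ fun q w A₂ k₁ k₂ k₃ => ?_
    refine eq_elim (le_synBase_map.1 k₃) fun r e A₃ l₁ => ?_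
    have : A₃ ≤ P.re (r ≫ w) (P.re f x) :=
      (re_res (im_intro _ k₂) l₁).trans (P.re_mono _ h)
    rw [← P.re_comp, Category.assoc, e] at this
    simpa only [P.re_comp] using this

theorem pullback_synSubTop {c d : P.base} (f : c ⟶ d) (x : P.El d) :
    (Subobject.pullback ((synBase P).map f)).obj (synSubTop x) = synSubTop (P.re f x) := by
  refine le_antisymm (le_iff_factors.2 ?_) (le_pullback_iff.2 ?_)
  · rw [synSubTop_factors_iff, ← im_comp_synBase_le_iff, ← synSubTop_factors_iff]
    exact le_pullback_iff.1 le_rfl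
  · rw [synSubTop_factors_iff, im_comp_synBase_le_iff, ← synSubTop_factors_iff]
    exact Subobject.factors_self _

variable (P) in
/-- The morphism from a doctrine to the doctrine of subobjects of its syntactic category. -/
noncomputable def synUnit : Mor P (subDoctrine P.Syn) where
  F := synBase P
  a x := synSubTop x
  mono h := synSubTop_mono h
  nat f x := (pullback_synSubTop f x).symm

theorem isExMor_synUnit : IsExMor (synUnit P) where
  preservesFiniteLimits := inferInstanceAs (PreservesFiniteLimits (synBase P))
  top {c t} ht := fun (A : Subobject ((synBase P).obj c)) =>
    le_iff_imSub_le.2 ((ht (imSub A)).trans_eq (imSub_synSubTop t).symm)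
  inf {c x y z} h := by
    change @IsGLB (Subobject ((synBase P).obj c)) _ {synSubTop x, synSubTop y} (synSubTop z)
    refine ⟨?_, fun A hA => ?_⟩
    · rintro _ (rfl | rfl)
      · exact synSubTop_mono (h.1 (.inl rfl))
      · exact synSubTop_mono (h.1 (.inr rfl))
    · have h₁ := le_iff_imSub_le.1 (hA (.inl rfl))
      have h₂ := le_iff_imSub_le.1 (hA (.inr rfl))
      rw [imSub_synSubTop] at h₁ h₂
      rw [le_iff_imSub_le, imSub_synSubTop]
      refine h.2 ?_
      rintro _ (rfl | rfl)
      exacts [h₁, h₂]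
  ex {c d} f x e h := fun (A : Subobject ((synBase P).obj d)) => by
    change synSubTop e ≤ A ↔ synSubTop x ≤ (Subobject.pullback ((synBase P).map f)).obj A
    conv_rhs => rw [← synSubTop_imSub A, pullback_synSubTop, synSubTop_le_iff, imSub_synSubTop]
    rw [synSubTop_le_iff]
    exact h _

theorem subMap_synMap_synSub {F : Mor P Q} [PreservesFiniteLimits F.F] (hF : IsExMor F)
    [PreservesFiniteLimits (synMap hF)] {Y : P.Syn} {U : P.El Y.pt} (h : U ≤ Y.el) :
    subMap (synMap hF) (synSub h) = synSub (Y := (synMap hF).obj Y) (F.mono h) := by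
  obtain ⟨c, y⟩ := Y
  change P.El c at U
  change U ≤ y at h
  refine (subMap_mk (synMap hF) (synIncl h)).trans ?_
  have hi : Mono (C := Q.Syn) (X := (synMap hF).obj ⟨c, U⟩) (Y := (synMap hF).obj ⟨c, y⟩)
    (synIncl (F.mono h)) := inferInstanceAs (Mono (synIncl (F.mono h)))
  exact @Subobject.mk_eq_mk_of_comm _ _ _ _ _ ((synMap hF).map (synIncl h)) _ inferInstance hi
    (Iso.refl _) ((Category.id_comp _).trans (synMap_synIncl hF h).symm)

/-- Covers are preserved by the unit. -/
theorem functorPushforward_synUnit_mem {K : Cov P.Total} (hK : IsTopology K)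
    (hcov : ∀ {X Y : P.Total} (f : X ⟶ Y), IsEx f.f X.el Y.el → Sieve.generateSingleton f ∈ K Y)
    {X : P.Total} {S : Sieve X} (hS : S ∈ K X) :
    S.functorPushforward (synUnit P).total ∈
      (subDoctrine P.Syn).exCov (fun c => subCov (synCov K) c) ((synUnit P).total.obj X) := by
  have hT := isTopology_synCov hK hcov
  obtain ⟨d, y⟩ := X
  refine (mem_exCov_sub_iff (V := synSubTop y) hT
    (fun f hf => generateSingleton_mem_synCov hK (isRegularEpi_iff_isSurj.1 hf))).2 ?_
  let e : ∀ {c : P.base} (x : P.El c), (synSubTop x : P.Syn) ≅ (⟨c, x⟩ : P.Syn) := fun x =>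
    Subobject.underlyingIso (Y := (synBase P).obj _) (synIncl (isTop_top _ x))
  have he : ∀ {c : P.base} (x : P.El c), (e x).inv ≫ (synSubTop x).arrow =
      synIncl (isTop_top _ x) := fun x =>
    Subobject.underlyingIso_arrow (Y := (synBase P).obj _) (synIncl (isTop_top _ x))
  -- The cover is transported from the chosen representative of the subobject to the object `(d, y)`
  -- itself.
  suffices h : (subSieve (V := synSubTop y) (S.functorPushforward (synUnit P).total)).pullback
      (e y).inv ∈ synCov K ⟨d, y⟩ by
    refine hT.superset (hT.pullback_mem h (e y).hom) (le_of_eq ?_)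
    rw [← Sieve.pullback_comp, Iso.hom_inv_id, Sieve.pullback_id]
  -- For `f` in `S` its graph `(Z.pt, Z.el) ⟶ (d, y)` belongs to the sieve in question, and `Z.el`
  -- lies below the reindexing along `f` of the image of this graph.
  refine hK.superset hS fun Z f hf => ⟨⟨Z.pt, Z.el⟩, synOf (Y := ⟨d, y⟩) f.f f.cond,
    ⟨(synBase P).obj Z.pt, synSubTop Z.el, (synBase P).map f.f,
      le_pullback_iff.1 ((synUnit P).total.map f).cond, (e Z.el).inv,
      Sieve.image_mem_functorPushforward (synUnit P).total _ hf, ?_⟩, ?_⟩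
  · rw [Category.assoc, he, ← Category.assoc, he]
    exact (synOf_comp (Y := ⟨d, y⟩) (Z := (synBase P).obj d) f.cond _ (le_re_top _ _)).trans
      ((synOf_congr ((Category.comp_id f.f).trans (Category.id_comp f.f).symm) _ _).trans
        (synOf_comp (X := ⟨Z.pt, Z.el⟩) (Y := (synBase P).obj Z.pt) (Z := (synBase P).obj d)
          _ (le_re_top f.f _) (le_re_top _ _)).symm)
  · have := graph_intro (f := f.f) (U := Z.el) (𝟙 Z.pt) (A := Z.el) (by simp)
    have h := im_intro _ this
    rw [Category.id_comp] at h
    exact h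

end Unit

end Doctrine

end GeomCompl

/-! ### Tabulations, and extension of transformations to the syntactic category. -/

namespace GeomCompl

namespace Doctrine

variable {P Q : Doctrine.{u}} [hP : P.IsExistential] [hQ : Q.IsExistential]

section Tabulation

/-- The object `(c × d, W)` that tabulates a provably functional relation `W`. -/
noncomputable abbrev synTab {X Y : P.Syn} (W : X ⟶ Y) : P.Syn := ⟨X.pt ⨯ Y.pt, W.rel⟩

variable {X Y : P.Syn} (W : X ⟶ Y)

theorem synTab_le_fst : W.rel ≤ P.re prod.fst X.el := W.isFunctional.le.trans (inf_le_left _ _)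

theorem synTab_le_snd : W.rel ≤ P.re prod.snd Y.el := W.isFunctional.le.trans (inf_le_right _ _)

/-- The first leg of the tabulation. -/
noncomputable def synTabFst : synTab W ⟶ X :=
  synOf (X := synTab W) prod.fst (synTab_le_fst W)

/-- The second leg of the tabulation. -/
noncomputable def synTabSnd : synTab W ⟶ Y :=
  synOf (X := synTab W) prod.snd (synTab_le_snd W)

/-- As the first leg is a regular epimorphism, this determines an arbitrary arrow `W` by two graphs;
statements about all arrows of `Syn P` are reduced to graphs in this way. -/
theorem synTabFst_comp : synTabFst W ≫ W = synTabSnd W := by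
  refine (syn_eq_of_at₂ fun {T} (t : T ⟶ X.pt ⨯ Y.pt) y A hA => ?_).symm
  obtain ⟨h₁, h₂⟩ := (le_synGraph (X := synTab W) (h := synTab_le_snd W)).1 hA
  rw [re_eq_at₂] at h₂
  exact relComp_intro (t ≫ prod.fst)
    ((le_synGraph (X := synTab W) (h := synTab_le_fst W)).2 ⟨eq_intro _ _, by rwa [re_eq_at₂]⟩) (eq_subst_right h₁ h₂)

theorem isRegularEpi_synTabFst : IsRegularEpi (synTabFst W) := by
  refine isRegularEpi_of_isSurj (le_of_re fun x A hA => ?_)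
  refine W.isFunctional.total_elim hA fun p y A' h₁ h₂ => ?_
  rw [← P.re_comp]
  refine im_intro (prod.lift (p ≫ x) y) ((le_synGraph (X := synTab W) (h := synTab_le_fst W)).2 ⟨?_, h₂⟩)
  rw [prod.lift_fst]
  exact eq_intro _ _

end Tabulation

section Transformations

variable {D : Type u} [SmallCategory D] {K K' : P.Syn ⥤ D}

/-- The inclusion `(c, U) ⟶ (c, ⊤)`. -/
noncomputable def synInclTop (X : P.Syn) : X ⟶ (synBase P).obj X.pt :=
  synIncl (isTop_top _ X.el)

instance (X : P.Syn) : Mono (synInclTop X) := inferInstanceAs (Mono (synIncl _))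

theorem synSubTop_eq_mk (X : P.Syn) : synSubTop X.el = Subobject.mk (synInclTop X) := rfl

theorem synOf_comp_congr {X Y Y' Z : P.Syn} {f : X.pt ⟶ Y.pt} {g : Y.pt ⟶ Z.pt} {f' : X.pt ⟶ Y'.pt}
    {g' : Y'.pt ⟶ Z.pt} (e : f ≫ g = f' ≫ g') (hf : X.el ≤ P.re f Y.el) (hg : Y.el ≤ P.re g Z.el)
    (hf' : X.el ≤ P.re f' Y'.el) (hg' : Y'.el ≤ P.re g' Z.el) :
    synOf f hf ≫ synOf g hg = synOf f' hf' ≫ synOf g' hg' := by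
  have h : ∀ {W : P.Syn} {k : X.pt ⟶ W.pt} {l : W.pt ⟶ Z.pt}, X.el ≤ P.re k W.el →
      W.el ≤ P.re l Z.el → X.el ≤ P.re (k ≫ l) Z.el := fun hk hl => by
    rw [P.re_comp]; exact hk.trans (P.re_mono _ hl)
  rw [synOf_comp hf hg (h hf hg), synOf_comp hf' hg' (h hf' hg')]
  exact synOf_congr e _ _

theorem synOf_comp_synInclTop {X Y : P.Syn} {f : X.pt ⟶ Y.pt} (h : X.el ≤ P.re f Y.el) :
    synOf f h ≫ synInclTop Y = synInclTop X ≫ (synBase P).map f :=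
  synOf_comp_congr (Y' := (synBase P).obj X.pt) (Z := (synBase P).obj Y.pt)
    ((Category.comp_id f).trans (Category.id_comp f).symm) h (le_re_top _ _) (le_re_top _ _)
    (le_re_top _ _)

/-- Transformations between functors on the syntactic category are determined on the base. -/
theorem synNatTrans_ext [PreservesFiniteLimits K'] {α β : K ⟶ K'}
    (h : ∀ c, α.app ((synBase P).obj c) = β.app ((synBase P).obj c)) : α = β := by
  ext X
  rw [← cancel_mono (K'.map (synInclTop X)), ← α.naturality, ← β.naturality, h]

/-- A transformation on the base that is compatible with subobjects extends to the syntactic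
category. -/
theorem exists_synNatTrans [HasPullbacks D] [PreservesFiniteLimits K] [PreservesFiniteLimits K']
    (hK : ∀ {X Y : P.Syn} (f : X ⟶ Y), IsRegularEpi f → IsRegularEpi (K.map f))
    (β : synBase P ⋙ K ⟶ synBase P ⋙ K')
    (hβ : ∀ {c : P.base} (x : P.El c), subMap K (synSubTop x) ≤
      (Subobject.pullback (β.app c)).obj (subMap K' (synSubTop x))) :
    ∃ α : K ⟶ K', ∀ c, α.app ((synBase P).obj c) = β.app c := by
  -- The component at `(c, U)` is the restriction of `β_c` to subobjects, which exists by `hβ`.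
  have comp : ∀ X : P.Syn, ∃ a : K.obj X ⟶ K'.obj X,
      a ≫ K'.map (synInclTop X) = K.map (synInclTop X) ≫ β.app X.pt := fun X => by
    have h := le_pullback_iff.1 (hβ X.el)
    rw [synSubTop_eq_mk, subMap_mk, subMap_mk] at h
    have h' := Subobject.factors_of_factors_right
      (Subobject.underlyingIso (K.map (synInclTop X))).inv h
    rw [← Category.assoc, Subobject.underlyingIso_arrow] at h'
    exact mk_factors_iff_exists.1 h'
  choose a ha using comp
  have nat : ∀ {X Y : P.Syn} {f : X.pt ⟶ Y.pt} (h : X.el ≤ P.re f Y.el),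
      K.map (synOf f h) ≫ a Y = a X ≫ K'.map (synOf f h) := fun {X Y f} h => by
    rw [← cancel_mono (K'.map (synInclTop Y)), Category.assoc, Category.assoc, ha,
      ← Category.assoc, ← K.map_comp, ← K'.map_comp, synOf_comp_synInclTop, K.map_comp,
      K'.map_comp, ← Category.assoc, ha, Category.assoc, Category.assoc]
    exact congrArg (K.map (synInclTop X) ≫ ·) (β.naturality f)
  refine ⟨⟨a, fun X Y W => ?_⟩, fun c => ?_⟩
  -- Naturality at `W` may be checked after precomposing with the image of the first leg, an
  -- epimorphism; it then follows from naturality at the two legs, which are graphs.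
  · have : IsRegularEpi (K.map (synTabFst W)) := hK _ (isRegularEpi_synTabFst W)
    have e : Epi (K.map (synTabFst W)) := inferInstance
    rw [← cancel_epi (K.map (synTabFst W)), ← Category.assoc, ← K.map_comp, synTabFst_comp]
    refine (nat (X := synTab W) (synTab_le_snd W)).trans ?_
    rw [← Category.assoc]
    refine Eq.trans ?_ (congrArg (· ≫ K'.map W) (nat (X := synTab W) (synTab_le_fst W))).symm
    rw [Category.assoc, ← K'.map_comp]
    exact congrArg (fun t => a (synTab W) ≫ K'.map t) (synTabFst_comp W).symm
  · have h := ha ((synBase P).obj c)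
    have e : synInclTop ((synBase P).obj c) = 𝟙 _ := rfl
    rw [e, K.map_id, K'.map_id, Category.comp_id, Category.id_comp] at h
    exact h

end Transformations

end Doctrine

end GeomCompl

/-! ### Comprehension: a regular category is the syntactic category of its subobjects. -/

namespace GeomCompl

namespace Doctrine

/-- If `x` is the image of a monomorphism `m`, then `(c, x)` is isomorphic to its source. -/
theorem isIso_synOf {P : Doctrine.{u}} [P.IsExistential] {e : P.base} {X : P.Syn} (m : e ⟶ X.pt)
    [Mono m] (h : IsEx m (top e) X.el) :
    IsIso (synOf (X := (synBase P).obj e) (Y := X) m ((h _).1 le_rfl)) := by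
  have hm' : top e ≤ P.re m X.el := (h _).1 le_rfl
  have hm : Mono ((synBase P).map m) := (synBase P).map_mono m
  have h₁ : Mono (synOf (X := (synBase P).obj e) (Y := X) m hm') :=
    mono_of_mono_fac ((synOf_comp_synInclTop (X := (synBase P).obj e) hm').trans
      (Category.id_comp _))
  have h₂ : IsRegularEpi (synOf (X := (synBase P).obj e) (Y := X) m hm') := by
    refine isRegularEpi_of_isSurj ((h _).2 ?_)
    have h' := im_intro _ (graph_intro (f := m) (U := top e) (𝟙 e) (A := top e)
      (by rw [P.re_id]))
    rw [Category.id_comp] at h'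
    exact h'
  exact isIso_of_mono_of_strongEpi _

theorem mk_synBase_map {P : Doctrine.{u}} [P.IsExistential] {e c : P.base} {x : P.El c} (m : e ⟶ c)
    [Mono m] [Mono ((synBase P).map m)] (h : IsEx m (top e) x) :
    Subobject.mk ((synBase P).map m) = synSubTop x := by
  have := isIso_synOf (X := ⟨c, x⟩) m h
  exact Subobject.mk_eq_mk_of_comm _ _ (asIso (synOf (X := (synBase P).obj e) (Y := ⟨c, x⟩) m _))
    ((synOf_comp_synInclTop (X := (synBase P).obj e) (Y := ⟨c, x⟩) ((h _).1 le_rfl)).trans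
      (Category.id_comp _))

/-- Doctrines whose predicates are comprehended by monomorphisms, and in which the
monomorphisms with full image are invertible. -/
structure HasComprehension (P : Doctrine.{u}) [P.IsExistential] : Prop where
  exists_mono : ∀ {c : P.base} (x : P.El c), ∃ (e : P.base) (m : e ⟶ c), Mono m ∧
    IsEx m (top e) x ∧ ∀ {t : P.base} (f : t ⟶ c), top t ≤ P.re f x → ∃ k, k ≫ m = f
  isIso : ∀ {c d : P.base} (m : c ⟶ d) [Mono m], IsEx m (top c) (top d) → IsIso m

namespace HasComprehension

variable {P : Doctrine.{u}} [hP : P.IsExistential]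

/-- If `x` and `y` are internally equal, their equalizer is a monomorphism with full image, hence
invertible: internal equality is equality. -/
theorem eq_of_top_le (h : P.HasComprehension) {T d : P.base} {x y : T ⟶ d} (hxy : top T ≤ at₂ (eqPred d) x y) : x = y := by
  have h' : top T ≤ ex (equalizer.ι x y) (top _) := by
    refine eq_elim hxy fun p hp A' _ => ?_
    have := ex_intro (f := equalizer.ι x y) (equalizer.lift p hp) (le_re_top _ A')
    rwa [equalizer.lift_ι] at this
  have := h.isIso (equalizer.ι x y) fun z =>
    ⟨fun hz => (isEx_ex _ _ z).1 ((isTop_top T _).trans hz),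
      fun hz => h'.trans ((isEx_ex _ _ z).2 hz)⟩
  rw [← cancel_epi (equalizer.ι x y), equalizer.condition]

theorem faithful (h : P.HasComprehension) : (synBase P).Faithful where
  map_injective {c d f g} hfg := by
    have h₁ := (le_synBase_map (f := f) (x := 𝟙 c) (y := f) (A := top c)).2
      (by rw [Category.id_comp]; exact eq_intro _ _)
    rw [hfg] at h₁
    have h₂ := le_synBase_map.1 h₁
    rw [Category.id_comp] at h₂
    exact (h.eq_of_top_le h₂).symm

/-- Let `m : e ⟶ c × d` comprehend the relation `W`. Single-valuedness makes `m ≫ prod.fst` a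
monomorphism, since internal equality is equality, and totality gives it full image; so it is
invertible, and `W` is the graph of its inverse followed by `m ≫ prod.snd`. -/
theorem full (h : P.HasComprehension) : (synBase P).Full where
  map_surjective {c d} W := by
    obtain ⟨e, m, hm, hW, hf⟩ := h.exists_mono W.rel
    have hmW : top e ≤ at₂ W.rel (m ≫ prod.fst) (m ≫ prod.snd) := by
      rw [← re_eq_at₂]; exact (hW _).1 le_rfl
    have : Mono (m ≫ prod.fst) := by
      refine ⟨fun {T} a b hab => ?_⟩
      have h₁ := at₂_res hmW (le_re_top a (top T))
      have h₂ := at₂_res hmW (le_re_top b (top T))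
      rw [← hab] at h₂
      have := h.eq_of_top_le (W.isFunctional.unique_eq h₁ h₂)
      rw [← cancel_mono m]
      exact prod.hom_ext (by simpa only [Category.assoc] using hab)
        (by simpa only [Category.assoc] using this)
    have hi : IsIso (m ≫ prod.fst) := h.isIso _ (hW.comp fun z =>
      ⟨fun hz => (le_re_top _ _).trans (P.re_mono _ hz),
        fun hz => W.isFunctional.total.trans ((isEx_ex prod.fst W.rel z).2 hz)⟩)
    have hf : top c ≤ at₂ W.rel (𝟙 c) (inv (m ≫ prod.fst) ≫ m ≫ prod.snd) := by
      have := at₂_res hmW (le_re_top (inv (m ≫ prod.fst)) (top c))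
      rwa [IsIso.inv_hom_id] at this
    refine ⟨inv (m ≫ prod.fst) ≫ m ≫ prod.snd, syn_eq_of_at₂ fun {T} x y A hA => ?_⟩
    refine eq_subst_right (le_synBase_map.1 hA) ?_
    have := at₂_res hf (le_re_top x A)
    rwa [Category.comp_id] at this

theorem exists_isIso (h : P.HasComprehension) (X : P.Syn) :
    ∃ (e : P.base) (m : e ⟶ X.pt) (hm : top e ≤ P.re m X.el),
      IsIso (synOf (X := (synBase P).obj e) (Y := X) m hm) := by
  obtain ⟨e, m, hm, hW, -⟩ := h.exists_mono X.el
  exact ⟨e, m, (hW _).1 le_rfl, isIso_synOf m hW⟩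

theorem isEquivalence (h : P.HasComprehension) : (synBase P).IsEquivalence :=
  have := h.faithful
  have := h.full
  have : (synBase P).EssSurj := ⟨fun X => by
    obtain ⟨e, m, hm, hi⟩ := h.exists_isIso X
    exact ⟨e, ⟨asIso (synOf (X := (synBase P).obj e) (Y := X) m hm)⟩⟩⟩
  { }

end HasComprehension

end Doctrine

open Doctrine

section SynSub

variable {D : Type u} [SmallCategory D] [Regular D]

variable (D) in
/-- The functor from a regular category to the syntactic category of its doctrine of
subobjects. -/
noncomputable abbrev subSyn : D ⥤ (subDoctrine D).Syn := synBase (subDoctrine D)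

theorem top_sub (c : D) : top (P := subDoctrine D) c = (⊤ : Subobject c) :=
  top_unique (α := Subobject c) (isTop_top (P := subDoctrine D) c (⊤ : Subobject c))

theorem isEx_arrow {c : D} (U : Subobject c) :
    IsEx (P := subDoctrine D) U.arrow (⊤ : Subobject (U : D)) U :=
  isEx_sub_iff.2 ⟨(⊤ : Subobject (U : D)).arrow, inferInstance, rfl⟩

/-- A subobject is comprehended by its own inclusion, and a monomorphism with full image is a
regular epimorphism, hence invertible. -/
theorem hasComprehension_subDoctrine : (subDoctrine D).HasComprehension where
  exists_mono := by
    intro (c : D) (x : Subobject c)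
    refine ⟨(x : D), x.arrow, inferInstanceAs (Mono (C := D) x.arrow), ?_, ?_⟩
    · rw [top_sub]; exact isEx_arrow x
    · intro (t : D) (f : t ⟶ c) h
      rw [top_sub] at h
      have h' := le_pullback_iff.1 (show ⊤ ≤ (Subobject.pullback f).obj x from h)
      obtain ⟨k, hk⟩ := factors_iff_exists.1 h'
      have e : (inv (⊤ : Subobject t).arrow ≫ k) ≫ x.arrow = f := by
        rw [Category.assoc, hk, IsIso.inv_hom_id_assoc]
      exact ⟨_, e⟩
  isIso := by
    intro (c : D) (d : D) (m : c ⟶ d) (hm : Mono m) h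
    rw [top_sub, top_sub] at h
    obtain ⟨q, hq, e⟩ := isEx_sub_iff.1 h
    have : IsRegularEpi (C := D) m := by
      have h₁ : IsRegularEpi (inv (⊤ : Subobject c).arrow) := inferInstance
      have h₂ : IsRegularEpi (⊤ : Subobject d).arrow := inferInstance
      have h₃ := isRegularEpi_comp h₁ (isRegularEpi_comp hq h₂)
      rw [e, IsIso.inv_hom_id_assoc] at h₃
      exact h₃
    exact isIso_of_mono_of_strongEpi (C := D) m

instance : (subSyn D).IsEquivalence := hasComprehension_subDoctrine.isEquivalence

/-- Needed to compute extensions on subobjects: the equivalence with the syntactic category takes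
the subobject `U` to the predicate `U`. -/
theorem subMap_subSyn {c : D} (U : Subobject c) :
    subMap (subSyn D) U = synSubTop (P := subDoctrine D) (c := c) U := by
  have h₁ : Mono (C := (subDoctrine D).base) U.arrow := inferInstanceAs (Mono (C := D) U.arrow)
  have h₂ : Mono ((subSyn D).map U.arrow) := (subSyn D).map_mono U.arrow
  refine mk_synBase_map (P := subDoctrine D) (e := (U : D)) (c := c) (x := U) U.arrow ?_
  rw [top_sub]
  exact isEx_arrow U

end SynSub

end GeomCompl

/-! ### Extension of morphisms along the unit. -/

namespace GeomCompl

open Doctrine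

section SubMap

variable {C D : Type u} [SmallCategory C] [SmallCategory D]

theorem subMap_le_subMap_iff (F : C ⥤ D) [PreservesFiniteLimits F] [F.Full] [F.Faithful] {c : C}
    {A B : Subobject c} : subMap F A ≤ subMap F B ↔ A ≤ B := by
  refine ⟨fun h => ?_, subMap_mono F⟩
  obtain ⟨k, hk⟩ := (subMap_factors_iff F).1 (mk_le_iff_factors.1 h)
  obtain ⟨k, rfl⟩ := F.map_surjective k
  rw [← F.map_comp] at hk
  exact le_iff_factors.2 (factors_iff_exists.2 ⟨k, F.map_injective hk⟩)

theorem subMap_eq_of_iso [HasFiniteLimits C] [HasFiniteLimits D] {F G : C ⥤ D}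
    [PreservesFiniteLimits F] [PreservesFiniteLimits G] (e : F ≅ G) {c : C} (A : Subobject c) :
    subMap F A = (Subobject.pullback (e.hom.app c)).obj (subMap G A) := by
  refine le_antisymm (subMap_le e.hom A) ?_
  refine ((Subobject.pullback (e.hom.app c)).monotone (subMap_le e.inv A)).trans_eq ?_
  rw [← Subobject.pullback_comp, e.hom_inv_id_app, Subobject.pullback_id]

end SubMap

section Extension

variable {P : Doctrine.{u}} [hP : P.IsExistential] {D : Type u} [SmallCategory D] [Regular D]

theorem map_top {Q : Doctrine.{u}} [Q.IsExistential] {F : Mor P Q} (hF : IsExMor F) (c : P.base) :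
    F.a (top c) = top (F.F.obj c) :=
  IsExistential.antisymm (isTop_top _ _) (hF.top (isTop_top c) _)

/-- Equal predicates give isomorphic objects. -/
noncomputable def synIsoOfEq {c : P.base} {U V : P.El c} (e : U = V) :
    (⟨c, U⟩ : P.Syn) ≅ ⟨c, V⟩ where
  hom := synIncl e.le
  inv := synIncl e.ge
  hom_inv_id := by subst e; exact Category.id_comp _
  inv_hom_id := by subst e; exact Category.id_comp _

/-- The elements `a ⊤` and `⊤` are equal but not by definition, so the objects `(F c, a ⊤)` and `(F
c, ⊤)` are compared by an isomorphism, and subobjects are transported along it. -/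
theorem pullback_synIncl {c : P.base} {x U V : P.El c} (e : U = V) (hU : x ≤ U) (hV : x ≤ V) :
    (Subobject.pullback (synIncl e.le)).obj (synSub (Y := ⟨c, V⟩) hV) = synSub (Y := ⟨c, U⟩) hU := by
  subst e; exact Subobject.pullback_id _

variable {Q : Doctrine.{u}} [hQ : Q.IsExistential] {F : Mor P Q} [PreservesFiniteLimits F.F]

/-- The comparison `(F c, a ⊤) ≅ (F c, ⊤)`. -/
noncomputable def synBaseMapIso (hF : IsExMor F) :
    synBase P ⋙ synMap hF ≅ F.F ⋙ synBase Q :=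
  NatIso.ofComponents (fun c => synIsoOfEq (map_top hF c)) fun {c d} f => by
    refine (congrArg (· ≫ _) (synMap_synGraph hF (X := (synBase P).obj c)
      (Y := (synBase P).obj d) (le_re_top f _) ?_)).trans ?_
    · exact (F.mono (le_re_top f _)).trans_eq (F.nat _ _)
    · exact synOf_comp_congr (X := (synMap hF).obj ((synBase P).obj c))
        (Y := (synMap hF).obj ((synBase P).obj d)) (Y' := (synBase Q).obj (F.F.obj c))
        (Z := (synBase Q).obj (F.F.obj d))
        ((Category.comp_id _).trans (Category.id_comp _).symm) _ (le_re_top _ _)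
        (le_re_top _ _) (le_re_top _ _)

theorem pullback_synBaseMapIso (hF : IsExMor F) [PreservesFiniteLimits (synMap hF)] {c : P.base}
    (x : P.El c) :
    (Subobject.pullback ((synBaseMapIso hF).hom.app c)).obj (synSubTop (F.a x)) =
      subMap (synMap hF) (synSubTop x) :=
  (pullback_synIncl (map_top hF c) (F.mono (isTop_top c x)) (isTop_top _ _)).trans
    (subMap_synMap_synSub hF (Y := (synBase P).obj c) (isTop_top c x)).symm

end Extension

section Extension

variable {P : Doctrine.{u}} [hP : P.IsExistential] {D : Type u} [SmallCategory D] [Regular D]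

/-- A morphism from an existential doctrine to the doctrine of subobjects of a regular category
extends to a regular functor on the syntactic category. -/
theorem exists_synExt {F : Mor P (subDoctrine D)} (hF : IsExMor F) :
    ∃ (H : P.Syn ⥤ D) (_ : PreservesFiniteLimits H) (e : synBase P ⋙ H ≅ F.F),
      (∀ {X Y : P.Syn} (f : X ⟶ Y), IsRegularEpi f → IsRegularEpi (H.map f)) ∧
      ∀ {c : P.base} (x : P.El c), subMap H (synSubTop x) =
        (Subobject.pullback (C := D) (e.hom.app c)).obj (F.a x) := by
  have := hF.preservesFiniteLimits
  have := preservesFiniteLimits_synMap hF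
  -- `Syn` of the given morphism lands in `Syn (Sub D)`, which is equivalent to `D`.
  let H : P.Syn ⥤ D := synMap hF ⋙ (subSyn D).inv
  have hH : PreservesFiniteLimits H := comp_preservesFiniteLimits _ _
  have hH' : PreservesFiniteLimits (H ⋙ subSyn D) := comp_preservesFiniteLimits _ _
  let eps : H ⋙ subSyn D ≅ synMap hF :=
    Functor.isoWhiskerLeft (synMap hF) (subSyn D).asEquivalence.counitIso ≪≫
      (synMap hF).rightUnitor
  let j : (synBase P ⋙ H) ⋙ subSyn D ≅ (F.F : P.base ⥤ D) ⋙ subSyn D :=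
    Functor.isoWhiskerLeft (synBase P) eps ≪≫ synBaseMapIso hF
  let e : synBase P ⋙ H ≅ (F.F : P.base ⥤ D) := Functor.fullyFaithfulCancelRight (subSyn D) j
  have he : ∀ c, (subSyn D).map (e.hom.app c) =
      eps.hom.app ((synBase P).obj c) ≫ (synBaseMapIso hF).hom.app c := fun c => by
    refine (congrArg (subSyn D).map (Functor.fullyFaithfulCancelRight_hom_app j c)).trans ?_
    exact (subSyn D).map_preimage _
  refine ⟨H, hH, e, fun f hf => ?_, fun {c} x => ?_⟩
  · have : IsRegularEpi ((synMap hF).map f) :=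
      isRegularEpi_of_isSurj (isSurj_synMap hF (isRegularEpi_iff_isSurj.1 hf))
    have : StrongEpi ((subSyn D).inv.map ((synMap hF).map f)) := inferInstance
    exact inferInstanceAs (IsRegularEpi ((subSyn D).inv.map ((synMap hF).map f)))
  · let A : Subobject (C := D) (F.F.obj c) := F.a x
    -- The fully faithful functor `subSyn D` reflects the order of subobjects, and in `Syn (Sub D)`
    -- both sides are computable.
    have key : subMap (subSyn D) (subMap H (synSubTop x)) =
        subMap (subSyn D) ((Subobject.pullback (C := D) (e.hom.app c)).obj A) := by
      rw [← subMap_comp, subMap_eq_of_iso eps]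
      refine (congrArg _ (pullback_synBaseMapIso hF x).symm).trans ?_
      refine (Subobject.pullback_comp _ _ _).symm.trans ?_
      rw [← he]
      refine Eq.trans ?_ (subMap_pullback (subSyn D) (C := D) (e.hom.app c) A)
      exact congrArg (Subobject.pullback _).obj (subMap_subSyn (D := D) (c := F.F.obj c) A).symm
    exact le_antisymm ((subMap_le_subMap_iff (subSyn D)).1 key.le)
      ((subMap_le_subMap_iff (subSyn D)).1 key.ge)

section Covers

variable (P) in
/-- The functor `C ⋊ P ⥤ Syn P` taking arrows to their graphs. -/
noncomputable abbrev synTotal : P.Total ⥤ P.Syn where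
  obj X := ⟨X.pt, X.el⟩
  map {X Y} f := synOf (X := ⟨X.pt, X.el⟩) (Y := ⟨Y.pt, Y.el⟩) f.f f.cond
  map_id _ := rfl
  map_comp {X Y Z} f g := (synOf_comp (X := ⟨X.pt, X.el⟩) (Y := ⟨Y.pt, Y.el⟩) (Z := ⟨Z.pt, Z.el⟩)
    f.cond g.cond (f ≫ g).cond).symm

/-- A `J_Syn`-cover is controlled by a cover of `C ⋊ P`: each graph in the latter factors through
the image of some `W` in the sieve, and lifts to `W` itself after pulling back the image under `H`
of the regular epimorphism onto that image. As such epimorphisms cover in `D`, only sieves of graphs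
need to be checked. -/
theorem functorPushforward_mem_of_synTotal {H : P.Syn ⥤ D} {K : Cov P.Total} {K' : Cov D}
    (hK' : IsTopology K')
    (hreg : ∀ {X Y : D} (f : X ⟶ Y), IsRegularEpi f → Sieve.generateSingleton f ∈ K' Y)
    (hr : ∀ {X Y : P.Syn} (f : X ⟶ Y), IsRegularEpi f → IsRegularEpi (H.map f))
    (hH : ∀ {X : P.Total} {S : Sieve X}, S ∈ K X →
      S.functorPushforward (synTotal P ⋙ H) ∈ K' (H.obj ((synTotal P).obj X)))
    {Y : P.Syn} {S : Sieve Y} (hS : S ∈ synCov K Y) : S.functorPushforward H ∈ K' (H.obj Y) := by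
  refine hK'.trans (hH hS) _ ?_
  rintro t k ⟨Z, g, s, ⟨X, W, hW, hZ⟩, hk⟩
  have hc := hr _ (isRegularEpi_of_isSurj (isSurj_synCorestr W))
  let Y' : P.Syn := ⟨Y.pt, Doctrine.im W.rel⟩
  let i : (synTotal P).obj Z ⟶ Y' := synOf (X := (synTotal P).obj Z) (Y := Y') g.f hZ
  have hi : i ≫ synIncl (im_le W) = (synTotal P).map g :=
    (synOf_comp (X := (synTotal P).obj Z) (Y := Y') (Z := Y) hZ
      ((im_le W).trans_eq (P.re_id _).symm)
      (g.cond.trans_eq (congrArg (fun f => P.re f Y.el) (Category.comp_id g.f).symm))).trans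
      (synOf_congr (Category.comp_id g.f) _ g.cond)
  refine hK'.superset (hK'.pullback_mem (hreg _ hc) (s ≫ H.map i)) ?_
  rintro b q ⟨r, hr'⟩
  refine ⟨X, W, r, hW, ?_⟩
  have e₁ : synCorestr W le_rfl ≫ synIncl (im_le W) = W := synCorestr_comp_synIncl W le_rfl _
  have e₂ : k = s ≫ H.map (i ≫ synIncl (im_le W)) := hk.trans (by rw [hi]; rfl)
  rw [e₂, H.map_comp, ← Category.assoc s, ← Category.assoc q, ← hr', Category.assoc, ← H.map_comp,
    e₁]

variable {F : P.base ⥤ D} {a : ∀ {c : P.base}, P.El c → Subobject (F.obj c)} {H : P.Syn ⥤ D}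
  [PreservesFiniteLimits H] {e : synBase P ⋙ H ≅ F}

/-- Through `e`, the object `H (c, U)` represents the subobject `a U` of `F c`; this is the
hypothesis on subobjects expressed by arrows. -/
theorem factors_synExt_iff
    (hH : ∀ {c : P.base} (x : P.El c), subMap H (synSubTop x) =
        (Subobject.pullback (e.hom.app c)).obj (a x))
    (X : P.Syn) {t : D} (k : t ⟶ H.obj ((synBase P).obj X.pt)) :
    (a X.el).Factors (k ≫ e.hom.app X.pt) ↔
      ∃ l : t ⟶ H.obj X, l ≫ H.map (synInclTop X) = k := by
  have h : Subobject.mk (H.map (synInclTop X)) =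
      (Subobject.pullback (e.hom.app X.pt)).obj (a X.el) :=
    (subMap_mk H (synInclTop X)).symm.trans (hH X.el)
  rw [← mk_factors_iff_exists, h]
  have pb := Subobject.isPullback (e.hom.app X.pt) (a X.el)
  constructor
  · intro hk
    obtain ⟨l, hl⟩ := factors_iff_exists.1 hk
    exact factors_iff_exists.2 ⟨pb.lift l k hl, pb.lift_snd _ _ _⟩
  · intro hk
    obtain ⟨l, rfl⟩ := factors_iff_exists.1 hk
    rw [Category.assoc, ← pb.w, ← Category.assoc]
    exact Subobject.factors_comp_arrow _

/-- The extension of a cover preserving morphism preserves covers. -/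
theorem functorPushforward_synTotal_mem {K : Cov P.Total} {K' : Cov D} (hK' : IsTopology K')
    (hF : ∀ {X : P.Total} {S : Sieve X}, S ∈ K X → ∃ T : Sieve (a X.el : D), T ∈ K' (a X.el : D) ∧
      ∀ {t : D} (k : t ⟶ (a X.el : D)), T k → ∃ (Z : P.Total) (g : Z ⟶ X) (m : t ⟶ F.obj Z.pt),
        S g ∧ (a Z.el).Factors m ∧ k ≫ (a X.el).arrow = m ≫ F.map g.f)
    (hH : ∀ {c : P.base} (x : P.El c), subMap H (synSubTop x) =
        (Subobject.pullback (e.hom.app c)).obj (a x))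
    {X : P.Total} {S : Sieve X} (hS : S ∈ K X) :
    S.functorPushforward (synTotal P ⋙ H) ∈ K' (H.obj ((synTotal P).obj X)) := by
  obtain ⟨T, hT, hTS⟩ := hF hS
  -- The monomorphisms `i Z` present the subobjects `a Z.el`. They are natural for graphs, so a
  -- cover of `a X.el` can be pulled back to `H X`.
  let i : ∀ Z : P.Total, H.obj ((synTotal P).obj Z) ⟶ F.obj Z.pt := fun Z =>
    H.map (synInclTop ((synTotal P).obj Z)) ≫ e.hom.app Z.pt
  have hi : Mono (i X) := mono_comp _ _
  have hm : ∀ (Z : P.Total) {t : D} (m : t ⟶ F.obj Z.pt), (a Z.el).Factors m →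
      ∃ l, l ≫ i Z = m := fun Z t m hm => by
    obtain ⟨l, hl⟩ := (factors_synExt_iff hH ((synTotal P).obj Z) (m ≫ e.inv.app Z.pt)).1 (by
      have : (m ≫ e.inv.app Z.pt) ≫ e.hom.app Z.pt = m := by
        rw [Category.assoc, e.inv_hom_id_app, Category.comp_id]
      exact this.symm ▸ hm)
    refine ⟨l, (Category.assoc _ _ _).symm.trans ((congrArg (· ≫ e.hom.app Z.pt) hl).trans ?_)⟩
    exact (Category.assoc _ _ _).trans ((congrArg (m ≫ ·) (e.inv_hom_id_app Z.pt)).trans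
      (Category.comp_id m))
  have hn : ∀ {Z : P.Total} (g : Z ⟶ X), H.map ((synTotal P).map g) ≫ i X = i Z ≫ F.map g.f :=
    fun {Z} g => by
      refine (Category.assoc _ _ _).symm.trans ?_
      refine (congrArg (· ≫ e.hom.app X.pt) ((H.map_comp _ _).symm.trans ((congrArg H.map
        (synOf_comp_synInclTop (X := (synTotal P).obj Z) (Y := (synTotal P).obj X)
          g.cond)).trans (H.map_comp _ _)))).trans ?_
      refine (Category.assoc _ _ _).trans ?_
      exact (congrArg (_ ≫ ·) (e.hom.naturality g.f)).trans (Category.assoc _ _ _).symm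
  obtain ⟨w, hw⟩ : ∃ w, w ≫ (a X.el).arrow = i X := factors_iff_exists.1
    ((factors_synExt_iff hH ((synTotal P).obj X) (H.map (synInclTop ((synTotal P).obj X)))).2
      ⟨𝟙 _, Category.id_comp _⟩)
  refine hK'.superset (hK'.pullback_mem hT w) ?_
  intro t k hk
  obtain ⟨Z, g, m, hg, hZ, hkm⟩ := hTS _ hk
  obtain ⟨l, rfl⟩ := hm Z m hZ
  refine ⟨Z, g, l, hg, (cancel_mono (i X)).1 ?_⟩
  have h₁ : k ≫ i X = (l ≫ i Z) ≫ F.map g.f := by rw [← hw, ← Category.assoc, hkm]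
  exact h₁.trans ((Category.assoc _ _ _).trans
    ((congrArg (l ≫ ·) (hn g).symm).trans (Category.assoc _ _ _).symm))

end Covers

/-- The covering condition in the definition of a morphism of doctrinal sites with values in the
doctrine of subobjects of a site. -/
theorem exists_sieve_of_functorPushforward_mem {K' : Cov D} (hK' : IsTopology K')
    (hreg : ∀ {X Y : D} (f : X ⟶ Y), IsRegularEpi f → Sieve.generateSingleton f ∈ K' Y)
    (F₀ : P.base ⥤ D) (a : ∀ {c : P.base}, P.El c → Subobject (F₀.obj c))
    (mono : ∀ {c : P.base} {x y : P.El c}, x ≤ y → a x ≤ a y)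
    (nat : ∀ {c d : P.base} (f : c ⟶ d) (x : P.El d),
      a (P.re f x) = (Subobject.pullback (F₀.map f)).obj (a x))
    {X : P.Total} {S : Sieve X}
    (hS : S.functorPushforward (Mor.total (Q := subDoctrine D) ⟨F₀, a, mono, nat⟩) ∈
      (subDoctrine D).exCov (fun c => subCov K' c) (subObj (F₀.obj X.pt) (a X.el))) :
    ∃ T : Sieve (a X.el : D), T ∈ K' (a X.el : D) ∧
      ∀ {t : D} (k : t ⟶ (a X.el : D)), T k → ∃ (Z : P.Total) (g : Z ⟶ X) (m : t ⟶ F₀.obj Z.pt),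
        S g ∧ (a Z.el).Factors m ∧ k ≫ (a X.el).arrow = m ≫ F₀.map g.f := by
  refine ⟨_, (mem_exCov_sub_iff hK' hreg).1 hS, ?_⟩
  rintro t k ⟨c, z, f, hf, s, ⟨Z, g, ⟨h, hc⟩, hg, hfg⟩, hk⟩
  change c ⟶ F₀.obj Z.pt at h
  have hc' : z ≤ (Subobject.pullback h).obj (a Z.el) := hc
  have e : f = h ≫ F₀.map g.f := congrArg TotalHom.f hfg
  refine ⟨Z, g, s ≫ z.arrow ≫ h, hg,
    Subobject.factors_of_factors_right _ (le_pullback_iff.1 hc'), ?_⟩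
  rw [hk, e, Category.assoc, Category.assoc]

/-- A cover preserving morphism from an existential doctrine to the doctrine of subobjects of a
regular site extends to a cover preserving regular functor on the syntactic category. -/
theorem exists_synExt_cover (F₀ : P.base ⥤ D) (a : ∀ {c : P.base}, P.El c → Subobject (F₀.obj c))
    (mono : ∀ {c : P.base} {x y : P.El c}, x ≤ y → a x ≤ a y)
    (nat : ∀ {c d : P.base} (f : c ⟶ d) (x : P.El d),
      a (P.re f x) = (Subobject.pullback (F₀.map f)).obj (a x))
    (hF : IsExMor (Q := subDoctrine D) ⟨F₀, a, mono, nat⟩) {K : Cov P.Total}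
    {K' : Cov D} (hK' : IsTopology K')
    (hreg : ∀ {X Y : D} (f : X ⟶ Y), IsRegularEpi f → Sieve.generateSingleton f ∈ K' Y)
    (hFc : ∀ {X : P.Total} {S : Sieve X}, S ∈ K X →
      S.functorPushforward (Mor.total (Q := subDoctrine D) ⟨F₀, a, mono, nat⟩) ∈
        (subDoctrine D).exCov (fun c => subCov K' c) (subObj (F₀.obj X.pt) (a X.el))) :
    ∃ (H : P.Syn ⥤ D) (_ : PreservesFiniteLimits H) (e : synBase P ⋙ H ≅ F₀),
      (∀ {X Y : P.Syn} (f : X ⟶ Y), IsRegularEpi f → IsRegularEpi (H.map f)) ∧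
      (∀ {Y : P.Syn} {S : Sieve Y}, S ∈ synCov K Y → S.functorPushforward H ∈ K' (H.obj Y)) ∧
      ∀ {c : P.base} (x : P.El c), subMap H (synSubTop x) =
        (Subobject.pullback (e.hom.app c)).obj (a x) := by
  obtain ⟨H, hH, e, hr, hs⟩ := exists_synExt hF
  refine ⟨H, hH, e, hr, fun {Y S} hS => ?_, hs⟩
  refine functorPushforward_mem_of_synTotal hK' hreg hr (fun {X S} hS => ?_) hS
  exact functorPushforward_synTotal_mem (F := F₀) (a := a) (e := e) hK' (fun {X S} hS =>
    exists_sieve_of_functorPushforward_mem hK' hreg F₀ a mono nat (hFc hS)) hs hS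

end Extension

end GeomCompl

/-! ### Pseudonaturality of the unit of `Syn ⊣ Sub`. -/

namespace GeomCompl

open Doctrine

namespace Doctrine

section IsGraph

variable {P Q : Doctrine.{u}} [hP : P.IsExistential] [hQ : Q.IsExistential]

/-- The arrow `F` of the syntactic category is the graph of `f`. -/
def IsGraph {X Y : P.Syn} (F : X ⟶ Y) (f : X.pt ⟶ Y.pt) : Prop :=
  ∃ h : X.el ≤ P.re f Y.el, F = synOf f h

theorem IsGraph.id (X : P.Syn) : IsGraph (𝟙 X) (𝟙 X.pt) := ⟨by simp, rfl⟩

theorem IsGraph.comp {X Y Z : P.Syn} {F : X ⟶ Y} {G : Y ⟶ Z} {f : X.pt ⟶ Y.pt} {g : Y.pt ⟶ Z.pt}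
    (hF : IsGraph F f) (hG : IsGraph G g) : IsGraph (F ≫ G) (f ≫ g) := by
  obtain ⟨hf, rfl⟩ := hF
  obtain ⟨hg, rfl⟩ := hG
  exact ⟨(hf.trans (P.re_mono _ hg)).trans_eq (P.re_comp _ _ _).symm, synOf_comp _ _ _⟩

theorem IsGraph.map {F : Mor P Q} [PreservesFiniteLimits F.F] (hF : IsExMor F) {X Y : P.Syn}
    {W : X ⟶ Y} {f : X.pt ⟶ Y.pt} (h : IsGraph W f) : IsGraph ((synMap hF).map W) (F.F.map f) := by
  obtain ⟨hf, rfl⟩ := h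
  exact ⟨_, synMap_synGraph hF hf ((F.mono hf).trans_eq (F.nat _ _))⟩

/-- The coherence cells in syntactic categories are all graphs of base arrows. By this lemma each
coherence equation becomes an equation in the base, mostly between composites of identities. -/
theorem IsGraph.eq {X Y : P.Syn} {F G : X ⟶ Y} {f g : X.pt ⟶ Y.pt} (hF : IsGraph F f)
    (hG : IsGraph G g) (e : f = g) : F = G := by
  obtain ⟨hf, rfl⟩ := hF
  obtain ⟨hg, rfl⟩ := hG
  subst e; rfl

theorem isGraph_synBase_map {c d : P.base} (f : c ⟶ d) : IsGraph ((synBase P).map f) f :=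
  ⟨le_re_top _ _, rfl⟩

theorem isGraph_synBaseMapIso_inv {F : Mor P Q} [PreservesFiniteLimits F.F] (hF : IsExMor F)
    (c : P.base) : IsGraph ((synBaseMapIso hF).inv.app c) (𝟙 (F.F.obj c)) :=
  ⟨(map_top hF c).ge.trans_eq (Q.re_id _).symm, rfl⟩

theorem isGraph_synCell_app {F G : Mor P Q} [PreservesFiniteLimits F.F] [PreservesFiniteLimits G.F]
    (hF : IsExMor F) (hG : IsExMor G) (α : F ⟶ G) (X : P.Syn) :
    IsGraph ((synCell hF hG α).app X) (α.α.app X.pt) := ⟨α.cond X.el, rfl⟩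

end IsGraph

end Doctrine

instance (P : exDocSites.{u}.Obj) : P.base.IsExistential := P.ok.2.1

/-- The unit of the adjunction between syntactic categories and doctrines of subobjects. -/
noncomputable def synSubUnitApp (P : exDocSites.{u}.Obj) :
    P ⟶ (wellDefined.{u}.Syn.comp wellDefined.Sub).obj P where
  hom := synUnit P.base
  isHom := by
    have hT := isTopology_synCov (P := P.base) P.ok.1 (generateSingleton_mem_str P)
    have hx := isExMor_synUnit (P := P.base)
    have hfl : PreservesFiniteLimits (synUnit P.base).F := hx.preservesFiniteLimits
    have hQ := isExistential_subDoctrine (C := P.base.Syn)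
    refine ⟨⟨flat_of_preservesFiniteLimits (synBase P.base), ?_⟩, hx⟩
    exact isMorphismOfSites_total (synUnit P.base)
      (isExistentialSite_sub hT fun f hf => generateSingleton_mem_synCov P.ok.1
        (isRegularEpi_iff_isSurj.1 hf)).isTopology P.ok.2.1.exists_top P.ok.2.1.exists_inf
      hQ.re_top hQ.re_inf hx.top hx.inf
      (functorPushforward_synUnit_mem P.ok.1 (generateSingleton_mem_str P))

/-- The naturality isomorphism of `synUnit`. -/
noncomputable def synUnitNaturality {P Q : Doctrine.{u}} [P.IsExistential] [Q.IsExistential]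
    {F : Mor P Q} [PreservesFiniteLimits F.F] (hF : IsExMor F)
    [PreservesFiniteLimits (synMap hF)] :
    F.compMor (synUnit Q) ≅ (synUnit P).compMor (subDoctrineMap (synMap hF)) :=
  isoOfLe (synBaseMapIso hF).symm
    (fun {c} x => by
      change synSubTop (F.a x) ≤ (Subobject.pullback ((synBaseMapIso hF).inv.app c)).obj
        (subMap (synMap hF) (synSubTop x))
      rw [← pullback_synBaseMapIso, ← Subobject.pullback_comp, Iso.inv_hom_id_app,
        Subobject.pullback_id])
    (fun {c} x => (pullback_synBaseMapIso hF x).ge)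

/-- The unit of the adjunction between syntactic categories and doctrines of subobjects. -/
noncomputable def synSubUnit : Pseudofunctor.StrongTrans (Pseudofunctor.id exDocSites.{u}.Obj)
    (wellDefined.{u}.Syn.comp wellDefined.Sub) where
  app := synSubUnitApp
  naturality {P Q} F :=
    have hfl : PreservesFiniteLimits (synMap F.isHom.2) :=
      preservesFiniteLimits_synMap F.isHom.2
    Structured.isoMk (synUnitNaturality F.isHom.2)
  naturality_naturality {P Q F G} α := Structured.hom_ext <| ext_app fun c => by
    change (synBase Q.base).map (α.cell.α.app c) ≫ (synBaseMapIso G.isHom.2).inv.app c =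
      (synBaseMapIso F.isHom.2).inv.app c ≫
        (synCell F.isHom.2 G.isHom.2 α.cell).app ((synBase P.base).obj c)
    exact ((isGraph_synBase_map _).comp (isGraph_synBaseMapIso_inv _ _)).eq
      ((isGraph_synBaseMapIso_inv _ _).comp (isGraph_synCell_app _ _ _ _))
      ((Category.comp_id _).trans (Category.id_comp _).symm)
  naturality_id P := Structured.hom_ext <| ext_app fun (c : P.base.base) => by
    change (synBaseMapIso (F := Mor.idMor P.base) .id).inv.app c ≫
        ((𝟙 ((synBase P.base).obj c) ≫ 𝟙 ((synBase P.base).obj c)) ≫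
          𝟙 ((synBase P.base).obj c) ≫ 𝟙 ((synBase P.base).obj c)) =
      (synBase P.base).map (𝟙 c) ≫ 𝟙 ((synBase P.base).obj c) ≫ 𝟙 ((synBase P.base).obj c)
    exact ((isGraph_synBaseMapIso_inv (F := Mor.idMor P.base) .id c).comp
        (((IsGraph.id _).comp (IsGraph.id _)).comp ((IsGraph.id _).comp (IsGraph.id _)))).eq
      ((isGraph_synBase_map _).comp ((IsGraph.id _).comp (IsGraph.id _))) (by
        change 𝟙 c ≫ (𝟙 c ≫ 𝟙 c) ≫ 𝟙 c ≫ 𝟙 c = 𝟙 c ≫ 𝟙 c ≫ 𝟙 c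
        simp)
  naturality_comp {P Q R} F G := Structured.hom_ext <| ext_app fun (c : P.base.base) => by
    have hF := F.isHom.2
    have hG := G.isHom.2
    let X : R.base.Syn := (synMap hG).obj ((synMap hF).obj ((synBase P.base).obj c))
    change (synBaseMapIso (hF.comp hG)).inv.app c ≫ (𝟙 X ≫ 𝟙 X) ≫ 𝟙 X ≫ 𝟙 X =
      (synBase R.base).map (𝟙 _) ≫ 𝟙 _ ≫ (synBaseMapIso hG).inv.app _ ≫ 𝟙 _ ≫
        (synMap hG).map ((synBaseMapIso hF).inv.app c) ≫ 𝟙 X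
    exact ((isGraph_synBaseMapIso_inv (hF.comp hG) c).comp
        (((IsGraph.id X).comp (IsGraph.id X)).comp ((IsGraph.id X).comp (IsGraph.id X)))).eq
      ((isGraph_synBase_map _).comp ((IsGraph.id _).comp ((isGraph_synBaseMapIso_inv hG _).comp
        ((IsGraph.id _).comp (((isGraph_synBaseMapIso_inv hF c).map hG).comp (IsGraph.id X)))))) (by
        let y : R.base.base := G.hom.F.obj (F.hom.F.obj c)
        change 𝟙 y ≫ (𝟙 y ≫ 𝟙 y) ≫ 𝟙 y ≫ 𝟙 y =
          𝟙 y ≫ 𝟙 y ≫ 𝟙 y ≫ 𝟙 y ≫ G.hom.F.map (𝟙 (F.hom.F.obj c)) ≫ 𝟙 y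
        rw [G.hom.F.map_id]
        simp [y])

end GeomCompl

/-! ### The adjunction `Syn ⊣ Sub` for regular sites. -/

namespace GeomCompl

open Doctrine

instance (C : regSites.{u}.Obj) : Regular C.base := C.ok.2.1

/-- The adjunction between syntactic categories and doctrines of subobjects. -/
noncomputable def synSubAdjunction :
    QuasiAdjunction wellDefined.{u}.Syn wellDefined.Sub where
  unit := synSubUnit
  isEquivalence P C := by
    have hP : P.base.IsExistential := P.ok.2.1
    have hC : Regular C.base := C.ok.2.1
    refine @Functor.IsEquivalence.mk _ _ _ _ _ ?_ ?_ ?_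
    · refine ⟨fun {G H α β} h => ?_⟩
      let K : P.base.Syn ⥤ C.base := H.hom.toFunctor
      have hH : PreservesFiniteLimits K := H.isHom.1.1
      refine Structured.hom_ext (Cat.Hom₂.ext ?_)
      refine synNatTrans_ext (K' := K) fun c => ?_
      have := congrArg (fun t => t.cell.α.app c) h
      exact this
    · refine ⟨fun {G H} γ => ?_⟩
      let K : P.base.Syn ⥤ C.base := G.hom.toFunctor
      let K' : P.base.Syn ⥤ C.base := H.hom.toFunctor
      have hG : PreservesFiniteLimits K := G.isHom.1.1
      have hH : PreservesFiniteLimits K' := H.isHom.1.1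
      obtain ⟨α, hα⟩ := exists_synNatTrans (K := K) (K' := K')
        (fun f hf => G.isHom.1.2 f hf) γ.cell.α (fun {c} x => γ.cell.cond x)
      exact ⟨⟨NatTrans.toCatHom₂ α⟩, Structured.hom_ext <| ext_app fun c => hα c⟩
    -- Essential surjectivity: the extension `H` restricts to `F` along the unit, by `e` on the base
    -- and by `hs` on predicates.
    · refine ⟨fun F => ?_⟩
      let F₀ : P.base.base ⥤ C.base := F.hom.F
      let a : ∀ {c : P.base.base}, P.base.El c → Subobject (F₀.obj c) := F.hom.a
      obtain ⟨H, hH, e, hr, hc, hs⟩ := exists_synExt_cover (P := P.base)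
        F₀ a F.hom.mono F.hom.nat F.isHom.2 (K := P.str) C.ok.1 C.ok.2.2
        (fun {X S} hS => F.isHom.1.2.cover hS)
      let H' : wellDefined.Syn.obj P ⟶ C := ⟨H.toCatHom, ⟨hH, hr⟩, hc⟩
      have hs' : ∀ {c : P.base.base} (x : P.base.El c),
          a x ≤ (Subobject.pullback (e.inv.app c)).obj (subMap H (synSubTop x)) := fun {c} x => by
        rw [hs, ← Subobject.pullback_comp, e.inv_hom_id_app, Subobject.pullback_id]
      exact ⟨H', ⟨Structured.isoMk (isoOfLe e (fun x => (hs x).le) fun x => hs' x)⟩⟩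

end GeomCompl

/-! ### The adjunction `Syn ⊣ Sub` for geometric categories. -/

namespace GeomCompl

open Doctrine

theorem isExistential_of_geomDocCart (L : geomDocCart.{u}.Obj) : L.base.IsExistential :=
  (wellDefined.InclDoc.obj L).ok.2.1

/-- Since the topologies agree, the unit for existential sites serves for geometric doctrines as
well. -/
theorem kSub_syn_inclDoc (L : geomDocCart.{u}.Obj) :
    kSub (wellDefined.Syn.obj (wellDefined.InclDoc.obj L)) =
      kSubGeom (wellDefined.SynGeom.obj L) := by
  have hL : L.base.IsExistential := isExistential_of_geomDocCart L
  have hG : IsGeometricCat L.base.Syn := isGeometricCat_syn_obj L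
  have h := jSyn_lift_inclDoc L
  change (subDoctrine L.base.Syn).exCov (fun c => subCov (synCov L.str) c) =
    (subDoctrine L.base.Syn).geomCov
  change synCov L.str = jointlyEpiCov L.base.Syn at h
  rw [h]
  exact exCov_subCov_jointlyEpiCov

/-- The unit of the adjunction between syntactic categories and doctrines of subobjects, for
geometric doctrines. -/
noncomputable def synSubGeomUnitApp (L : geomDocCart.{u}.Obj) :
    L ⟶ (wellDefined.{u}.SynGeom.comp wellDefined.SubGeom).obj L where
  hom := (synSubUnitApp (wellDefined.InclDoc.obj L)).hom
  isHom := by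
    have h := (synSubUnitApp (wellDefined.InclDoc.obj L)).isHom.1
    change docSites.IsHom L.str (kSub (wellDefined.Syn.obj (wellDefined.InclDoc.obj L))) _ at h
    rw [kSub_syn_inclDoc] at h
    exact h

/-- The unit of the adjunction between syntactic categories and doctrines of subobjects, for
geometric doctrines. -/
noncomputable def synSubGeomUnit : Pseudofunctor.StrongTrans
    (Pseudofunctor.id geomDocCart.{u}.Obj) (wellDefined.{u}.SynGeom.comp wellDefined.SubGeom) where
  app := synSubGeomUnitApp
  naturality {L M} F :=
    Structured.isoMk ((exDocSites.forget).map₂Iso (synSubUnit.naturality (wellDefined.InclDoc.map F)))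
  naturality_naturality {L M F G} α := Structured.hom_ext
    (congrArg Structured.Cell.cell (synSubUnit.naturality_naturality (wellDefined.InclDoc.map₂ α)) :)
  naturality_id L := Structured.hom_ext <| ext_app fun (c : L.base.base) => by
    have hL : L.base.IsExistential := isExistential_of_geomDocCart L
    change (synBaseMapIso (F := Mor.idMor L.base) .id).inv.app c ≫
        ((𝟙 ((synBase L.base).obj c) ≫ 𝟙 ((synBase L.base).obj c) ≫ 𝟙 ((synBase L.base).obj c)) ≫
          𝟙 ((synBase L.base).obj c) ≫ 𝟙 ((synBase L.base).obj c)) =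
      (synBase L.base).map (𝟙 c) ≫ 𝟙 ((synBase L.base).obj c) ≫ 𝟙 ((synBase L.base).obj c)
    exact ((isGraph_synBaseMapIso_inv (F := Mor.idMor L.base) .id c).comp
        (((IsGraph.id _).comp ((IsGraph.id _).comp (IsGraph.id _))).comp
          ((IsGraph.id _).comp (IsGraph.id _)))).eq
      ((isGraph_synBase_map _).comp ((IsGraph.id _).comp (IsGraph.id _))) (by
        change 𝟙 c ≫ (𝟙 c ≫ 𝟙 c ≫ 𝟙 c) ≫ 𝟙 c ≫ 𝟙 c = 𝟙 c ≫ 𝟙 c ≫ 𝟙 c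
        simp)
  naturality_comp {L M N} F G := Structured.hom_ext <| ext_app fun (c : L.base.base) => by
    have hL : L.base.IsExistential := isExistential_of_geomDocCart L
    have hM : M.base.IsExistential := isExistential_of_geomDocCart M
    have hN : N.base.IsExistential := isExistential_of_geomDocCart N
    have hF := (wellDefined.InclDoc.map F).isHom.2
    have hG := (wellDefined.InclDoc.map G).isHom.2
    have := hF.1
    have := hG.1
    let X : N.base.Syn := (synMap hG).obj ((synMap hF).obj ((synBase L.base).obj c))
    change (synBaseMapIso (hF.comp hG)).inv.app c ≫ (𝟙 X ≫ 𝟙 X ≫ 𝟙 X) ≫ 𝟙 X ≫ 𝟙 X =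
      (synBase N.base).map (𝟙 _) ≫ 𝟙 _ ≫ (synBaseMapIso hG).inv.app _ ≫ 𝟙 _ ≫
        (synMap hG).map ((synBaseMapIso hF).inv.app c) ≫ 𝟙 X
    exact ((isGraph_synBaseMapIso_inv (hF.comp hG) c).comp
        (((IsGraph.id X).comp ((IsGraph.id X).comp (IsGraph.id X))).comp
          ((IsGraph.id X).comp (IsGraph.id X)))).eq
      ((isGraph_synBase_map _).comp ((IsGraph.id _).comp ((isGraph_synBaseMapIso_inv hG _).comp
        ((IsGraph.id _).comp (((isGraph_synBaseMapIso_inv hF c).map hG).comp (IsGraph.id X)))))) (by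
        let y : N.base.base := (Doctrine.Mor.F G.hom).obj ((Doctrine.Mor.F F.hom).obj c)
        change 𝟙 y ≫ (𝟙 y ≫ 𝟙 y ≫ 𝟙 y) ≫ 𝟙 y ≫ 𝟙 y =
          𝟙 y ≫ 𝟙 y ≫ 𝟙 y ≫ 𝟙 y ≫ (Doctrine.Mor.F G.hom).map (𝟙 ((Doctrine.Mor.F F.hom).obj c)) ≫ 𝟙 y
        rw [(Doctrine.Mor.F G.hom).map_id]
        simp [y])

/-- The adjunction between syntactic categories and doctrines of subobjects, for geometric
doctrines. -/
noncomputable def synSubGeomAdjunction :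
    QuasiAdjunction wellDefined.{u}.SynGeom wellDefined.SubGeom where
  unit := synSubGeomUnit
  isEquivalence L C := by
    have hL : L.base.IsExistential := isExistential_of_geomDocCart L
    have hC : IsGeometricCat C.base := C.ok
    have hGL : IsGeometricCat L.base.Syn := isGeometricCat_syn_obj L
    refine @Functor.IsEquivalence.mk _ _ _ _ _ ?_ ?_ ?_
    · refine ⟨fun {G H α β} h => ?_⟩
      let K : L.base.Syn ⥤ C.base := H.hom.toFunctor
      have hH : PreservesFiniteLimits K := H.isHom.1.1
      refine Structured.hom_ext (Cat.Hom₂.ext ?_)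
      refine synNatTrans_ext (K' := K) fun c => ?_
      have := congrArg (fun t => t.cell.α.app c) h
      exact this
    · refine ⟨fun {G H} γ => ?_⟩
      let K : L.base.Syn ⥤ C.base := G.hom.toFunctor
      let K' : L.base.Syn ⥤ C.base := H.hom.toFunctor
      have hG : PreservesFiniteLimits K := G.isHom.1.1
      have hH : PreservesFiniteLimits K' := H.isHom.1.1
      obtain ⟨α, hα⟩ := exists_synNatTrans (K := K) (K' := K')
        (fun f hf => G.isHom.1.2 f hf) γ.cell.α (fun {c} x => γ.cell.cond x)
      exact ⟨⟨NatTrans.toCatHom₂ α⟩, Structured.hom_ext <| ext_app fun c => hα c⟩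
    · refine ⟨fun F => ?_⟩
      let F' : wellDefined.InclDoc.obj L ⟶ wellDefined.InclDoc.obj (wellDefined.SubGeom.obj C) :=
        wellDefined.InclDoc.map F
      let F₀ : L.base.base ⥤ C.base := F'.hom.F
      let a : ∀ {c : L.base.base}, L.base.El c → Subobject (F₀.obj c) := F'.hom.a
      have hcov : ∀ {X : L.base.Total} {S : Sieve X}, S ∈ L.str X → S.functorPushforward
          (Mor.total (Q := subDoctrine C.base) ⟨F₀, a, F'.hom.mono, F'.hom.nat⟩) ∈
            (subDoctrine C.base).exCov (fun c => subCov (jointlyEpiCov C.base) c)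
              (subObj (F₀.obj X.pt) (a X.el)) := fun {X S} hS => by
        rw [exCov_subCov_jointlyEpiCov]
        exact F'.isHom.1.2.cover hS
      obtain ⟨H, hH, e, hr, hc, hs⟩ := exists_synExt_cover (P := L.base)
        F₀ a F'.hom.mono F'.hom.nat F'.isHom.2 (K := L.str) isTopology_jointlyEpiCov
        (fun f hf => generateSingleton_mem_jointlyEpiCov f hf) hcov
      have hj : synCov L.str = jointlyEpiCov L.base.Syn := jSyn_lift_inclDoc L
      rw [hj] at hc
      -- The extension preserves jointly epimorphic sieves, and hence joins of subobjects.
      let H' : wellDefined.SynGeom.obj L ⟶ C :=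
        ⟨H.toCatHom, ⟨hH, hr⟩, fun hs => isLUB_subMap H hc hs⟩
      have hs' : ∀ {c : L.base.base} (x : L.base.El c),
          a x ≤ (Subobject.pullback (e.inv.app c)).obj (subMap H (synSubTop x)) := fun {c} x => by
        rw [hs, ← Subobject.pullback_comp, e.inv_hom_id_app, Subobject.pullback_id]
      exact ⟨H', ⟨Structured.isoMk (isoOfLe e (fun x => (hs x).le) fun x => hs' x)⟩⟩

end GeomCompl

/-! ### Principal elements, and evaluation in a geometric doctrine. -/

namespace GeomCompl

open Doctrine

/-- An upper bound of the values on a cover is an upper bound. -/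
theorem Doctrine.Mor.le_of_mem {P Q : Doctrine.{u}} (F : Mor P Q) {J : Cov P.Total}
    (hF : ∀ {X : P.Total} {S : Sieve X}, S ∈ J X →
      S.functorPushforward F.total ∈ Q.geomCov (F.total.obj X))
    {X : P.Total} {S : Sieve X} (hS : S ∈ J X) {b : Q.El (F.F.obj X.pt)}
    (hb : ∀ {Y : P.Total} (g : Y ⟶ X), S g → F.a Y.el ≤ Q.re (F.F.map g.f) b) : F.a X.el ≤ b := by
  refine le_of_mem_geomCov (hF hS) ?_
  rintro Z _ ⟨Y, g, k, hg, rfl⟩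
  exact (k.cond.trans (Q.re_mono _ (hb g hg))).trans_eq (Q.re_comp k.f (F.F.map g.f) b).symm

namespace ZEl

variable {P Q : Doctrine.{u}} {J : Cov P.Total} {K : Cov Q.Total}

/-- The principal element generated by `(1, x)`. -/
def principal (hJ : IsTopology J) {c : P.base} (x : P.El c) : ZEl J c :=
  cl hJ fun f y => y ≤ P.re f x

section

variable {hJ : IsTopology J}

theorem principal_mem {c d : P.base} {f : d ⟶ c} {x : P.El c} {y : P.El d} (h : y ≤ P.re f x) :
    (principal hJ x).mem f y := mem_cl h

/-- The Yoneda rule for the completion: closed sets containing `(1, x)` contain all its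
restrictions. -/
theorem principal_le_iff {c : P.base} {x : P.El c} {T : ZEl J c} :
    principal hJ x ≤ T ↔ T.mem (𝟙 c) x := by
  refine cl_le.trans ⟨fun h => h _ _ _ (P.re_id x).ge, fun h d f y hy => ?_⟩
  have := T.down f hy h
  rwa [Category.comp_id] at this

theorem principal_le_re_iff {c d : P.base} {f : d ⟶ c} {x : P.El d} {T : ZEl J c} :
    principal hJ x ≤ re f T ↔ T.mem f x :=
  principal_le_iff.trans (iff_of_eq (congrArg (T.mem · x) (Category.id_comp f)))

theorem principal_mono {c : P.base} {x y : P.El c} (h : x ≤ y) :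
    principal hJ x ≤ principal hJ y :=
  principal_le_iff.2 (principal_mem (h.trans_eq (P.re_id y).symm))

theorem principal_mem_elim {c d e : P.base} {f : d ⟶ c} {x : P.El c} {y : P.El d}
    (h : (principal hJ x).mem f y) (p : d ⟶ e) (b : ZEl J e)
    (H : ∀ {Y : P.Total} (g : Y ⟶ (⟨d, y⟩ : P.Total)), Y.el ≤ P.re (g.f ≫ f) x →
      b.mem (g.f ≫ p) Y.el) : b.mem p y :=
  cl_mem_elim h p b fun {Y} g {Z} h k hZ e => H g (by
    rw [e, P.re_comp]; exact k.cond.trans (P.re_mono _ hZ))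

theorem principal_re {c d : P.base} (f : c ⟶ d) (x : P.El d) :
    principal hJ (P.re f x) = re f (principal hJ x) := by
  refine le_antisymm (principal_le_re_iff.2 (principal_mem le_rfl)) (le_iff.2 fun g y hy => ?_)
  refine principal_mem_elim (hJ := hJ) (f := g ≫ f) hy g _ fun {Y} k hk => principal_mem ?_
  rwa [← P.re_comp, Category.assoc]

variable (hJ) in
/-- The unit of the geometric completion. -/
def unit : Mor P (doctrine J) where
  F := 𝟭 P.base
  a x := principal hJ x
  mono h := principal_mono h
  nat f x := principal_re f x

theorem map_principal (hK : IsTopology K) (F : Mor P Q) {c : P.base} (x : P.El c)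
    (hF : ∀ {X : P.Total} {S : Sieve X}, S ∈ J X →
      S.functorPushforward F.total ∈ K (F.total.obj X)) :
    map F K (principal hJ x) = principal hK (F.a x) := by
  refine le_antisymm ((map_le_iff hF).2 (principal_le_iff.2 ?_)) (principal_le_iff.2 ?_)
  · change (principal hK (F.a x)).mem (F.F.map (𝟙 c)) (F.a x)
    rw [F.F.map_id]
    exact principal_mem (Q.re_id _).ge
  · rw [← F.F.map_id]
    exact mem_map (principal_mem (P.re_id x).ge)

/-- Preservation of `∃_f` is exactly where the covers generated by the arrows `(c, x) ⟶ (d, ∃_f x)`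
are used: a closed set containing `(f, x)` then contains `(1, ∃_f x)`. Meets hold because membership
in both principal sets is, locally, being below both restrictions. -/
theorem isExMor_unit [hP : P.IsExistential]
    (hcov : ∀ {X Y : P.Total} (f : X ⟶ Y), IsEx f.f X.el Y.el → Sieve.generateSingleton f ∈ J Y) :
    IsExMor (unit hJ) where
  preservesFiniteLimits := inferInstanceAs (PreservesFiniteLimits (𝟭 P.base))
  top {c t} ht := isTop_of_mem (S := principal hJ t) fun f x => principal_mem (hP.re_top f ht x)
  inf {c x y z} h := by
    change @IsGLB (ZEl J c) _ {principal hJ x, principal hJ y} (principal hJ z)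
    refine ⟨?_, fun b hb => le_iff.2 fun f w hw => ?_⟩
    · rintro _ (rfl | rfl)
      · exact principal_mono (h.1 (.inl rfl))
      · exact principal_mono (h.1 (.inr rfl))
    · refine principal_mem_elim (le_iff.1 (hb (.inl rfl)) _ _ hw) f _ fun {Y} g hg => ?_
      refine principal_mem_elim (ZEl.down _ g.f g.cond (le_iff.1 (hb (.inr rfl)) _ _ hw)) _ _
        fun {Y'} g' hg' => principal_mem ((hP.re_inf _ h).2 ?_)
      rintro _ (rfl | rfl)
      · rw [P.re_comp]
        exact g'.cond.trans (P.re_mono _ hg)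
      · exact hg'
  ex {c d} f x e h := fun (T : ZEl J d) => by
    change principal hJ e ≤ T ↔ principal hJ x ≤ re f T
    rw [principal_le_iff, principal_le_re_iff]
    have hxe : x ≤ P.re f e := (h e).1 le_rfl
    constructor
    · intro hT
      have := T.down f hxe hT
      rwa [Category.comp_id] at this
    · intro hT
      let t : (⟨c, x⟩ : P.Total) ⟶ ⟨d, e⟩ := ⟨f, hxe⟩
      refine T.closed (X := ⟨d, e⟩) (hcov t h) ?_
      rintro Y g ⟨k, rfl⟩
      rw [Category.comp_id]
      exact T.down k.f k.cond hT

theorem functorPushforward_unit_mem {X : P.Total} {S : Sieve X} (hS : S ∈ J X) :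
    S.functorPushforward (unit hJ).total ∈ (doctrine J).geomCov ((unit hJ).total.obj X) := by
  refine mem_geomCov_of_forall (isGeometric hJ).exists_ex fun (b : ZEl J X.pt) hb => ?_
  refine (principal_le_iff (hJ := hJ)).2 (b.closed hS fun {Y} g hg => ?_)
  refine Eq.mp (congrArg (b.mem · Y.el) (Category.comp_id g.f).symm) ?_
  exact (principal_le_re_iff (hJ := hJ)).1 (hb _ (Sieve.image_mem_functorPushforward (unit hJ).total _ hg))

/-- An inequality between morphisms out of the geometric completion holds if it holds on principal
elements. -/
theorem le_re_of_principal {L : Doctrine.{u}} (G H : Mor (doctrine J) L)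
    (hG : ∀ {X : (doctrine J).Total} {S : Sieve X}, S ∈ (doctrine J).geomCov X →
      S.functorPushforward G.total ∈ L.geomCov (G.total.obj X)) (γ : G.F ⟶ H.F)
    (h : ∀ {c : P.base} (x : P.El c), G.a (c := c) (principal hJ x) ≤
      L.re (γ.app c) (H.a (c := c) (principal hJ x)))
    {c : P.base} (S : ZEl J c) : G.a (c := c) S ≤ L.re (γ.app c) (H.a (c := c) S) := by
  let X : (doctrine J).Total := ⟨c, S⟩
  -- `R` collects the arrows into `(c, S)` over which the inequality holds. It contains the arrows
  -- out of `principal x` given by the pairs `(g, x)` in `S`, and these already cover `S`.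
  let R : Sieve X :=
    { arrows := fun Y g => G.a Y.el ≤ L.re (G.F.map g.f) (L.re (γ.app c) (H.a (c := c) S))
      downward_closed := by
        intro Y Z g hg k
        refine (G.total.map k).cond.trans ?_
        change L.re (G.F.map k.f) (G.a Y.el) ≤ L.re (G.F.map (k.f ≫ g.f)) _
        rw [G.F.map_comp, L.re_comp]
        exact L.re_mono _ hg }
  refine G.le_of_mem (X := X) hG (S := R) ?_ fun g hg => hg
  refine mem_geomCov_of_forall (isGeometric hJ).exists_ex fun (b : ZEl J c) hb => ?_
  refine le_iff.2 fun {d} g x hx => ?_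
  let t : (⟨d, principal hJ x⟩ : (doctrine J).Total) ⟶ X := ⟨g, (principal_le_re_iff (hJ := hJ)).2 hx⟩
  refine (principal_le_re_iff (hJ := hJ)).1 (hb t ?_)
  refine (h x).trans ?_
  rw [← L.re_comp]
  change _ ≤ L.re (G.F.map t.f ≫ γ.app c) _
  rw [γ.naturality, L.re_comp]
  exact L.re_mono _ (H.total.map t).cond

end

section Evaluation

variable {L : Doctrine.{u}}

/-- Closing under `K_L` adds nothing new over the identity: if `(1, x)` is generated by `y`, then
`x` is covered by arrows from elements below restrictions of `y`, and so `x ≤ y`. -/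
theorem principal_le_principal_iff {hJ : IsTopology L.geomCov} {c : L.base} {x y : L.El c} :
    principal hJ x ≤ principal hJ y ↔ x ≤ y := by
  refine ⟨fun h => ?_, principal_mono⟩
  refine le_of_mem_geomCov (X := ⟨c, x⟩) (principal_le_iff.1 h) ?_
  rintro Z f ⟨W, k, hW, l, hl⟩
  rw [Category.comp_id] at hl
  rw [hl, L.re_comp]
  exact l.cond.trans (L.re_mono _ hW)

/-- The generator is the join `m` of all `∃_g x` with `(g, x)` in `T`. The arrows into `(c, m)` that
belong to `T` form a cover, so the closed set `T` contains `(1, m)`. -/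
theorem exists_eq_principal (hL : L.IsGeometric) (hJ : IsTopology L.geomCov) {c : L.base} (T : ZEl L.geomCov c) :
    ∃ m, T = principal hJ m := by
  obtain ⟨m, hm⟩ := hL.exists_sup {e | ∃ (d : L.base) (g : d ⟶ c) (x : L.El d),
    T.mem g x ∧ IsEx g x e}
  refine ⟨m, le_antisymm (le_iff.2 fun {d} g x hx => ?_) (principal_le_iff.2 ?_)⟩
  · obtain ⟨e, he⟩ := hL.exists_ex g x
    exact principal_mem ((he _).1 (hm.1 ⟨d, g, x, hx, he⟩))
  · let S : Sieve (⟨c, m⟩ : L.Total) :=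
      { arrows := fun Y g => T.mem g.f Y.el
        downward_closed := fun {Y Z g} hg k => T.down k.f k.cond hg }
    refine T.closed (X := ⟨c, m⟩) (T := S) ?_ fun g hg => ?_
    · refine mem_geomCov_of_forall hL.exists_ex fun b hb => hm.2 ?_
      rintro e ⟨d, g, x, hx, he⟩
      have hxm : x ≤ L.re g m := (he _).1 (hm.1 ⟨d, g, x, hx, he⟩)
      exact (he b).2 (hb (Z := ⟨d, x⟩) ⟨g, hxm⟩ hx)
    · rw [Category.comp_id]; exact hg

variable (hL : L.IsGeometric)

/-- The value of an element of the completion of a geometric doctrine: the join of all the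
`∃_g x`. -/
noncomputable def ev {c : L.base} (T : ZEl L.geomCov c) : L.El c :=
  (exists_eq_principal hL hL.isTopology T).choose

theorem principal_ev {c : L.base} (T : ZEl L.geomCov c) : principal hL.isTopology (ev hL T) = T :=
  (exists_eq_principal hL hL.isTopology T).choose_spec.symm

theorem ev_le_iff {c : L.base} {T : ZEl L.geomCov c} {y : L.El c} :
    ev hL T ≤ y ↔ T ≤ principal hL.isTopology y := by
  rw [← principal_le_principal_iff (hJ := hL.isTopology), principal_ev]

theorem le_ev_iff {c : L.base} {T : ZEl L.geomCov c} {y : L.El c} :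
    y ≤ ev hL T ↔ principal hL.isTopology y ≤ T := by
  rw [← principal_le_principal_iff (hJ := hL.isTopology), principal_ev]

theorem ev_principal {c : L.base} (x : L.El c) : ev hL (principal hL.isTopology x) = x :=
  hL.antisymm ((ev_le_iff hL).2 le_rfl) ((le_ev_iff hL).2 le_rfl)

/-- Evaluation, as a morphism of doctrines. -/
noncomputable def evMor : Mor (doctrine L.geomCov) L where
  F := 𝟭 L.base
  a T := ev hL T
  mono := by
    intro (c : L.base) (S : ZEl L.geomCov c) (T : ZEl L.geomCov c) (h : S ≤ T)
    exact (ev_le_iff hL).2 (h.trans_eq (principal_ev hL T).symm)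
  nat := by
    intro (c : L.base) (d : L.base) (f : c ⟶ d) (T : ZEl L.geomCov d)
    change ev hL (re f T) = L.re f (ev hL T)
    conv_lhs => rw [← principal_ev hL T, ← principal_re, ev_principal]

/-- As `ev` is inverse to `principal`, it is adjoint to it on both sides; it therefore preserves all
meets and joins, and it preserves `∃_f` because `principal` commutes with reindexing. -/
theorem isMorphismOfSites_evMor [HasFiniteLimits L.base] :
    IsMorphismOfSites (evMor hL).total (doctrine L.geomCov).geomCov L.geomCov := by
  have : HasFiniteLimits (doctrine L.geomCov).base := inferInstanceAs (HasFiniteLimits L.base)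
  have : PreservesFiniteLimits (evMor hL).F := inferInstanceAs (PreservesFiniteLimits (𝟭 L.base))
  have hZ := isGeometric hL.isTopology
  refine isMorphismOfSites_total _ hL.isTopology hZ.exists_top hZ.exists_inf hL.re_top hL.re_inf
    ?_ ?_ (functorPushforward_mem_geomCov hL.exists_ex _ ?_ ?_)
  · intro (c : L.base) (T : ZEl L.geomCov c) hT y
    exact (le_ev_iff hL).2 (hT _)
  · intro (c : L.base) (S : ZEl L.geomCov c) (T : ZEl L.geomCov c) (U : ZEl L.geomCov c)
      (h : @IsGLB (ZEl L.geomCov c) _ {S, T} U)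
    change IsGLB {ev hL S, ev hL T} (ev hL U)
    refine ⟨?_, fun b hb => (le_ev_iff hL).2 (h.2 ?_)⟩
    · rintro _ (rfl | rfl)
      · exact (evMor hL).mono (c := c) (h.1 (.inl rfl))
      · exact (evMor hL).mono (c := c) (h.1 (.inr rfl))
    · rintro _ (rfl | rfl)
      · exact (le_ev_iff hL).1 (hb (.inl rfl))
      · exact (le_ev_iff hL).1 (hb (.inr rfl))
  · intro (c : L.base) (A : Set (ZEl L.geomCov c)) (s : ZEl L.geomCov c) hs
    refine ⟨?_, fun b hb => (ev_le_iff hL).2 (hs.2 fun S hS => (ev_le_iff hL).1 (hb ⟨S, hS, rfl⟩))⟩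
    rintro _ ⟨S, hS, rfl⟩
    exact (evMor hL).mono (c := c) (hs.1 hS)
  · intro (c : L.base) (d : L.base) (f : c ⟶ d) (S : ZEl L.geomCov c) (T : ZEl L.geomCov d) h
      (y : L.El d)
    change ev hL T ≤ y ↔ ev hL S ≤ L.re f y
    rw [ev_le_iff, ev_le_iff, principal_re]
    exact h _

end Evaluation

end ZEl

end GeomCompl

/-! ### The adjunction between the geometric completion and the inclusion of geometric doctrines. -/

namespace GeomCompl

open Doctrine

namespace ZEl

variable {P L : Doctrine.{u}} {J : Cov P.Total} [HasFiniteLimits P.base] [HasFiniteLimits L.base]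

/-- The extension of a morphism with values in a geometric doctrine to the geometric completion. -/
noncomputable def extMor (hL : L.IsGeometric) (F : Mor P L) [PreservesFiniteLimits F.F] :
    Mor (doctrine J) L :=
  (mor F hL.isTopology).compMor (evMor hL)

theorem extMor_principal (hL : L.IsGeometric) (hJ : IsTopology J) (F : Mor P L)
    [PreservesFiniteLimits F.F] (hF : ∀ {X : P.Total} {S : Sieve X}, S ∈ J X →
      S.functorPushforward F.total ∈ L.geomCov (F.total.obj X)) {c : P.base} (x : P.El c) :
    (extMor (J := J) hL F).a (c := c) (principal hJ x) = F.a x :=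
  (congrArg (ev hL) (map_principal hL.isTopology F x hF)).trans (ev_principal hL (F.a x))

theorem isMorphismOfSites_extMor (hL : L.IsGeometric) (hJ : IsTopology J) {F : Mor P L}
    [hfl : PreservesFiniteLimits F.F] (hP : P.IsExistential) (hx : IsExMor F)
    (hF : ∀ {X : P.Total} {S : Sieve X}, S ∈ J X →
      S.functorPushforward F.total ∈ L.geomCov (F.total.obj X)) :
    IsMorphismOfSites (extMor (J := J) hL F).total (doctrine J).geomCov L.geomCov := by
  refine IsMorphismOfSites.comp hL.isTopology (isMorphismOfSites_mor F hJ hL.isTopology hF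
    (fun c => ?_) (fun {c} x y => ?_) hL.re_top hL.re_inf) (isMorphismOfSites_evMor hL)
  · obtain ⟨t, ht⟩ := hP.exists_top c
    exact ⟨t, hx.top ht⟩
  · obtain ⟨z, hz⟩ := hP.exists_inf x y
    exact ⟨z, hz.1 (.inl rfl), hz.1 (.inr rfl), hx.inf hz⟩

end ZEl

/-- The unit of the geometric completion. -/
noncomputable def zUnitApp (P : exDocSites.{u}.Obj) :
    P ⟶ (wellDefined.{u}.Z.comp wellDefined.InclDoc).obj P where
  hom := ZEl.unit P.ok.1
  isHom := by
    have hx := ZEl.isExMor_unit (hJ := P.ok.1) (generateSingleton_mem_str P)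
    have hZ := ZEl.isGeometric P.ok.1
    have hfl : PreservesFiniteLimits (ZEl.unit P.ok.1).F := hx.preservesFiniteLimits
    refine ⟨⟨flat_of_preservesFiniteLimits (𝟭 P.base.base), ?_⟩, hx⟩
    exact isMorphismOfSites_total (ZEl.unit P.ok.1) hZ.isTopology P.ok.2.1.exists_top
      P.ok.2.1.exists_inf hZ.re_top hZ.re_inf hx.top hx.inf
      (fun hS => ZEl.functorPushforward_unit_mem hS)

/-- The naturality isomorphism of the unit of the geometric completion. -/
noncomputable def zUnitNaturality {P Q : Doctrine.{u}} [HasPullbacks P.base] {J : Cov P.Total}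
    {K : Cov Q.Total} (hJ : IsTopology J) (hK : IsTopology K) (F : Mor P Q)
    [PreservesFiniteLimits F.F] (hF : ∀ {X : P.Total} {S : Sieve X}, S ∈ J X →
      S.functorPushforward F.total ∈ K (F.total.obj X)) :
    F.compMor (ZEl.unit hK) ≅ (ZEl.unit hJ).compMor (ZEl.mor F hK) :=
  isoOfLe (Iso.refl F.F)
    (fun x => ((ZEl.map_principal (hJ := hJ) hK F x hF).symm.trans
      ((ZEl.doctrine K).re_id _).symm).le)
    (fun x => ((ZEl.map_principal (hJ := hJ) hK F x hF).trans ((ZEl.doctrine K).re_id _).symm).le)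

/-- The unit of the geometric completion. -/
noncomputable def zUnit : Pseudofunctor.StrongTrans
    (Pseudofunctor.id exDocSites.{u}.Obj) (wellDefined.{u}.Z.comp wellDefined.InclDoc) where
  app := zUnitApp
  naturality {P Q} F := Structured.isoMk (zUnitNaturality P.ok.1 Q.ok.1 F.hom F.isHom.1.2.cover)
  naturality_naturality {P Q F G} α := Structured.hom_ext <| ext_app fun (c : P.base.base) =>
    (Category.comp_id (α.cell.α.app c)).trans (Category.id_comp _).symm
  naturality_id P := Structured.hom_ext <| ext_app fun (c : P.base.base) => by
    change 𝟙 c ≫ 𝟙 c ≫ 𝟙 c = 𝟙 c ≫ 𝟙 c ≫ 𝟙 c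
    rfl
  naturality_comp {P Q R} F G := Structured.hom_ext <| ext_app fun (c : P.base.base) => by
    let y : R.base.base := G.hom.F.obj (F.hom.F.obj c)
    change 𝟙 y ≫ 𝟙 y ≫ 𝟙 y = 𝟙 y ≫ 𝟙 y ≫ 𝟙 y ≫ 𝟙 y ≫ G.hom.F.map (𝟙 (F.hom.F.obj c)) ≫ 𝟙 y
    rw [G.hom.F.map_id]
    simp [y]

/-- The adjunction between the geometric completion and the inclusion of geometric doctrines. -/
noncomputable def zAdjunction : QuasiAdjunction wellDefined.{u}.Z wellDefined.InclDoc where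
  unit := zUnit
  isEquivalence P L := by
    obtain ⟨hK, hfl, hL, hKL⟩ := L.ok
    refine @Functor.IsEquivalence.mk _ _ _ _ _ ?_ ?_ ?_
    · refine ⟨fun {G H α β} h => ?_⟩
      refine Structured.hom_ext (ext_app fun c => ?_)
      exact congrArg (fun t => t.cell.α.app c) h
    · refine ⟨fun {G H} γ => ?_⟩
      have hG : ∀ {X : (ZEl.doctrine P.str).Total} {S : Sieve X},
          S ∈ (ZEl.doctrine P.str).geomCov X → S.functorPushforward (Mor.total G.hom) ∈
            L.base.geomCov ((Mor.total G.hom).obj X) := fun {X S} hS => by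
        rw [← hKL]; exact G.isHom.2.cover hS
      let γ' : Mor.F G.hom ⟶ Mor.F H.hom := γ.cell.α
      -- The unit is the identity on the base, so the natural transformation is kept; only the
      -- inequality has to be extended from principal elements to all closed sets.
      exact ⟨⟨⟨γ', fun S => ZEl.le_re_of_principal (hJ := P.ok.1) G.hom H.hom hG γ'
        (fun x => γ.cell.cond x) S⟩⟩, rfl⟩
    · refine ⟨fun F => ?_⟩
      let F' : Mor P.base L.base := F.hom
      have hF : ∀ {X : P.base.Total} {S : Sieve X}, S ∈ P.str X →
          S.functorPushforward F'.total ∈ L.base.geomCov (F'.total.obj X) :=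
        fun {X S} hS => by
          rw [← hKL]; exact F.isHom.1.2.cover hS
      have hlex : PreservesFiniteLimits F'.F := F.isHom.2.1
      let H : wellDefined.Z.obj P ⟶ L := ⟨ZEl.extMor (P := P.base) (J := P.str) hL F',
        flat_of_preservesFiniteLimits F'.F, by
          have := ZEl.isMorphismOfSites_extMor hL P.ok.1 (F := F') P.ok.2.1 F.isHom.2 hF
          rw [← hKL] at this
          exact this⟩
      have e := fun {c : P.base.base} (x : P.base.El c) =>
        ZEl.extMor_principal hL P.ok.1 F' hF x
      exact ⟨H, ⟨Structured.isoMk (isoOfLe (Iso.refl F'.F)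
        (fun x => ((e x).trans (L.base.re_id _).symm).le)
        fun x => ((e x).symm.trans (L.base.re_id _).symm).le)⟩⟩

end GeomCompl

/-! ### The strictly commuting squares. -/

namespace GeomCompl

open Doctrine

section Strict

variable {A : Type*} [Bicategory A] {B : Type u} [Bicategory.{w, v} B]

/-- Pseudofunctors that agree on cells and have the same structure isomorphisms are equal. -/
theorem pseudofunctor_eq {F G : A ⥤ᵖ B} (h : F.toPrelaxFunctor = G.toPrelaxFunctor)
    (hId : ∀ a, (F.mapId a).hom ≍ (G.mapId a).hom)
    (hComp : ∀ {a b c : A} (f : a ⟶ b) (g : b ⟶ c), (F.mapComp f g).hom ≍ (G.mapComp f g).hom) :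
    F = G := by
  obtain ⟨F, i, m, _, _, _, _, _⟩ := F
  obtain ⟨G, i', m', _, _, _, _, _⟩ := G
  change F = G at h
  subst h
  have hi : i = i' := funext fun a => Iso.ext (eq_of_heq (hId a))
  have hm : @m = @m' := by
    funext a b c f g
    exact Iso.ext (eq_of_heq (hComp f g))
  subst hi hm
  rfl

theorem lift_eq_lift {S : Structured.{u, v, w, u'} B} {F : A ⥤ᵖ B} {s t : ∀ a, S.Str (F.obj a)}
    (hs : S.LiftsTo F s) (ht : S.LiftsTo F t) (h : ∀ a, s a = t a) : S.lift hs = S.lift ht := by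
  obtain rfl : s = t := funext h
  rfl

end Strict

/-- Both composites lift the same pseudofunctor to doctrines, equipped with topologies that agree by
`kSub_lift_inclCat`. What remains is to see that the structure cells, composites of identities,
coincide. -/
theorem inclCat_comp_sub : wellDefined.{u}.InclCat.comp wellDefined.Sub =
    wellDefined.SubGeom.comp wellDefined.InclDoc := by
  let K : geomCat.{u}.Obj ⥤ᵖ Doctrine.{u} := geomCatToReg.comp subDoc
  have hs : exDocSites.LiftsTo K fun G => kSub (wellDefined.InclCat.obj G) :=
    ⟨fun G => ((wellDefined.InclCat.comp wellDefined.Sub).obj G).ok,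
      fun F => ((wellDefined.InclCat.comp wellDefined.Sub).map F).isHom⟩
  have ht : exDocSites.LiftsTo K kSubGeom :=
    ⟨fun G => ((wellDefined.SubGeom.comp wellDefined.InclDoc).obj G).ok,
      fun F => ((wellDefined.SubGeom.comp wellDefined.InclDoc).map F).isHom⟩
  have e₁ : wellDefined.InclCat.comp wellDefined.Sub = exDocSites.lift hs :=
    pseudofunctor_eq rfl
      (fun G => heq_of_eq (Structured.hom_ext (ext_app fun (c : G.base) => by
        change (𝟙 c ≫ (𝟙 c ≫ 𝟙 c)) = 𝟙 c ≫ 𝟙 c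
        simp)))
      fun {G₁ G₂ G₃} F F' => heq_of_eq (Structured.hom_ext (ext_app fun (c : G₁.base) => by
        let y : G₃.base := F'.hom.toFunctor.obj (F.hom.toFunctor.obj c)
        change (𝟙 y ≫ (𝟙 y ≫ 𝟙 y)) = 𝟙 y ≫ 𝟙 y
        simp))
  have e₂ : wellDefined.SubGeom.comp wellDefined.InclDoc = exDocSites.lift ht :=
    pseudofunctor_eq rfl
      (fun G => heq_of_eq (Structured.hom_ext (ext_app fun (c : G.base) => by
        change ((𝟙 c ≫ 𝟙 c) ≫ 𝟙 c) = 𝟙 c ≫ 𝟙 c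
        simp)))
      fun {G₁ G₂ G₃} F F' => heq_of_eq (Structured.hom_ext (ext_app fun (c : G₁.base) => by
        let y : G₃.base := F'.hom.toFunctor.obj (F.hom.toFunctor.obj c)
        change ((𝟙 y ≫ 𝟙 y) ≫ 𝟙 y) = 𝟙 y ≫ 𝟙 y
        simp))
  rw [e₁, e₂]
  exact lift_eq_lift hs ht kSub_lift_inclCat

theorem inclDoc_comp_syn : wellDefined.{u}.InclDoc.comp wellDefined.Syn =
    wellDefined.SynGeom.comp wellDefined.InclCat := by
  let K : geomDocCart.{u}.Obj ⥤ᵖ Cat.{u, u} :=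
    (exDocSites.lift liftsTo_inclDoc).comp (exDocSitesToExDoc.comp synCat)
  have hs : regSites.LiftsTo K fun L => jSyn (wellDefined.InclDoc.obj L) :=
    ⟨fun L => ((wellDefined.InclDoc.comp wellDefined.Syn).obj L).ok,
      fun F => ((wellDefined.InclDoc.comp wellDefined.Syn).map F).isHom⟩
  have ht : regSites.LiftsTo K fun L => jointlyEpiCov (K.obj L) :=
    ⟨fun L => ((wellDefined.SynGeom.comp wellDefined.InclCat).obj L).ok,
      fun F => ((wellDefined.SynGeom.comp wellDefined.InclCat).map F).isHom⟩
  have e₁ : wellDefined.InclDoc.comp wellDefined.Syn = regSites.lift hs :=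
    pseudofunctor_eq rfl (fun L => heq_of_eq (Structured.hom_ext rfl))
      fun F F' => heq_of_eq (Structured.hom_ext rfl)
  have e₂ : wellDefined.SynGeom.comp wellDefined.InclCat = regSites.lift ht :=
    pseudofunctor_eq rfl
      (fun L => heq_of_eq (Structured.hom_ext (Category.comp_id ((K.mapId L).hom))))
      fun F F' => heq_of_eq (Structured.hom_ext (Category.comp_id ((K.mapComp F F').hom)))
  rw [e₁, e₂]
  exact lift_eq_lift hs ht jSyn_lift_inclDoc

end GeomCompl

/-! ### The unit of the geometric completion of regular sites. -/

namespace GeomCompl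

open Doctrine

theorem Doctrine.factors_synBase_map_iff {P : Doctrine.{u}} [hP : P.IsExistential] {c d : P.base}
    {f : d ⟶ c} {A : Subobject ((synBase P).obj c)} :
    A.Factors ((synBase P).map f) ↔ top d ≤ P.re f (imSub A) := by
  conv_lhs => rw [← synSubTop_imSub A, synSubTop_factors_iff,
    ← Category.id_comp ((synBase P).map f), im_comp_synBase_le_iff]
  refine ⟨fun h => (isSurj_of_isIso (𝟙 ((synBase P).obj d))).trans h, fun h => le_trans ?_ h⟩
  exact isTop_top _ _

theorem Doctrine.eq_top_iff_top_le {P : Doctrine.{u}} [hP : P.IsExistential] {c : P.base}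
    {A : Subobject ((synBase P).obj c)} : A = ⊤ ↔ top c ≤ imSub A :=
  eq_top_iff_le_imSub

namespace ZEl

variable {P : Doctrine.{u}} {J : Cov P.Total} [hZ : (doctrine J).IsExistential]

/-- A subobject of `(c, ⊤)` in the syntactic category of the geometric completion, as an element of
the completion. -/
noncomputable def ofSubobject {c : P.base}
    (A : Subobject ((synBase (doctrine J)).obj c)) : ZEl J c := imSub A

theorem mem_of_factors (hJ : IsTopology J) {c d : P.base} {f : d ⟶ c}
    {A : Subobject ((synBase (doctrine J)).obj c)}
    (h : A.Factors ((synBase (doctrine J)).map f)) (x : P.El d) : (ofSubobject A).mem f x := by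
  have h' : principal hJ x ≤ re f (ofSubobject A) :=
    le_trans (α := ZEl J d) (b := top (P := doctrine J) d) (isTop_top (P := doctrine J) d _)
      ((factors_synBase_map_iff (P := doctrine J) (c := c) (d := d) (f := f)).1 h)
  exact principal_le_re_iff.1 h'

theorem eq_top_of_mem {c : P.base} {A : Subobject ((synBase (doctrine J)).obj c)}
    (h : ∀ {d : P.base} (f : d ⟶ c) (x : P.El d), (ofSubobject A).mem f x) : A = ⊤ :=
  (eq_top_iff_top_le (P := doctrine J) (c := c)).2 (isTop_of_mem h _)

end ZEl

/-- The geometric completion of the doctrine of subobjects of a regular site. -/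
noncomputable abbrev zSub (C : regSites.{u}.Obj) : Doctrine.{u} :=
  ZEl.doctrine (P := subDoctrine C.base) (kSub C)

instance (C : regSites.{u}.Obj) : (zSub C).IsExistential :=
  isExistential_of_geomDocCart ((wellDefined.Sub.comp wellDefined.Z).obj C)

theorem isTopology_kSub (C : regSites.{u}.Obj) : IsTopology (kSub C) :=
  (wellDefined.Sub.obj C).ok.1

/-- The functor from a regular site to its geometric completion. -/
noncomputable def geomUnit (C : regSites.{u}.Obj) : C.base ⥤ (zSub C).Syn :=
  synBase (zSub C)

instance (C : regSites.{u}.Obj) : PreservesFiniteLimits (geomUnit C) :=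
  inferInstanceAs (PreservesFiniteLimits (synBase (zSub C)))

/-- In `Sub_C` the element `U` is `∃` of `⊤` along the inclusion of `U`. The unit of the completion
preserves this, so the inclusion has image `principal U` in the completed doctrine, and a
monomorphism represents its image. -/
theorem subMap_geomUnit (C : regSites.{u}.Obj) {c : C.base} (U : Subobject c) :
    subMap (geomUnit C) U = synSubTop (P := zSub C) (c := c)
      (ZEl.principal (P := subDoctrine C.base) (isTopology_kSub C) U) := by
  have hx := (zUnitApp (wellDefined.Sub.obj C)).isHom.2
  have h : IsEx (P := zSub C) (c := (U : C.base)) (d := c) U.arrow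
      (ZEl.principal (P := subDoctrine C.base) (isTopology_kSub C) (⊤ : Subobject (U : C.base)))
      (ZEl.principal (P := subDoctrine C.base) (isTopology_kSub C) U) :=
    hx.ex (c := (U : C.base)) (d := c) U.arrow (isEx_arrow U)
  have ht : ZEl.principal (P := subDoctrine C.base) (isTopology_kSub C)
      (⊤ : Subobject (U : C.base)) = top (P := zSub C) (U : C.base) := by
    refine IsExistential.antisymm (P := zSub C) (c := (U : C.base))
      (isTop_top (P := zSub C) _ _) ?_
    refine hx.top (c := (U : C.base)) (t := (⊤ : Subobject (U : C.base))) ?_ _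
    intro (V : Subobject (U : C.base))
    exact le_top (α := Subobject (U : C.base))
  rw [ht] at h
  have hm : Mono (C := (zSub C).base) (X := (U : C.base)) (Y := c) U.arrow :=
    inferInstanceAs (Mono (C := C.base) U.arrow)
  have hm' : Mono ((synBase (zSub C)).map (X := (U : C.base)) (Y := c) U.arrow) :=
    inferInstanceAs (Mono ((geomUnit C).map U.arrow))
  exact mk_synBase_map (P := zSub C) (e := (U : C.base)) (c := c) U.arrow h

/-- A subobject `A` of `(c, ⊤)` is a closed set of pairs. If the image of every `f` in `S` factors
through `A`, this set contains the pairs `(f, ⊤)`; since `S` covers, it contains `(1, ⊤)` and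
therefore all pairs. -/
theorem functorPushforward_geomUnit_mem (C : regSites.{u}.Obj) {c : C.base} {S : Sieve c}
    (hS : S ∈ C.str c) : S.functorPushforward (geomUnit C) ∈
      jointlyEpiCov (zSub C).Syn ((geomUnit C).obj c) := by
  intro A hA
  let T : ZEl (P := subDoctrine C.base) (kSub C) c := ZEl.ofSubobject A
  have hT : ∀ {d : C.base} (f : d ⟶ c), S f → T.mem f (⊤ : Subobject d) := fun {d} f hf =>
    ZEl.mem_of_factors (P := subDoctrine C.base) (isTopology_kSub C)
      (hA _ (Sieve.image_mem_functorPushforward (geomUnit C) S hf)) _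
  have hc : T.mem (𝟙 c) (⊤ : Subobject c) := by
    let R : Sieve (subObj c (⊤ : Subobject c)) :=
      { arrows := fun Y g => T.mem g.f Y.el
        downward_closed := fun {Y Z g} hg k => T.down k.f k.cond hg }
    refine T.closed (X := subObj c (⊤ : Subobject c)) (T := R) ?_ fun g hg => ?_
    · refine (mem_exCov_sub_iff C.ok.1 C.ok.2.2).2 ?_
      refine C.ok.1.superset (C.ok.1.pullback_mem hS (⊤ : Subobject c).arrow) ?_
      intro t k hk
      exact ⟨t, ⊤, k ≫ (⊤ : Subobject c).arrow, (Subobject.top_factors _),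
        (inv (⊤ : Subobject t).arrow), hT _ hk, by simp⟩
    · exact Eq.mp (congrArg (T.mem · _) (Category.comp_id g.f).symm) hg
  refine ZEl.eq_top_of_mem (P := subDoctrine C.base) ?_
  intro (d : C.base) (f : d ⟶ c) (x : Subobject d)
  have hx : x ≤ (Subobject.pullback f).obj (⊤ : Subobject c) := by
    rw [Subobject.pullback_top]
    exact le_top
  exact Eq.mp (congrArg (T.mem · x) (Category.comp_id f))
    (@ZEl.down (subDoctrine C.base) _ _ T c d (𝟙 c) (⊤ : Subobject c) x f hx hc)

/-- Applied to the image of `f`, the hypothesis gives surjectivity. Thus the unit preserves regular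
epimorphisms simply because they generate covers in the site. -/
theorem isRegularEpi_of_generateSingleton_mem {P : Doctrine.{u}} [P.IsExistential] {X Y : P.Syn}
    (f : X ⟶ Y) (h : ∀ A : Subobject Y, A.Factors f → A = ⊤) : IsRegularEpi f := by
  refine isRegularEpi_of_isSurj ?_
  have := h (synSub (im_le f)) ((synSub_factors_iff _).2 le_rfl)
  rw [eq_top_iff_le_imSub, imSub_synSub] at this
  exact this

/-- The unit of the geometric completion of regular sites. -/
noncomputable def zCatUnitApp (C : regSites.{u}.Obj) :
    C ⟶ (wellDefined.{u}.ZCat.comp wellDefined.InclCat).obj C where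
  hom := (geomUnit C).toCatHom
  isHom := by
    refine ⟨⟨inferInstanceAs (PreservesFiniteLimits (geomUnit C)), fun {X Y} f hf => ?_⟩,
      fun hS => functorPushforward_geomUnit_mem C hS⟩
    refine isRegularEpi_of_generateSingleton_mem (P := zSub C)
      ((geomUnit C).map f) fun A hA => ?_
    refine functorPushforward_geomUnit_mem C (C.ok.2.2 f hf) A ?_
    rintro Z _ ⟨W, g, k, ⟨l, rfl⟩, rfl⟩
    rw [Functor.map_comp, ← Category.assoc]
    exact Subobject.factors_of_factors_right _ hA

theorem isExMor_z_sub {C D : regSites.{u}.Obj} (F : C ⟶ D) :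
    IsExMor (P := zSub C) (Q := zSub D) ((wellDefined.Sub.comp wellDefined.Z).map F).hom :=
  (wellDefined.InclDoc.map ((wellDefined.Sub.comp wellDefined.Z).map F)).isHom.2

instance (L : geomDocCart.{u}.Obj) : L.base.IsExistential := isExistential_of_geomDocCart L

theorem isGraph_synGeom_map₂ {L M : geomDocCart.{u}.Obj} {F G : L ⟶ M} (β : F ⟶ G)
    (X : L.base.Syn) : IsGraph (P := M.base) ((wellDefined.SynGeom.map₂ β).cell.toNatTrans.app X)
      (Cell.α β.cell |>.app X.pt) :=
  have hF := (wellDefined.InclDoc.map F).isHom.2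
  have hG := (wellDefined.InclDoc.map G).isHom.2
  have := hF.1
  have := hG.1
  isGraph_synCell_app hF hG β.cell X

theorem isGraph_synGeom_mapId (L : geomDocCart.{u}.Obj) (X : L.base.Syn) :
    IsGraph (P := L.base) ((wellDefined.SynGeom.mapId L).hom.cell.toNatTrans.app X) (𝟙 X.pt) := by
  refine ⟨(L.base.re_id _).ge, ?_⟩
  change 𝟙 X ≫ 𝟙 X ≫ 𝟙 X = 𝟙 X
  simp

theorem isGraph_synGeom_mapComp {L M N : geomDocCart.{u}.Obj} (F : L ⟶ M) (G : M ⟶ N)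
    (X : L.base.Syn) : IsGraph (P := N.base)
      ((wellDefined.SynGeom.mapComp F G).hom.cell.toNatTrans.app X) (𝟙 _) := by
  have hF := (wellDefined.InclDoc.map F).isHom.2
  have hG := (wellDefined.InclDoc.map G).isHom.2
  have := hF.1
  have := hG.1
  let Y : N.base.Syn := (synMap hG).obj ((synMap hF).obj X)
  refine ⟨(N.base.re_id _).ge, ?_⟩
  change 𝟙 Y ≫ 𝟙 Y ≫ 𝟙 Y = 𝟙 Y
  simp

/-- The unit of the geometric completion of regular sites. -/
noncomputable def zCatUnit : Pseudofunctor.StrongTrans (Pseudofunctor.id regSites.{u}.Obj)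
    (wellDefined.{u}.ZCat.comp wellDefined.InclCat) where
  app := zCatUnitApp
  naturality {C D} F :=
    have hF := isExMor_z_sub F
    have := hF.1
    Structured.isoMk (Cat.Hom.isoMk (synBaseMapIso hF).symm)
  naturality_naturality {C D F G} α := Structured.hom_ext <| cat_ext fun (c : C.base) => by
    have hF := isExMor_z_sub F
    have hG := isExMor_z_sub G
    have := hF.1
    have := hG.1
    let α' := ((wellDefined.Sub.comp wellDefined.Z).map₂ α).cell
    change (geomUnit D).map (α.cell.toNatTrans.app c) ≫ (synBaseMapIso hG).inv.app c =
      (synBaseMapIso hF).inv.app c ≫ (synCell hF hG α').app ((synBase (zSub C)).obj c)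
    exact ((isGraph_synBase_map _).comp (isGraph_synBaseMapIso_inv hG c)).eq
      ((isGraph_synBaseMapIso_inv hF c).comp (isGraph_synCell_app hF hG α' _))
      ((Category.comp_id _).trans (Category.id_comp _).symm)
  naturality_id C := Structured.hom_ext <| cat_ext fun (c : C.base) => by
    have h := isExMor_z_sub (𝟙 C)
    have := h.1
    let S := wellDefined.{u}.Sub.comp wellDefined.Z
    let X : (zSub C).Syn := (geomUnit C).obj c
    have h₁ : IsGraph (P := zSub C) _ _ := isGraph_synGeom_map₂ (S.mapId C).hom X
    have h₂ : IsGraph (P := zSub C) _ _ := isGraph_synGeom_mapId (S.obj C) X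
    have h₃ : IsGraph (P := zSub C) _ _ :=
      (isGraph_synBaseMapIso_inv h c).comp ((h₁.comp h₂).comp (IsGraph.id X))
    have h₄ : IsGraph (P := zSub C) _ _ :=
      (isGraph_synBase_map (𝟙 c)).comp ((IsGraph.id X).comp (IsGraph.id X))
    refine h₃.eq h₄ ?_
    change 𝟙 c ≫ (((𝟙 c ≫ 𝟙 c) ≫ 𝟙 c) ≫ 𝟙 c) ≫ 𝟙 c = 𝟙 c ≫ 𝟙 c ≫ 𝟙 c
    simp
  naturality_comp {C D E} F G := Structured.hom_ext <| cat_ext fun (c : C.base) => by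
    have h := isExMor_z_sub (F ≫ G)
    have hF := isExMor_z_sub F
    have hG := isExMor_z_sub G
    have := h.1
    have := hF.1
    have := hG.1
    let S := wellDefined.{u}.Sub.comp wellDefined.Z
    let X : (zSub C).Syn := (geomUnit C).obj c
    let Y : (zSub E).Syn := (synMap hG).obj ((synMap hF).obj X)
    let y : E.base := G.hom.toFunctor.obj (F.hom.toFunctor.obj c)
    have h₁ : IsGraph (P := zSub E) _ _ := isGraph_synGeom_map₂ (S.mapComp F G).hom X
    have h₂ : IsGraph (P := zSub E) _ _ := isGraph_synGeom_mapComp (S.map F) (S.map G) X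
    have h₃ : IsGraph (P := zSub E) _ _ :=
      (isGraph_synBaseMapIso_inv h c).comp ((h₁.comp h₂).comp (IsGraph.id Y))
    have h₄ : IsGraph (P := zSub E) _ _ := (isGraph_synBaseMapIso_inv hF c).map hG
    have h₅ : IsGraph (P := zSub E) _ _ :=
      (isGraph_synBase_map (P := zSub E) (c := y) (d := y) (𝟙 y)).comp
        ((IsGraph.id _).comp ((isGraph_synBaseMapIso_inv hG (F.hom.toFunctor.obj c)).comp
          ((IsGraph.id _).comp (h₄.comp (IsGraph.id Y)))))
    refine h₃.eq h₅ ?_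
    change 𝟙 y ≫ (((𝟙 y ≫ 𝟙 y) ≫ 𝟙 y) ≫ 𝟙 y) ≫ 𝟙 y =
      𝟙 y ≫ 𝟙 y ≫ 𝟙 y ≫ 𝟙 y ≫ G.hom.toFunctor.map (𝟙 (F.hom.toFunctor.obj c)) ≫ 𝟙 y
    rw [G.hom.toFunctor.map_id]
    simp [y]

end GeomCompl

/-! ### The adjunction between the completion of regular sites and geometric categories. -/

namespace GeomCompl

open Doctrine

/-- The isomorphism of functors underlying an invertible 2-cell of doctrines. -/
def Doctrine.functorIso {P Q : Doctrine.{u}} {F G : Mor P Q} (e : F ≅ G) : F.F ≅ G.F where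
  hom := Cell.α e.hom
  inv := Cell.α e.inv
  hom_inv_id := congrArg Cell.α e.hom_inv_id
  inv_hom_id := congrArg Cell.α e.inv_hom_id

/-- The adjunction between the geometric completion of regular sites and the inclusion of geometric
categories. -/
noncomputable def zCatAdjunction : QuasiAdjunction wellDefined.{u}.ZCat wellDefined.InclCat where
  unit := zCatUnit
  isEquivalence C D := by
    have hD : IsGeometricCat D.base := D.ok
    let L : geomDocCart.{u}.Obj := (wellDefined.Sub.comp wellDefined.Z).obj C
    refine @Functor.IsEquivalence.mk _ _ _ _ _ ?_ ?_ ?_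
    · refine ⟨fun {G H α β} h => ?_⟩
      let K : (zSub C).Syn ⥤ D.base := H.hom.toFunctor
      have hH : PreservesFiniteLimits K := H.isHom.1.1
      refine Structured.hom_ext (Cat.Hom₂.ext ?_)
      refine synNatTrans_ext (P := zSub C) (K' := K) fun (c : C.base) => ?_
      exact congrArg (fun t => t.cell.toNatTrans.app c) h
    · refine ⟨fun {G H} γ => ?_⟩
      let K : (zSub C).Syn ⥤ D.base := G.hom.toFunctor
      let K' : (zSub C).Syn ⥤ D.base := H.hom.toFunctor
      have hG : PreservesFiniteLimits K := G.isHom.1.1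
      have hH : PreservesFiniteLimits K' := H.isHom.1.1
      let β : geomUnit C ⋙ K ⟶ geomUnit C ⋙ K' := γ.cell.toNatTrans
      let G' := synSubGeomUnitApp L ≫ wellDefined.SubGeom.map G
      let H' := synSubGeomUnitApp L ≫ wellDefined.SubGeom.map H
      -- To extend `β` to the syntactic category it must respect every predicate `T`. On principal
      -- ones this is the naturality of `β` on subobjects of `C`, by `subMap_geomUnit`; the others
      -- are joins of images of principal ones.
      have key := fun {c : C.base} (T : ZEl (P := subDoctrine C.base) (kSub C) c) =>
        ZEl.le_re_of_principal (hJ := isTopology_kSub C) (L := subDoctrine D.base)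
          G'.hom H'.hom (fun {X S} hS => G'.isHom.2.cover hS) β
          (fun {c : C.base} (U : Subobject c) => by
            have h := subMap_le β U
            rw [subMap_comp, subMap_comp, subMap_geomUnit] at h
            exact h) T
      obtain ⟨α, hα⟩ := exists_synNatTrans (P := zSub C) (K := K) (K' := K')
        (fun f hf => G.isHom.1.2 f hf) β (fun {c : C.base} T => key T)
      exact ⟨⟨NatTrans.toCatHom₂ α⟩, Structured.hom_ext <| cat_ext fun c => hα c⟩
    · refine ⟨fun F => ?_⟩
      -- `Sub F`, with its target regarded as a geometric doctrine, is extended first along `Z ⊣ ι`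
      -- and then along `Syn ⊣ Sub`; composing the isomorphisms on the base gives the required one.
      let F' : wellDefined.Sub.obj C ⟶ wellDefined.InclDoc.obj (wellDefined.SubGeom.obj D) :=
        ⟨(wellDefined.Sub.map F).hom, by
          have h := (wellDefined.Sub.map F).isHom
          change exDocSites.IsHom _ (kSub (wellDefined.InclCat.obj D)) _ at h
          rw [show kSub (wellDefined.InclCat.obj D) = kSubGeom D from kSub_lift_inclCat D] at h
          exact h⟩
      obtain ⟨G, ⟨e⟩⟩ := (zAdjunction.isEquivalence (wellDefined.Sub.obj C)
        (wellDefined.SubGeom.obj D)).essSurj.mem_essImage F'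
      obtain ⟨H, ⟨e'⟩⟩ := (synSubGeomAdjunction.isEquivalence L D).essSurj.mem_essImage G
      let K : (zSub C).Syn ⥤ D.base := H.hom.toFunctor
      let G₀ : C.base ⥤ D.base := Mor.F G.hom
      let F₀ : C.base ⥤ D.base := F.hom.toFunctor
      let i : G₀ ≅ F₀ := functorIso (exDocSites.forget.map₂Iso e)
      let i' : geomUnit C ⋙ K ≅ G₀ := functorIso (geomDocCart.forget.map₂Iso e')
      exact ⟨H, ⟨Structured.isoMk (Cat.Hom.isoMk (i' ≪≫ i))⟩⟩

end GeomCompl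

/-! ### Bicategorical preliminaries: whiskering, precomposition, Yoneda. -/

namespace GeomCompl

open Doctrine

section Bicategories

variable {A : Type*} [Bicategory A] {B : Type*} [Bicategory B] {C : Type*} [Bicategory C]

open Pseudofunctor Bicategory

theorem mapComp_comp_map₂_associator_inv (T : A ⥤ᵖ B) {a b c d : A} (f : a ⟶ b) (g : b ⟶ c)
    (h : c ⟶ d) :
    (T.mapComp f (g ≫ h)).inv ≫ T.map₂ (α_ f g h).inv ≫ (T.mapComp (f ≫ g) h).hom =
      T.map f ◁ (T.mapComp g h).hom ≫ (α_ _ _ _).inv ≫ (T.mapComp f g).inv ▷ T.map h := by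
  have e : T.map₂ (α_ f g h).hom ≫ T.map₂ (α_ f g h).inv = 𝟙 _ := by
    rw [← T.map₂_comp, Iso.hom_inv_id, T.map₂_id]
  rw [← cancel_epi (T.mapComp f (g ≫ h)).hom, ← cancel_epi (T.map₂ (α_ f g h).hom),
    Iso.hom_inv_id_assoc, reassoc_of% e]
  simp [map₂_associator]

theorem mapComp_comp_map₂_associator_inv_assoc (T : A ⥤ᵖ B) {a b c d : A} (f : a ⟶ b)
    (g : b ⟶ c) (h : c ⟶ d) {k : T.obj a ⟶ T.obj d} (z : T.map (f ≫ g) ≫ T.map h ⟶ k) :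
    (T.mapComp f (g ≫ h)).inv ≫ T.map₂ (α_ f g h).inv ≫ (T.mapComp (f ≫ g) h).hom ≫ z =
      T.map f ◁ (T.mapComp g h).hom ≫ (α_ _ _ _).inv ≫ (T.mapComp f g).inv ▷ T.map h ≫ z := by
  simpa using mapComp_comp_map₂_associator_inv T f g h =≫ z

theorem map₂_rightUnitor_inv_comp_mapComp (T : A ⥤ᵖ B) {a b : A} (f : a ⟶ b) :
    T.map₂ (ρ_ f).inv ≫ (T.mapComp f (𝟙 b)).hom ≫ T.map f ◁ (T.mapId b).hom =
      (ρ_ (T.map f)).inv := by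
  have e : T.map₂ (ρ_ f).inv ≫ T.map₂ (ρ_ f).hom = 𝟙 _ := by
    rw [← T.map₂_comp, Iso.inv_hom_id, T.map₂_id]
  rw [T.whiskerLeft_mapId_hom, Iso.hom_inv_id_assoc, reassoc_of% e]

theorem whiskerLeft_map₂_comp_mapComp_inv (R : B ⥤ᵖ A) {a a' : A} {c c' b : B} (f : a ⟶ a')
    {l : c ⟶ c'} {g g' : c' ⟶ b} (β : g ⟶ g') {t' : a' ⟶ R.obj c'} {t : a ⟶ R.obj c}
    (n : f ≫ t' ⟶ t ≫ R.map l) :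
    f ◁ t' ◁ R.map₂ β ≫ (α_ f t' (R.map g')).inv ≫ n ▷ R.map g' ≫ (α_ _ _ _).hom ≫
        t ◁ (R.mapComp l g').inv =
      ((α_ f t' (R.map g)).inv ≫ n ▷ R.map g ≫ (α_ _ _ _).hom ≫ t ◁ (R.mapComp l g).inv) ≫
        t ◁ R.map₂ (l ◁ β) := by
  rw [map₂_whisker_left, associator_inv_naturality_right_assoc, whisker_exchange_assoc]
  simp

/-- The composite of a transformation with a pseudofunctor. -/
noncomputable def whiskerPseudo {F G : A ⥤ᵖ B} (η : StrongTrans F G) (T : B ⥤ᵖ C) :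
    StrongTrans (F.comp T) (G.comp T) where
  app a := T.map (η.app a)
  naturality {a b} f := (T.mapComp (F.map f) (η.app b)).symm ≪≫ T.map₂Iso (η.naturality f) ≪≫
    T.mapComp (η.app a) (G.map f)
  naturality_naturality {a b f g} β := by
    have h := congrArg T.map₂ (η.naturality_naturality β)
    simp only [PrelaxFunctor.map₂_comp, map₂_whisker_left, map₂_whisker_right] at h
    change T.map₂ (F.map₂ β) ▷ T.map (η.app b) ≫ (T.mapComp (F.map g) (η.app b)).inv ≫
      T.map₂ (η.naturality g).hom ≫ (T.mapComp (η.app a) (G.map g)).hom =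
      ((T.mapComp (F.map f) (η.app b)).inv ≫ T.map₂ (η.naturality f).hom ≫
        (T.mapComp (η.app a) (G.map f)).hom) ≫ T.map (η.app a) ◁ T.map₂ (G.map₂ β)
    -- Cancelling the invertible structure cells of `T` reduces the axiom to the image under `T` of
    -- the same axiom for `η`; the other two axioms are treated alike.
    rw [← cancel_epi (T.mapComp (F.map f) (η.app b)).hom,
      ← cancel_mono (T.mapComp (η.app a) (G.map g)).inv]
    simpa using h
  naturality_id a := by
    have h := congrArg T.map₂ (η.naturality_id a)
    simp only [PrelaxFunctor.map₂_comp, map₂_whisker_left, map₂_whisker_right,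
      map₂_left_unitor] at h
    change ((T.mapComp (F.map (𝟙 a)) (η.app a)).inv ≫ T.map₂ (η.naturality (𝟙 a)).hom ≫
      (T.mapComp (η.app a) (G.map (𝟙 a))).hom) ≫
        T.map (η.app a) ◁ (T.map₂ (G.mapId a).hom ≫ (T.mapId _).hom) =
      (T.map₂ (F.mapId a).hom ≫ (T.mapId _).hom) ▷ T.map (η.app a) ≫
        (λ_ (T.map (η.app a))).hom ≫ (ρ_ (T.map (η.app a))).inv
    rw [← cancel_epi (T.mapComp (F.map (𝟙 a)) (η.app a)).hom]
    have h := h =≫ ((T.mapComp (η.app a) (𝟙 (G.obj a))).hom ≫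
      T.map (η.app a) ◁ (T.mapId (G.obj a)).hom)
    simpa [map₂_rightUnitor_inv_comp_mapComp] using h
  naturality_comp {a b c} f g := by
    have h := congrArg T.map₂ (η.naturality_comp f g)
    simp only [PrelaxFunctor.map₂_comp, map₂_whisker_left, map₂_whisker_right,
      map₂_associator, map₂_associator] at h
    change ((T.mapComp (F.map (f ≫ g)) (η.app c)).inv ≫ T.map₂ (η.naturality (f ≫ g)).hom ≫
      (T.mapComp (η.app a) (G.map (f ≫ g))).hom) ≫
        T.map (η.app a) ◁ (T.map₂ (G.mapComp f g).hom ≫ (T.mapComp (G.map f) (G.map g)).hom) =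
      (T.map₂ (F.mapComp f g).hom ≫ (T.mapComp (F.map f) (F.map g)).hom) ▷ T.map (η.app c) ≫
        (α_ _ _ _).hom ≫
          T.map (F.map f) ◁ ((T.mapComp (F.map g) (η.app c)).inv ≫ T.map₂ (η.naturality g).hom ≫
            (T.mapComp (η.app b) (G.map g)).hom) ≫ (α_ _ _ _).inv ≫
          ((T.mapComp (F.map f) (η.app b)).inv ≫ T.map₂ (η.naturality f).hom ≫
            (T.mapComp (η.app a) (G.map f)).hom) ▷ T.map (G.map g) ≫ (α_ _ _ _).hom
    rw [← cancel_epi (T.mapComp (F.map (f ≫ g)) (η.app c)).hom]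
    have h := h =≫ ((T.mapComp (η.app a) (G.map f ≫ G.map g)).hom ≫
      T.map (η.app a) ◁ (T.mapComp (G.map f) (G.map g)).hom)
    simpa [mapComp_comp_map₂_associator_inv_assoc] using h

/-- Precomposition with `f` corresponds to precomposition with `L f` under a quasi 2-adjunction. -/
noncomputable def QuasiAdjunction.precompIso {L : A ⥤ᵖ B} {R : B ⥤ᵖ A} (h : QuasiAdjunction L R)
    {a a' : A} (f : a ⟶ a') (b : B) :
    (R.toPrelaxFunctor.mapFunctor (L.obj a') b ⋙ precomp (R.obj b) (h.unit.app a')) ⋙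
        precomp (R.obj b) f ≅
      precomp b (L.map f) ⋙
        R.toPrelaxFunctor.mapFunctor (L.obj a) b ⋙ precomp (R.obj b) (h.unit.app a) :=
  NatIso.ofComponents (fun g => (α_ f (h.unit.app a') (R.map g)).symm ≪≫
      whiskerRightIso (h.unit.naturality f) (R.map g) ≪≫ α_ _ _ _ ≪≫
        whiskerLeftIso (h.unit.app a) (R.mapComp (L.map f) g).symm)
    (fun {_ _} β => whiskerLeft_map₂_comp_mapComp_inv R f β (h.unit.naturality f).hom)

/-- Two-out-of-three in the square of `precompIso`, whose two adjunction sides are equivalences. -/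
theorem QuasiAdjunction.isEquivalence_precomp_map {L : A ⥤ᵖ B} {R : B ⥤ᵖ A}
    (h : QuasiAdjunction L R) {a a' : A} (f : a ⟶ a') (b : B)
    (hf : (precomp (R.obj b) f).IsEquivalence) : (precomp b (L.map f)).IsEquivalence := by
  have h₁ := h.isEquivalence a b
  have h₂ := h.isEquivalence a' b
  have h₃ : (precomp b (L.map f) ⋙ R.toPrelaxFunctor.mapFunctor (L.obj a) b ⋙
      precomp (R.obj b) (h.unit.app a)).IsEquivalence :=
    @Functor.isEquivalence_of_iso _ _ _ _ _ _ (h.precompIso f b)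
      (@Functor.isEquivalence_trans _ _ _ _ _ _ _ _ h₂ hf)
  exact @Functor.isEquivalence_of_comp_right _ _ _ _ _ _ (precomp b (L.map f))
    (R.toPrelaxFunctor.mapFunctor (L.obj a) b ⋙ precomp (R.obj b) (h.unit.app a)) h₁ h₃

/-- A 1-cell such that precomposition with it is an equivalence is invertible up to isomorphism. -/
theorem exists_inverse {a b : A} (t : a ⟶ b) (h : ∀ c, (precomp c t).IsEquivalence) :
    ∃ s : b ⟶ a, Nonempty (t ≫ s ≅ 𝟙 a) ∧ Nonempty (s ≫ t ≅ 𝟙 b) := by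
  have h₁ := h a
  have h₂ := h b
  obtain ⟨s, ⟨e⟩⟩ := h₁.essSurj.mem_essImage (𝟙 a)
  have e : t ≫ s ≅ 𝟙 a := e
  refine ⟨s, ⟨e⟩, ⟨(precomp b t).preimageIso ?_⟩⟩
  -- The isomorphism `t ≫ (s ≫ t) ≅ t ≅ t ≫ 1` is reflected by precomposition with `t`, which is
  -- fully faithful.
  exact (α_ t s t).symm ≪≫ whiskerRightIso e t ≪≫ λ_ t ≪≫ (ρ_ t).symm

theorem id_comp_pseudofunctor (T : A ⥤ᵖ B) : (Pseudofunctor.id A).comp T = T :=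
  pseudofunctor_eq rfl
    (fun a => heq_of_eq (by
      change T.map₂ (𝟙 (𝟙 a)) ≫ (T.mapId a).hom = (T.mapId a).hom
      simp))
    fun f g => heq_of_eq (by
      change T.map₂ (𝟙 (f ≫ g)) ≫ (T.mapComp f g).hom = (T.mapComp f g).hom
      simp)

theorem pseudofunctor_comp_assoc {D : Type*} [Bicategory D] (F : A ⥤ᵖ B) (G : B ⥤ᵖ C)
    (H : C ⥤ᵖ D) : (F.comp G).comp H = F.comp (G.comp H) :=
  pseudofunctor_eq rfl
    (fun a => heq_of_eq (by
      change H.map₂ (G.map₂ (F.mapId a).hom ≫ (G.mapId (F.obj a)).hom) ≫ (H.mapId _).hom =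
        H.map₂ (G.map₂ (F.mapId a).hom) ≫ H.map₂ (G.mapId (F.obj a)).hom ≫ (H.mapId _).hom
      simp))
    fun f g => heq_of_eq (by
      change H.map₂ (G.map₂ (F.mapComp f g).hom ≫ (G.mapComp (F.map f) (F.map g)).hom) ≫
          (H.mapComp _ _).hom =
        H.map₂ (G.map₂ (F.mapComp f g).hom) ≫ H.map₂ (G.mapComp (F.map f) (F.map g)).hom ≫
          (H.mapComp _ _).hom
      simp)

end Bicategories

end GeomCompl

/-! ### Mates, and inverses of pseudonatural transformations. -/

namespace GeomCompl

section Mates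

open Pseudofunctor Bicategory

variable {B : Type*} [Bicategory B] {c d e f : B} {g g' : c ⟶ e} {h h' : d ⟶ f} {l₁ : c ⟶ d}
  {r₁ : d ⟶ c} {l₂ : e ⟶ f} {r₂ : f ⟶ e} (adj₁ : l₁ ⊣ r₁) (adj₂ : l₂ ⊣ r₂)

/-- Naturality of the mate correspondence in `g`; the next lemma is naturality in `h`. They transfer
the naturality axioms of a transformation to its inverse. -/
theorem mateEquiv_whiskerRight_comp (ψ : g ⟶ g') (x : g' ≫ l₂ ⟶ l₁ ≫ h) :
    mateEquiv adj₁ adj₂ (ψ ▷ l₂ ≫ x) = r₁ ◁ ψ ≫ mateEquiv adj₁ adj₂ x := by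
  have e : adj₂.homEquiv₂ (ψ ▷ l₂ ≫ x) = ψ ≫ adj₂.homEquiv₂ x := by
    rw [← Equiv.eq_symm_apply]
    obtain ⟨y, rfl⟩ := adj₂.homEquiv₂.symm.surjective x
    rw [Equiv.apply_symm_apply, Adjunction.homEquiv₂_symm_apply,
      Adjunction.homEquiv₂_symm_apply, comp_whiskerRight, Category.assoc]
  rw [Bicategory.mateEquiv_apply, Bicategory.mateEquiv_apply, e, Adjunction.homEquiv₁_apply,
    Adjunction.homEquiv₁_apply]
  simp

theorem mateEquiv_comp_whiskerLeft (x : g ≫ l₂ ⟶ l₁ ≫ h) (φ : h ⟶ h') :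
    mateEquiv adj₁ adj₂ (x ≫ l₁ ◁ φ) = mateEquiv adj₁ adj₂ x ≫ φ ▷ r₂ := by
  have e {z : B} {k : c ⟶ z} {k' k'' : d ⟶ z} (y : k ⟶ l₁ ≫ k') (ψ : k' ⟶ k'') :
      adj₁.homEquiv₁ (y ≫ l₁ ◁ ψ) = adj₁.homEquiv₁ y ≫ ψ := by
    rw [← Equiv.eq_symm_apply]
    obtain ⟨y, rfl⟩ := adj₁.homEquiv₁.symm.surjective y
    rw [Equiv.apply_symm_apply, Adjunction.homEquiv₁_symm_apply,
      Adjunction.homEquiv₁_symm_apply]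
    simp
  rw [Bicategory.mateEquiv_apply, Bicategory.mateEquiv_apply, ← e]
  simp [Adjunction.homEquiv₂_apply]

theorem mateEquiv_symm_eq (β : r₁ ≫ g ⟶ h ≫ r₂) :
    (mateEquiv adj₁ adj₂).symm β = adj₁.homEquiv₁.symm ((α_ _ _ _).inv ≫ adj₂.homEquiv₂.symm β) := by
  simp only [Bicategory.mateEquiv_symm_apply, Adjunction.homEquiv₁_symm_apply, Adjunction.homEquiv₂_symm_apply]
  simp

/-- The mate is a pasting of `β` with the unit of `adj₁` and the counit of `adj₂`, all of which are
invertible. -/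
theorem isIso_mateEquiv_symm (β : r₁ ≫ g ⟶ h ≫ r₂) [IsIso β] [IsIso adj₁.unit]
    [IsIso adj₂.counit] : IsIso ((mateEquiv adj₁ adj₂).symm β) := by
  rw [mateEquiv_symm_eq, Adjunction.homEquiv₁_symm_apply, Adjunction.homEquiv₂_symm_apply]
  infer_instance

/-- This is the modification axiom for the units of the componentwise adjunctions; the following
lemma is the one for the counits. -/
theorem whiskerLeft_unit_comp_mateEquiv_symm (β : r₁ ≫ g ≅ h ≫ r₂) :
    g ◁ adj₂.unit ≫ (α_ _ _ _).inv ≫ (mateEquiv adj₁ adj₂).symm β.hom ▷ r₂ ≫ (α_ _ _ _).hom ≫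
      l₁ ◁ β.inv ≫ (α_ _ _ _).inv = ((ρ_ g).hom ≫ (λ_ g).inv) ≫ adj₁.unit ▷ g := by
  have e := (mateEquiv_eq_iff adj₁ adj₂ _ β.hom).1 (Equiv.apply_symm_apply _ _)
  rw [Adjunction.homEquiv₁_symm_apply, Adjunction.homEquiv₂_apply] at e
  have e' := (ρ_ g).hom ≫= e =≫ (l₁ ◁ β.inv ≫ (α_ _ _ _).inv)
  simpa using e'.symm

theorem mateEquiv_symm_comp_counit (β : r₁ ≫ g ≅ h ≫ r₂) :
    ((α_ _ _ _).inv ≫ β.inv ▷ l₂ ≫ (α_ _ _ _).hom ≫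
      r₁ ◁ (mateEquiv adj₁ adj₂).symm β.hom ≫ (α_ _ _ _).inv) ≫ adj₁.counit ▷ h =
    h ◁ adj₂.counit ≫ (ρ_ h).hom ≫ (λ_ h).inv := by
  have e := congrArg adj₁.homEquiv₁ (mateEquiv_symm_eq adj₁ adj₂ β.hom)
  rw [Equiv.apply_symm_apply, Adjunction.homEquiv₁_apply, Adjunction.homEquiv₂_symm_apply] at e
  have e' := ((α_ _ _ _).inv ≫ β.inv ▷ l₂ ≫ (α_ _ _ _).hom) ≫= e =≫ (λ_ h).inv
  simpa using e'

end Mates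

section Inverse

open Pseudofunctor Bicategory
open scoped Pseudofunctor.StrongTrans

variable {A : Type*} [Bicategory A] {B : Type*} [Bicategory B] {F G : A ⥤ᵖ B}

/-- The inverse of a transformation whose components are equivalences. -/
noncomputable def inverseTrans (t : StrongTrans F G) (s : ∀ a, G.obj a ⟶ F.obj a)
    (adj : ∀ a, s a ⊣ t.app a) [h₁ : ∀ a, IsIso (adj a).unit] [h₂ : ∀ a, IsIso (adj a).counit] :
    StrongTrans G F where
  app := s
  naturality {a b} f :=
    have := isIso_mateEquiv_symm (adj a) (adj b) (t.naturality f).inv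
    asIso ((mateEquiv (adj a) (adj b)).symm (t.naturality f).inv)
  naturality_naturality {a b f g} β := by
    -- Each axiom of the inverse is the mate of the corresponding axiom for the inverse cells of
    -- `t`.
    apply (mateEquiv (adj a) (adj b)).injective
    rw [asIso_hom, asIso_hom, mateEquiv_whiskerRight_comp, mateEquiv_comp_whiskerLeft,
      Equiv.apply_symm_apply, Equiv.apply_symm_apply, Iso.eq_inv_comp, ← Category.assoc,
      Iso.comp_inv_eq]
    exact (t.naturality_naturality β).symm
  naturality_id a := by
    apply (mateEquiv (adj a) (adj a)).injective
    rw [asIso_hom, mateEquiv_comp_whiskerLeft, mateEquiv_whiskerRight_comp,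
      Equiv.apply_symm_apply, mateEquiv_leftUnitor_hom_rightUnitor_inv,
      StrongTrans.naturality_id_inv]
    simp
  naturality_comp {a b c} f g := by
    apply (mateEquiv (adj a) (adj c)).injective
    have h := mateEquiv_vcomp (adj a) (adj b) (adj c)
      ((mateEquiv (adj a) (adj b)).symm (t.naturality f).inv)
      ((mateEquiv (adj b) (adj c)).symm (t.naturality g).inv)
    simp only [leftAdjointSquare.vcomp, rightAdjointSquare.vcomp, Equiv.apply_symm_apply] at h
    rw [asIso_hom, asIso_hom, asIso_hom, mateEquiv_comp_whiskerLeft, mateEquiv_whiskerRight_comp,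
      Equiv.apply_symm_apply, h, StrongTrans.naturality_comp_inv]
    simp

/-- A transformation whose components are equivalences is an equivalence. -/
noncomputable def equivalenceOfTrans (t : StrongTrans F G) (s : ∀ a, G.obj a ⟶ F.obj a)
    (adj : ∀ a, s a ⊣ t.app a) [h₁ : ∀ a, IsIso (adj a).unit] [h₂ : ∀ a, IsIso (adj a).counit] :
    Bicategory.Equivalence G F :=
  .mkOfAdjointifyCounit (f := inverseTrans t s adj) (g := t)
    (StrongTrans.isoMk (fun a => @asIso _ _ _ _ (adj a).unit (h₁ a)) fun {a b} f =>
      whiskerLeft_unit_comp_mateEquiv_symm (adj a) (adj b) (t.naturality f).symm)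
    (StrongTrans.isoMk (fun a => @asIso _ _ _ _ (adj a).counit (h₂ a)) fun {a b} f =>
      (mateEquiv_symm_comp_counit (adj a) (adj b) (t.naturality f).symm).symm)

theorem nonempty_equivalence_of_trans (t : StrongTrans F G)
    (h : ∀ a, ∃ s : G.obj a ⟶ F.obj a, Nonempty (t.app a ≫ s ≅ 𝟙 _) ∧
      Nonempty (s ≫ t.app a ≅ 𝟙 _)) : Nonempty (Bicategory.Equivalence G F) := by
  choose s e e' using h
  -- The pointwise inverses are improved to adjoint equivalences, since mates require the triangle
  -- identities.
  let E : ∀ a, Bicategory.Equivalence (G.obj a) (F.obj a) := fun a =>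
    .mkOfAdjointifyCounit (e' a).some.symm (e a).some
  let adj : ∀ a, s a ⊣ t.app a := fun a =>
    ⟨(E a).unit.hom, (E a).counit.hom, (E a).left_triangle_hom, (E a).right_triangle_hom⟩
  have h₁ : ∀ a, IsIso (adj a).unit := fun a => inferInstanceAs (IsIso (E a).unit.hom)
  have h₂ : ∀ a, IsIso (adj a).counit := fun a => inferInstanceAs (IsIso (E a).counit.hom)
  exact ⟨equivalenceOfTrans t s adj⟩

end Inverse

end GeomCompl

/-! ### The square of left adjoints. -/

namespace GeomCompl

open Doctrine

section Sub

variable {C D : Type u} [SmallCategory C] [SmallCategory D] [Regular C] [Regular D]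

theorem isEx_top_of_isRegularEpi {X Y : C} {f : X ⟶ Y} (hf : IsRegularEpi f) :
    IsEx (P := subDoctrine C) f (⊤ : Subobject X) (⊤ : Subobject Y) := by
  have h := isEx_mk (f := f) (i := 𝟙 X) (j := 𝟙 Y) hf (by simp)
  rwa [Subobject.mk_eq_top_of_isIso, Subobject.mk_eq_top_of_isIso] at h

theorem isRegularEpi_of_isEx_top {X Y : C} {f : X ⟶ Y}
    (h : IsEx (P := subDoctrine C) f (⊤ : Subobject X) (⊤ : Subobject Y)) : IsRegularEpi f := by
  obtain ⟨q, hq, e⟩ := isEx_sub_iff.1 h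
  have hf : f = inv (⊤ : Subobject X).arrow ≫ q ≫ (⊤ : Subobject Y).arrow := by
    rw [e, IsIso.inv_hom_id_assoc]
  rw [hf]
  exact isRegularEpi_comp inferInstance (isRegularEpi_comp hq inferInstance)

variable {F₀ : C ⥤ D} {a : ∀ {c : C}, Subobject c → Subobject (F₀.obj c)}

/-- A morphism of existential doctrines between doctrines of subobjects is determined by its
functor. -/
theorem eq_subMap [PreservesFiniteLimits F₀] (ht : ∀ c : C, a (⊤ : Subobject c) = ⊤)
    (hx : ∀ {c d : C} (f : c ⟶ d) {x : Subobject c} {e : Subobject d},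
      IsEx (P := subDoctrine C) f x e → IsEx (P := subDoctrine D) (F₀.map f) (a x) (a e))
    {c : C} (U : Subobject c) : a U = subMap F₀ U := by
  -- `U` is `∃` of `⊤` along its own inclusion, and `a` preserves both; hence `a U` is the image of
  -- `F₀` of that inclusion.
  have h := hx _ (isEx_arrow U)
  rw [ht] at h
  have h' := isEx_arrow (Subobject.mk (F₀.map U.arrow))
  have h'' : IsEx (P := subDoctrine D) (F₀.map U.arrow) (⊤ : Subobject (F₀.obj (U : C)))
      (subMap F₀ U) := by
    have := isEx_mk (f := F₀.map U.arrow) (i := 𝟙 _) (j := F₀.map U.arrow) (q := 𝟙 _)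
      inferInstance rfl
    rwa [Subobject.mk_eq_top_of_isIso] at this
  exact le_antisymm (α := Subobject (F₀.obj c)) ((h _).2 h''.le) ((h'' _).2 h.le)

/-- An arrow `f` is a regular epimorphism exactly when `∃_f ⊤ = ⊤`, a condition that is visible in
the doctrine. -/
theorem isRegularEpi_map_of_ex (ht : ∀ c : C, a (⊤ : Subobject c) = ⊤)
    (hx : ∀ {c d : C} (f : c ⟶ d) {x : Subobject c} {e : Subobject d},
      IsEx (P := subDoctrine C) f x e → IsEx (P := subDoctrine D) (F₀.map f) (a x) (a e))
    {X Y : C} {f : X ⟶ Y} (hf : IsRegularEpi f) :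
    IsRegularEpi (F₀.map f) := by
  have h := hx f (isEx_top_of_isRegularEpi hf)
  rw [ht, ht] at h
  exact isRegularEpi_of_isEx_top h

end Sub

/-- A sieve on an object of a regular site, as a sieve on its largest subobject. -/
def topSieve {C : Type u} [SmallCategory C] [Regular C] {c : C} (S : Sieve c) :
    Sieve (subObj c (⊤ : Subobject c)) where
  arrows _ g := S.arrows g.f
  downward_closed hg k := S.downward_closed hg k.f

theorem topSieve_mem (C : regSites.{u}.Obj) {c : C.base} {S : Sieve c} (hS : S ∈ C.str c) :
    topSieve S ∈ kSub C (subObj c (⊤ : Subobject c)) := by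
  refine (mem_exCov_sub_iff C.ok.1 C.ok.2.2).2 ?_
  refine C.ok.1.superset (C.ok.1.pullback_mem hS (⊤ : Subobject c).arrow) ?_
  intro t k hk
  exact ⟨t, ⊤, k ≫ (⊤ : Subobject c).arrow, (Subobject.top_factors _),
    (inv (⊤ : Subobject t).arrow), hk, by simp⟩

/-- Taking doctrines of subobjects is an equivalence on categories of 1-cells. -/
theorem isEquivalence_sub_mapFunctor (C D : regSites.{u}.Obj) :
    (wellDefined.{u}.Sub.toPrelaxFunctor.mapFunctor C D).IsEquivalence := by
  refine @Functor.IsEquivalence.mk _ _ _ _ _ ?_ ?_ ?_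
  · refine ⟨fun {G H α β} h => ?_⟩
    refine Structured.hom_ext (Cat.Hom₂.ext ?_)
    exact congrArg (fun t => t.cell.α) h
  · exact ⟨fun {G H} γ => ⟨⟨NatTrans.toCatHom₂ γ.cell.α⟩, rfl⟩⟩
  · refine ⟨fun F => ?_⟩
    let F₀ : C.base ⥤ D.base := F.hom.F
    let a : ∀ {c : C.base}, Subobject c → Subobject (F₀.obj c) := F.hom.a
    have hF : PreservesFiniteLimits F₀ := F.isHom.2.1
    have htop : ∀ c : C.base, a (⊤ : Subobject c) = ⊤ := fun c => by
      refine top_unique (α := Subobject (F₀.obj c)) (F.isHom.2.top (c := c)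
        (t := (⊤ : Subobject c)) ?_ (⊤ : Subobject (F₀.obj c)))
      intro (V : Subobject c)
      exact le_top (α := Subobject c)
    have hex : ∀ {c d : C.base} (f : c ⟶ d) {x : Subobject c} {e : Subobject d},
        IsEx (P := subDoctrine C.base) f x e →
          IsEx (P := subDoctrine D.base) (F₀.map f) (a x) (a e) :=
      fun {c d} f {x e} h => F.isHom.2.ex (c := c) (d := d) f h
    -- A cover of `X` in the site is seen by the doctrine as a cover of `(X, ⊤)`; since `a ⊤ = ⊤`,
    -- its image gives back a cover of `F₀ X`.
    have hcov : ∀ {X : C.base} {S : Sieve X}, S ∈ C.str X →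
        S.functorPushforward F₀ ∈ D.str (F₀.obj X) := fun {X S} hS => by
      let A : Subobject (F₀.obj X) := a (⊤ : Subobject X)
      obtain ⟨(T : Sieve (A : D.base)), hT, h⟩ := exists_sieve_of_functorPushforward_mem
        (P := subDoctrine C.base) D.ok.1 D.ok.2.2 F₀ a F.hom.mono F.hom.nat (S := topSieve S)
        (F.isHom.1.2.cover (topSieve_mem C hS))
      have hi : IsIso A.arrow := (Subobject.isIso_arrow_iff_eq_top _).2 (htop X)
      have hT : T ∈ D.str (A : D.base) := hT
      refine D.ok.1.superset (D.ok.1.pullback_mem hT (inv A.arrow)) ?_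
      intro t k hk
      obtain ⟨Z, g, m, hg, -, e⟩ := h _ hk
      change (k ≫ inv A.arrow) ≫ A.arrow = m ≫ F₀.map g.f at e
      rw [Category.assoc, IsIso.inv_hom_id, Category.comp_id] at e
      exact ⟨_, g.f, m, hg, e⟩
    let H : C ⟶ D := ⟨F₀.toCatHom, ⟨hF, fun f hf => isRegularEpi_map_of_ex htop hex hf⟩, hcov⟩
    have e := fun {c : C.base} (U : Subobject c) => eq_subMap (F₀ := F₀) htop hex U
    exact ⟨H, ⟨Structured.isoMk (isoOfLe (Iso.refl F₀)
      (fun {c : C.base} (U : Subobject c) =>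
        ((e U).symm.trans (Subobject.pullback_id _).symm).le)
      (fun {c : C.base} (U : Subobject c) => ((e U).trans (Subobject.pullback_id _).symm).le))⟩⟩

/-- Precomposition with the unit of the completion of an existential doctrine under comprehension
and quotients is an equivalence on the 1-cells to doctrines of subobjects. -/
theorem isEquivalence_precomp_synSubUnit (P : exDocSites.{u}.Obj) (C : regSites.{u}.Obj) :
    (Bicategory.precomp (wellDefined.Sub.obj C) (synSubUnit.app P)).IsEquivalence := by
  have h₁ := isEquivalence_sub_mapFunctor (wellDefined.Syn.obj P) C
  have h₂ := synSubAdjunction.isEquivalence P C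
  exact @Functor.isEquivalence_of_comp_left _ _ _ _ _ _
    (wellDefined.{u}.Sub.toPrelaxFunctor.mapFunctor (wellDefined.Syn.obj P) C)
    (Bicategory.precomp (wellDefined.Sub.obj C) (synSubUnit.app P)) h₁ h₂

/-- The two adjunctions turn precomposition with `Syn (Z η)` on 1-cells into `G` into precomposition
with `η` on 1-cells into `ι (Sub G)`. This object equals `Sub (ι G)`, where
`isEquivalence_precomp_synSubUnit` applies. -/
theorem isEquivalence_precomp_synGeom_z (P : exDocSites.{u}.Obj) (G : geomCat.{u}.Obj) :
    (Bicategory.precomp G (wellDefined.SynGeom.map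
      (wellDefined.Z.map (synSubUnit.app P)))).IsEquivalence := by
  refine synSubGeomAdjunction.isEquivalence_precomp_map _ G ?_
  refine zAdjunction.isEquivalence_precomp_map _ (wellDefined.SubGeom.obj G) ?_
  have e : wellDefined.Sub.obj (wellDefined.InclCat.obj G) =
      wellDefined.InclDoc.obj (wellDefined.SubGeom.obj G) :=
    congrArg (fun T : geomCat.{u}.Obj ⥤ᵖ exDocSites.{u}.Obj => T.obj G) inclCat_comp_sub
  exact e ▸ isEquivalence_precomp_synSubUnit P (wellDefined.InclCat.obj G)

open scoped Pseudofunctor.StrongTrans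

/-- The comparison of the completion of the doctrine with that of the syntactic category. -/
noncomputable def synGeomZTrans : Pseudofunctor.StrongTrans
    ((Pseudofunctor.id _).comp (wellDefined.{u}.Z.comp wellDefined.SynGeom))
    ((wellDefined.Syn.comp wellDefined.Sub).comp (wellDefined.Z.comp wellDefined.SynGeom)) :=
  whiskerPseudo synSubUnit _

/-- The square of left adjoints commutes up to equivalence. -/
theorem nonempty_syn_zCat_equivalence : Nonempty (Bicategory.Equivalence
    (wellDefined.{u}.Syn.comp wellDefined.ZCat) (wellDefined.Z.comp wellDefined.SynGeom)) := by
  have h := nonempty_equivalence_of_trans synGeomZTrans fun P =>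
    exists_inverse _ (isEquivalence_precomp_synGeom_z P)
  rw [id_comp_pseudofunctor, pseudofunctor_comp_assoc, ← pseudofunctor_comp_assoc wellDefined.Sub]
    at h
  exact h

end GeomCompl

open GeomCompl CategoryTheory
open scoped Bicategory Pseudofunctor.StrongTrans

/-- All the 2-functors of the square are well defined; `Syn ∘ Z ∘ Sub` is left quasi 2-adjoint to
the inclusion of geometric categories into regular sites; the other three sides of the square are
quasi 2-adjunctions too; and the squares of left adjoints (up to equivalence), of right adjoints,
and of the inclusions with `Syn` commute. -/
theorem theorem5p19 :
    ∃ h : WellDefined.{u},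
      Nonempty (QuasiAdjunction h.ZCat h.InclCat) ∧
      Nonempty (QuasiAdjunction h.Z h.InclDoc) ∧
      Nonempty (QuasiAdjunction h.Syn h.Sub) ∧
      Nonempty (QuasiAdjunction h.SynGeom h.SubGeom) ∧
      Nonempty (Bicategory.Equivalence (h.Syn.comp h.ZCat) (h.Z.comp h.SynGeom)) ∧
      h.InclCat.comp h.Sub = h.SubGeom.comp h.InclDoc ∧
      h.InclDoc.comp h.Syn = h.SynGeom.comp h.InclCat :=
  ⟨wellDefined, ⟨zCatAdjunction⟩, ⟨zAdjunction⟩, ⟨synSubAdjunction⟩, ⟨synSubGeomAdjunction⟩,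
    nonempty_syn_zCat_equivalence, inclCat_comp_sub, inclDoc_comp_syn⟩
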